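/- Let $n\ge 1$ and $m\ge 1$ be integers. Write points of $\mathbb R^{n+1}$ as $(x,t)$ with $x\in\mathbb R^n$, $t\in\mathbb R$, let $\mathbb R^{n+1}_+=\{t>0\}$, and write multiindices $\alpha\in\mathbb N^{n+1}$ as $\alpha=(\alpha_\parallel,\alpha_\perp)\in\mathbb N^n\times\mathbb N$; $\nabla^k u$ denotes the array $(\partial^\alpha u)_{|\alpha|=k}$, and $\langle F,G\rangle_{\mathbb R^n}=\sum_{\alpha}\int_{\mathbb R^n}\overline{F_\alpha}\,G_\alpha\,dx$. Let $A=(A_{\alpha\beta})_{|\alpha|=|\beta|=m}$ be the real, constant, diagonal matrix $$A_{\alpha\alpha}=\frac{|\alpha_\parallel|!}{\alpha_\parallel!},\qquad A_{\alpha\beta}=0\ \text{ if }\alpha\ne\beta .$$ Then: 1. $A$ is real and self-adjoint, $A_{\alpha\beta}=\overline{A_{\beta\alpha}}$, and there are $\Lambda>\lambda>0$ such that $|A_{\alpha\beta}|\le\Lambda$ for all $|\alpha|=|\beta|=m$ and such that the strong slice ellipticity $$\operatorname{Re}\langle\nabla^m\varphi(\cdot,t),A\nabla^m\varphi(\cdot,t)\rangle_{\mathbb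 R^n}\ge\lambda\,\|\nabla^m\varphi(\cdot,t)\|_{L^2(\mathbb R^n)}^2$$ holds for all $\varphi\in C_0^\infty(\mathbb R^{n+1})$ and all $t\in\mathbb R$. 2. The operator $Lu=(-1)^m\sum_{|\alpha|=|\beta|=m}\partial^\alpha(A_{\alpha\beta}\partial^\beta u)$ is, on smooth functions $u$ on $\mathbb R^{n+1}$, $$Lu=\sum_{j=0}^m(-1)^j(-\Delta_\parallel)^{m-j}\partial_t^{2j}u,\qquad \Delta_\parallel=\partial_{x_1}^2+\dots+\partial_{x_n}^2 .$$ 3. The $L^2$ Neumann problem for $A$ in $\mathbb R^{n+1}_+$ is well posed: there is a constant $C$, depending only on $n$ and $m$, such that for every array $g=(g_\gamma)_{|\gamma|=m-1}$ of functions in $L^2(\mathbb R^n)$ there is a function $w$, smooth in $\mathbb R^{n+1}_+$, with $$Lw=0\ \text{in }\mathbb R^{n+1}_+,\qquad \mathrm M_A w=g,\qquad \int_0^\infty\!\!\int_{\mathbb R^n}|\nabla^m\partial_t w(x,t)|^2\,t\,dx\,dt+\sup_{t>0}\|\nabla^m w(\cdot,t)\|_{L^2(\mathbb R^n)}^2\le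 C\|g\|_{L^2(\mathbb R^n)}^2 .$$ Moreover solutions are unique up to polynomials: if $w_1,w_2\in L^1_{\mathrm{loc}}(\mathbb R^{n+1}_+)$ have weak derivatives $\nabla^m w_i$ and $\nabla^m\partial_tw_i$ in $L^1_{\mathrm{loc}}(\mathbb R^{n+1}_+)$, have a finite left-hand side in the last estimate (with the essential supremum over $t>0$), satisfy $Lw_i=0$ weakly, that is, $\sum_{|\alpha|=|\beta|=m}\int_{\mathbb R^{n+1}_+}\partial^\alpha\overline\varphi\,A_{\alpha\beta}\,\partial^\beta w_i=0$ for all $\varphi\in C_0^\infty(\mathbb R^{n+1}_+)$, and satisfy $\mathrm M_Aw_1=\mathrm M_Aw_2=g$, then $w_1-w_2$ is almost everywhere equal to a polynomial of degree at most $m-1$. Here $\mathrm M_Aw=g$ means that for every $\varphi\in C_0^\infty(\mathbb R^{n+1})$ $$\lim_{\varepsilon\to0^+}\lim_{T\to\infty}\int_\varepsilon^T\langle A\nabla^mw(\cdot,t),\nabla^m\mathcal E\varphi(\cdot,t)\rangle_{\mathbb R^n}\,dt=\sum_{|\gamma|=m-1}\int_{\mathbb R^n}\overline{g_\gamma(x)}\,\partial^\gamma\varphi(x,0)\,dx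 ,$$ where $$\mathcal E\varphi(x,t)=\sum_{k=0}^{m-1}\frac{t^k}{k!}\,e^{-(-t^2\Delta_\parallel)^m}\varphi_k(x),\qquad \varphi_k(x)=\partial_t^k\varphi(x,0),$$ and $e^{-(-t^2\Delta_\parallel)^m}$ is the Fourier multiplier with symbol $e^{-(4\pi^2t^2|\xi|^2)^m}$ for $\widehat f(\xi)=\int_{\mathbb R^n}e^{-2\pi i x\cdot\xi}f(x)\,dx$. -/

import Mathlib

open Set Filter Topology MeasureTheory
open scoped ENNReal ContDiff FourierTransform

noncomputable section

namespace HigherOrderNeumann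

/-- The horizontal space `ℝⁿ`, with the Euclidean norm. -/
abbrev Hor (n : ℕ) : Type := EuclideanSpace ℝ (Fin n)

/-- The space `ℝⁿ⁺¹`, written as pairs `(x, t)` with `x ∈ ℝⁿ` and `t ∈ ℝ`. It carries the product
of the Lebesgue measures, that is, Lebesgue measure on `ℝⁿ⁺¹`. -/
abbrev Space (n : ℕ) : Type := Hor n × ℝ

/-- The open upper half-space `ℝⁿ × (0, ∞)`. -/
def halfSpace (n : ℕ) : Set (Space n) := {z | 0 < z.2}

/-- Multiindices in `ℕⁿ⁺¹`, split into the horizontal part `α.1` and the vertical entry `α.2`. -/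
abbrev MIdx (n : ℕ) : Type := (Fin n → ℕ) × ℕ

/-- The length `|α|` of a multiindex. -/
def MIdx.len {n : ℕ} (α : MIdx n) : ℕ := (∑ i, α.1 i) + α.2

/-- The finite set of the multiindices `α ∈ ℕⁿ⁺¹` with `|α| = k`. -/
def multiIdx (n k : ℕ) : Finset (MIdx n) :=
  ((Fintype.piFinset fun _ : Fin n => Finset.range (k + 1)) ×ˢ Finset.range (k + 1)).filter
    fun α => α.len = k

theorem mem_multiIdx {n k : ℕ} {α : MIdx n} : α ∈ multiIdx n k ↔ α.len = k := by
  constructor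
  · intro h
    exact (Finset.mem_filter.1 h).2
  · intro h
    refine Finset.mem_filter.2 ⟨Finset.mem_product.2 ⟨Fintype.mem_piFinset.2 fun i => ?_, ?_⟩, h⟩
    · have h1 : α.1 i ≤ ∑ j, α.1 j :=
        Finset.single_le_sum (f := α.1) (fun j _ => Nat.zero_le _) (Finset.mem_univ i)
      have h2 : (∑ j, α.1 j) + α.2 = k := h
      exact Finset.mem_range.2 (by omega)
    · have h2 : (∑ j, α.1 j) + α.2 = k := h
      exact Finset.mem_range.2 (by omega)

/-- The multiindex `α + e_{n+1}`, with one more vertical derivative. -/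
def MIdx.addVert {n : ℕ} (α : MIdx n) : MIdx n := (α.1, α.2 + 1)

/-- The horizontal partial derivative `∂_{x_i}`. -/
def dHor {n : ℕ} (i : Fin n) (f : Space n → ℂ) : Space n → ℂ :=
  fun z => lineDeriv ℝ f z (EuclideanSpace.single i (1 : ℝ), (0 : ℝ))

/-- The vertical partial derivative `∂_t`. -/
def dVert {n : ℕ} (f : Space n → ℂ) : Space n → ℂ :=
  fun z => lineDeriv ℝ f z ((0 : Hor n), (1 : ℝ))

/-- The classical partial derivative `∂^α = ∂_{x_1}^{α_1} ⋯ ∂_{x_n}^{α_n} ∂_t^{α_{n+1}}`. -/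
def partialD {n : ℕ} (α : MIdx n) (f : Space n → ℂ) : Space n → ℂ :=
  (List.finRange n).foldr (fun i h => (dHor i)^[α.1 i] h) (dVert^[α.2] f)

/-- `φ` is smooth and compactly supported in `ℝⁿ⁺¹`. -/
def IsTest {n : ℕ} (φ : Space n → ℂ) : Prop := ContDiff ℝ ∞ φ ∧ HasCompactSupport φ

/-- `φ` is smooth and compactly supported in the open half-space. -/
def IsTestHalf {n : ℕ} (φ : Space n → ℂ) : Prop := IsTest φ ∧ tsupport φ ⊆ halfSpace n

/-- `v` is the weak derivative `∂^α w` in the half-space. -/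
def IsWeakDeriv {n : ℕ} (α : MIdx n) (w v : Space n → ℂ) : Prop :=
  LocallyIntegrableOn v (halfSpace n) ∧
    ∀ φ : Space n → ℂ, IsTestHalf φ →
      ∫ z in halfSpace n, w z * partialD α φ z =
        (-1 : ℂ) ^ α.len * ∫ z in halfSpace n, v z * φ z

/-- The array `(A F)_α = ∑_{|β| = m} A_{αβ} F_β`. -/
def applyCoeff {n : ℕ} (m : ℕ) (A : MIdx n → MIdx n → ℂ) (F : MIdx n → ℂ) (α : MIdx n) : ℂ :=
  ∑ β ∈ multiIdx n m, A α β * F β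

/-- The divergence form operator
`L u = (-1)^m ∑_{|α| = |β| = m} ∂^α (A_{αβ} ∂^β u)` on smooth functions. -/
def divOp {n : ℕ} (m : ℕ) (A : MIdx n → MIdx n → ℂ) (u : Space n → ℂ) (z : Space n) : ℂ :=
  (-1 : ℂ) ^ m * ∑ α ∈ multiIdx n m, ∑ β ∈ multiIdx n m,
    partialD α (fun y => A α β * partialD β u y) z

/-- The negative horizontal Laplacian `-Δ_∥ = -(∂_{x_1}² + ⋯ + ∂_{x_n}²)`. -/
def negLapHor {n : ℕ} (f : Space n → ℂ) : Space n → ℂ :=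
  fun z => -∑ i, dHor i (dHor i f) z

/-- The strong slice ellipticity with constant `lam`:
`Re ⟨∇^m φ(·,t), A ∇^m φ(·,t)⟩_{ℝⁿ} ≥ lam ‖∇^m φ(·,t)‖²_{L²(ℝⁿ)}` for all test functions `φ` on
`ℝⁿ⁺¹` and all `t`. -/
def SliceElliptic {n : ℕ} (m : ℕ) (A : MIdx n → MIdx n → ℂ) (lam : ℝ) : Prop :=
  ∀ φ : Space n → ℂ, IsTest φ → ∀ t : ℝ,
    lam * ∑ α ∈ multiIdx n m, ∫ x : Hor n, ‖partialD α φ (x, t)‖ ^ 2 ≤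
      (∑ α ∈ multiIdx n m, ∫ x : Hor n,
        starRingEnd ℂ (partialD α φ (x, t)) *
          applyCoeff m A (fun β => partialD β φ (x, t)) α).re

/-- The operator `Q_t^m = exp(-(-t² Δ_∥)^m)`, as the Fourier multiplier
`exp(-(4 π² t² |ξ|²)^m)`, where `f̂(ξ) = ∫ exp(-2 π i x·ξ) f(x) dx`. -/
def heatQ {n : ℕ} (m : ℕ) (t : ℝ) (f : Hor n → ℂ) : Hor n → ℂ :=
  𝓕⁻ (fun ξ : Hor n => ((Real.exp (-((4 * Real.pi ^ 2 * t ^ 2 * ‖ξ‖ ^ 2) ^ m)) : ℝ) : ℂ) * 𝓕 f ξ)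

/-- The extension `ℰφ(x,t) = ∑_{k=0}^{m-1} (t^k / k!) Q_t^m φ_k(x)`, `φ_k(x) = ∂_t^k φ(x,0)`. -/
def extE {n : ℕ} (m : ℕ) (φ : Space n → ℂ) : Space n → ℂ :=
  fun z => ∑ k ∈ Finset.range m,
    ((z.2 : ℂ) ^ k / (k.factorial : ℂ)) * heatQ m z.2 (fun x => dVert^[k] φ (x, 0)) z.1

/-- `M_A w = g`, where `D` is the array `∇^m w`: for every test function `φ` on `ℝⁿ⁺¹`,
`lim_{ε → 0⁺} lim_{T → ∞} ∫_ε^T ⟨A ∇^m w(·,t), ∇^m ℰφ(·,t)⟩_{ℝⁿ} dt`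
exists and equals `⟨g, Tr_{m-1} φ⟩_{ℝⁿ} = ∑_{|γ| = m-1} ∫ conj(g_γ(x)) ∂^γ φ(x,0) dx`.
The inner limit is `I ε`. -/
def HasNeumannData {n : ℕ} (m : ℕ) (A : MIdx n → MIdx n → ℂ) (D : MIdx n → Space n → ℂ)
    (g : MIdx n → Hor n → ℂ) : Prop :=
  ∀ φ : Space n → ℂ, IsTest φ → ∃ I : ℝ → ℂ,
    (∀ ε : ℝ, 0 < ε → Tendsto
      (fun T : ℝ => ∫ t in ε..T, ∑ α ∈ multiIdx n m, ∫ x : Hor n,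
        starRingEnd ℂ (applyCoeff m A (fun β => D β (x, t)) α) * partialD α (extE m φ) (x, t))
      atTop (𝓝 (I ε))) ∧
    Tendsto I (𝓝[>] 0)
      (𝓝 (∑ γ ∈ multiIdx n (m - 1), ∫ x : Hor n,
        starRingEnd ℂ (g γ x) * partialD γ φ (x, 0)))

/-- The square function `∫_0^∞ ∫_{ℝⁿ} |∇^m ∂_t w(x,t)|² t dx dt`, where `D` is the array of the
derivatives of `w`. -/
def squareFn {n : ℕ} (m : ℕ) (D : MIdx n → Space n → ℂ) : ℝ≥0∞ :=
  ∫⁻ t in Ioi (0 : ℝ), ∫⁻ x : Hor n,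
    (∑ α ∈ multiIdx n m, ‖D α.addVert (x, t)‖ₑ ^ 2) * ENNReal.ofReal t

/-- `sup_{t > 0} ‖∇^m w(·,t)‖²_{L²(ℝⁿ)}`, where `D` is the array of the derivatives of `w`. -/
def supSlice {n : ℕ} (m : ℕ) (D : MIdx n → Space n → ℂ) : ℝ≥0∞ :=
  ⨆ t : Ioi (0 : ℝ), ∫⁻ x : Hor n, ∑ α ∈ multiIdx n m, ‖D α (x, (t : ℝ))‖ₑ ^ 2

/-- `‖g‖²_{L²(ℝⁿ)}` for an array `g` indexed by the multiindices of length `k`. -/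
def arrNormSq {n : ℕ} (k : ℕ) (g : MIdx n → Hor n → ℂ) : ℝ≥0∞ :=
  ∫⁻ x : Hor n, ∑ γ ∈ multiIdx n k, ‖g γ x‖ₑ ^ 2

/-- `w` is a weak solution, with finite norms, of the `L²` Neumann problem in the half-space with
boundary data `g`. The array `D` consists of functions that represent the weak derivatives
`∂^α w` and `∂^α ∂_t w`, `|α| = m`. Weak derivatives are determined only almost everywhere; since
a representative may be changed for a null set of values of `t`, finiteness of `supSlice m D`
for some `D` says that the essential supremum over `t` is finite. -/
structure IsNeumannSol {n : ℕ} (m : ℕ) (A : MIdx n → MIdx n → ℂ) (g : MIdx n → Hor n → ℂ)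
    (w : Space n → ℂ) (D : MIdx n → Space n → ℂ) : Prop where
  locInt : LocallyIntegrableOn w (halfSpace n)
  weakDeriv : ∀ α ∈ multiIdx n m, IsWeakDeriv α w (D α)
  weakDeriv_vert : ∀ α ∈ multiIdx n m, IsWeakDeriv α.addVert w (D α.addVert)
  square_lt_top : squareFn m D < ⊤
  sup_lt_top : supSlice m D < ⊤
  /-- `L w = 0` in the weak sense. -/
  equation : ∀ φ : Space n → ℂ, IsTestHalf φ →
    ∑ α ∈ multiIdx n m, ∫ z in halfSpace n,
      starRingEnd ℂ (partialD α φ z) * applyCoeff m A (fun β => D β z) α = 0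
  neumann : HasNeumannData m A D g

/-- The value at `z = (x, t)` of a complex polynomial in the `n + 1` variables `x_1, …, x_n, t`. -/
def polyEval {n : ℕ} (p : MvPolynomial (Fin n ⊕ Unit) ℂ) (z : Space n) : ℂ :=
  MvPolynomial.eval (Sum.elim (fun i => ((z.1 i : ℝ) : ℂ)) (fun _ => ((z.2 : ℝ) : ℂ))) p

/-- Well posedness of the `L²` Neumann problem for order `2m` and constant coefficients `A`: with
one constant `C` for all data `g ∈ L²(ℝⁿ)`, a solution exists and satisfies the estimate, and
solutions are unique up to polynomials of degree at most `m - 1`. The solution found is smooth in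
the open half-space and the norms in its estimate are those of its classical derivatives (so the
supremum is over every `t > 0`); uniqueness is among all weak solutions. -/
def NeumannWellPosed (n m : ℕ) (A : MIdx n → MIdx n → ℂ) : Prop :=
  ∃ C : ℝ, ∀ g : MIdx n → Hor n → ℂ, (∀ γ ∈ multiIdx n (m - 1), MemLp (g γ) 2 volume) →
    (∃ w : Space n → ℂ, ContDiffOn ℝ ∞ w (halfSpace n) ∧
      IsNeumannSol m A g w (fun α => partialD α w) ∧
      squareFn m (fun α => partialD α w) + supSlice m (fun α => partialD α w) ≤
        ENNReal.ofReal C * arrNormSq (m - 1) g) ∧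
    (∀ (w₁ w₂ : Space n → ℂ) (D₁ D₂ : MIdx n → Space n → ℂ),
      IsNeumannSol m A g w₁ D₁ → IsNeumannSol m A g w₂ D₂ →
        ∃ p : MvPolynomial (Fin n ⊕ Unit) ℂ, p.totalDegree ≤ m - 1 ∧
          ∀ᵐ z ∂(volume.restrict (halfSpace n)), w₁ z = w₂ z + polyEval p z)

/-- The coefficients `A_{αα} = |α_∥|! / α_∥!` and `A_{αβ} = 0` for `α ≠ β`. -/
def specialCoeff (n : ℕ) (α β : MIdx n) : ℂ :=
  if α = β then ((∑ i, α.1 i).factorial : ℂ) / ((∏ i, (α.1 i).factorial : ℕ) : ℂ) else 0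

end HigherOrderNeumann

end

open Set Filter Topology MeasureTheory
open scoped ENNReal ContDiff FourierTransform

noncomputable section

namespace HigherOrderNeumann

section


/-! ### Calculus of partial derivatives -/

/-! Existence. Put τ = 2π|ξ|. The multinomial theorem (`sum_multinomial_mul`) is what the weights
|α_∥|!/α_∥! are made for: after the Fourier transform in x, both the operator and the energy form
depend on ξ through τ only. For each frequency there remains the ordinary differential equation ∑
(-1)^j τ^(2(m-j)) u^(2j) = 0. Its characteristic polynomial is a geometric sum, so the roots divided
by τ are the solutions of (-z²)^(m+1) = 1 with z² ≠ -1. They are simple, lie on the unit circle, and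
exactly m of them have negative real part (`root`).

The natural boundary operators of the energy form are partial geometric sums. Because (-z²)^(m+1) =
1, their values at a root z are, up to the factor 1/z, monic polynomials of degree 0, …, m-1 in z -
1/z (`neuMat_eq`). Hence the matrix of the Neumann problem is a Vandermonde matrix up to triangular
and diagonal factors, and it is invertible because z - 1/z = 2i Im z separates the roots
(`det_neuMat_ne_zero`). By homogeneity the coefficients of the decaying exponentials are
O(τ^(-m)|ĝ|). Derivatives of order m of the solution are therefore O(|ĝ| exp(-cτt)) on the Fourier
side, and Plancherel gives the supremum bound. One more derivative costs a factor τ, and ∫ τ² t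
exp(-2cτt) dt is bounded uniformly in τ, which gives the square function. The singularity τ^(-m) at
ξ = 0 is removed by subtracting from the exponential its Taylor polynomial of degree m-1, which
derivatives of order at least m do not see (`exists_kernel_bound`, `partialD_neuSol`). The Neumann
data follow from Green's formula on the half-line: the energy density is the t-derivative of the
pairing of boundary operators with traces (`bdryPair_deriv`, `integral_energySym`).

Uniqueness. Only the conjugated gradient d of the difference of two solutions is needed
(`IsGradArray`): it is bounded in L² on slices, its components are compatible as derivatives of one
function, it satisfies the weak equation, and its Neumann functional is zero. Since φ - ℰφ vanishes
to order m at t = 0, it can be cut off near the boundary, so the weak equation holds for every test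
function on ℝⁿ⁺¹ (`IsGradArray.sum_integral_eq_zero`), and then for test functions with bounded
frequencies and decay in t (`IsGradArray.sum_integral_symFn`). Compatibility moves all derivatives
to the single component d of ∂_{i₀}^m: this component is orthogonal to Lq for each q whose Neumann
boundary operators vanish at t = 0 (`IsGradArray.integral_bdrySym`).

The rest is duality. The same invertible matrix solves the problem with right-hand side a(ξ)
exp(-σt) and zero Neumann data, for large |σ| with Re σ > 0 (`IsGradArray.integral_symFn_exp`). So
the Laplace transform in t of the pairing of this component with any admissible a vanishes on a
vertical line, and the component is zero. Division by the symbol of ∂_{i₀}^m gives the same for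
every component (`IsGradArray.ae_eq_zero`). A locally integrable function whose weak derivatives of
order m all vanish is a polynomial of degree at most m-1, by mollification, Taylor's formula, and
closedness of finite-dimensional spaces (`ae_eq_polyEval_of_weakDeriv_eq_zero`). -/

/-- The coordinate directions of `ℝⁿ⁺¹`; `none` is the vertical one. -/
def dirVec {n : ℕ} : Option (Fin n) → Space n
  | none => ((0 : Hor n), (1 : ℝ))
  | some i => (EuclideanSpace.single i (1 : ℝ), (0 : ℝ))

/-- The multiindex of the first derivative in a coordinate direction. -/
def unitIdx {n : ℕ} : Option (Fin n) → MIdx n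
  | none => (0, 1)
  | some i => (Pi.single i 1, 0)

/-- The partial derivative in a coordinate direction. -/
def dDir {n : ℕ} (o : Option (Fin n)) (f : Space n → ℂ) : Space n → ℂ :=
  fun z => lineDeriv ℝ f z (dirVec o)

theorem dHor_eq_dDir {n : ℕ} (i : Fin n) : dHor (n := n) i = dDir (some i) := rfl

theorem dVert_eq_dDir {n : ℕ} : dVert (n := n) = dDir none := rfl

theorem dDir_eq_fderiv {n : ℕ} (o : Option (Fin n)) {f : Space n → ℂ} {z : Space n}
    (hf : DifferentiableAt ℝ f z) : dDir o f z = fderiv ℝ f z (dirVec o) :=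
  hf.lineDeriv_eq_fderiv

theorem dDir_eq_fderiv_fun {n : ℕ} (o : Option (Fin n)) {f : Space n → ℂ}
    (hf : Differentiable ℝ f) : dDir o f = fun z => fderiv ℝ f z (dirVec o) :=
  funext fun z => dDir_eq_fderiv o (hf z)

theorem contDiff_dDir {n : ℕ} (o : Option (Fin n)) {f : Space n → ℂ} (hf : ContDiff ℝ ∞ f) :
    ContDiff ℝ ∞ (dDir o f) := by
  rw [dDir_eq_fderiv_fun o (hf.differentiable (by simp))]
  exact (contDiff_infty_iff_fderiv.1 hf).2.clm_apply contDiff_const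

theorem dDir_comm {n : ℕ} (o p : Option (Fin n)) {f : Space n → ℂ} (hf : ContDiff ℝ ∞ f) :
    dDir o (dDir p f) = dDir p (dDir o f) := by
  have key : ∀ o p : Option (Fin n), ∀ z, dDir o (dDir p f) z =
      fderiv ℝ (fderiv ℝ f) z (dirVec o) (dirVec p) := by
    intro o p z
    have h2 : Differentiable ℝ (fderiv ℝ f) :=
      (contDiff_infty_iff_fderiv.1 hf).2.differentiable (by simp)
    rw [dDir_eq_fderiv o ((contDiff_dDir p hf).differentiable (by simp) z),
      dDir_eq_fderiv_fun p (hf.differentiable (by simp))]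
    rw [fderiv_clm_apply (h2 z) (by fun_prop)]
    simp
  funext z
  rw [key, key]
  have := (hf.contDiffAt (x := z)).isSymmSndFDerivAt (n := ∞)
    (by simpa using WithTop.coe_le_coe.2 (le_top : (2 : ℕ∞) ≤ ⊤))
  exact this _ _

/-- Smooth functions on `ℝⁿ⁺¹`. -/
def smoothFn (n : ℕ) : Submodule ℂ (Space n → ℂ) where
  carrier := {f | ContDiff ℝ ∞ f}
  add_mem' := fun {f g} (hf : ContDiff ℝ ∞ f) (hg : ContDiff ℝ ∞ g) => hf.add hg
  zero_mem' := (contDiff_const : ContDiff ℝ ∞ fun _ : Space n => (0 : ℂ))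
  smul_mem' := fun c f (hf : ContDiff ℝ ∞ f) =>
    (contDiff_const.mul hf : ContDiff ℝ ∞ fun z => c * f z)

theorem smoothFn.contDiff {n : ℕ} (f : smoothFn n) : ContDiff ℝ ∞ f.1 := f.2

theorem smoothFn.differentiable {n : ℕ} (f : smoothFn n) : Differentiable ℝ f.1 :=
  (smoothFn.contDiff f).differentiable (by simp)

theorem dDir_add {n : ℕ} (o : Option (Fin n)) {f g : Space n → ℂ}
    (hf : Differentiable ℝ f) (hg : Differentiable ℝ g) :
    dDir o (fun z => f z + g z) = fun z => dDir o f z + dDir o g z := by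
  funext z
  rw [dDir_eq_fderiv o (hf z), dDir_eq_fderiv o (hg z), dDir_eq_fderiv o ((hf z).fun_add (hg z)),
    fderiv_fun_add (hf z) (hg z)]
  rfl

theorem dDir_const_mul {n : ℕ} (o : Option (Fin n)) {f : Space n → ℂ} (c : ℂ)
    (hf : Differentiable ℝ f) :
    dDir o (fun z => c * f z) = fun z => c * dDir o f z := by
  funext z
  rw [dDir_eq_fderiv o (hf z), dDir_eq_fderiv o ((hf z).const_mul c), fderiv_const_mul (hf z)]
  rfl

theorem dDir_mul {n : ℕ} (o : Option (Fin n)) {f g : Space n → ℂ}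
    (hf : Differentiable ℝ f) (hg : Differentiable ℝ g) :
    dDir o (fun z => f z * g z) = fun z => f z * dDir o g z + dDir o f z * g z := by
  funext z
  rw [dDir_eq_fderiv o (hf z), dDir_eq_fderiv o (hg z), dDir_eq_fderiv o ((hf z).fun_mul (hg z)),
    fderiv_fun_mul (hf z) (hg z)]
  simp [mul_comm]

/-- The partial derivative as an endomorphism of the space of smooth functions. -/
def dEnd {n : ℕ} (o : Option (Fin n)) : Module.End ℂ (smoothFn n) where
  toFun f := ⟨dDir o f.1, contDiff_dDir o f.2⟩
  map_add' f g := Subtype.ext (dDir_add o (smoothFn.differentiable f) (smoothFn.differentiable g))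
  map_smul' c f := Subtype.ext (dDir_const_mul o c (smoothFn.differentiable f))

theorem dEnd_apply {n : ℕ} (o : Option (Fin n)) (f : smoothFn n) :
    (dEnd o f).1 = dDir o f.1 := rfl

theorem dEnd_comm {n : ℕ} (o p : Option (Fin n)) :
    dEnd (n := n) o * dEnd p = dEnd p * dEnd o := by
  refine LinearMap.ext fun f => Subtype.ext ?_
  rw [Module.End.mul_apply, Module.End.mul_apply, dEnd_apply, dEnd_apply, dEnd_apply, dEnd_apply]
  exact dDir_comm o p f.2

-- Evaluation of polynomials needs a commutative target. Pairwise commuting elements generate a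
-- commutative subalgebra, so the evaluation is made there and then included into the full algebra.
open scoped IsMulCommutative in
theorem exists_algHom_of_commute {ι B : Type*} [Semiring B] [Algebra ℂ B] (x : ι → B)
    (hx : ∀ i j, x i * x j = x j * x i) :
    ∃ Φ : MvPolynomial ι ℂ →ₐ[ℂ] B, ∀ i, Φ (MvPolynomial.X i) = x i := by
  have : IsMulCommutative (Algebra.adjoin ℂ (range x)) := Algebra.isMulCommutative_adjoin ℂ (by
    rintro _ ⟨o, rfl⟩ _ ⟨p, rfl⟩
    exact hx o p)
  let A : MvPolynomial ι ℂ →ₐ[ℂ] Algebra.adjoin ℂ (range x) :=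
    MvPolynomial.aeval fun o => ⟨x o, Algebra.subset_adjoin ⟨o, rfl⟩⟩
  refine ⟨(Subalgebra.val _).comp A, fun o => ?_⟩
  simp [A]

theorem exists_opHom (n : ℕ) :
    ∃ Φ : MvPolynomial (Option (Fin n)) ℂ →ₐ[ℂ] Module.End ℂ (smoothFn n),
      ∀ o, Φ (MvPolynomial.X o) = dEnd o :=
  exists_algHom_of_commute _ dEnd_comm

/-- Constant coefficient differential operators acting on smooth functions. -/
def opHom (n : ℕ) : MvPolynomial (Option (Fin n)) ℂ →ₐ[ℂ] Module.End ℂ (smoothFn n) :=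
  (exists_opHom n).choose

theorem opHom_X {n : ℕ} (o : Option (Fin n)) : opHom n (MvPolynomial.X o) = dEnd o :=
  (exists_opHom n).choose_spec o

/-- The monomial of a multiindex. -/
def monoIdx {n : ℕ} (α : MIdx n) : MvPolynomial (Option (Fin n)) ℂ :=
  (∏ i, MvPolynomial.X (some i) ^ α.1 i) * MvPolynomial.X none ^ α.2

theorem monoIdx_add {n : ℕ} (α β : MIdx n) : monoIdx (α + β) = monoIdx α * monoIdx β := by
  simp only [monoIdx, Prod.fst_add, Prod.snd_add, Pi.add_apply, pow_add, Finset.prod_mul_distrib]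
  ring

theorem monoIdx_unitIdx {n : ℕ} (o : Option (Fin n)) :
    monoIdx (unitIdx o) = MvPolynomial.X o := by
  cases o with
  | none => simp [monoIdx, unitIdx]
  | some i =>
    simp only [monoIdx, unitIdx, pow_zero, mul_one]
    rw [Finset.prod_eq_single i] <;> simp +contextual

theorem iterate_dDir {n : ℕ} (o : Option (Fin n)) (k : ℕ) (f : smoothFn n) :
    (dDir o)^[k] f.1 = (opHom n (MvPolynomial.X o ^ k) f).1 := by
  induction k generalizing f with
  | zero => simp
  | succ k ih =>
    rw [Function.iterate_succ_apply, pow_succ, map_mul, opHom_X, Module.End.mul_apply,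
      ← dEnd_apply]
    exact ih (dEnd o f)

/-- Identifying ∂^α with a monomial turns the rules for mixed derivatives (composition, linearity,
independence of the order) into identities in a polynomial ring. -/
theorem partialD_eq_opHom {n : ℕ} (α : MIdx n) (f : smoothFn n) :
    partialD α f.1 = (opHom n (monoIdx α) f).1 := by
  have h1 : ∀ (l : List (Fin n)) (g : smoothFn n),
      l.foldr (fun i h => (dHor i)^[α.1 i] h) g.1 =
        (opHom n ((l.map fun i => MvPolynomial.X (some i) ^ α.1 i).prod) g).1 := by
    intro l g
    induction l with
    | nil => simp
    | cons i l ih =>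
      rw [List.foldr_cons, ih, List.map_cons, List.prod_cons, map_mul, dHor_eq_dDir, iterate_dDir]
      rfl
  rw [partialD, dVert_eq_dDir, iterate_dDir, h1, monoIdx, Fin.prod_univ_def, map_mul]
  rfl

theorem contDiff_partialD {n : ℕ} (α : MIdx n) {f : Space n → ℂ} (hf : ContDiff ℝ ∞ f) :
    ContDiff ℝ ∞ (partialD α f) := by
  rw [show f = (⟨f, hf⟩ : smoothFn n).1 from rfl, partialD_eq_opHom]
  exact (opHom n (monoIdx α) ⟨f, hf⟩).2

theorem partialD_zero {n : ℕ} (f : Space n → ℂ) : partialD (0 : MIdx n) f = f := by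
  have : ∀ l : List (Fin n), l.foldr (fun i h => (dHor i)^[(0 : MIdx n).1 i] h) f = f := by
    intro l
    induction l with
    | nil => rfl
    | cons i l ih => rw [List.foldr_cons, ih]; rfl
  exact this _

theorem partialD_partialD {n : ℕ} (α β : MIdx n) {f : Space n → ℂ} (hf : ContDiff ℝ ∞ f) :
    partialD α (partialD β f) = partialD (α + β) f := by
  rw [show f = (⟨f, hf⟩ : smoothFn n).1 from rfl, partialD_eq_opHom, partialD_eq_opHom,
    partialD_eq_opHom, monoIdx_add, map_mul]
  rfl

theorem partialD_unitIdx {n : ℕ} (o : Option (Fin n)) {f : Space n → ℂ} (hf : ContDiff ℝ ∞ f) :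
    partialD (unitIdx o) f = dDir o f := by
  rw [show f = (⟨f, hf⟩ : smoothFn n).1 from rfl, partialD_eq_opHom, monoIdx_unitIdx, opHom_X, dEnd_apply]

theorem partialD_add_unitIdx {n : ℕ} (α : MIdx n) (o : Option (Fin n)) {f : Space n → ℂ}
    (hf : ContDiff ℝ ∞ f) : partialD (α + unitIdx o) f = dDir o (partialD α f) := by
  rw [add_comm, ← partialD_partialD _ _ hf, partialD_unitIdx o (contDiff_partialD α hf)]

theorem partialD_add_unitIdx' {n : ℕ} (α : MIdx n) (o : Option (Fin n)) {f : Space n → ℂ}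
    (hf : ContDiff ℝ ∞ f) : partialD (α + unitIdx o) f = partialD α (dDir o f) := by
  rw [← partialD_partialD _ _ hf, partialD_unitIdx o hf]

theorem partialD_sum {n : ℕ} (α : MIdx n) {ι : Type*} (s : Finset ι) (c : ι → ℂ)
    (f : ι → Space n → ℂ) (hf : ∀ i ∈ s, ContDiff ℝ ∞ (f i)) :
    partialD α (fun z => ∑ i ∈ s, c i * f i z) = fun z => ∑ i ∈ s, c i * partialD α (f i) z := by
  classical
  let F : ι → smoothFn n := fun i => if h : i ∈ s then ⟨f i, hf i h⟩ else 0
  have hF : ∀ i ∈ s, (F i).1 = f i := fun i hi => by simp [F, hi]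
  have h1 : (fun z => ∑ i ∈ s, c i * f i z) = (∑ i ∈ s, c i • F i : smoothFn n).1 := by
    funext z
    simp only [Submodule.coe_sum, Submodule.coe_smul, Finset.sum_apply, Pi.smul_apply, smul_eq_mul]
    exact Finset.sum_congr rfl fun i hi => by rw [hF i hi]
  rw [h1, partialD_eq_opHom, map_sum]
  funext z
  simp only [map_smul, Submodule.coe_sum, Submodule.coe_smul, Finset.sum_apply, Pi.smul_apply,
    smul_eq_mul]
  exact Finset.sum_congr rfl fun i hi => by rw [← partialD_eq_opHom, hF i hi]

theorem partialD_add {n : ℕ} (α : MIdx n) {f g : Space n → ℂ} (hf : ContDiff ℝ ∞ f)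
    (hg : ContDiff ℝ ∞ g) :
    partialD α (fun z => f z + g z) = fun z => partialD α f z + partialD α g z := by
  have := partialD_sum α Finset.univ (fun _ : Bool => (1 : ℂ)) (fun b => if b then f else g)
    (by intro i _; cases i <;> simpa)
  simpa using this

theorem partialD_const_mul {n : ℕ} (α : MIdx n) {f : Space n → ℂ} (c : ℂ)
    (hf : ContDiff ℝ ∞ f) :
    partialD α (fun z => c * f z) = fun z => c * partialD α f z := by
  have := partialD_sum α Finset.univ (fun _ : Unit => c) (fun _ => f) (by intro i _; simpa)
  simpa using this

theorem partialD_sub {n : ℕ} (α : MIdx n) {f g : Space n → ℂ} (hf : ContDiff ℝ ∞ f)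
    (hg : ContDiff ℝ ∞ g) :
    partialD α (fun z => f z - g z) = fun z => partialD α f z - partialD α g z := by
  have h : (fun z => f z - g z) = fun z => f z + (-1) * g z := by funext z; ring
  rw [h, partialD_add α hf (contDiff_const.mul hg), partialD_const_mul α _ hg]
  funext z; ring

/-- Every multiindex is a sum of unit multiindices. This is the induction used for nearly all
statements about ∂^α, since it reduces them to a single first derivative. -/
theorem MIdx.induction_unit {n : ℕ} {P : MIdx n → Prop} (h0 : P 0)
    (hs : ∀ α o, P α → P (α + unitIdx o)) (α : MIdx n) : P α := by
  have hadd : ∀ k : ℕ, ∀ o, ∀ α, P α → P (α + k • unitIdx o) := by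
    intro k
    induction k with
    | zero => intro o α h; simpa using h
    | succ k ih => intro o α h; rw [succ_nsmul, ← add_assoc]; exact hs _ _ (ih o α h)
  have hsum : ∀ s : Finset (Fin n), P (∑ i ∈ s, α.1 i • unitIdx (some i)) := by
    classical
    intro s
    induction s using Finset.induction_on with
    | empty => simpa using h0
    | insert i s hi ih =>
      rw [Finset.sum_insert hi, add_comm]
      exact hadd _ _ _ ih
  have := hadd α.2 none _ (hsum Finset.univ)
  convert this using 1
  refine Prod.ext ?_ ?_
  · funext j
    simp [unitIdx, Finset.sum_apply, Pi.single_apply, Prod.fst_sum]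
  · simp [unitIdx, Prod.snd_sum]

theorem MIdx.len_add {n : ℕ} (α β : MIdx n) : (α + β).len = α.len + β.len := by
  simp only [MIdx.len, Prod.fst_add, Prod.snd_add, Pi.add_apply, Finset.sum_add_distrib]
  ring

@[simp] theorem MIdx.len_unitIdx {n : ℕ} (o : Option (Fin n)) :
    (unitIdx o : MIdx n).len = 1 := by
  cases o <;> simp [MIdx.len, unitIdx]

@[simp] theorem MIdx.len_zero {n : ℕ} : (0 : MIdx n).len = 0 := by simp [MIdx.len]

/-! ### Locality and supports of partial derivatives -/

theorem eventuallyEq_dDir {n : ℕ} (o : Option (Fin n)) {f g : Space n → ℂ} {z : Space n}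
    (h : f =ᶠ[𝓝 z] g) : dDir o f =ᶠ[𝓝 z] dDir o g := by
  filter_upwards [h.eventually_nhds] with y hy
  exact Filter.EventuallyEq.lineDeriv_eq hy

theorem eventuallyEq_partialD {n : ℕ} (α : MIdx n) {f g : Space n → ℂ} {z : Space n}
    (h : f =ᶠ[𝓝 z] g) : partialD α f =ᶠ[𝓝 z] partialD α g := by
  have hit : ∀ (o : Option (Fin n)) (k : ℕ) {f g : Space n → ℂ}, f =ᶠ[𝓝 z] g →
      (dDir o)^[k] f =ᶠ[𝓝 z] (dDir o)^[k] g := by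
    intro o k
    induction k with
    | zero => intro f g h; exact h
    | succ k ih => intro f g h; exact ih (eventuallyEq_dDir o h)
  have hl : ∀ l : List (Fin n),
      l.foldr (fun i h => (dHor i)^[α.1 i] h) (dVert^[α.2] f) =ᶠ[𝓝 z]
        l.foldr (fun i h => (dHor i)^[α.1 i] h) (dVert^[α.2] g) := by
    intro l
    induction l with
    | nil => exact hit none _ h
    | cons i l ih => exact hit (some i) _ ih
  exact hl _

theorem support_partialD_subset {n : ℕ} (α : MIdx n) (f : Space n → ℂ) :
    tsupport (partialD α f) ⊆ tsupport f := by
  refine closure_minimal (fun z hz => ?_) (isClosed_tsupport f)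
  by_contra hn
  have h0 : f =ᶠ[𝓝 z] fun _ => 0 := notMem_tsupport_iff_eventuallyEq.1 hn
  have h1 := (eventuallyEq_partialD α h0).eq_of_nhds
  have h2 : partialD α (fun _ : Space n => (0 : ℂ)) = fun _ => 0 := by
    simpa using partialD_const_mul α (f := fun _ => (0 : ℂ)) 0 contDiff_const
  rw [h2] at h1
  exact hz h1

theorem IsTest.partialD {n : ℕ} {φ : Space n → ℂ} (h : IsTest φ) (α : MIdx n) :
    IsTest (partialD α φ) :=
  ⟨contDiff_partialD α h.1, h.2.mono' ((subset_tsupport _).trans (support_partialD_subset α φ))⟩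

theorem IsTestHalf.partialD {n : ℕ} {φ : Space n → ℂ} (h : IsTestHalf φ) (α : MIdx n) :
    IsTestHalf (partialD α φ) :=
  ⟨h.1.partialD α, (support_partialD_subset α φ).trans h.2⟩

/-- Leibniz formula. -/
theorem exists_leibniz {n : ℕ} (α : MIdx n) :
    ∃ (ι : Type) (_ : Fintype ι) (β γ : ι → MIdx n), (∀ i, β i + γ i = α) ∧
      ∀ f g : Space n → ℂ, ContDiff ℝ ∞ f → ContDiff ℝ ∞ g →
        partialD α (fun z => f z * g z) =
          fun z => ∑ i, partialD (β i) f z * partialD (γ i) g z := by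
  induction α using MIdx.induction_unit with
  | h0 =>
    refine ⟨Unit, inferInstance, fun _ => 0, fun _ => 0, by simp, fun f g hf hg => ?_⟩
    funext z
    simp [partialD_zero]
  | hs α o ih =>
    obtain ⟨ι, _, β, γ, hα, h⟩ := ih
    -- One more derivative doubles the index set: on the left summand it falls on g, on the right
    -- one on f. Binomial coefficients appear as repetitions of index pairs and need never be
    -- computed.
    refine ⟨ι ⊕ ι, inferInstance, Sum.elim β fun i => β i + unitIdx o,
      Sum.elim (fun i => γ i + unitIdx o) γ, ?_, fun f g hf hg => ?_⟩
    · rintro (i | i)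
      · simp [← hα i, add_assoc]
      · simp [← hα i, add_left_comm, add_comm]
    have hprod : ∀ i, ContDiff ℝ ∞ (fun z => partialD (β i) f z * partialD (γ i) g z) :=
      fun i => (contDiff_partialD _ hf).mul (contDiff_partialD _ hg)
    rw [partialD_add_unitIdx _ _ (hf.mul hg), h f g hf hg,
      ← partialD_unitIdx o (ContDiff.sum fun i _ => hprod i)]
    have h1 := partialD_sum (unitIdx o) Finset.univ (fun _ => (1 : ℂ)) _ fun i _ => hprod i
    simp only [one_mul] at h1
    rw [h1]
    funext z
    rw [Fintype.sum_sum_type, ← Finset.sum_add_distrib]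
    refine Finset.sum_congr rfl fun i _ => ?_
    rw [partialD_unitIdx o (hprod i), dDir_mul o
      ((contDiff_partialD _ hf).differentiable (by simp))
      ((contDiff_partialD _ hg).differentiable (by simp))]
    simp only [Sum.elim_inl, Sum.elim_inr]
    rw [partialD_add_unitIdx _ _ hf, partialD_add_unitIdx _ _ hg]

end

section


/-! ### Integration by parts -/

instance isAddHaarMeasure_volume_space {n : ℕ} :
    (volume : Measure (Space n)).IsAddHaarMeasure :=
  inferInstanceAs ((volume : Measure (Hor n)).prod (volume : Measure ℝ)).IsAddHaarMeasure

theorem integral_mul_dDir {n : ℕ} (o : Option (Fin n)) {f g : Space n → ℂ}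
    (hf : ContDiff ℝ ∞ f) (hg : IsTest g) :
    ∫ z, f z * dDir o g z = -∫ z, dDir o f z * g z := by
  have hfd := hf.differentiable (by simp)
  have hgd := hg.1.differentiable (by simp)
  have hg' : IsTest (dDir o g) := by
    have := hg.partialD (unitIdx o)
    rwa [partialD_unitIdx o hg.1] at this
  have hc : ∀ {u v : Space n → ℂ}, Continuous u → IsTest v → Integrable fun z => u z * v z :=
    fun {u v} hu hv => (hu.mul hv.1.continuous).integrable_of_hasCompactSupport hv.2.mul_left
  have h1 := hc hf.continuous hg'
  have h2 := hc (contDiff_dDir o hf).continuous hg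
  rw [dDir_eq_fderiv_fun o hgd] at h1 ⊢
  rw [dDir_eq_fderiv_fun o hfd] at h2 ⊢
  exact integral_mul_fderiv_eq_neg_fderiv_mul_of_integrable h2 h1 (hc hf.continuous hg)
    (fun z _ => hfd z) (fun z _ => hgd z)

theorem integral_mul_partialD {n : ℕ} (α : MIdx n) {f g : Space n → ℂ}
    (hf : ContDiff ℝ ∞ f) (hg : IsTest g) :
    ∫ z, f z * partialD α g z = (-1 : ℂ) ^ α.len * ∫ z, partialD α f z * g z := by
  induction α using MIdx.induction_unit generalizing g with
  | h0 => simp [partialD_zero]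
  | hs α o ih =>
    have hg' : IsTest (dDir o g) := by
      have := hg.partialD (unitIdx o)
      rwa [partialD_unitIdx o hg.1] at this
    rw [partialD_add_unitIdx' _ _ hg.1, ih hg', partialD_add_unitIdx _ _ hf,
      integral_mul_dDir o (contDiff_partialD α hf) hg, MIdx.len_add, MIdx.len_unitIdx, pow_succ]
    ring

/-! ### Complex conjugation -/

theorem dDir_conj {n : ℕ} (o : Option (Fin n)) {f : Space n → ℂ} (hf : Differentiable ℝ f) :
    dDir o (fun z => starRingEnd ℂ (f z)) = fun z => starRingEnd ℂ (dDir o f z) := by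
  have h := fun z => (Complex.conjCLE.toContinuousLinearMap.hasFDerivAt (x := f z)).comp z
    (hf z).hasFDerivAt
  funext z
  rw [dDir_eq_fderiv o (hf z)]
  exact ((h z).hasLineDerivAt (dirVec o)).lineDeriv

theorem contDiff_conj {n : ℕ} {f : Space n → ℂ} (hf : ContDiff ℝ ∞ f) :
    ContDiff ℝ ∞ fun z => starRingEnd ℂ (f z) :=
  Complex.conjCLE.contDiff.comp hf

theorem partialD_conj {n : ℕ} (α : MIdx n) {f : Space n → ℂ} (hf : ContDiff ℝ ∞ f) :
    partialD α (fun z => starRingEnd ℂ (f z)) = fun z => starRingEnd ℂ (partialD α f z) := by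
  induction α using MIdx.induction_unit with
  | h0 => simp [partialD_zero]
  | hs α o ih =>
    rw [partialD_add_unitIdx _ _ (contDiff_conj hf), ih, partialD_add_unitIdx _ _ hf,
      dDir_conj o ((contDiff_partialD α hf).differentiable (by simp))]

theorem IsTest.conj {n : ℕ} {φ : Space n → ℂ} (h : IsTest φ) :
    IsTest fun z => starRingEnd ℂ (φ z) :=
  ⟨contDiff_conj h.1, h.2.comp_left (g := starRingEnd ℂ) (map_zero _)⟩

theorem IsTestHalf.conj {n : ℕ} {φ : Space n → ℂ} (h : IsTestHalf φ) :
    IsTestHalf fun z => starRingEnd ℂ (φ z) :=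
  ⟨h.1.conj, (closure_mono (Function.support_comp_subset (g := starRingEnd ℂ) (map_zero _)
    φ)).trans h.2⟩

/-! ### Sums over multiindices and the special coefficients -/

theorem sum_multiIdx {n m : ℕ} {M : Type*} [AddCommMonoid M] (F : MIdx n → M) :
    ∑ α ∈ multiIdx n m, F α =
      ∑ j ∈ Finset.range (m + 1), ∑ β ∈ Finset.piAntidiag Finset.univ (m - j), F (β, j) := by
  rw [Finset.sum_sigma']
  refine Finset.sum_bij' (fun α _ => ⟨α.2, α.1⟩) (fun x _ => (x.2, x.1)) ?_ ?_ ?_ ?_ ?_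
  · intro α hα
    have h : (∑ i, α.1 i) + α.2 = m := mem_multiIdx.1 hα
    simp only [Finset.mem_sigma, Finset.mem_range, Finset.mem_piAntidiag]
    exact ⟨by omega, (by omega : ∑ i, α.1 i = m - α.2), by simp⟩
  · rintro ⟨j, β⟩ h
    simp only [Finset.mem_sigma, Finset.mem_range, Finset.mem_piAntidiag] at h
    refine mem_multiIdx.2 ?_
    simp only [MIdx.len]
    have : ∑ i, β i = m - j := h.2.1
    omega
  · intro α _; rfl
  · intro x _; rfl
  · intro α _; rfl

theorem specialCoeff_self {n : ℕ} (α : MIdx n) :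
    specialCoeff n α α = (Nat.multinomial Finset.univ α.1 : ℂ) := by
  rw [specialCoeff, if_pos rfl]
  have h := Nat.multinomial_spec Finset.univ α.1
  have h0 : ((∏ i, (α.1 i).factorial : ℕ) : ℂ) ≠ 0 := by
    exact_mod_cast (Finset.prod_pos fun i _ => Nat.factorial_pos _).ne'
  rw [div_eq_iff h0, mul_comm]
  exact_mod_cast h.symm

theorem applyCoeff_specialCoeff {n m : ℕ} (F : MIdx n → ℂ) {α : MIdx n} (hα : α ∈ multiIdx n m) :
    applyCoeff m (specialCoeff n) F α = (Nat.multinomial Finset.univ α.1 : ℂ) * F α := by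
  rw [applyCoeff, Finset.sum_eq_single α, specialCoeff_self]
  · intro β _ hβ
    simp [specialCoeff, hβ.symm]
  · exact fun h => absurd hα h

/-- The multinomial theorem in the horizontal variables, for fixed vertical order. It explains the
choice of coefficients: weighted sums over multiindices collapse to powers of the single quantity ∑
y i. It is applied to differential operators, to symbols and to the energy form. -/
theorem sum_multinomial_mul {n m : ℕ} {R : Type*} [CommSemiring R] (y : Fin n → R) (F : ℕ → R) :
    ∑ α ∈ multiIdx n m, (Nat.multinomial Finset.univ α.1 : R) * ((∏ i, y i ^ α.1 i) * F α.2) =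
      ∑ j ∈ Finset.range (m + 1), (∑ i, y i) ^ (m - j) * F j := by
  rw [sum_multiIdx]
  refine Finset.sum_congr rfl fun j _ => ?_
  rw [Finset.sum_pow_eq_sum_piAntidiag, Finset.sum_mul]
  exact Finset.sum_congr rfl fun β _ => by ring

theorem multinomial_pos' {n : ℕ} (β : Fin n → ℕ) : 1 ≤ Nat.multinomial Finset.univ β :=
  Nat.multinomial_pos _ _

theorem multinomial_le_factorial {n m : ℕ} {α : MIdx n} (hα : α ∈ multiIdx n m) :
    Nat.multinomial Finset.univ α.1 ≤ m.factorial := by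
  have h := Nat.multinomial_spec Finset.univ α.1
  have h1 : 1 ≤ ∏ i, (α.1 i).factorial := Finset.prod_pos fun i _ => Nat.factorial_pos _
  have h2 : (∑ i, α.1 i) + α.2 = m := mem_multiIdx.1 hα
  calc Nat.multinomial Finset.univ α.1
      ≤ (∏ i, (α.1 i).factorial) * Nat.multinomial Finset.univ α.1 := Nat.le_mul_of_pos_left _ h1
    _ = (∑ i, α.1 i).factorial := h
    _ ≤ m.factorial := Nat.factorial_le (by omega)

theorem specialCoeff_real {n : ℕ} (α β : MIdx n) :
    (specialCoeff n α β).im = 0 ∧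
      specialCoeff n α β = starRingEnd ℂ (specialCoeff n β α) := by
  by_cases h : α = β
  · subst h
    rw [specialCoeff_self]
    simp
  · simp [specialCoeff, h, Ne.symm h]

theorem norm_specialCoeff_le {n m : ℕ} {α : MIdx n} (hα : α ∈ multiIdx n m) (β : MIdx n) :
    ‖specialCoeff n α β‖ ≤ m.factorial := by
  by_cases h : α = β
  · subst h
    rw [specialCoeff_self, Complex.norm_natCast]
    exact_mod_cast multinomial_le_factorial hα
  · simp [specialCoeff, h]

/-- Ellipticity holds pointwise under the integral: the matrix is diagonal with entries that are
positive integers, so the constant is 1. -/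
theorem sliceElliptic_specialCoeff (n m : ℕ) : SliceElliptic m (specialCoeff n) 1 := by
  intro φ _ t
  rw [one_mul, Complex.re_sum]
  refine Finset.sum_le_sum fun α hα => ?_
  have h : ∀ x : Hor n, starRingEnd ℂ (partialD α φ (x, t)) *
      applyCoeff m (specialCoeff n) (fun β => partialD β φ (x, t)) α =
        (((Nat.multinomial Finset.univ α.1 : ℝ) * ‖partialD α φ (x, t)‖ ^ 2 : ℝ) : ℂ) := by
    intro x
    rw [applyCoeff_specialCoeff _ hα, mul_left_comm, ← Complex.normSq_eq_conj_mul_self,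
      Complex.normSq_eq_norm_sq]
    push_cast
    ring
  simp_rw [h]
  rw [integral_complex_ofReal, Complex.ofReal_re, integral_const_mul]
  refine le_mul_of_one_le_left (integral_nonneg fun x => by positivity) ?_
  exact_mod_cast multinomial_pos' α.1

theorem iterate_negLapHor {n : ℕ} (k : ℕ) (f : smoothFn n) :
    negLapHor^[k] f.1 =
      (opHom n ((-∑ i, MvPolynomial.X (some i) ^ 2) ^ k) f).1 := by
  induction k generalizing f with
  | zero => simp
  | succ k ih =>
    have h : negLapHor f.1 = (opHom n (-∑ i, MvPolynomial.X (some i) ^ 2) f).1 := by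
      funext z
      simp only [negLapHor, map_neg, map_sum, pow_two, map_mul, opHom_X]
      simp only [LinearMap.neg_apply, LinearMap.sum_apply, Module.End.mul_apply,
        Submodule.coe_neg, Submodule.coe_sum, Pi.neg_apply, Finset.sum_apply, dEnd_apply]
      rfl
    rw [Function.iterate_succ_apply, h, ih, pow_succ, map_mul, Module.End.mul_apply]

/-- Both sides are the values at u of constant coefficient operators, so the claim is an identity of
polynomials in the symbols of the derivatives, namely the multinomial theorem for their squares. -/
theorem divOp_specialCoeff {n m : ℕ} {u : Space n → ℂ} (hu : ContDiff ℝ ∞ u) (z : Space n) :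
    divOp m (specialCoeff n) u z = ∑ j ∈ Finset.range (m + 1), (-1 : ℂ) ^ j *
      (negLapHor^[m - j] (dVert^[2 * j] u)) z := by
  let U : smoothFn n := ⟨u, hu⟩
  have hL : divOp m (specialCoeff n) u z = (opHom n ((-1) ^ m * ∑ α ∈ multiIdx n m,
      (Nat.multinomial Finset.univ α.1 : MvPolynomial (Option (Fin n)) ℂ) *
        ((∏ i, (MvPolynomial.X (some i) ^ 2) ^ α.1 i) * (MvPolynomial.X none ^ 2) ^ α.2)) U).1 z := by
    have h1 : ((-1 : MvPolynomial (Option (Fin n)) ℂ) ^ m * ∑ α ∈ multiIdx n m,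
      (Nat.multinomial Finset.univ α.1 : MvPolynomial (Option (Fin n)) ℂ) *
        ((∏ i, (MvPolynomial.X (some i) ^ 2) ^ α.1 i) * (MvPolynomial.X none ^ 2) ^ α.2)) =
        ((-1 : ℂ) ^ m) • ∑ α ∈ multiIdx n m, (Nat.multinomial Finset.univ α.1 : ℂ) •
          monoIdx (α + α) := by
      rw [MvPolynomial.smul_eq_C_mul, map_pow, map_neg, map_one]
      refine congrArg _ (Finset.sum_congr rfl fun α _ => ?_)
      rw [MvPolynomial.smul_eq_C_mul, map_natCast, monoIdx_add, monoIdx]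
      refine congrArg _ ?_
      simp only [pow_two, mul_pow, Finset.prod_mul_distrib]
      ring
    rw [h1, map_smul, map_sum]
    simp only [map_smul, LinearMap.smul_apply, LinearMap.sum_apply, Submodule.coe_smul,
      Submodule.coe_sum, Pi.smul_apply, Finset.sum_apply, smul_eq_mul, divOp,
      ← partialD_eq_opHom]
    refine congrArg _ (Finset.sum_congr rfl fun α hα => ?_)
    rw [Finset.sum_eq_single α]
    · rw [partialD_const_mul α _ (contDiff_partialD α hu), partialD_partialD α α hu,
        specialCoeff_self]
    · intro β _ hβ
      have : (fun y => specialCoeff n α β * partialD β u y) = fun y => 0 * partialD β u y := by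
        funext y; simp [specialCoeff, hβ.symm]
      rw [this, partialD_const_mul α _ (contDiff_partialD β hu)]
      simp
    · exact fun h => absurd hα h
  rw [hL, sum_multinomial_mul]
  have hR : ∀ j ∈ Finset.range (m + 1),
      (-1 : ℂ) ^ j * (negLapHor^[m - j] (dVert^[2 * j] u)) z =
      (opHom n (((-1 : ℂ) ^ j) • ((-∑ i, MvPolynomial.X (some i) ^ 2) ^ (m - j) *
        MvPolynomial.X none ^ (2 * j))) U).1 z := by
    intro j _
    rw [map_smul, map_mul, show u = U.1 from rfl, dVert_eq_dDir, iterate_dDir, iterate_negLapHor]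
    rfl
  have hS : ∀ g : ℕ → MvPolynomial (Option (Fin n)) ℂ,
      ∑ j ∈ Finset.range (m + 1), (opHom n (g j) U).1 z =
        (opHom n (∑ j ∈ Finset.range (m + 1), g j) U).1 z := by
    intro g
    rw [map_sum, LinearMap.sum_apply, Submodule.coe_sum, Finset.sum_apply]
  rw [Finset.sum_congr rfl hR, hS, Finset.mul_sum]
  refine congrArg (fun p => (opHom n p U).1 z) ?_
  refine Finset.sum_congr rfl fun j hj => ?_
  have hj' : j ≤ m := Nat.lt_succ_iff.1 (Finset.mem_range.1 hj)
  -- The signs match because (-1)^m = (-1)^j (-1)^(m-j), and the factor (-1)^(m-j) turns the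
  -- horizontal Laplacian into its negative.
  rw [MvPolynomial.smul_eq_C_mul, map_pow, map_neg, map_one, neg_pow (∑ i, _), ← pow_mul]
  obtain ⟨k, rfl⟩ := Nat.exists_eq_add_of_le hj'
  rw [Nat.add_sub_cancel_left, pow_add]
  ring

end

section


/-! ### Integrals depending smoothly on a point of `ℝⁿ⁺¹` -/

/-- The coordinate functionals dual to `dirVec`. -/
def coordCLM {n : ℕ} : Option (Fin n) → Space n →L[ℝ] ℝ
  | none => ContinuousLinearMap.snd ℝ (Hor n) ℝ
  | some i => (EuclideanSpace.proj i).comp (ContinuousLinearMap.fst ℝ (Hor n) ℝ)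

theorem sum_coordCLM_smul_dirVec {n : ℕ} (z : Space n) :
    ∑ o, coordCLM o z • dirVec o = z := by
  rw [Fintype.sum_option]
  refine Prod.ext ?_ ?_
  · ext i
    simp [coordCLM, dirVec, Prod.fst_sum, Pi.single_apply]
  · simp [coordCLM, dirVec, Prod.snd_sum]

/-- The linear map sending `c` to the functional `v ↦ v_o c`. -/
def dirForm {n : ℕ} (o : Option (Fin n)) : ℂ →L[ℝ] (Space n →L[ℝ] ℂ) :=
  ContinuousLinearMap.smulRightL ℝ (Space n) ℂ (coordCLM o)

theorem dirForm_apply {n : ℕ} (o : Option (Fin n)) (c : ℂ) (v : Space n) :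
    dirForm o c v = (coordCLM o v : ℝ) • c := rfl

theorem hasFDerivAt_of_dDir {n : ℕ} {f : Space n → ℂ} {z : Space n}
    (hf : DifferentiableAt ℝ f z) :
    HasFDerivAt f (∑ o, dirForm o (dDir o f z)) z := by
  convert hf.hasFDerivAt using 1
  refine ContinuousLinearMap.ext fun v => ?_
  conv_rhs => rw [← sum_coordCLM_smul_dirVec v]
  simp only [map_sum, map_smul, sum_apply, dirForm_apply]
  exact Finset.sum_congr rfl fun o _ => by rw [dDir_eq_fderiv o hf]

theorem partialD_add_unitIdx_fun {n : ℕ} (α : MIdx n) {f : Space n → ℂ} (hf : ContDiff ℝ ∞ f)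
    (z : Space n) : ∑ o, dirForm o (partialD (α + unitIdx o) f z) =
      ∑ o, dirForm o (dDir o (partialD α f) z) :=
  Finset.sum_congr rfl fun o _ => by rw [partialD_add_unitIdx _ _ hf]

variable {n : ℕ} {X : Type*} [MeasurableSpace X] {μ : Measure X} {k : X → Space n → ℂ}
  {Ω : Set (Space n)}

/-- All derivatives of the kernel `k ξ` are, locally uniformly in `Ω`, dominated by integrable
functions of the parameter `ξ`. -/
structure IsSmoothKernel (μ : Measure X) (k : X → Space n → ℂ) (Ω : Set (Space n)) : Prop where
  contDiff : ∀ ξ, ContDiff ℝ ∞ (k ξ)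
  meas : ∀ α, ∀ z ∈ Ω, AEStronglyMeasurable (fun ξ => partialD α (k ξ) z) μ
  dom : ∀ α, ∀ z ∈ Ω, ∃ U ∈ 𝓝 z, ∃ b : X → ℝ, Integrable b μ ∧
    ∀ᵐ ξ ∂μ, ∀ y ∈ U, ‖partialD α (k ξ) y‖ ≤ b ξ

theorem IsSmoothKernel.integrable (h : IsSmoothKernel μ k Ω) (α : MIdx n) {z : Space n}
    (hz : z ∈ Ω) : Integrable (fun ξ => partialD α (k ξ) z) μ := by
  obtain ⟨U, hU, b, hb, hd⟩ := h.dom α z hz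
  exact hb.mono' (h.meas α z hz) (hd.mono fun ξ hξ => hξ z (mem_of_mem_nhds hU))

theorem integral_sum_clm {ι E F : Type*} [Fintype ι] [NormedAddCommGroup E] [NormedSpace ℝ E]
    [NormedAddCommGroup F] [NormedSpace ℝ F] [CompleteSpace E] [CompleteSpace F]
    (T : ι → F →L[ℝ] E) {f : ι → X → F} (hf : ∀ i, Integrable (f i) μ) :
    Integrable (fun ξ => ∑ i, T i (f i ξ)) μ ∧
      ∫ ξ, ∑ i, T i (f i ξ) ∂μ = ∑ i, T i (∫ ξ, f i ξ ∂μ) := by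
  have h1 : ∀ i, Integrable (fun ξ => T i (f i ξ)) μ := fun i => (T i).integrable_comp (hf i)
  refine ⟨integrable_finsetSum _ fun i _ => h1 i, ?_⟩
  rw [integral_finsetSum _ fun i _ => h1 i]
  exact Finset.sum_congr rfl fun i _ => (T i).integral_comp_comm (hf i)

/-- Domination of all the derivatives of the next order is exactly what differentiation under the
integral needs. The derivative is again built from integrals of the same kind, so the argument can
be iterated. -/
theorem IsSmoothKernel.hasFDerivAt (hΩ : IsOpen Ω) (h : IsSmoothKernel μ k Ω) (α : MIdx n)
    {z : Space n} (hz : z ∈ Ω) :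
    HasFDerivAt (fun y => ∫ ξ, partialD α (k ξ) y ∂μ)
      (∑ o, dirForm o (∫ ξ, partialD (α + unitIdx o) (k ξ) z ∂μ)) z := by
  choose U hU b hb hd using fun o => h.dom (α + unitIdx o) z hz
  let F' : Space n → X → Space n →L[ℝ] ℂ := fun y ξ =>
    ∑ o, dirForm o (partialD (α + unitIdx o) (k ξ) y)
  have hF' := integral_sum_clm (dirForm (n := n)) fun o => h.integrable (α + unitIdx o) hz
  have hs : (⋂ o, U o) ∈ 𝓝 z := Filter.iInter_mem.2 hU
  have hI : Integrable (F' z) μ := hF'.1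
  have hbd : ∀ᵐ ξ ∂μ, ∀ y ∈ ⋂ o, U o, ‖F' y ξ‖ ≤ ∑ o, ‖dirForm (n := n) o‖ * b o ξ := by
    filter_upwards [ae_all_iff.2 hd] with ξ hξ y hy
    refine (norm_sum_le _ _).trans (Finset.sum_le_sum fun o _ => ?_)
    exact (ContinuousLinearMap.le_opNorm _ _).trans
      (mul_le_mul_of_nonneg_left (hξ o y (mem_iInter.1 hy o)) (norm_nonneg _))
  have hbi : Integrable (fun ξ => ∑ o, ‖dirForm (n := n) o‖ * b o ξ) μ :=
    integrable_finsetSum _ fun o _ => (hb o).const_mul _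
  have hdiff : ∀ᵐ ξ ∂μ, ∀ y ∈ ⋂ o, U o, HasFDerivAt (fun y => partialD α (k ξ) y) (F' y ξ) y := by
    refine Filter.Eventually.of_forall fun ξ y _ => ?_
    have := hasFDerivAt_of_dDir
      ((contDiff_partialD α (h.contDiff ξ)).differentiable (by simp) y)
    rw [← partialD_add_unitIdx_fun α (h.contDiff ξ) y] at this
    exact this
  have hms : ∀ᶠ y in 𝓝 z, AEStronglyMeasurable (fun ξ => partialD α (k ξ) y) μ := by
    filter_upwards [hΩ.mem_nhds hz] with y hy using h.meas α y hy
  have hmain : HasFDerivAt (fun y => ∫ ξ, partialD α (k ξ) y ∂μ) (∫ ξ, F' z ξ ∂μ) z :=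
    hasFDerivAt_integral_of_dominated_of_fderiv_le hs hms (h.integrable α hz)
      hI.aestronglyMeasurable hbd hbi hdiff
  rwa [show ∫ ξ, F' z ξ ∂μ = _ from hF'.2] at hmain

theorem IsSmoothKernel.contDiffOn_partialD (hΩ : IsOpen Ω) (h : IsSmoothKernel μ k Ω)
    (α : MIdx n) : ContDiffOn ℝ ∞ (fun y => ∫ ξ, partialD α (k ξ) y ∂μ) Ω := by
  rw [contDiffOn_infty]
  intro N
  induction N generalizing α with
  | zero =>
    exact contDiffOn_zero.2 fun z hz => (h.hasFDerivAt hΩ α hz).continuousAt.continuousWithinAt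
  | succ N ih =>
    push_cast
    rw [contDiffOn_succ_iff_fderiv_of_isOpen hΩ]
    refine ⟨fun z hz => (h.hasFDerivAt hΩ α hz).differentiableAt.differentiableWithinAt,
      by simp, ?_⟩
    have : ContDiffOn ℝ N (fun z => ∑ o, dirForm (n := n) o
        (∫ ξ, partialD (α + unitIdx o) (k ξ) z ∂μ)) Ω :=
      ContDiffOn.sum fun o _ =>
        (dirForm o).contDiff.comp_contDiffOn (ih _)
    exact this.congr fun z hz => (h.hasFDerivAt hΩ α hz).fderiv

/-- A smooth function on an open set agrees near a given point with a globally smooth one. -/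
theorem exists_contDiff_eventuallyEq {f : Space n → ℂ} (hΩ : IsOpen Ω) (hf : ContDiffOn ℝ ∞ f Ω)
    {z : Space n} (hz : z ∈ Ω) : ∃ g : Space n → ℂ, ContDiff ℝ ∞ g ∧ f =ᶠ[𝓝 z] g := by
  obtain ⟨r, hr, hrΩ⟩ := Metric.isOpen_iff.1 hΩ z hz
  let b : ContDiffBump z := ⟨r / 4, r / 2, by positivity, by linarith⟩
  refine ⟨fun y => (b y : ℂ) * f y, ?_, ?_⟩
  · rw [contDiff_iff_contDiffAt]
    intro y
    by_cases hy : y ∈ Ω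
    · exact (Complex.ofRealCLM.contDiff.contDiffAt.comp y b.contDiffAt).mul
        (hf.contDiffAt (hΩ.mem_nhds hy))
    · have : y ∉ tsupport b := fun h => hy (hrΩ (by
        rw [b.tsupport_eq] at h
        exact Metric.closedBall_subset_ball (by simp [b]; linarith) h))
      have h0 : (fun y => (b y : ℂ) * f y) =ᶠ[𝓝 y] fun _ => 0 := by
        filter_upwards [notMem_tsupport_iff_eventuallyEq.1 this] with w hw
        simp [hw]
      exact contDiffAt_const.congr_of_eventuallyEq h0
  · filter_upwards [b.eventuallyEq_one] with y hy
    simp [hy]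

theorem partialD_add_unitIdx_of_contDiffOn {f : Space n → ℂ} (hΩ : IsOpen Ω)
    (hf : ContDiffOn ℝ ∞ f Ω) (α : MIdx n) (o : Option (Fin n)) {z : Space n} (hz : z ∈ Ω) :
    partialD (α + unitIdx o) f z = dDir o (partialD α f) z := by
  obtain ⟨g, hg, hfg⟩ := exists_contDiff_eventuallyEq hΩ hf hz
  rw [(eventuallyEq_partialD _ hfg).eq_of_nhds, partialD_add_unitIdx _ _ hg]
  exact (eventuallyEq_dDir o (eventuallyEq_partialD α hfg)).eq_of_nhds.symm

theorem IsSmoothKernel.partialD_integral (hΩ : IsOpen Ω) (h : IsSmoothKernel μ k Ω) (α : MIdx n)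
    {z : Space n} (hz : z ∈ Ω) :
    partialD α (fun y => ∫ ξ, k ξ y ∂μ) z = ∫ ξ, partialD α (k ξ) z ∂μ := by
  have h0 : ContDiffOn ℝ ∞ (fun y => ∫ ξ, k ξ y ∂μ) Ω := by
    simpa only [partialD_zero] using h.contDiffOn_partialD hΩ 0
  induction α using MIdx.induction_unit generalizing z with
  | h0 => simp only [partialD_zero]
  | hs α o ih =>
    rw [partialD_add_unitIdx_of_contDiffOn hΩ h0 _ _ hz]
    have he : partialD α (fun y => ∫ ξ, k ξ y ∂μ) =ᶠ[𝓝 z] fun y => ∫ ξ, partialD α (k ξ) y ∂μ := by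
      filter_upwards [hΩ.mem_nhds hz] with y hy using ih hy
    rw [(eventuallyEq_dDir o he).eq_of_nhds]
    have hd := (h.hasFDerivAt hΩ α hz).hasLineDerivAt (dirVec o)
    have hco : ∀ p : Option (Fin n), coordCLM (n := n) p (dirVec o) = if p = o then 1 else 0 := by
      intro p
      cases p <;> cases o <;> simp [coordCLM, dirVec]
    rw [dDir, hd.lineDeriv]
    simp only [sum_apply, dirForm_apply, hco]
    simp

end

section


/-! ### The Fourier transform on `L¹ ∩ L²` and on `L²` -/

section Fourier

variable {V : Type*} [NormedAddCommGroup V] [InnerProductSpace ℝ V] [FiniteDimensional ℝ V]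
  [MeasurableSpace V] [BorelSpace V]

theorem continuous_neg_innerL {V : Type*} [NormedAddCommGroup V] [InnerProductSpace ℝ V] :
    Continuous fun p : V × V => (-innerₗ V) p.1 p.2 := by
  have h : (fun p : V × V => (-innerₗ V) p.1 p.2) = fun p => -inner ℝ p.1 p.2 := by
    funext p; simp
  rw [h]
  exact continuous_inner.neg

/-- Fubini: the kernel of the transform is symmetric. The inverse transform is treated as the
Fourier integral for the form -⟨x, ξ⟩. -/
theorem integral_fourierInv_mul {f q : V → ℂ} (hf : Integrable f) (hq : Integrable q) :
    ∫ x, 𝓕⁻ f x * q x = ∫ x, f x * 𝓕⁻ q x := by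
  have h := VectorFourier.integral_fourierIntegral_smul_eq_flip (L := -innerₗ V)
    Real.continuous_fourierChar continuous_neg_innerL hf hq
  have hi : ∀ (f : V → ℂ) (x : V), 𝓕⁻ f x =
      VectorFourier.fourierIntegral Real.fourierChar volume (-innerₗ V) f x := by
    intro f x
    rw [Real.fourierInv_eq]
    simp [VectorFourier.fourierIntegral]
  have hi' : ∀ (f : V → ℂ) (x : V), 𝓕⁻ f x =
      VectorFourier.fourierIntegral Real.fourierChar volume (-innerₗ V).flip f x := by
    intro f x
    rw [Real.fourierInv_eq]
    simp [VectorFourier.fourierIntegral, real_inner_comm]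
  simpa only [hi f, hi' q, smul_eq_mul] using h

theorem continuous_fourierInv {f : V → ℂ} (hf : Integrable f) : Continuous (𝓕⁻ f) := by
  have := VectorFourier.fourierIntegral_continuous (L := -innerₗ V) (μ := volume)
    Real.continuous_fourierChar continuous_neg_innerL hf
  convert this using 1
  funext x
  rw [Real.fourierInv_eq]
  simp [VectorFourier.fourierIntegral]

/-- The transform on L² is an abstract isometry, the one on L¹ an integral. Tested against smooth
functions of compact support they agree, because in both cases the transform can be moved to the
test function. -/
theorem fourierInv_toLp_ae_eq {f : V → ℂ} (h1 : Integrable f) (h2 : MemLp f 2) :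
    (𝓕⁻ (h2.toLp f) : Lp (α := V) ℂ 2 volume) =ᵐ[volume] 𝓕⁻ f := by
  refine ae_eq_of_integral_contDiff_smul_eq
    ((Lp.memLp (𝓕⁻ (h2.toLp f))).locallyIntegrable (by norm_num))
    (continuous_fourierInv h1).locallyIntegrable fun g hg hgc => ?_
  have hg₁ : HasCompactSupport (Complex.ofRealCLM ∘ g) := hgc.comp_left rfl
  have hg₂ : ContDiff ℝ ∞ (Complex.ofRealCLM ∘ g) := by fun_prop
  let ψ : SchwartzMap V ℂ := hg₁.toSchwartzMap hg₂
  have hψ : ∀ x, ψ x = (g x : ℂ) := fun x => rfl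
  have e1 := congrArg (fun T => T ψ) (Lp.fourierInv_toTemperedDistribution_eq (h2.toLp f))
  simp only [TemperedDistribution.fourierInv_apply, Lp.toTemperedDistribution_apply,
    smul_eq_mul] at e1
  calc ∫ x, g x • (𝓕⁻ (h2.toLp f) : Lp (α := V) ℂ 2 volume) x
      = ∫ x, ψ x * (𝓕⁻ (h2.toLp f) : Lp (α := V) ℂ 2 volume) x := by
        simp only [hψ, Complex.real_smul]
    _ = ∫ x, (𝓕⁻ ψ) x * (h2.toLp f) x := e1.symm
    _ = ∫ x, f x * 𝓕⁻ (ψ : V → ℂ) x := by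
        refine integral_congr_ae ?_
        filter_upwards [h2.coeFn_toLp] with x hx
        rw [hx, mul_comm, SchwartzMap.fourierInv_coe]
    _ = ∫ x, 𝓕⁻ f x * ψ x := (integral_fourierInv_mul h1 ψ.integrable).symm
    _ = ∫ x, g x • 𝓕⁻ f x := by simp only [hψ, Complex.real_smul, mul_comm]

theorem memLp_fourierInv {f : V → ℂ} (h1 : Integrable f) (h2 : MemLp f 2) : MemLp (𝓕⁻ f) 2 :=
  (memLp_congr_ae (fourierInv_toLp_ae_eq h1 h2)).1 (Lp.memLp _)

theorem integral_conj_mul_eq_inner (f g : Lp (α := V) ℂ 2 volume) :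
    ∫ x, starRingEnd ℂ (f x) * g x = inner ℂ f g := by
  rw [L2.inner_def]
  refine integral_congr_ae (Filter.Eventually.of_forall fun x => ?_)
  simp [mul_comm]

theorem inner_fourierInv_eq (f g : Lp (α := V) ℂ 2 volume) : inner ℂ (𝓕⁻ f) (𝓕⁻ g) = inner ℂ f g :=
  (Lp.fourierTransformₗᵢ V ℂ).symm.inner_map_map f g

theorem norm_fourierInv_eq (f : Lp (α := V) ℂ 2 volume) : ‖𝓕⁻ f‖ = ‖f‖ :=
  (Lp.fourierTransformₗᵢ V ℂ).symm.norm_map f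

theorem integral_conj_fourierInv_mul {f q : V → ℂ} (hf1 : Integrable f) (hf2 : MemLp f 2)
    (hq1 : Integrable q) (hq2 : MemLp q 2) :
    ∫ x, starRingEnd ℂ (𝓕⁻ f x) * 𝓕⁻ q x = ∫ x, starRingEnd ℂ (f x) * q x := by
  have h := inner_fourierInv_eq (hf2.toLp f) (hq2.toLp q)
  rw [← integral_conj_mul_eq_inner, ← integral_conj_mul_eq_inner] at h
  refine Eq.trans (integral_congr_ae ?_) (h.trans (integral_congr_ae ?_))
  · filter_upwards [fourierInv_toLp_ae_eq hf1 hf2, fourierInv_toLp_ae_eq hq1 hq2] with x h1 h2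
    rw [h1, h2]
  · filter_upwards [hf2.coeFn_toLp, hq2.coeFn_toLp] with x h1 h2
    rw [h1, h2]

theorem eLpNorm_fourierInv {f : V → ℂ} (h1 : Integrable f) (h2 : MemLp f 2) :
    eLpNorm (𝓕⁻ f) 2 volume = eLpNorm f 2 volume := by
  have h := congrArg ENNReal.ofReal (norm_fourierInv_eq (h2.toLp f))
  rw [Lp.norm_def, Lp.norm_def, ENNReal.ofReal_toReal (Lp.memLp _).2.ne,
    ENNReal.ofReal_toReal (Lp.memLp _).2.ne] at h
  rwa [eLpNorm_congr_ae (fourierInv_toLp_ae_eq h1 h2), eLpNorm_congr_ae h2.coeFn_toLp] at h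

theorem eLpNorm_two_sq {f : V → ℂ} : eLpNorm f 2 volume ^ 2 = ∫⁻ x, ‖f x‖ₑ ^ 2 := by
  have := eLpNorm_nnreal_pow_eq_lintegral (μ := (volume : Measure V)) (f := f) (p := 2)
    (by norm_num)
  simpa using this

theorem lintegral_enorm_sq_fourierInv {f : V → ℂ} (h1 : Integrable f) (h2 : MemLp f 2) :
    ∫⁻ x, ‖𝓕⁻ f x‖ₑ ^ 2 = ∫⁻ x, ‖f x‖ₑ ^ 2 := by
  rw [← eLpNorm_two_sq, ← eLpNorm_two_sq, eLpNorm_fourierInv h1 h2]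

open scoped Classical in
/-- A representative of the Fourier transform of a square integrable function. -/
def fourierL2 (g : V → ℂ) : V → ℂ :=
  if h : MemLp g 2 volume then (𝓕 (h.toLp g) : Lp (α := V) ℂ 2 volume) else 0

theorem fourierL2_ae_eq {g : V → ℂ} (h : MemLp g 2) :
    fourierL2 g = (𝓕 (h.toLp g) : Lp (α := V) ℂ 2 volume) := by
  rw [fourierL2, dif_pos h]

theorem memLp_fourierL2 {g : V → ℂ} (h : MemLp g 2) : MemLp (fourierL2 g) 2 := by
  rw [fourierL2_ae_eq h]
  exact Lp.memLp _

theorem lintegral_enorm_sq_fourierL2 {g : V → ℂ} (hg : MemLp g 2) :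
    ∫⁻ x, ‖fourierL2 g x‖ₑ ^ 2 = ∫⁻ x, ‖g x‖ₑ ^ 2 := by
  have h := congrArg ENNReal.ofReal (Lp.norm_fourier_eq (hg.toLp g))
  rw [Lp.norm_def, Lp.norm_def, ENNReal.ofReal_toReal (Lp.memLp _).2.ne,
    ENNReal.ofReal_toReal (Lp.memLp _).2.ne, eLpNorm_congr_ae hg.coeFn_toLp] at h
  rw [← eLpNorm_two_sq, ← eLpNorm_two_sq, fourierL2_ae_eq hg, h]

/-- Parseval's identity when only one factor is known to be integrable on the Fourier side; the
other is arbitrary data in L². -/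
theorem integral_conj_mul_fourierInv {g q : V → ℂ} (hg : MemLp g 2) (hq1 : Integrable q)
    (hq2 : MemLp q 2) :
    ∫ x, starRingEnd ℂ (g x) * 𝓕⁻ q x = ∫ x, starRingEnd ℂ (fourierL2 g x) * q x := by
  have h := inner_fourierInv_eq (𝓕 (hg.toLp g)) (hq2.toLp q)
  rw [FourierTransform.fourierInv_fourier_eq, ← integral_conj_mul_eq_inner,
    ← integral_conj_mul_eq_inner] at h
  refine Eq.trans (integral_congr_ae ?_) (h.trans (integral_congr_ae ?_))
  · filter_upwards [hg.coeFn_toLp, fourierInv_toLp_ae_eq hq1 hq2] with x h1 h2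
    rw [h1, h2]
  · filter_upwards [hq2.coeFn_toLp] with x h2
    rw [fourierL2_ae_eq hg, h2]

/-- A square integrable function is determined by its pairings with functions whose Fourier
transforms are smooth and compactly supported in an open set of full measure. -/
theorem ae_eq_zero_of_integral_mul_fourierInv {h : V → ℂ} (hh : MemLp h 2) {U : Set V}
    (hU : IsOpen U) (hU' : ∀ᵐ ξ, ξ ∈ U)
    (H : ∀ a : V → ℝ, ContDiff ℝ ∞ a → HasCompactSupport a → tsupport a ⊆ U →
      ∫ x, h x * 𝓕⁻ (fun ξ => (a ξ : ℂ)) x = 0) : ∀ᵐ x, h x = 0 := by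
  have hg : MemLp (fun x => starRingEnd ℂ (h x)) 2 :=
    hh.of_le (Complex.continuous_conj.comp_aestronglyMeasurable hh.1)
      (Filter.Eventually.of_forall fun x => by simp)
  have h0 : ∀ᵐ ξ, ξ ∈ U → starRingEnd ℂ (fourierL2 (fun x => starRingEnd ℂ (h x)) ξ) = 0 := by
    refine hU.ae_eq_zero_of_integral_contDiff_smul_eq_zero ?_ fun a ha hac haU => ?_
    · refine LocallyIntegrable.locallyIntegrableOn ?_ _
      refine MemLp.locallyIntegrable (p := 2) ?_ (by norm_num)
      exact (memLp_fourierL2 hg).of_le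
        (Complex.continuous_conj.comp_aestronglyMeasurable (memLp_fourierL2 hg).1)
        (Filter.Eventually.of_forall fun x => by simp)
    · have hac' : HasCompactSupport fun ξ => (a ξ : ℂ) := hac.comp_left (g := Complex.ofReal) rfl
      have hcont : Continuous fun ξ => (a ξ : ℂ) := Complex.continuous_ofReal.comp ha.continuous
      have := integral_conj_mul_fourierInv hg (hcont.integrable_of_hasCompactSupport hac')
        (hcont.memLp_of_hasCompactSupport hac')
      simp only [Complex.conj_conj] at this
      rw [H a ha hac haU] at this
      rw [this]
      exact integral_congr_ae (Filter.Eventually.of_forall fun ξ => by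
        simp only [Complex.real_smul]; ring)
  have h1 : ∫⁻ x, ‖fourierL2 (fun x => starRingEnd ℂ (h x)) x‖ₑ ^ 2 = 0 := by
    rw [lintegral_eq_zero_iff' (by
      exact ((memLp_fourierL2 hg).1.enorm.pow_const _))]
    filter_upwards [h0, hU'] with ξ h2 h3
    have := h2 h3
    simp only [map_eq_zero] at this
    simp [this]
  rw [lintegral_enorm_sq_fourierL2 hg, lintegral_eq_zero_iff' (hg.1.enorm.pow_const _)] at h1
  filter_upwards [h1] with x hx
  simpa using hx

/-- An integrable function on the line with vanishing Fourier transform vanishes. -/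
theorem ae_eq_zero_of_fourier_eq_zero {f : V → ℂ} (hf : Integrable f)
    (H : ∀ ξ, 𝓕⁻ f ξ = 0) : ∀ᵐ x, f x = 0 := by
  refine ae_eq_zero_of_integral_contDiff_smul_eq_zero hf.locallyIntegrable fun g hg hgc => ?_
  have hg₁ : HasCompactSupport (Complex.ofRealCLM ∘ g) := hgc.comp_left rfl
  have hg₂ : ContDiff ℝ ∞ (Complex.ofRealCLM ∘ g) := by fun_prop
  let ψ : SchwartzMap V ℂ := hg₁.toSchwartzMap hg₂
  have h := integral_fourierInv_mul hf (𝓕 ψ).integrable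
  have h2 : 𝓕⁻ ((𝓕 ψ : SchwartzMap V ℂ) : V → ℂ) = ψ := by
    rw [← SchwartzMap.fourierInv_coe, FourierTransform.fourierInv_fourier_eq]
  simp only [H, zero_mul, integral_zero, h2] at h
  rw [h]
  exact integral_congr_ae (Filter.Eventually.of_forall fun x => by
    simp only [Complex.real_smul]; exact mul_comm _ _)

end Fourier

end

section


/-! ### The ordinary differential equation for a fixed frequency -/

section Symbol

open Polynomial in
/-- The polynomials with `(z + z⁻¹) S_k(z - z⁻¹) = z^(k+1) - (-z⁻¹)^(k+1)`. -/
def fibPoly : ℕ → ℂ[X]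
  | 0 => 1
  | 1 => X
  | k + 2 => X * fibPoly (k + 1) + fibPoly k

open Polynomial in
theorem fibPoly_monic_natDegree (k : ℕ) : (fibPoly k).Monic ∧ (fibPoly k).natDegree = k := by
  induction k using Nat.strong_induction_on with
  | _ k ih =>
    match k, ih with
    | 0, _ => exact ⟨monic_one, natDegree_one⟩
    | 1, _ => exact ⟨monic_X, natDegree_X⟩
    | k + 2, ih =>
      obtain ⟨h1, h1'⟩ := ih (k + 1) (by omega)
      obtain ⟨_, h0'⟩ := ih k (by omega)
      have hm : (X * fibPoly (k + 1)).Monic := monic_X.mul h1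
      have hd : (X * fibPoly (k + 1)).natDegree = k + 2 := by
        rw [monic_X.natDegree_mul h1, natDegree_X, h1']; ring
      have hlt : (fibPoly k).natDegree < (X * fibPoly (k + 1)).natDegree := by omega
      rw [fibPoly]
      exact ⟨hm.add_of_left (degree_lt_degree hlt), by
        rw [natDegree_add_eq_left_of_natDegree_lt hlt, hd]⟩

/-- The numbers z and -1/z have sum z - 1/z and product -1, so their powers satisfy the recurrence
that defines the polynomials. -/
theorem eval_fibPoly {z : ℂ} (hz : z ≠ 0) (k : ℕ) :
    (z + z⁻¹) * (fibPoly k).eval (z - z⁻¹) = z ^ (k + 1) - (-z⁻¹) ^ (k + 1) := by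
  have h : z * z⁻¹ = 1 := mul_inv_cancel₀ hz
  induction k using Nat.strong_induction_on with
  | _ k ih =>
    match k, ih with
    | 0, _ => simp [fibPoly]
    | 1, _ => simp only [fibPoly, Polynomial.eval_X]; ring
    | k + 2, ih =>
      have h1 := ih (k + 1) (by omega)
      have h0 := ih k (by omega)
      rw [fibPoly, Polynomial.eval_add, Polynomial.eval_mul, Polynomial.eval_X]
      calc (z + z⁻¹) * ((z - z⁻¹) * (fibPoly (k + 1)).eval (z - z⁻¹) +
            (fibPoly k).eval (z - z⁻¹))
          = (z - z⁻¹) * ((z + z⁻¹) * (fibPoly (k + 1)).eval (z - z⁻¹)) +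
            (z + z⁻¹) * (fibPoly k).eval (z - z⁻¹) := by ring
        _ = _ := by
            rw [h1, h0]
            have e1 : z⁻¹ * z ^ (k + 1 + 1) = z ^ (k + 1) := by rw [pow_succ' z (k + 1)]; grind
            have e2 : z * (-z⁻¹) ^ (k + 1 + 1) = -(-z⁻¹) ^ (k + 1) := by
              rw [pow_succ' (-z⁻¹) (k + 1)]; grind
            linear_combination -e1 - e2

/-- The arguments of the characteristic roots. -/
def rootArg (m : ℕ) (l : Fin m) : ℝ := Real.pi * ((l : ℝ) + 1) / (m + 1)

/-- The characteristic roots with negative real part, for `2π|ξ| = 1`. -/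
def root (m : ℕ) (l : Fin m) : ℂ := Complex.I * Complex.exp (rootArg m l * Complex.I)

variable {m : ℕ}

theorem rootArg_mem (l : Fin m) : rootArg m l ∈ Ioo 0 Real.pi := by
  have h1 : ((l : ℕ) : ℝ) + 1 ≤ m := by exact_mod_cast l.2
  have h2 : (0 : ℝ) ≤ (l : ℕ) := Nat.cast_nonneg _
  constructor
  · unfold rootArg; positivity
  · rw [rootArg, div_lt_iff₀ (by positivity)]
    nlinarith [Real.pi_pos]

theorem root_re (l : Fin m) : (root m l).re = -Real.sin (rootArg m l) := by
  simp [root, Complex.exp_ofReal_mul_I_im]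

theorem root_im (l : Fin m) : (root m l).im = Real.cos (rootArg m l) := by
  simp [root, Complex.exp_ofReal_mul_I_re]

theorem root_re_neg (l : Fin m) : (root m l).re < 0 := by
  rw [root_re]
  exact neg_neg_of_pos (Real.sin_pos_of_mem_Ioo (rootArg_mem l))

theorem norm_root (l : Fin m) : ‖root m l‖ = 1 := by
  simp [root, Complex.norm_exp_ofReal_mul_I]

theorem root_ne_zero (l : Fin m) : root m l ≠ 0 := by
  rw [← norm_ne_zero_iff, norm_root]; exact one_ne_zero

theorem one_add_root_sq_ne_zero (l : Fin m) : 1 + root m l ^ 2 ≠ 0 := by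
  intro h
  have h1 : (root m l - Complex.I) * (root m l + Complex.I) = 0 := by
    linear_combination h - Complex.I_sq
  have h2 := root_re_neg l
  rcases mul_eq_zero.1 h1 with h3 | h3
  · rw [sub_eq_zero.1 h3] at h2; simp at h2
  · rw [eq_neg_of_add_eq_zero_left h3] at h2; simp at h2

theorem neg_root_sq_pow (l : Fin m) : (-root m l ^ 2) ^ (m + 1) = 1 := by
  have h1 : -root m l ^ 2 = Complex.exp (2 * (rootArg m l * Complex.I)) := by
    rw [root, mul_pow, Complex.I_sq, ← Complex.exp_nat_mul]; simp
  have hm : (m : ℂ) + 1 ≠ 0 := by exact_mod_cast Nat.succ_ne_zero m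
  rw [h1, ← Complex.exp_nat_mul, Complex.exp_eq_one_iff]
  refine ⟨(l : ℕ) + 1, ?_⟩
  simp only [rootArg]
  push_cast
  field_simp

/-- The characteristic polynomial is the geometric sum of the powers of -z², which times -z² - 1 is
(-z²)^(m+1) - 1 = 0; the factor -z² - 1 is not zero. -/
theorem sum_root_pow (l : Fin m) :
    ∑ i ∈ Finset.range (m + 1), (-1 : ℂ) ^ i * root m l ^ (2 * i) = 0 := by
  have h1 : ∀ i, (-1 : ℂ) ^ i * root m l ^ (2 * i) = (-root m l ^ 2) ^ i := by
    intro i; rw [pow_mul, ← mul_pow]; congr 1; ring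
  simp_rw [h1]
  have h2 := geom_sum_mul (-root m l ^ 2) (m + 1)
  rw [neg_root_sq_pow, sub_self] at h2
  refine (mul_eq_zero.1 h2).resolve_right fun h => one_add_root_sq_ne_zero l ?_
  linear_combination -h

/-- On the unit circle 1/z is the conjugate of z, so z - 1/z = 2i cos θ, and the cosine is injective
on (0, π). -/
theorem root_sub_inv_injective (m : ℕ) :
    Function.Injective fun l : Fin m => root m l - (root m l)⁻¹ := by
  have key : ∀ l : Fin m, root m l - (root m l)⁻¹ =
      (2 * Real.cos (rootArg m l) : ℝ) * Complex.I := by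
    intro l
    have h : (root m l)⁻¹ = starRingEnd ℂ (root m l) := by
      rw [Complex.inv_def, Complex.normSq_eq_norm_sq, norm_root]; simp
    rw [h, Complex.sub_conj, root_im]
  intro l l' h
  simp only [key] at h
  have h1 := mul_right_cancel₀ Complex.I_ne_zero h
  have h2 : Real.cos (rootArg m l) = Real.cos (rootArg m l') := by
    have := Complex.ofReal_injective h1
    linarith
  have h3 := Real.injOn_cos (Ioo_subset_Icc_self (rootArg_mem l))
    (Ioo_subset_Icc_self (rootArg_mem l')) h2
  have hm : (0 : ℝ) < m + 1 := by positivity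
  simp only [rootArg] at h3
  rw [div_left_inj' hm.ne'] at h3
  have h4 := mul_left_cancel₀ Real.pi_pos.ne' h3
  exact Fin.ext (by exact_mod_cast add_right_cancel h4)

theorem exists_root_re_le (m : ℕ) : ∃ c : ℝ, 0 < c ∧ ∀ l : Fin m, (root m l).re ≤ -c := by
  rcases isEmpty_or_nonempty (Fin m) with h | h
  · exact ⟨1, one_pos, fun l => h.elim l⟩
  · obtain ⟨l0, h0⟩ := Finite.exists_max fun l : Fin m => (root m l).re
    exact ⟨-(root m l0).re, by linarith [root_re_neg l0], fun l => by linarith [h0 l]⟩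

/-- The Neumann boundary operators of the decaying exponentials. -/
def neuMat (m : ℕ) : Matrix (Fin m) (Fin m) ℂ :=
  Matrix.of fun k l => ∑ i ∈ Finset.range (m - k), (-1 : ℂ) ^ i * root m l ^ ((k : ℕ) + 1 + 2 * i)

/-- An entry is z^(k+1) times a truncated geometric sum. Multiplied by 1 + z², it becomes a
difference of two powers, and (-z²)^(m+1) = 1 rewrites the second one as a power of -1/z. This
difference is the right-hand side of `eval_fibPoly`. -/
theorem neuMat_eq (k l : Fin m) :
    neuMat m k l = (fibPoly k).eval (root m l - (root m l)⁻¹) * (root m l)⁻¹ := by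
  have hz := root_ne_zero l
  have h1 := one_add_root_sq_ne_zero l
  have hp := neg_root_sq_pow l
  set z := root m l with hzdef
  have hS := eval_fibPoly hz k
  have hN : neuMat m k l = z ^ ((k : ℕ) + 1) * ∑ i ∈ Finset.range (m - k), (-z ^ 2) ^ i := by
    simp only [neuMat, Matrix.of_apply, Finset.mul_sum, ← hzdef]
    refine Finset.sum_congr rfl fun i _ => ?_
    rw [pow_add, pow_mul, neg_pow (z ^ 2)]; ring
  have hg := geom_sum_mul (-z ^ 2) (m - k)
  -- Since (-z²)^(m+1) = 1, the factor (-z²)^(m-k) is the inverse of (-z²)^(k+1).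
  have hpow : (-z ^ 2) ^ (m - k) * z ^ ((k : ℕ) + 1) = (-z⁻¹) ^ ((k : ℕ) + 1) := by
    have e1 : (-z ^ 2) ^ (m - k) * (-z ^ 2) ^ ((k : ℕ) + 1) = 1 := by
      rw [← pow_add, ← hp]; congr 1; have := k.2; omega
    have e2 : (-z ^ 2) ^ ((k : ℕ) + 1) * (-z⁻¹) ^ ((k : ℕ) + 1) = z ^ ((k : ℕ) + 1) := by
      rw [← mul_pow]; congr 1; field_simp
    rw [← e2, ← mul_assoc, e1, one_mul]
  have h3 : (1 + z ^ 2) * neuMat m k l = z ^ ((k : ℕ) + 1) - (-z⁻¹) ^ ((k : ℕ) + 1) := by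
    rw [hN, ← hpow]
    linear_combination (-z ^ ((k : ℕ) + 1)) * hg
  refine mul_left_cancel₀ h1 ?_
  rw [h3, ← hS]
  field_simp
  ring

/-- Evaluating monic polynomials of degrees 0, …, m-1 at m nodes has the Vandermonde determinant.
The nodes z - 1/z are distinct, and the diagonal factor 1/z does not vanish. This is the Lopatinskii
condition for the Neumann problem. -/
theorem det_neuMat_ne_zero (m : ℕ) : (neuMat m).det ≠ 0 := by
  have h1 : neuMat m = (Matrix.of fun l k : Fin m =>
      (fibPoly k).eval (root m l - (root m l)⁻¹)).transpose *
        Matrix.diagonal fun l => (root m l)⁻¹ := by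
    ext k l
    rw [Matrix.mul_diagonal, neuMat_eq]
    rfl
  rw [h1, Matrix.det_mul, Matrix.det_transpose, Matrix.det_diagonal,
    ← Matrix.det_eval_matrixOfPolynomials_eq_det_vandermonde _ (fun k : Fin m => fibPoly k)
      (fun k => (fibPoly_monic_natDegree k).2) fun k => (fibPoly_monic_natDegree k).1]
  exact mul_ne_zero (Matrix.det_vandermonde_ne_zero_iff.2 (root_sub_inv_injective m))
    (Finset.prod_ne_zero_iff.2 fun l _ => inv_ne_zero (root_ne_zero l))

/-- The Neumann boundary operators on the sequence `u` of the derivatives of a function; the value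
at `j = 0` is the differential operator itself. -/
def bdry (m : ℕ) (s : ℂ) (u : ℕ → ℂ) (j : ℕ) : ℂ :=
  ∑ i ∈ Finset.range (m + 1 - j), (-1 : ℂ) ^ i * s ^ (m - j - i) * u (j + 2 * i)

theorem bdry_top (s : ℂ) (u : ℕ → ℂ) : bdry m s u m = u m := by
  simp [bdry]

/-- This is one integration by parts in t: the operator of index j is the zero-order contribution
s^(m-j) u_j minus the derivative of the operator of index j+1. The same recursion drives Green's
formula and the uniqueness proof. -/
theorem bdry_rec (s : ℂ) (u : ℕ → ℂ) {j : ℕ} (hj : j < m) :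
    bdry m s u j = s ^ (m - j) * u j - bdry m s (fun k => u (k + 1)) (j + 1) := by
  rw [bdry, bdry, show m + 1 - j = m + 1 - (j + 1) + 1 by omega, Finset.sum_range_succ',
    add_comm, sub_eq_add_neg, ← Finset.sum_neg_distrib]
  congr 1
  · simp
  · refine Finset.sum_congr rfl fun i _ => ?_
    rw [show m - j - (i + 1) = m - (j + 1) - i by omega,
      show j + 2 * (i + 1) = j + 1 + 2 * i + 1 by ring, pow_succ]
    ring

theorem bdry_sum {ι : Type*} (t : Finset ι) (s : ℂ) (c : ι → ℂ) (u : ι → ℕ → ℂ) (j : ℕ) :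
    bdry m s (fun k => ∑ l ∈ t, c l * u l k) j = ∑ l ∈ t, c l * bdry m s (u l) j := by
  simp only [bdry, Finset.mul_sum]
  rw [Finset.sum_comm]
  exact Finset.sum_congr rfl fun l _ => Finset.sum_congr rfl fun i _ => by ring

/-- The pairing of Neumann and Dirichlet data. -/
def bdryPair (m : ℕ) (s : ℂ) (u v : ℕ → ℂ) : ℂ :=
  ∑ j ∈ Finset.range m, bdry m s u (j + 1) * v j

/-- Green's formula on the half-line in differential form. By `bdry_rec` the sum telescopes; what
remains is the energy density minus the equation applied to u, times v. -/
theorem bdryPair_deriv (s : ℂ) (u v : ℕ → ℂ) :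
    ∑ j ∈ Finset.range m, (bdry m s (fun k => u (k + 1)) (j + 1) * v j +
      bdry m s u (j + 1) * v (j + 1)) =
    (∑ j ∈ Finset.range (m + 1), s ^ (m - j) * (u j * v j)) - bdry m s u 0 * v 0 := by
  have h1 : ∀ j ∈ Finset.range m, bdry m s (fun k => u (k + 1)) (j + 1) * v j +
      bdry m s u (j + 1) * v (j + 1) = s ^ (m - j) * (u j * v j) +
        (bdry m s u (j + 1) * v (j + 1) - bdry m s u j * v j) := by
    intro j hj
    rw [bdry_rec s u (Finset.mem_range.1 hj)]
    ring
  rw [Finset.sum_congr rfl h1, Finset.sum_add_distrib,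
    Finset.sum_range_sub (fun j => bdry m s u j * v j), Finset.sum_range_succ, bdry_top]
  simp
  ring

/-- Homogeneity: all terms scale with the same power of τ when s = τ², which leaves a matrix
independent of the frequency. -/
theorem bdry_root {τ : ℂ} (l : Fin m) (k : Fin m) :
    bdry m (τ ^ 2) (fun j => (root m l * τ) ^ j) (k + 1) =
      τ ^ (2 * m - 1 - k) * neuMat m k l := by
  simp only [bdry, neuMat, Matrix.of_apply, Finset.mul_sum]
  refine Finset.sum_congr (by congr 1; omega) fun i hi => ?_
  have hi' := Finset.mem_range.1 hi
  have hk := k.2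
  rw [mul_pow, ← pow_mul, show 2 * m - 1 - (k : ℕ) = 2 * (m - (k + 1) - i) + (k + 1 + 2 * i) by
    omega, pow_add]
  ring

theorem bdry_root_zero {τ : ℂ} (l : Fin m) :
    bdry m (τ ^ 2) (fun j => (root m l * τ) ^ j) 0 = 0 := by
  have h := sum_root_pow l
  have : bdry m (τ ^ 2) (fun j => (root m l * τ) ^ j) 0 = τ ^ (2 * m) *
      ∑ i ∈ Finset.range (m + 1), (-1 : ℂ) ^ i * root m l ^ (2 * i) := by
    simp only [bdry, Finset.mul_sum]
    refine Finset.sum_congr rfl fun i hi => ?_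
    have hi' := Finset.mem_range.1 hi
    rw [mul_pow, ← pow_mul, show 2 * m = 2 * (m - 0 - i) + (0 + 2 * i) by omega, pow_add]
    simp
    ring
  rw [this, h, mul_zero]

/-- The coefficients of the decaying solution with prescribed Neumann data. -/
def neuCoef (m : ℕ) (τ : ℂ) (G : Fin m → ℂ) (l : Fin m) : ℂ :=
  ∑ k, (neuMat m)⁻¹ l k * (G k / τ ^ (2 * m - 1 - k))

theorem bdry_neuCoef {τ : ℂ} (hτ : τ ≠ 0) (G : Fin m → ℂ) (k : Fin m) :
    bdry m (τ ^ 2) (fun j => ∑ l, neuCoef m τ G l * (root m l * τ) ^ j) (k + 1) = G k := by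
  rw [bdry_sum]
  simp only [bdry_root]
  have h1 : ∀ l, neuCoef m τ G l * (τ ^ (2 * m - 1 - (k : ℕ)) * neuMat m k l) =
      τ ^ (2 * m - 1 - (k : ℕ)) * (neuMat m k l * neuCoef m τ G l) := fun l => by ring
  simp only [h1, ← Finset.mul_sum]
  have h2 : (neuMat m).mulVec ((neuMat m)⁻¹.mulVec fun k => G k / τ ^ (2 * m - 1 - (k : ℕ))) =
      fun k => G k / τ ^ (2 * m - 1 - (k : ℕ)) := by
    rw [Matrix.mulVec_mulVec, Matrix.mul_nonsing_inv _ (det_neuMat_ne_zero m).isUnit,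
      Matrix.one_mulVec]
  have h3 : ∑ l, neuMat m k l * neuCoef m τ G l = G k / τ ^ (2 * m - 1 - (k : ℕ)) :=
    congrFun h2 k
  rw [h3, mul_div_cancel₀ _ (pow_ne_zero _ hτ)]

/-- A bound for the inverse of the matrix of the Neumann problem. -/
def neuBound (m : ℕ) : ℝ := ∑ l, ∑ k, ‖(neuMat m)⁻¹ l k‖

theorem neuBound_nonneg (m : ℕ) : 0 ≤ neuBound m :=
  Finset.sum_nonneg fun _ _ => Finset.sum_nonneg fun _ _ => norm_nonneg _

/-- Since 2m-1-k = (m-1-k) + m, data of the natural size B τ^(m-1-k) lose exactly τ^m, uniformly in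
the index k. -/
theorem norm_neuCoef_le {τ : ℝ} (hτ : 0 < τ) {B : ℝ} (hB : 0 ≤ B) {G : Fin m → ℂ}
    (hG : ∀ k : Fin m, ‖G k‖ ≤ B * τ ^ (m - 1 - k)) (l : Fin m) :
    ‖neuCoef m τ G l‖ ≤ neuBound m * (B / τ ^ m) := by
  have h1 : ∀ k : Fin m, ‖(neuMat m)⁻¹ l k * (G k / (τ : ℂ) ^ (2 * m - 1 - k))‖ ≤
      ‖(neuMat m)⁻¹ l k‖ * (B / τ ^ m) := by
    intro k
    rw [norm_mul, norm_div, norm_pow, Complex.norm_real, Real.norm_of_nonneg hτ.le]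
    refine mul_le_mul_of_nonneg_left ?_ (norm_nonneg _)
    rw [div_le_div_iff₀ (by positivity) (by positivity)]
    calc ‖G k‖ * τ ^ m ≤ B * τ ^ (m - 1 - k) * τ ^ m :=
          mul_le_mul_of_nonneg_right (hG k) (by positivity)
      _ = B * τ ^ (2 * m - 1 - k) := by
          rw [mul_assoc, ← pow_add]; congr 2; have := k.2; omega
  calc ‖neuCoef m τ G l‖ ≤ ∑ k, ‖(neuMat m)⁻¹ l k‖ * (B / τ ^ m) :=
        (norm_sum_le _ _).trans (Finset.sum_le_sum fun k _ => h1 k)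
    _ = (∑ k, ‖(neuMat m)⁻¹ l k‖) * (B / τ ^ m) := by rw [Finset.sum_mul]
    _ ≤ neuBound m * (B / τ ^ m) := by
        refine mul_le_mul_of_nonneg_right ?_ (by positivity)
        exact Finset.single_le_sum (f := fun l => ∑ k, ‖(neuMat m)⁻¹ l k‖)
          (fun _ _ => Finset.sum_nonneg fun _ _ => norm_nonneg _) (Finset.mem_univ l)

end Symbol

end

section


/-! ### Functions given by symbols on the Fourier side -/

/-- The frequency `2π|ξ|`. -/
def tau {n : ℕ} (ξ : Hor n) : ℝ := 2 * Real.pi * ‖ξ‖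

theorem tau_nonneg {n : ℕ} (ξ : Hor n) : 0 ≤ tau ξ := by unfold tau; positivity

theorem tau_pos {n : ℕ} {ξ : Hor n} (h : ξ ≠ 0) : 0 < tau ξ := by
  have := norm_pos_iff.2 h
  unfold tau; positivity

@[fun_prop]
theorem continuous_tau {n : ℕ} : Continuous (tau (n := n)) := by unfold tau; fun_prop

/-- The symbol of the horizontal derivative `∂^β`. -/
def horMono {n : ℕ} (β : Fin n → ℕ) (ξ : Hor n) : ℂ :=
  ∏ i, ((2 * Real.pi * ξ i : ℝ) * Complex.I) ^ β i

@[simp] theorem horMono_zero {n : ℕ} (ξ : Hor n) : horMono 0 ξ = 1 := by simp [horMono]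

theorem horMono_add {n : ℕ} (β γ : Fin n → ℕ) (ξ : Hor n) :
    horMono (β + γ) ξ = horMono β ξ * horMono γ ξ := by
  simp [horMono, pow_add, Finset.prod_mul_distrib]

theorem horMono_single {n : ℕ} (i : Fin n) (k : ℕ) (ξ : Hor n) :
    horMono (Pi.single i k) ξ = ((2 * Real.pi * ξ i : ℝ) * Complex.I) ^ k := by
  rw [horMono, Finset.prod_eq_single i]
  · simp
  · intro j _ hj; simp [hj]
  · simp

@[fun_prop]
theorem continuous_horMono {n : ℕ} (β : Fin n → ℕ) : Continuous (horMono (n := n) β) := by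
  unfold horMono; fun_prop

theorem norm_horMono_le {n : ℕ} (β : Fin n → ℕ) (ξ : Hor n) :
    ‖horMono β ξ‖ ≤ tau ξ ^ ∑ i, β i := by
  rw [horMono, norm_prod, ← Finset.prod_pow_eq_pow_sum]
  refine Finset.prod_le_prod (fun _ _ => norm_nonneg _) fun i _ => ?_
  rw [norm_pow, norm_mul, Complex.norm_I, mul_one, Complex.norm_real, norm_mul]
  refine pow_le_pow_left₀ (by positivity) ?_ _
  rw [tau, Real.norm_of_nonneg (by positivity)]
  exact mul_le_mul_of_nonneg_left (PiLp.norm_apply_le ξ i) (by positivity)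

theorem sum_horMono_sq {n : ℕ} (ξ : Hor n) :
    ∑ i, (((2 * Real.pi * ξ i : ℝ) * Complex.I) ^ 2) = -(tau ξ : ℂ) ^ 2 := by
  have h : (tau ξ : ℝ) ^ 2 = ∑ i, (2 * Real.pi * ξ i) ^ 2 := by
    rw [tau, mul_pow, EuclideanSpace.real_norm_sq_eq, Finset.mul_sum]
    exact Finset.sum_congr rfl fun i _ => by ring
  rw [← Complex.ofReal_pow, h]
  push_cast
  rw [← Finset.sum_neg_distrib]
  exact Finset.sum_congr rfl fun i _ => by rw [mul_pow, Complex.I_sq]; ring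

/-- The linear functional `(x, t) ↦ 2πi x·ξ + ζ t`. -/
def ell {n : ℕ} (ξ : Hor n) (ζ : ℂ) : Space n →L[ℝ] ℂ :=
  ((innerSL ℝ ξ).comp (ContinuousLinearMap.fst ℝ (Hor n) ℝ)).smulRight
      ((2 * Real.pi : ℝ) * Complex.I) +
    (ContinuousLinearMap.snd ℝ (Hor n) ℝ).smulRight ζ

theorem ell_apply {n : ℕ} (ξ : Hor n) (ζ : ℂ) (z : Space n) :
    ell ξ ζ z = ((2 * Real.pi * inner ℝ ξ z.1 : ℝ) : ℂ) * Complex.I + z.2 * ζ := by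
  simp only [ell, add_apply, ContinuousLinearMap.smulRight_apply, ContinuousLinearMap.comp_apply,
    ContinuousLinearMap.coe_fst', ContinuousLinearMap.coe_snd', innerSL_apply_apply,
    Complex.real_smul]
  push_cast
  ring

theorem ell_dirVec_none {n : ℕ} (ξ : Hor n) (ζ : ℂ) : ell ξ ζ (dirVec none) = ζ := by
  simp [ell_apply, dirVec]

theorem ell_dirVec_some {n : ℕ} (ξ : Hor n) (ζ : ℂ) (i : Fin n) :
    ell ξ ζ (dirVec (some i)) = (2 * Real.pi * ξ i : ℝ) * Complex.I := by
  simp [ell_apply, dirVec, EuclideanSpace.inner_single_right]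

theorem horMono_mul_add_unitIdx {n : ℕ} (ξ : Hor n) (ζ : ℂ) (α : MIdx n) (o : Option (Fin n)) :
    horMono (α + unitIdx o).1 ξ * ζ ^ (α + unitIdx o).2 =
      horMono α.1 ξ * ζ ^ α.2 * ell ξ ζ (dirVec o) := by
  cases o with
  | none => simp [unitIdx, ell_dirVec_none, pow_succ, mul_assoc]
  | some i =>
    simp [unitIdx, ell_dirVec_some, horMono_add, horMono_single]
    ring

/-- Symbols are carried as sequences of explicit derivatives; this gives their smoothness without
iterated derivatives of Mathlib. -/
theorem contDiff_of_hasDerivAt_succ {𝕜 : Type*} [NontriviallyNormedField 𝕜] {E : Type*}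
    [NormedAddCommGroup E] [NormedSpace 𝕜 E] {u : ℕ → 𝕜 → E}
    (h : ∀ j t, HasDerivAt (u j) (u (j + 1) t) t) (j : ℕ) : ContDiff 𝕜 ∞ (u j) := by
  rw [contDiff_infty]
  intro N
  induction N generalizing j with
  | zero => exact contDiff_zero.2 (continuous_iff_continuousAt.2 fun t => (h j t).continuousAt)
  | succ N ih =>
    push_cast
    rw [contDiff_succ_iff_deriv]
    refine ⟨fun t => (h j t).differentiableAt, by simp, ?_⟩
    rw [show deriv (u j) = u (j + 1) from funext fun t => (h j t).deriv]
    exact ih _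

theorem _root_.HasFDerivAt.dDir_eq {n : ℕ} {f : Space n → ℂ} {L : Space n →L[ℝ] ℂ} {z : Space n}
    (h : HasFDerivAt f L z) (o : Option (Fin n)) : dDir o f z = L (dirVec o) :=
  (h.hasLineDerivAt (dirVec o)).lineDeriv

/-- The chain rule along a linear functional: each derivative of an exponential-type kernel only
multiplies by a coordinate of the functional and shifts F. -/
theorem partialD_comp_ell {n : ℕ} {F : ℕ → ℂ → ℂ} (hF : ∀ k w, HasDerivAt (F k) (F (k + 1) w) w)
    (ξ : Hor n) (ζ : ℂ) (α : MIdx n) :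
    ContDiff ℝ ∞ (fun z : Space n => F 0 (ell ξ ζ z)) ∧
    partialD α (fun z => F 0 (ell ξ ζ z)) =
      fun z => horMono α.1 ξ * ζ ^ α.2 * F α.len (ell ξ ζ z) := by
  have hsm : ∀ k, ContDiff ℝ ∞ (fun z : Space n => F k (ell ξ ζ z)) := fun k =>
    ((contDiff_of_hasDerivAt_succ hF k).restrict_scalars ℝ).comp (ell ξ ζ).contDiff
  refine ⟨hsm 0, ?_⟩
  induction α using MIdx.induction_unit with
  | h0 => simp [partialD_zero]
  | hs α o ih =>
    rw [partialD_add_unitIdx _ _ (hsm 0), ih,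
      dDir_const_mul o _ ((hsm _).differentiable (by simp)), MIdx.len_add, MIdx.len_unitIdx]
    funext z
    rw [horMono_mul_add_unitIdx]
    have h1 : HasFDerivAt (fun z : Space n => F α.len (ell ξ ζ z))
        (F (α.len + 1) (ell ξ ζ z) • (ell ξ ζ : Space n →L[ℝ] ℂ)) z :=
      (hF α.len (ell ξ ζ z)).comp_hasFDerivAt z (ell ξ ζ).hasFDerivAt
    rw [h1.dDir_eq o, smul_apply, smul_eq_mul]
    ring

/-- A symbol `q 0 ξ t` with its derivatives `q j ξ t` in `t`, rapidly decreasing in `ξ`. -/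
structure RapidSymbol {n : ℕ} (q : ℕ → Hor n → ℝ → ℂ) : Prop where
  deriv : ∀ j ξ t, HasDerivAt (q j ξ) (q (j + 1) ξ t) t
  meas : ∀ j t, AEStronglyMeasurable (fun ξ => q j ξ t) volume
  bound : ∀ (j N : ℕ) (T : ℝ), ∃ C : ℝ, ∀ ξ t, |t| ≤ T → (1 + ‖ξ‖) ^ N * ‖q j ξ t‖ ≤ C

/-- The function with the symbol `q`. -/
def symFn {n : ℕ} (q : Hor n → ℝ → ℂ) : Space n → ℂ :=
  fun z => 𝓕⁻ (fun ξ => q ξ z.2) z.1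

theorem symFn_eq_integral {n : ℕ} (q : Hor n → ℝ → ℂ) (z : Space n) :
    symFn q z = ∫ ξ, Complex.exp (ell ξ 0 z) * q ξ z.2 := by
  rw [symFn, Real.fourierInv_eq']
  simp [ell_apply]

theorem integrable_inv_one_add_norm_pow (n : ℕ) :
    Integrable fun ξ : Hor n => ((1 + ‖ξ‖) ^ (n + 1))⁻¹ := by
  have := integrable_one_add_norm (E := Hor n) (μ := volume) (r := n + 1) (by simp)
  refine this.congr (Filter.Eventually.of_forall fun ξ => ?_)
  simp only
  rw [Real.rpow_neg (by positivity)]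
  congr 1
  exact_mod_cast Real.rpow_natCast (1 + ‖ξ‖) (n + 1)

theorem memLp_two_inv_one_add_norm_pow (n : ℕ) :
    MemLp (fun ξ : Hor n => ((1 + ‖ξ‖) ^ (n + 1))⁻¹) 2 := by
  have hc : Continuous fun ξ : Hor n => ((1 + ‖ξ‖) ^ (n + 1))⁻¹ := by
    refine Continuous.inv₀ (by fun_prop) fun ξ => ?_
    positivity
  rw [memLp_two_iff_integrable_sq hc.aestronglyMeasurable]
  refine (integrable_inv_one_add_norm_pow n).mono' (hc.pow 2).aestronglyMeasurable
    (Filter.Eventually.of_forall fun ξ => ?_)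
  have h1 : ((1 + ‖ξ‖) ^ (n + 1))⁻¹ ≤ 1 := inv_le_one_of_one_le₀ (one_le_pow₀ (by simp))
  have h0 : 0 ≤ ((1 + ‖ξ‖) ^ (n + 1))⁻¹ := by positivity
  rw [Real.norm_of_nonneg (by positivity)]
  nlinarith

namespace RapidSymbol

variable {n : ℕ} {q : ℕ → Hor n → ℝ → ℂ}

theorem bound' (h : RapidSymbol q) (j N : ℕ) (T : ℝ) :
    ∃ C : ℝ, 0 ≤ C ∧ ∀ ξ t, |t| ≤ T → ‖q j ξ t‖ ≤ C * ((1 + ‖ξ‖) ^ N)⁻¹ := by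
  obtain ⟨C, hC⟩ := h.bound j N T
  refine ⟨|C|, abs_nonneg _, fun ξ t ht => ?_⟩
  rw [← div_eq_mul_inv, le_div_iff₀ (by positivity), mul_comm]
  exact (hC ξ t ht).trans (le_abs_self _)

theorem integrable (h : RapidSymbol q) (j : ℕ) (t : ℝ) : Integrable fun ξ => q j ξ t := by
  obtain ⟨C, _, hC⟩ := h.bound' j (n + 1) |t|
  exact ((integrable_inv_one_add_norm_pow n).const_mul C).mono' (h.meas j t)
    (Filter.Eventually.of_forall fun ξ => hC ξ t le_rfl)

theorem memLp (h : RapidSymbol q) (j : ℕ) (t : ℝ) : MemLp (fun ξ => q j ξ t) 2 := by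
  obtain ⟨C, _, hC⟩ := h.bound' j (n + 1) |t|
  exact ((memLp_two_inv_one_add_norm_pow n).const_mul C).mono' (h.meas j t)
    (Filter.Eventually.of_forall fun ξ => hC ξ t le_rfl)

/-- The symbol of a derivative. -/
def diff (q : ℕ → Hor n → ℝ → ℂ) (α : MIdx n) : ℕ → Hor n → ℝ → ℂ :=
  fun j ξ t => horMono α.1 ξ * q (j + α.2) ξ t

theorem isRapid_diff (h : RapidSymbol q) (α : MIdx n) : RapidSymbol (diff q α) where
  deriv j ξ t := by
    have := (h.deriv (j + α.2) ξ t).const_mul (horMono α.1 ξ)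
    rwa [show j + α.2 + 1 = j + 1 + α.2 by ring] at this
  meas j t := (continuous_horMono _).aestronglyMeasurable.mul (h.meas _ t)
  bound j N T := by
    obtain ⟨C, hC0, hC⟩ := h.bound' (j + α.2) (N + ∑ i, α.1 i) T
    refine ⟨(2 * Real.pi) ^ (∑ i, α.1 i) * C, fun ξ t ht => ?_⟩
    have h1 : ‖horMono α.1 ξ‖ ≤ (2 * Real.pi) ^ (∑ i, α.1 i) * (1 + ‖ξ‖) ^ ∑ i, α.1 i := by
      refine (norm_horMono_le _ _).trans ?_
      rw [← mul_pow]
      refine pow_le_pow_left₀ (tau_nonneg ξ) ?_ _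
      unfold tau
      exact mul_le_mul_of_nonneg_left (by linarith) (by positivity)
    rw [diff, norm_mul]
    calc (1 + ‖ξ‖) ^ N * (‖horMono α.1 ξ‖ * ‖q (j + α.2) ξ t‖)
        ≤ (1 + ‖ξ‖) ^ N * (((2 * Real.pi) ^ (∑ i, α.1 i) * (1 + ‖ξ‖) ^ ∑ i, α.1 i) *
          (C * ((1 + ‖ξ‖) ^ (N + ∑ i, α.1 i))⁻¹)) := by
          gcongr
          exact hC ξ t ht
      _ = _ := by
          rw [pow_add]
          field_simp

theorem contDiff_kernel (h : RapidSymbol q) (ξ : Hor n) (j : ℕ) :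
    ContDiff ℝ ∞ fun z : Space n => Complex.exp (ell ξ 0 z) * q j ξ z.2 :=
  (ell ξ 0).contDiff.cexp.mul
    ((contDiff_of_hasDerivAt_succ (u := fun j => q j ξ) (fun j t => h.deriv j ξ t) j).comp
      contDiff_snd)

theorem partialD_kernel (h : RapidSymbol q) (ξ : Hor n) (α : MIdx n) :
    partialD α (fun z : Space n => Complex.exp (ell ξ 0 z) * q 0 ξ z.2) =
      fun z => Complex.exp (ell ξ 0 z) * diff q α 0 ξ z.2 := by
  induction α using MIdx.induction_unit with
  | h0 => simp [partialD_zero, diff]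
  | hs α o ih =>
    have hsm : ContDiff ℝ ∞ fun z : Space n => Complex.exp (ell ξ 0 z) * q α.2 ξ z.2 :=
      h.contDiff_kernel ξ _
    have e1 : (fun z : Space n => Complex.exp (ell ξ 0 z) * diff q α 0 ξ z.2) =
        fun z => horMono α.1 ξ * (Complex.exp (ell ξ 0 z) * q α.2 ξ z.2) := by
      funext z; simp only [diff, zero_add]; ring
    rw [partialD_add_unitIdx _ _ (h.contDiff_kernel ξ 0), ih, e1,
      dDir_const_mul o _ (hsm.differentiable (by simp))]
    funext z
    have h1 : HasFDerivAt (fun z : Space n => Complex.exp (ell ξ 0 z))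
        (Complex.exp (ell ξ 0 z) • (ell ξ 0 : Space n →L[ℝ] ℂ)) z :=
      (Complex.hasDerivAt_exp _).comp_hasFDerivAt z (ell ξ 0).hasFDerivAt
    have h2 : HasFDerivAt (fun z : Space n => q α.2 ξ z.2) _ z :=
      (h.deriv α.2 ξ z.2).hasFDerivAt.comp z hasFDerivAt_snd
    refine (congrArg (horMono α.1 ξ * ·) ((h1.mul h2).dDir_eq o)).trans ?_
    cases o with
    | none =>
      simp only [diff, unitIdx, add_apply, smul_apply, ell_dirVec_none]
      simp [dirVec]
      ring
    | some i =>
      simp only [diff, unitIdx, add_apply, smul_apply, ell_dirVec_some,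
        smul_eq_mul, Prod.fst_add, Prod.snd_add,
        horMono_add, horMono_single]
      simp [dirVec]
      ring

theorem isSmoothKernel (h : RapidSymbol q) :
    IsSmoothKernel volume (fun ξ (z : Space n) => Complex.exp (ell ξ 0 z) * q 0 ξ z.2) univ where
  contDiff ξ := h.contDiff_kernel ξ 0
  meas α z _ := by
    simp only [h.partialD_kernel]
    refine AEStronglyMeasurable.mul (Continuous.aestronglyMeasurable ?_)
      ((h.isRapid_diff α).meas 0 z.2)
    simp only [ell_apply]
    fun_prop
  dom α z _ := by
    obtain ⟨C, hC0, hC⟩ := (h.isRapid_diff α).bound' 0 (n + 1) (|z.2| + 1)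
    refine ⟨Metric.ball z 1, Metric.ball_mem_nhds z one_pos,
      fun ξ => C * ((1 + ‖ξ‖) ^ (n + 1))⁻¹, (integrable_inv_one_add_norm_pow n).const_mul C,
      Filter.Eventually.of_forall fun ξ y hy => ?_⟩
    rw [h.partialD_kernel, norm_mul, Complex.norm_exp]
    have hre : (ell ξ 0 y).re = 0 := by simp [ell_apply]
    rw [hre, Real.exp_zero, one_mul]
    refine hC ξ y.2 ?_
    have h1 : |y.2 - z.2| < 1 := by
      have : dist y.2 z.2 ≤ dist y z := le_max_right _ _
      rw [← Real.dist_eq]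
      exact this.trans_lt hy
    have h2 := abs_sub_abs_le_abs_sub y.2 z.2
    linarith

theorem symFn_eq (q : ℕ → Hor n → ℝ → ℂ) : symFn (q 0) =
    fun z => ∫ ξ, Complex.exp (ell ξ 0 z) * q 0 ξ z.2 := funext (symFn_eq_integral _)

theorem contDiff_symFn (h : RapidSymbol q) : ContDiff ℝ ∞ (symFn (q 0)) := by
  rw [symFn_eq, ← contDiffOn_univ]
  simpa only [partialD_zero] using h.isSmoothKernel.contDiffOn_partialD isOpen_univ 0

theorem partialD_symFn (h : RapidSymbol q) (α : MIdx n) :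
    partialD α (symFn (q 0)) = symFn (diff q α 0) := by
  funext z
  rw [symFn_eq, h.isSmoothKernel.partialD_integral isOpen_univ α (mem_univ z), symFn_eq_integral]
  simp only [h.partialD_kernel]

theorem lintegral_slice (h : RapidSymbol q) (t : ℝ) :
    ∫⁻ x, ‖symFn (q 0) (x, t)‖ₑ ^ 2 = ∫⁻ ξ, ‖q 0 ξ t‖ₑ ^ 2 := by
  change ∫⁻ x, ‖(𝓕⁻ fun ξ => q 0 ξ t) x‖ₑ ^ 2 = _
  exact lintegral_enorm_sq_fourierInv (h.integrable 0 t) (h.memLp 0 t)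

end RapidSymbol

end

section


/-! ### Smooth functions on the half-space -/

theorem isOpen_halfSpace (n : ℕ) : IsOpen (halfSpace n) :=
  isOpen_lt continuous_const continuous_snd

theorem contDiffOn_partialD {n : ℕ} {Ω : Set (Space n)} (hΩ : IsOpen Ω) {f : Space n → ℂ}
    (hf : ContDiffOn ℝ ∞ f Ω) (α : MIdx n) : ContDiffOn ℝ ∞ (partialD α f) Ω := by
  intro z hz
  obtain ⟨g, hg, hfg⟩ := exists_contDiff_eventuallyEq hΩ hf hz
  exact ((contDiff_partialD α hg).contDiffAt.congr_of_eventuallyEq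
    (eventuallyEq_partialD α hfg)).contDiffWithinAt

/-- Multiplication by a smooth step in t that vanishes for t ≤ δ/2 and is 1 for t ≥ δ. Statements
for globally smooth functions then apply to functions on the half-space when tested away from the
boundary. -/
theorem exists_contDiff_eq_of_lt {n : ℕ} {f : Space n → ℂ} (hf : ContDiffOn ℝ ∞ f (halfSpace n))
    {δ : ℝ} (hδ : 0 < δ) : ∃ g : Space n → ℂ, ContDiff ℝ ∞ g ∧ ∀ z, δ < z.2 → g z = f z := by
  refine ⟨fun z => (Real.smoothTransition (2 * z.2 / δ - 1) : ℂ) * f z, ?_, fun z hz => ?_⟩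
  · rw [contDiff_iff_contDiffAt]
    intro z
    rcases lt_or_ge 0 z.2 with hz | hz
    · refine ContDiffAt.mul ?_ (hf.contDiffAt ((isOpen_halfSpace n).mem_nhds hz))
      refine Complex.ofRealCLM.contDiff.contDiffAt.comp z (ContDiff.contDiffAt ?_)
      exact Real.smoothTransition.contDiff.comp
        (((contDiff_const.mul contDiff_snd).div_const δ).sub contDiff_const)
    · have h0 : (fun z : Space n => (Real.smoothTransition (2 * z.2 / δ - 1) : ℂ) * f z)
          =ᶠ[𝓝 z] fun _ => 0 := by
        have : {y : Space n | y.2 < δ / 2} ∈ 𝓝 z :=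
          (isOpen_lt continuous_snd continuous_const).mem_nhds (by
            simp only [mem_ofPred_eq]; linarith)
        filter_upwards [this] with y hy
        rw [Real.smoothTransition.zero_of_nonpos]
        · simp
        · have : 2 * y.2 / δ < 1 := by rw [div_lt_one hδ]; linarith [show y.2 < δ / 2 from hy]
          linarith
      exact contDiffAt_const.congr_of_eventuallyEq h0
  · show (Real.smoothTransition (2 * z.2 / δ - 1) : ℂ) * f z = f z
    rw [Real.smoothTransition.one_of_one_le]
    · simp
    · have : 2 < 2 * z.2 / δ := by rw [lt_div_iff₀ hδ]; linarith
      linarith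

theorem IsTestHalf.exists_lt {n : ℕ} {φ : Space n → ℂ} (h : IsTestHalf φ) :
    ∃ δ : ℝ, 0 < δ ∧ ∀ z ∈ tsupport φ, δ < z.2 := by
  rcases (tsupport φ).eq_empty_or_nonempty with h0 | h0
  · exact ⟨1, one_pos, by simp [h0]⟩
  · obtain ⟨z0, hz0, hmin⟩ := h.1.2.isCompact.exists_isMinOn h0 continuous_snd.continuousOn
    have hp : 0 < z0.2 := h.2 hz0
    exact ⟨z0.2 / 2, by linarith, fun z hz => by
      have : z0.2 ≤ z.2 := hmin hz
      linarith⟩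

theorem setIntegral_halfSpace_eq {n : ℕ} {F : Space n → ℂ} (hF : ∀ z, ¬ 0 < z.2 → F z = 0) :
    ∫ z in halfSpace n, F z = ∫ z, F z :=
  setIntegral_eq_integral_of_forall_compl_eq_zero fun z hz => hF z hz

theorem IsTestHalf.eq_zero {n : ℕ} {φ : Space n → ℂ} (h : IsTestHalf φ) {z : Space n}
    (hz : ¬ 0 < z.2) : φ z = 0 :=
  image_eq_zero_of_notMem_tsupport fun hs => hz (h.2 hs)

theorem integral_halfSpace_mul_partialD {n : ℕ} {w φ : Space n → ℂ}
    (hw : ContDiffOn ℝ ∞ w (halfSpace n)) (hφ : IsTestHalf φ) (α : MIdx n) :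
    ∫ z in halfSpace n, w z * partialD α φ z =
      (-1 : ℂ) ^ α.len * ∫ z in halfSpace n, partialD α w z * φ z := by
  rw [setIntegral_halfSpace_eq fun z hz => by rw [(hφ.partialD α).eq_zero hz, mul_zero],
    setIntegral_halfSpace_eq fun z hz => by rw [hφ.eq_zero hz, mul_zero]]
  obtain ⟨δ, hδ, hs⟩ := hφ.exists_lt
  obtain ⟨g, hg, hgw⟩ := exists_contDiff_eq_of_lt hw hδ
  have h := integral_mul_partialD α hg hφ.1
  have hloc : ∀ z ∈ tsupport φ, g =ᶠ[𝓝 z] w := fun z hz => by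
    filter_upwards [(isOpen_lt continuous_const continuous_snd).mem_nhds (hs z hz)] with y hy
    exact hgw y hy
  have e1 : ∀ z, g z * partialD α φ z = w z * partialD α φ z := fun z => by
    by_cases hz : z ∈ tsupport φ
    · rw [(hloc z hz).eq_of_nhds]
    · rw [image_eq_zero_of_notMem_tsupport fun h => hz (support_partialD_subset α φ h), mul_zero,
        mul_zero]
  have e2 : ∀ z, partialD α g z * φ z = partialD α w z * φ z := fun z => by
    by_cases hz : z ∈ tsupport φ
    · rw [(eventuallyEq_partialD α (hloc z hz)).eq_of_nhds]
    · rw [image_eq_zero_of_notMem_tsupport hz, mul_zero, mul_zero]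
  simpa only [e1, e2] using h

theorem isWeakDeriv_partialD {n : ℕ} {w : Space n → ℂ} (hw : ContDiffOn ℝ ∞ w (halfSpace n))
    (α : MIdx n) : IsWeakDeriv α w (partialD α w) :=
  ⟨((contDiffOn_partialD (isOpen_halfSpace n) hw α).continuousOn).locallyIntegrableOn
    (isOpen_halfSpace n).measurableSet, fun _ hφ => integral_halfSpace_mul_partialD hw hφ α⟩

/-! ### Elementary estimates -/

theorem exists_pow_mul_exp_le (a : ℕ) {δ : ℝ} (hδ : 0 < δ) :
    ∃ C : ℝ, 0 ≤ C ∧ ∀ x : ℝ, 0 ≤ x → (1 + x) ^ a * Real.exp (-(δ * x)) ≤ C := by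
  refine ⟨a.factorial * Real.exp δ / δ ^ a, by positivity, fun x hx => ?_⟩
  have h := Real.pow_div_factorial_le_exp (x := δ * (1 + x)) (by positivity) a
  rw [div_le_iff₀ (by positivity), mul_pow] at h
  rw [Real.exp_neg, ← div_eq_mul_inv, div_le_div_iff₀ (Real.exp_pos _) (by positivity)]
  calc (1 + x) ^ a * δ ^ a = δ ^ a * (1 + x) ^ a := mul_comm _ _
    _ ≤ Real.exp (δ * (1 + x)) * a.factorial := h
    _ = a.factorial * Real.exp δ * Real.exp (δ * x) := by
        rw [mul_add, mul_one, Real.exp_add]; ring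

theorem exists_tau_pow_mul_exp_le (n a N : ℕ) {δ : ℝ} (hδ : 0 < δ) :
    ∃ C : ℝ, 0 ≤ C ∧ ∀ ξ : Hor n,
      tau ξ ^ a * Real.exp (-(δ * tau ξ)) ≤ C * ((1 + ‖ξ‖) ^ N)⁻¹ := by
  obtain ⟨C, hC0, hC⟩ := exists_pow_mul_exp_le (a + N) hδ
  refine ⟨C, hC0, fun ξ => ?_⟩
  have hτ := tau_nonneg ξ
  have h1 : 1 + ‖ξ‖ ≤ 1 + tau ξ := by
    have : 1 ≤ 2 * Real.pi := by linarith [Real.pi_gt_three]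
    have := le_mul_of_one_le_left (norm_nonneg ξ) this
    unfold tau; linarith
  rw [← div_eq_mul_inv, le_div_iff₀ (by positivity)]
  calc tau ξ ^ a * Real.exp (-(δ * tau ξ)) * (1 + ‖ξ‖) ^ N
      ≤ (1 + tau ξ) ^ a * Real.exp (-(δ * tau ξ)) * (1 + tau ξ) ^ N := by
        gcongr
        linarith
    _ = (1 + tau ξ) ^ (a + N) * Real.exp (-(δ * tau ξ)) := by rw [pow_add]; ring
    _ ≤ C := hC _ hτ

/-- The exponential function minus its Taylor polynomial of degree `j - 1`. -/
def cutExp (j : ℕ) (w : ℂ) : ℂ := Complex.exp w - ∑ k ∈ Finset.range j, w ^ k / k.factorial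

theorem cutExp_zero (w : ℂ) : cutExp 0 w = Complex.exp w := by simp [cutExp]

/-- Differentiation lowers the number of removed Taylor terms by one. The subtraction is truncated,
so that for j = 0 this is the derivative of the exponential itself. -/
theorem hasDerivAt_cutExp (j : ℕ) (w : ℂ) : HasDerivAt (cutExp j) (cutExp (j - 1) w) w := by
  have h2 : HasDerivAt (fun w : ℂ => ∑ k ∈ Finset.range j, w ^ k / k.factorial)
      (∑ k ∈ Finset.range (j - 1), w ^ k / k.factorial) w := by
    have h3 : HasDerivAt (fun w : ℂ => ∑ k ∈ Finset.range j, w ^ k / k.factorial)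
        (∑ k ∈ Finset.range j, (k * w ^ (k - 1)) / k.factorial) w :=
      HasDerivAt.fun_sum fun k _ => (hasDerivAt_pow k w).div_const _
    convert h3 using 1
    cases j with
    | zero => simp
    | succ j =>
      rw [Finset.sum_range_succ', Nat.add_sub_cancel]
      simp only [Nat.cast_zero, zero_mul, zero_div, add_zero, Nat.add_sub_cancel]
      refine Finset.sum_congr rfl fun k _ => ?_
      rw [Nat.factorial_succ]
      push_cast
      have : (k : ℂ) + 1 ≠ 0 := by exact_mod_cast Nat.succ_ne_zero k
      field_simp
  exact (Complex.hasDerivAt_exp w).sub h2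

theorem norm_cutExp_le (j : ℕ) (w : ℂ) : ‖cutExp j w‖ ≤ ‖w‖ ^ j * Real.exp ‖w‖ :=
  Complex.norm_exp_sub_sum_le_norm_mul_exp w j

end

section


/-! ### The solution of the Neumann problem: symbols -/

section Solution

variable {n m : ℕ} {G : MIdx n → Hor n → ℂ}

/-- The Neumann data on the Fourier side: the coefficient that is paired with `∂_t^k φ`. -/
def neuDatum (m : ℕ) (G : MIdx n → Hor n → ℂ) (ξ : Hor n) (k : ℕ) : ℂ :=
  -∑ γ ∈ (multiIdx n (m - 1)).filter (fun γ => γ.2 = k),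
    starRingEnd ℂ (horMono γ.1 ξ) * G γ ξ

/-- The size of the array `G`. -/
def arrSize (m : ℕ) (G : MIdx n → Hor n → ℂ) (ξ : Hor n) : ℝ :=
  ∑ γ ∈ multiIdx n (m - 1), ‖G γ ξ‖

theorem arrSize_nonneg (ξ : Hor n) : 0 ≤ arrSize m G ξ :=
  Finset.sum_nonneg fun _ _ => norm_nonneg _

theorem norm_neuDatum_le (ξ : Hor n) (k : ℕ) :
    ‖neuDatum m G ξ k‖ ≤ arrSize m G ξ * tau ξ ^ (m - 1 - k) := by
  rw [neuDatum, norm_neg, arrSize, Finset.sum_mul]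
  refine (norm_sum_le _ _).trans ?_
  refine (Finset.sum_le_sum fun γ hγ => ?_).trans (Finset.sum_le_sum_of_subset_of_nonneg
    (Finset.filter_subset _ _) fun γ _ _ => mul_nonneg (norm_nonneg _)
      (pow_nonneg (tau_nonneg ξ) _))
  obtain ⟨h1, h2⟩ := Finset.mem_filter.1 hγ
  have h3 : ∑ i, γ.1 i = m - 1 - k := by
    have : (∑ i, γ.1 i) + γ.2 = m - 1 := mem_multiIdx.1 h1
    omega
  rw [norm_mul, RCLike.norm_conj, mul_comm, ← h3]
  exact mul_le_mul_of_nonneg_left (norm_horMono_le _ _) (norm_nonneg _)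

theorem measurable_neuDatum (hG : ∀ γ, Measurable (G γ)) (k : ℕ) :
    Measurable fun ξ => neuDatum m G ξ k := by
  unfold neuDatum
  refine (Finset.measurable_fun_sum _ fun γ _ => ?_).neg
  exact (Complex.continuous_conj.comp (continuous_horMono _)).measurable.mul (hG γ)

theorem measurable_arrSize (hG : ∀ γ, Measurable (G γ)) : Measurable (arrSize m G) := by
  unfold arrSize
  exact Finset.measurable_fun_sum _ fun γ _ => (hG γ).norm

theorem memLp_arrSize (hG : ∀ γ ∈ multiIdx n (m - 1), MemLp (G γ) 2) :
    MemLp (arrSize m G) 2 := by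
  unfold arrSize
  exact memLp_finsetSum _ fun γ hγ => (hG γ hγ).norm

/-- The coefficients of the solution on the Fourier side. -/
def solCoef (m : ℕ) (G : MIdx n → Hor n → ℂ) (ξ : Hor n) (l : Fin m) : ℂ :=
  neuCoef m (tau ξ) (fun k => neuDatum m G ξ k) l

theorem measurable_solCoef (hG : ∀ γ, Measurable (G γ)) (l : Fin m) :
    Measurable fun ξ => solCoef m G ξ l := by
  unfold solCoef neuCoef
  refine Finset.measurable_fun_sum _ fun k _ => measurable_const.mul
    ((measurable_neuDatum hG k).div ?_)
  exact (Complex.continuous_ofReal.comp continuous_tau).measurable.pow_const _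

/-- Written as a product so that it also holds at ξ = 0: derivatives of total order at least m
compensate the singularity τ^(-m) of the coefficients. -/
theorem norm_solCoef_mul_le (ξ : Hor n) (l : Fin m) (j : ℕ) :
    ‖solCoef m G ξ l‖ * tau ξ ^ (m + j) ≤ neuBound m * arrSize m G ξ * tau ξ ^ j := by
  rcases (tau_nonneg ξ).eq_or_lt with h | h
  · have hm : m ≠ 0 := by have := l.2; omega
    rw [← h, zero_pow (by omega), mul_zero]
    exact mul_nonneg (mul_nonneg (neuBound_nonneg m) (arrSize_nonneg ξ)) (pow_nonneg le_rfl _)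
  · have h1 := norm_neuCoef_le h (arrSize_nonneg (m := m) (G := G) ξ)
      (G := fun k => neuDatum m G ξ k) (fun k => norm_neuDatum_le ξ k) l
    calc ‖solCoef m G ξ l‖ * tau ξ ^ (m + j)
        ≤ neuBound m * (arrSize m G ξ / tau ξ ^ m) * tau ξ ^ (m + j) :=
          mul_le_mul_of_nonneg_right h1 (by positivity)
      _ = _ := by rw [pow_add]; field_simp

/-- The `j`-th vertical derivative of the solution on the Fourier side. -/
def solSym (m : ℕ) (G : MIdx n → Hor n → ℂ) (j : ℕ) (ξ : Hor n) (t : ℝ) : ℂ :=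
  ∑ l, solCoef m G ξ l * (root m l * tau ξ) ^ j * Complex.exp (t * (root m l * tau ξ))

theorem hasDerivAt_cexp_ofReal_mul (ζ : ℂ) (t : ℝ) :
    HasDerivAt (fun t : ℝ => Complex.exp (t * ζ)) (ζ * Complex.exp (t * ζ)) t := by
  have h : HasDerivAt (fun t : ℝ => (t : ℂ) * ζ) ζ t := by
    simpa using (Complex.ofRealCLM.hasDerivAt (x := t)).mul_const ζ
  have := h.cexp
  rwa [mul_comm] at this

theorem hasDerivAt_solSym (j : ℕ) (ξ : Hor n) (t : ℝ) :
    HasDerivAt (solSym m G j ξ) (solSym m G (j + 1) ξ t) t := by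
  unfold solSym
  refine HasDerivAt.fun_sum fun l _ => ?_
  have := (hasDerivAt_cexp_ofReal_mul (root m l * tau ξ) t).const_mul
    (solCoef m G ξ l * (root m l * tau ξ) ^ j)
  rwa [← mul_assoc, mul_assoc _ _ (root m l * (tau ξ : ℂ)), ← pow_succ] at this

theorem measurable_solSym (hG : ∀ γ, Measurable (G γ)) (j : ℕ) :
    Measurable fun p : Hor n × ℝ => solSym m G j p.1 p.2 := by
  unfold solSym
  refine Finset.measurable_fun_sum _ fun l _ => ((measurable_solCoef hG l).comp
    measurable_fst |>.mul ?_).mul ?_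
  · exact Continuous.measurable (by fun_prop)
  · exact Continuous.measurable (by fun_prop)

/-- The rate of decay of the solutions. -/
def decayRate (m : ℕ) : ℝ := (exists_root_re_le m).choose

theorem decayRate_pos (m : ℕ) : 0 < decayRate m := (exists_root_re_le m).choose_spec.1

theorem root_re_le (l : Fin m) : (root m l).re ≤ -decayRate m :=
  (exists_root_re_le m).choose_spec.2 l

theorem norm_exp_root_le (l : Fin m) {τ t : ℝ} (hτ : 0 ≤ τ) (ht : 0 ≤ t) :
    ‖Complex.exp (t * (root m l * τ))‖ ≤ Real.exp (-(decayRate m * t * τ)) := by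
  rw [Complex.norm_exp, Real.exp_le_exp]
  have h1 : ((t : ℂ) * (root m l * τ)).re = t * ((root m l).re * τ) := by simp
  rw [h1]
  have := mul_le_mul_of_nonneg_left (mul_le_mul_of_nonneg_right (root_re_le l) hτ) ht
  linarith

/-- The symbol of the derivative `∂^α` of the solution. -/
def solDiff (m : ℕ) (G : MIdx n → Hor n → ℂ) (α : MIdx n) (ξ : Hor n) (t : ℝ) : ℂ :=
  horMono α.1 ξ * solSym m G α.2 ξ t

theorem measurable_solDiff (hG : ∀ γ, Measurable (G γ)) (α : MIdx n) :
    Measurable fun p : Hor n × ℝ => solDiff m G α p.1 p.2 := by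
  unfold solDiff
  exact ((continuous_horMono α.1).measurable.comp measurable_fst).mul (measurable_solSym hG _)

theorem measurable_solDiff_slice (hG : ∀ γ, Measurable (G γ)) (α : MIdx n) (t : ℝ) :
    Measurable fun ξ : Hor n => solDiff m G α ξ t :=
  Measurable.of_uncurry_right (f := solDiff m G α) (measurable_solDiff hG α)

/-- The constant in the bounds for the solution. -/
def solBound (m : ℕ) : ℝ := m * neuBound m

theorem solBound_nonneg (m : ℕ) : 0 ≤ solBound m := mul_nonneg (by positivity) (neuBound_nonneg m)

/-- The basic decay estimate: i is the excess of the order a + j over m, and each unit of excess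
costs one factor τ. -/
theorem norm_tau_pow_mul_solSym_le (a j i : ℕ) (h : a + j = m + i) (ξ : Hor n) {t : ℝ}
    (ht : 0 ≤ t) : tau ξ ^ a * ‖solSym m G j ξ t‖ ≤
      solBound m * arrSize m G ξ * (tau ξ ^ i * Real.exp (-(decayRate m * t * tau ξ))) := by
  have hτ := tau_nonneg ξ
  have h1 : ∀ l : Fin m, tau ξ ^ a *
      ‖solCoef m G ξ l * (root m l * tau ξ) ^ j * Complex.exp (t * (root m l * tau ξ))‖ ≤
      neuBound m * arrSize m G ξ * (tau ξ ^ i * Real.exp (-(decayRate m * t * tau ξ))) := by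
    intro l
    rw [norm_mul, norm_mul, norm_pow, norm_mul, norm_root, one_mul, Complex.norm_real,
      Real.norm_of_nonneg hτ]
    calc tau ξ ^ a * (‖solCoef m G ξ l‖ * tau ξ ^ j * ‖Complex.exp (t * (root m l * tau ξ))‖)
        = ‖solCoef m G ξ l‖ * tau ξ ^ (m + i) * ‖Complex.exp (t * (root m l * tau ξ))‖ := by
          rw [← h, pow_add]; ring
      _ ≤ (neuBound m * arrSize m G ξ * tau ξ ^ i) * Real.exp (-(decayRate m * t * tau ξ)) :=
          mul_le_mul (norm_solCoef_mul_le ξ l i) (norm_exp_root_le l hτ ht) (norm_nonneg _)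
            (mul_nonneg (mul_nonneg (neuBound_nonneg m) (arrSize_nonneg ξ)) (pow_nonneg hτ _))
      _ = _ := by ring
  calc tau ξ ^ a * ‖solSym m G j ξ t‖
      ≤ tau ξ ^ a * ∑ l, ‖solCoef m G ξ l * (root m l * tau ξ) ^ j *
          Complex.exp (t * (root m l * tau ξ))‖ :=
        mul_le_mul_of_nonneg_left (norm_sum_le _ _) (pow_nonneg hτ _)
    _ ≤ ∑ _l : Fin m, neuBound m * arrSize m G ξ *
          (tau ξ ^ i * Real.exp (-(decayRate m * t * tau ξ))) := by
        rw [Finset.mul_sum]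
        exact Finset.sum_le_sum fun l _ => h1 l
    _ = _ := by
        rw [Finset.sum_const, Finset.card_univ, Fintype.card_fin, nsmul_eq_mul, solBound]
        ring

theorem norm_solDiff_le (α : MIdx n) (i : ℕ) (h : α.len = m + i) (ξ : Hor n) {t : ℝ}
    (ht : 0 ≤ t) : ‖solDiff m G α ξ t‖ ≤
      solBound m * arrSize m G ξ * (tau ξ ^ i * Real.exp (-(decayRate m * t * tau ξ))) := by
  rw [solDiff, norm_mul]
  exact (mul_le_mul_of_nonneg_right (norm_horMono_le _ _) (norm_nonneg _)).trans
    (norm_tau_pow_mul_solSym_le _ _ i h ξ ht)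

theorem integrable_arrSize_mul
    (hG : ∀ γ ∈ multiIdx n (m - 1), MemLp (G γ) 2) :
    Integrable fun ξ => arrSize m G ξ * ((1 + ‖ξ‖) ^ (n + 1))⁻¹ :=
  (memLp_arrSize hG).integrable_mul (memLp_two_inv_one_add_norm_pow n)

theorem integrable_solDiff (hGm : ∀ γ, Measurable (G γ))
    (hG : ∀ γ ∈ multiIdx n (m - 1), MemLp (G γ) 2) (α : MIdx n) (h : m ≤ α.len) {t : ℝ}
    (ht : 0 < t) : Integrable (fun ξ => solDiff m G α ξ t) := by
  obtain ⟨i, hi⟩ := Nat.exists_eq_add_of_le h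
  obtain ⟨C, hC0, hC⟩ := exists_tau_pow_mul_exp_le n i (n + 1) (mul_pos (decayRate_pos m) ht)
  refine ((integrable_arrSize_mul hG).const_mul (solBound m * C)).mono'
    (measurable_solDiff_slice hGm α t).aestronglyMeasurable (Eventually.of_forall fun ξ => ?_)
  calc ‖solDiff m G α ξ t‖ ≤ _ := norm_solDiff_le α i hi ξ ht.le
    _ ≤ solBound m * arrSize m G ξ * (C * ((1 + ‖ξ‖) ^ (n + 1))⁻¹) :=
        mul_le_mul_of_nonneg_left (hC ξ) (mul_nonneg (solBound_nonneg m) (arrSize_nonneg ξ))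
    _ = _ := by ring

theorem memLp_solDiff (hGm : ∀ γ, Measurable (G γ))
    (hG : ∀ γ ∈ multiIdx n (m - 1), MemLp (G γ) 2) (α : MIdx n) (h : m ≤ α.len) {t : ℝ}
    (ht : 0 < t) : MemLp (fun ξ => solDiff m G α ξ t) 2 := by
  obtain ⟨i, hi⟩ := Nat.exists_eq_add_of_le h
  obtain ⟨C, hC0, hC⟩ := exists_tau_pow_mul_exp_le n i 0 (mul_pos (decayRate_pos m) ht)
  refine ((memLp_arrSize hG).const_mul (solBound m * C)).mono'
    (measurable_solDiff_slice hGm α t).aestronglyMeasurable (Eventually.of_forall fun ξ => ?_)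
  calc ‖solDiff m G α ξ t‖ ≤ _ := norm_solDiff_le α i hi ξ ht.le
    _ ≤ solBound m * arrSize m G ξ * (C * ((1 + ‖ξ‖) ^ 0)⁻¹) :=
        mul_le_mul_of_nonneg_left (hC ξ) (mul_nonneg (solBound_nonneg m) (arrSize_nonneg ξ))
    _ = _ := by ring

/-! ### The solution of the Neumann problem: the kernel -/

/-- The number of Taylor terms removed from the exponential at the frequency `ξ`. -/
def cutOrd (m : ℕ) (ξ : Hor n) : ℕ := if ‖ξ‖ < 1 then m else 0

/-- The solution is the integral of this kernel. -/
def solKer (m : ℕ) (G : MIdx n → Hor n → ℂ) (ξ : Hor n) (z : Space n) : ℂ :=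
  ∑ l, solCoef m G ξ l * cutExp (cutOrd m ξ) (ell ξ (root m l * tau ξ) z)

theorem contDiff_cutExp_ell (p : ℕ) (ξ : Hor n) (ζ : ℂ) (α : MIdx n) :
    ContDiff ℝ ∞ (fun z : Space n => cutExp p (ell ξ ζ z)) ∧
    partialD α (fun z : Space n => cutExp p (ell ξ ζ z)) =
      fun z => horMono α.1 ξ * ζ ^ α.2 * cutExp (p - α.len) (ell ξ ζ z) :=
  partialD_comp_ell (F := fun k => cutExp (p - k))
    (fun k w => by
      have := hasDerivAt_cutExp (p - k) w
      rwa [Nat.sub_sub] at this) ξ ζ α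

theorem contDiff_solKer (ξ : Hor n) : ContDiff ℝ ∞ (solKer m G ξ) := by
  unfold solKer
  exact ContDiff.sum fun l _ => contDiff_const.mul (contDiff_cutExp_ell _ _ _ 0).1

theorem partialD_solKer (ξ : Hor n) (α : MIdx n) : partialD α (solKer m G ξ) = fun z =>
    ∑ l, solCoef m G ξ l * (horMono α.1 ξ * (root m l * tau ξ) ^ α.2 *
      cutExp (cutOrd m ξ - α.len) (ell ξ (root m l * tau ξ) z)) := by
  have h1 := partialD_sum α Finset.univ (fun l => solCoef m G ξ l)
    (fun l (z : Space n) => cutExp (cutOrd m ξ) (ell ξ (root m l * tau ξ) z))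
    (fun l _ => (contDiff_cutExp_ell _ _ _ 0).1)
  unfold solKer
  rw [h1]
  funext z
  exact Finset.sum_congr rfl fun l _ => by rw [(contDiff_cutExp_ell _ _ _ α).2]

theorem norm_ell_le (ξ : Hor n) {ζ : ℂ} (hζ : ‖ζ‖ ≤ tau ξ) (z : Space n) :
    ‖ell ξ ζ z‖ ≤ tau ξ * (2 * ‖z‖) := by
  rw [ell_apply]
  have h1 : ‖((2 * Real.pi * inner ℝ ξ z.1 : ℝ) : ℂ) * Complex.I‖ ≤ tau ξ * ‖z‖ := by
    rw [norm_mul, Complex.norm_I, mul_one, Complex.norm_real, norm_mul,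
      Real.norm_of_nonneg (by positivity : 0 ≤ 2 * Real.pi), tau, mul_assoc (2 * Real.pi)]
    refine mul_le_mul_of_nonneg_left ?_ (by positivity)
    exact (norm_inner_le_norm _ _).trans
      (mul_le_mul_of_nonneg_left (norm_fst_le z) (norm_nonneg _))
  have h2 : ‖(z.2 : ℂ) * ζ‖ ≤ ‖z‖ * tau ξ := by
    rw [norm_mul, Complex.norm_real]
    exact mul_le_mul (norm_snd_le z) hζ (norm_nonneg _) (norm_nonneg _)
  refine (norm_add_le _ _).trans ?_
  linarith

theorem norm_root_mul_tau (l : Fin m) (ξ : Hor n) : ‖root m l * (tau ξ : ℂ)‖ = tau ξ := by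
  rw [norm_mul, norm_root, one_mul, Complex.norm_real, Real.norm_of_nonneg (tau_nonneg ξ)]

theorem exp_ell (ξ : Hor n) (ζ : ℂ) (z : Space n) :
    Complex.exp (ell ξ ζ z) = Complex.exp (ell ξ 0 z) * Complex.exp (z.2 * ζ) := by
  rw [← Complex.exp_add]
  congr 1
  simp [ell_apply]

theorem norm_exp_ell_zero (ξ : Hor n) (z : Space n) : ‖Complex.exp (ell ξ 0 z)‖ = 1 := by
  rw [Complex.norm_exp]
  simp [ell_apply]

/-- Two regimes. For |ξ| < 1 the Taylor remainder of order m - |α|, together with the factor τ^|α|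
from the derivatives, supplies the power τ^m that the coefficients need. For |ξ| ≥ 1 nothing is
removed, and the exponential decay at height t ≥ δ beats all powers of τ. The bound is an L²
function times an L² weight, hence integrable. -/
theorem exists_kernel_bound (m : ℕ) (α : MIdx n) {δ R : ℝ} (hδ : 0 < δ) (hR : 0 ≤ R) :
    ∃ C : ℝ, 0 ≤ C ∧ ∀ (G : MIdx n → Hor n → ℂ) (ξ : Hor n) (z : Space n) (l : Fin m),
      δ ≤ z.2 → ‖z‖ ≤ R →
      ‖solCoef m G ξ l * (horMono α.1 ξ * (root m l * tau ξ) ^ α.2 *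
        cutExp (cutOrd m ξ - α.len) (ell ξ (root m l * tau ξ) z))‖ ≤
      C * (arrSize m G ξ * ((1 + ‖ξ‖) ^ (n + 1))⁻¹) := by
  obtain ⟨C₁, hC₁0, hC₁⟩ := exists_tau_pow_mul_exp_le n α.len (n + 1)
    (mul_pos (decayRate_pos m) hδ)
  set a := α.len with ha
  -- The factors come from τ ≤ 2π, from the Taylor remainder with |ell| ≤ 2Rτ, and from 1 + |ξ| ≤ 2,
  -- which makes the weight harmless. The two truncated exponents cover |α| ≥ m and |α| ≤ m
  -- together.
  set C₂ : ℝ := (2 * Real.pi) ^ (a - m) * (2 * R) ^ (m - a) *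
    Real.exp (2 * Real.pi * (2 * R)) * 2 ^ (n + 1) with hC₂
  have hC₂0 : 0 ≤ C₂ := by positivity
  have hK := neuBound_nonneg m
  refine ⟨neuBound m * C₁ + neuBound m * C₂, by positivity, fun G ξ z l hz hzR => ?_⟩
  have hg := arrSize_nonneg (m := m) (G := G) ξ
  have hτ := tau_nonneg ξ
  have hinv : 0 ≤ ((1 + ‖ξ‖) ^ (n + 1))⁻¹ := by positivity
  have h0 : ‖solCoef m G ξ l * (horMono α.1 ξ * (root m l * tau ξ) ^ α.2 *
        cutExp (cutOrd m ξ - a) (ell ξ (root m l * tau ξ) z))‖ ≤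
      ‖solCoef m G ξ l‖ * (tau ξ ^ a *
        ‖cutExp (cutOrd m ξ - a) (ell ξ (root m l * tau ξ) z)‖) := by
    rw [norm_mul, norm_mul, norm_mul, norm_pow, norm_root_mul_tau]
    refine mul_le_mul_of_nonneg_left (mul_le_mul_of_nonneg_right ?_ (norm_nonneg _))
      (norm_nonneg _)
    rw [ha, MIdx.len, pow_add]
    exact mul_le_mul_of_nonneg_right (norm_horMono_le _ _) (by positivity)
  refine h0.trans ?_
  by_cases hξ : ‖ξ‖ < 1
  · have hτ1 : tau ξ ≤ 2 * Real.pi := by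
      unfold tau; exact mul_le_of_le_one_right (by positivity) hξ.le
    have hell : ‖ell ξ (root m l * tau ξ) z‖ ≤ tau ξ * (2 * R) :=
      (norm_ell_le ξ (norm_root_mul_tau l ξ).le z).trans
        (mul_le_mul_of_nonneg_left (by linarith) hτ)
    have h1 : ‖cutExp (cutOrd m ξ - a) (ell ξ (root m l * tau ξ) z)‖ ≤
        (tau ξ * (2 * R)) ^ (m - a) * Real.exp (2 * Real.pi * (2 * R)) := by
      rw [cutOrd, if_pos hξ]
      refine (norm_cutExp_le _ _).trans (mul_le_mul (pow_le_pow_left₀ (norm_nonneg _) hell _)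
        (Real.exp_le_exp.2 (hell.trans (mul_le_mul_of_nonneg_right hτ1 (by positivity))))
        (by positivity) (by positivity))
    have h2 : (1 : ℝ) ≤ 2 ^ (n + 1) * ((1 + ‖ξ‖) ^ (n + 1))⁻¹ := by
      rw [← div_eq_mul_inv, one_le_div (by positivity)]
      exact pow_le_pow_left₀ (by positivity) (by linarith) _
    calc ‖solCoef m G ξ l‖ * (tau ξ ^ a *
          ‖cutExp (cutOrd m ξ - a) (ell ξ (root m l * tau ξ) z)‖)
        ≤ ‖solCoef m G ξ l‖ * (tau ξ ^ a *
          ((tau ξ * (2 * R)) ^ (m - a) * Real.exp (2 * Real.pi * (2 * R)))) := by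
          gcongr
      _ = (‖solCoef m G ξ l‖ * tau ξ ^ (m + (a - m))) * ((2 * R) ^ (m - a) *
          Real.exp (2 * Real.pi * (2 * R))) := by
          rw [show m + (a - m) = a + (m - a) by omega, pow_add, mul_pow]; ring
      _ ≤ (neuBound m * arrSize m G ξ * (2 * Real.pi) ^ (a - m)) * ((2 * R) ^ (m - a) *
          Real.exp (2 * Real.pi * (2 * R))) := by
          refine mul_le_mul_of_nonneg_right ((norm_solCoef_mul_le ξ l _).trans ?_) (by positivity)
          gcongr
      _ ≤ (neuBound m * arrSize m G ξ * (2 * Real.pi) ^ (a - m)) * ((2 * R) ^ (m - a) *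
          Real.exp (2 * Real.pi * (2 * R))) * (2 ^ (n + 1) * ((1 + ‖ξ‖) ^ (n + 1))⁻¹) :=
          le_mul_of_one_le_right (by positivity) h2
      _ = neuBound m * C₂ * (arrSize m G ξ * ((1 + ‖ξ‖) ^ (n + 1))⁻¹) := by rw [hC₂]; ring
      _ ≤ _ := mul_le_mul_of_nonneg_right (le_add_of_nonneg_left (by positivity)) (by positivity)
  · have hξ' : 1 ≤ ‖ξ‖ := not_lt.1 hξ
    have hτ1 : 1 ≤ tau ξ := by
      have : 1 ≤ 2 * Real.pi := by linarith [Real.pi_gt_three]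
      unfold tau; nlinarith
    have h1 : ‖cutExp (cutOrd m ξ - a) (ell ξ (root m l * tau ξ) z)‖ ≤
        Real.exp (-(decayRate m * δ * tau ξ)) := by
      rw [cutOrd, if_neg hξ, Nat.zero_sub, cutExp_zero, exp_ell, norm_mul, norm_exp_ell_zero,
        one_mul]
      refine (norm_exp_root_le l hτ (hδ.le.trans hz)).trans (Real.exp_le_exp.2 (neg_le_neg ?_))
      exact mul_le_mul_of_nonneg_right
        (mul_le_mul_of_nonneg_left hz (decayRate_pos m).le) hτ
    -- Since τ ≥ 1 here, the missing power τ^m may be inserted before the bound for the coefficients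
    -- is used.
    calc ‖solCoef m G ξ l‖ * (tau ξ ^ a *
          ‖cutExp (cutOrd m ξ - a) (ell ξ (root m l * tau ξ) z)‖)
        ≤ ‖solCoef m G ξ l‖ * (tau ξ ^ (m + a) * Real.exp (-(decayRate m * δ * tau ξ))) := by
          gcongr
          · omega
      _ = ‖solCoef m G ξ l‖ * tau ξ ^ (m + a) * Real.exp (-(decayRate m * δ * tau ξ)) := by ring
      _ ≤ neuBound m * arrSize m G ξ * tau ξ ^ a * Real.exp (-(decayRate m * δ * tau ξ)) :=
          mul_le_mul_of_nonneg_right (norm_solCoef_mul_le ξ l a) (Real.exp_pos _).le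
      _ = neuBound m * arrSize m G ξ * (tau ξ ^ a * Real.exp (-(decayRate m * δ * tau ξ))) := by
          ring
      _ ≤ neuBound m * arrSize m G ξ * (C₁ * ((1 + ‖ξ‖) ^ (n + 1))⁻¹) :=
          mul_le_mul_of_nonneg_left (hC₁ ξ) (by positivity)
      _ = neuBound m * C₁ * (arrSize m G ξ * ((1 + ‖ξ‖) ^ (n + 1))⁻¹) := by ring
      _ ≤ _ := mul_le_mul_of_nonneg_right (le_add_of_nonneg_right (by positivity)) (by positivity)

theorem isSmoothKernel_solKer (hGm : ∀ γ, Measurable (G γ))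
    (hG : ∀ γ ∈ multiIdx n (m - 1), MemLp (G γ) 2) :
    IsSmoothKernel volume (solKer m G) (halfSpace n) where
  contDiff := contDiff_solKer
  meas α z _ := by
    simp only [partialD_solKer]
    refine Measurable.aestronglyMeasurable (Finset.measurable_fun_sum _ fun l _ => ?_)
    refine (measurable_solCoef hGm l).mul (Measurable.mul ?_ ?_)
    · exact Continuous.measurable (by fun_prop)
    · have h1 : (fun ξ : Hor n => cutExp (cutOrd m ξ - α.len) (ell ξ (root m l * tau ξ) z)) =
          fun ξ => if ‖ξ‖ < 1 then cutExp (m - α.len) (ell ξ (root m l * tau ξ) z) else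
            cutExp 0 (ell ξ (root m l * tau ξ) z) := by
        funext ξ
        unfold cutOrd
        split_ifs <;> simp
      rw [h1]
      refine Measurable.ite (measurableSet_lt measurable_norm measurable_const) ?_ ?_ <;>
      · simp only [ell_apply, cutExp]
        exact Continuous.measurable (by fun_prop)
  dom α z hz := by
    have hz' : 0 < z.2 := hz
    obtain ⟨C, hC0, hC⟩ := exists_kernel_bound m α (half_pos hz')
      (by positivity : 0 ≤ ‖z‖ + 1)
    refine ⟨{y | z.2 / 2 < y.2} ∩ {y | ‖y‖ < ‖z‖ + 1}, ?_,
      fun ξ => ∑ _l : Fin m, C * (arrSize m G ξ * ((1 + ‖ξ‖) ^ (n + 1))⁻¹),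
      integrable_finsetSum _ fun _ _ => (integrable_arrSize_mul hG).const_mul C,
      Eventually.of_forall fun ξ y hy => ?_⟩
    · refine IsOpen.mem_nhds ((isOpen_lt continuous_const continuous_snd).inter
        (isOpen_lt continuous_norm continuous_const)) ⟨?_, ?_⟩
      · exact half_lt_self hz'
      · exact lt_add_one ‖z‖
    · rw [partialD_solKer]
      exact (norm_sum_le _ _).trans (Finset.sum_le_sum fun l _ =>
        hC G ξ y l (le_of_lt hy.1) (le_of_lt hy.2))

/-- The solution of the Neumann problem whose data have the Fourier transforms `G`. -/
def neuSol (m : ℕ) (G : MIdx n → Hor n → ℂ) : Space n → ℂ := fun z => ∫ ξ, solKer m G ξ z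

theorem contDiffOn_neuSol (hGm : ∀ γ, Measurable (G γ))
    (hG : ∀ γ ∈ multiIdx n (m - 1), MemLp (G γ) 2) : ContDiffOn ℝ ∞ (neuSol m G) (halfSpace n) := by
  have := (isSmoothKernel_solKer hGm hG).contDiffOn_partialD (isOpen_halfSpace n) 0
  simp only [partialD_zero] at this
  exact this

/-- From order m on, all removed Taylor terms have been differentiated away, so the derivatives are
honest inverse Fourier transforms at every frequency. -/
theorem partialD_neuSol (hGm : ∀ γ, Measurable (G γ))
    (hG : ∀ γ ∈ multiIdx n (m - 1), MemLp (G γ) 2) {α : MIdx n} (hα : m ≤ α.len) {z : Space n}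
    (hz : z ∈ halfSpace n) : partialD α (neuSol m G) z = symFn (solDiff m G α) z := by
  change partialD α (fun y => ∫ ξ, solKer m G ξ y) z = _
  rw [(isSmoothKernel_solKer hGm hG).partialD_integral (isOpen_halfSpace n) α hz,
    symFn_eq_integral]
  congr 1
  funext ξ
  rw [partialD_solKer, solDiff, solSym, Finset.mul_sum, Finset.mul_sum]
  have h1 : cutOrd m ξ - α.len = 0 := by unfold cutOrd; split_ifs <;> omega
  simp only [h1, cutExp_zero]
  refine Finset.sum_congr rfl fun l _ => ?_
  rw [exp_ell]
  ring

end Solution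

end

section


section Solution

variable {n m : ℕ} {G : MIdx n → Hor n → ℂ}

/-! ### Norm estimates and the differential equation for the solution -/

theorem enorm_sq_eq_ofReal (c : ℂ) : ‖c‖ₑ ^ 2 = ENNReal.ofReal (‖c‖ ^ 2) := by
  rw [ENNReal.ofReal_pow (norm_nonneg _), ofReal_norm]

theorem lintegral_arrSize_sq_le (m : ℕ) (hGm : ∀ γ, Measurable (G γ)) :
    ∫⁻ ξ, ENNReal.ofReal (arrSize m G ξ ^ 2) ≤
      (multiIdx n (m - 1)).card * ∑ γ ∈ multiIdx n (m - 1), ∫⁻ ξ, ‖G γ ξ‖ₑ ^ 2 := by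
  rw [← lintegral_finsetSum _ fun γ _ => ((hGm γ).enorm.pow_const _),
    ← lintegral_const_mul _ (Finset.measurable_fun_sum _ fun γ _ => ((hGm γ).enorm.pow_const _))]
  refine lintegral_mono fun ξ => ?_
  simp only [enorm_sq_eq_ofReal]
  rw [← ENNReal.ofReal_sum_of_nonneg fun _ _ => by positivity, ← ENNReal.ofReal_natCast,
    ← ENNReal.ofReal_mul (by positivity)]
  exact ENNReal.ofReal_le_ofReal (sq_sum_le_card_mul_sum_sq)

theorem lintegral_slice_neuSol (hGm : ∀ γ, Measurable (G γ))
    (hG : ∀ γ ∈ multiIdx n (m - 1), MemLp (G γ) 2) {α : MIdx n} (hα : m ≤ α.len) {t : ℝ}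
    (ht : 0 < t) : ∫⁻ x, ‖partialD α (neuSol m G) (x, t)‖ₑ ^ 2 = ∫⁻ ξ, ‖solDiff m G α ξ t‖ₑ ^ 2 := by
  have h1 : ∀ x : Hor n, partialD α (neuSol m G) (x, t) = 𝓕⁻ (fun ξ => solDiff m G α ξ t) x :=
    fun x => partialD_neuSol hGm hG hα (z := (x, t)) ht
  simp only [h1]
  exact lintegral_enorm_sq_fourierInv (integrable_solDiff hGm hG α hα ht)
    (memLp_solDiff hGm hG α hα ht)

theorem measurable_partialD_slice (hGm : ∀ γ, Measurable (G γ))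
    (hG : ∀ γ ∈ multiIdx n (m - 1), MemLp (G γ) 2) (α : MIdx n) {t : ℝ} (ht : 0 < t) :
    Continuous fun x : Hor n => partialD α (neuSol m G) (x, t) := by
  refine continuous_iff_continuousAt.2 fun x => ?_
  have h := (contDiffOn_partialD (isOpen_halfSpace n) (contDiffOn_neuSol hGm hG) α).continuousOn
  exact ContinuousAt.comp (f := fun x : Hor n => (x, t)) (x := x)
    (h.continuousAt ((isOpen_halfSpace n).mem_nhds (show (0:ℝ) < t from ht)))
    (by fun_prop)

theorem lintegral_sum_slice_neuSol (hGm : ∀ γ, Measurable (G γ))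
    (hG : ∀ γ ∈ multiIdx n (m - 1), MemLp (G γ) 2) {ι : Type*} (s : Finset ι) {α : ι → MIdx n}
    (hα : ∀ i ∈ s, m ≤ (α i).len) {t : ℝ} (ht : 0 < t) :
    ∫⁻ x : Hor n, ∑ i ∈ s, ‖partialD (α i) (neuSol m G) (x, t)‖ₑ ^ 2 =
      ∑ i ∈ s, ∫⁻ ξ, ‖solDiff m G (α i) ξ t‖ₑ ^ 2 := by
  rw [lintegral_finsetSum _ fun i _ =>
    ((measurable_partialD_slice hGm hG (α i) ht).measurable.enorm.pow_const _)]
  exact Finset.sum_congr rfl fun i hi => lintegral_slice_neuSol hGm hG (hα i hi) ht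

theorem supSlice_neuSol_le (hGm : ∀ γ, Measurable (G γ))
    (hG : ∀ γ ∈ multiIdx n (m - 1), MemLp (G γ) 2) :
    supSlice m (fun α => partialD α (neuSol m G)) ≤
      ENNReal.ofReal ((multiIdx n m).card * solBound m ^ 2) *
        ∫⁻ ξ, ENNReal.ofReal (arrSize m G ξ ^ 2) := by
  refine iSup_le fun t => ?_
  have ht : 0 < (t : ℝ) := t.2
  rw [lintegral_sum_slice_neuSol hGm hG _ (fun α hα => (mem_multiIdx.1 hα).ge) ht]
  have h1 : ∀ α ∈ multiIdx n m, ∫⁻ ξ, ‖solDiff m G α ξ t‖ₑ ^ 2 ≤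
      ENNReal.ofReal (solBound m ^ 2) * ∫⁻ ξ, ENNReal.ofReal (arrSize m G ξ ^ 2) := by
    intro α hα
    rw [← lintegral_const_mul _ ((measurable_arrSize hGm).pow_const 2).ennreal_ofReal]
    refine lintegral_mono fun ξ => ?_
    rw [enorm_sq_eq_ofReal, ← ENNReal.ofReal_mul (by positivity), ← mul_pow]
    refine ENNReal.ofReal_le_ofReal (pow_le_pow_left₀ (norm_nonneg _) ?_ 2)
    refine (norm_solDiff_le α 0 (mem_multiIdx.1 hα) ξ ht.le).trans ?_
    rw [pow_zero, one_mul]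
    refine mul_le_of_le_one_right (mul_nonneg (solBound_nonneg m) (arrSize_nonneg ξ)) ?_
    have := mul_nonneg (mul_nonneg (decayRate_pos m).le ht.le) (tau_nonneg ξ)
    exact Real.exp_le_one_iff.2 (by linarith)
  refine (Finset.sum_le_sum h1).trans ?_
  rw [Finset.sum_const, nsmul_eq_mul, ENNReal.ofReal_mul (by positivity), ENNReal.ofReal_natCast,
    mul_assoc]

/-- Scaling makes the integral independent of τ. Concretely, x exp(-x) ≤ 1 with x = cτt uses up the
weight t and one of the two exponentials; the other one is integrated. -/
theorem lintegral_exp_decay_le {c τ : ℝ} (hc : 0 < c) (hτ : 0 ≤ τ) :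
    ∫⁻ t in Ioi (0 : ℝ), ENNReal.ofReal ((τ * Real.exp (-(c * t * τ))) ^ 2 * t) ≤
      ENNReal.ofReal (1 / c ^ 2) := by
  rcases hτ.eq_or_lt with h | h
  · simp [← h]
  have h0 : -(c * τ) < 0 := by have := mul_pos hc h; linarith
  have hint : IntegrableOn (fun t => τ / c * Real.exp (-(c * τ) * t)) (Ioi 0) :=
    (integrableOn_exp_mul_Ioi h0 0).const_mul _
  have h1 : ∫⁻ t in Ioi (0 : ℝ), ENNReal.ofReal (τ / c * Real.exp (-(c * τ) * t)) =
      ENNReal.ofReal (1 / c ^ 2) := by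
    rw [← ofReal_integral_eq_lintegral_ofReal hint (Eventually.of_forall fun t => by positivity),
      integral_const_mul, integral_exp_mul_Ioi h0]
    congr 1
    simp
    field_simp
  rw [← h1]
  refine setLIntegral_mono (by fun_prop) fun t ht => ENNReal.ofReal_le_ofReal ?_
  have ht' : 0 < t := ht
  have h2 : c * t * τ ≤ Real.exp (c * t * τ) := by
    have := Real.add_one_le_exp (c * t * τ); linarith
  have h3 : Real.exp (-(c * t * τ)) * Real.exp (c * t * τ) = 1 := by
    rw [← Real.exp_add]; simp
  have h4 : -(c * τ) * t = -(c * t * τ) := by ring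
  rw [h4]
  have hE := Real.exp_pos (-(c * t * τ))
  have h5 : c * t * τ * Real.exp (-(c * t * τ)) ≤ 1 := by
    rw [← h3, mul_comm (Real.exp _)]
    exact mul_le_mul_of_nonneg_right h2 hE.le
  rw [div_mul_eq_mul_div, le_div_iff₀ hc]
  calc (τ * Real.exp (-(c * t * τ))) ^ 2 * t * c
      = τ * Real.exp (-(c * t * τ)) * (c * t * τ * Real.exp (-(c * t * τ))) := by ring
    _ ≤ τ * Real.exp (-(c * t * τ)) * 1 := mul_le_mul_of_nonneg_left h5 (by positivity)
    _ = _ := mul_one _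

theorem len_addVert (α : MIdx n) : α.addVert.len = α.len + 1 := by
  simp [MIdx.addVert, MIdx.len, add_assoc]

/-- Plancherel on slices, then Tonelli: for each frequency the integral in t is the scale-invariant
one of `lintegral_exp_decay_le`, where the extra vertical derivative provides the factor τ. -/
theorem squareFn_neuSol_le (hGm : ∀ γ, Measurable (G γ))
    (hG : ∀ γ ∈ multiIdx n (m - 1), MemLp (G γ) 2) :
    squareFn m (fun α => partialD α (neuSol m G)) ≤
      ENNReal.ofReal ((multiIdx n m).card * solBound m ^ 2 * (1 / decayRate m ^ 2)) *
        ∫⁻ ξ, ENNReal.ofReal (arrSize m G ξ ^ 2) := by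
  set c := decayRate m
  set A : ℝ := (multiIdx n m).card * solBound m ^ 2 with hA
  have hA0 : 0 ≤ A := by positivity
  have hgm := (measurable_arrSize (m := m) hGm)
  have hmeas : Measurable fun p : ℝ × Hor n => ENNReal.ofReal (A * arrSize m G p.2 ^ 2 *
      ((tau p.2 * Real.exp (-(c * p.1 * tau p.2))) ^ 2 * p.1)) := by
    refine Measurable.ennreal_ofReal (Measurable.mul ?_ (Continuous.measurable (by fun_prop)))
    exact ((hgm.comp measurable_snd).pow_const 2).const_mul A
  calc squareFn m (fun α => partialD α (neuSol m G))
      ≤ ∫⁻ t in Ioi (0 : ℝ), ∫⁻ ξ : Hor n, ENNReal.ofReal (A * arrSize m G ξ ^ 2 *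
          ((tau ξ * Real.exp (-(c * t * tau ξ))) ^ 2 * t)) := by
        refine setLIntegral_mono hmeas.lintegral_prod_right' fun t ht => ?_
        have ht' : 0 < t := ht
        rw [lintegral_mul_const' _ _ ENNReal.ofReal_ne_top, lintegral_sum_slice_neuSol hGm hG _
          (fun α hα => by rw [len_addVert, mem_multiIdx.1 hα]; omega) ht',
          ← lintegral_finsetSum _ fun α _ =>
            ((measurable_solDiff_slice hGm _ t).enorm.pow_const _),
          ← lintegral_mul_const' _ _ ENNReal.ofReal_ne_top]
        refine lintegral_mono fun ξ => ?_
        simp only [enorm_sq_eq_ofReal]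
        rw [← ENNReal.ofReal_sum_of_nonneg fun _ _ => by positivity,
          ← ENNReal.ofReal_mul (Finset.sum_nonneg fun _ _ => by positivity)]
        refine ENNReal.ofReal_le_ofReal ?_
        have h1 : ∀ α ∈ multiIdx n m, ‖solDiff m G α.addVert ξ t‖ ^ 2 ≤
            (solBound m * arrSize m G ξ * (tau ξ * Real.exp (-(c * t * tau ξ)))) ^ 2 := by
          intro α hα
          refine pow_le_pow_left₀ (norm_nonneg _) ?_ 2
          have := norm_solDiff_le (m := m) (G := G) α.addVert 1
            (by rw [len_addVert, mem_multiIdx.1 hα]) ξ ht'.le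
          rwa [pow_one] at this
        calc (∑ α ∈ multiIdx n m, ‖solDiff m G α.addVert ξ t‖ ^ 2) * t
            ≤ (∑ _α ∈ multiIdx n m,
              (solBound m * arrSize m G ξ * (tau ξ * Real.exp (-(c * t * tau ξ)))) ^ 2) * t :=
              mul_le_mul_of_nonneg_right (Finset.sum_le_sum h1) ht'.le
          _ = _ := by rw [Finset.sum_const, nsmul_eq_mul, hA]; ring
    _ = ∫⁻ ξ : Hor n, ∫⁻ t in Ioi (0 : ℝ), ENNReal.ofReal (A * arrSize m G ξ ^ 2 *
          ((tau ξ * Real.exp (-(c * t * tau ξ))) ^ 2 * t)) :=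
        lintegral_lintegral_swap hmeas.aemeasurable
    _ ≤ ∫⁻ ξ : Hor n, ENNReal.ofReal (A * (1 / c ^ 2)) * ENNReal.ofReal (arrSize m G ξ ^ 2) := by
        refine lintegral_mono fun ξ => ?_
        have h0 : 0 ≤ A * arrSize m G ξ ^ 2 := by positivity
        simp only [ENNReal.ofReal_mul h0]
        rw [lintegral_const_mul' _ _ ENNReal.ofReal_ne_top, ← ENNReal.ofReal_mul (by positivity)]
        refine (mul_le_mul_right (lintegral_exp_decay_le (decayRate_pos m) (tau_nonneg ξ)) _).trans ?_
        rw [← ENNReal.ofReal_mul h0]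
        exact ENNReal.ofReal_le_ofReal (le_of_eq (by ring))
    _ = _ := lintegral_const_mul _ (hgm.pow_const 2).ennreal_ofReal

/-- The multinomial theorem collapses the sum to the characteristic polynomial, which vanishes on
each exponential. -/
theorem sum_specialCoeff_mul_solDiff (ξ : Hor n) (t : ℝ) :
    ∑ α ∈ multiIdx n m, specialCoeff n α α * solDiff m G (α + α) ξ t = 0 := by
  have h1 := sum_multinomial_mul (m := m)
    (fun i : Fin n => ((2 * Real.pi * ξ i : ℝ) * Complex.I) ^ 2) fun j => solSym m G (2 * j) ξ t
  have h2 : ∑ α ∈ multiIdx n m, specialCoeff n α α * solDiff m G (α + α) ξ t =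
      ∑ j ∈ Finset.range (m + 1), (-(tau ξ : ℂ) ^ 2) ^ (m - j) * solSym m G (2 * j) ξ t := by
    rw [← sum_horMono_sq, ← h1]
    refine Finset.sum_congr rfl fun α _ => ?_
    rw [specialCoeff_self, solDiff, Prod.fst_add, Prod.snd_add, ← two_mul α.2, horMono_add, horMono,
      ← Finset.prod_mul_distrib]
    simp only [← pow_add, ← pow_mul, two_mul]
  have h3 : bdry m ((tau ξ : ℂ) ^ 2) (fun j => solSym m G j ξ t) 0 = 0 := by
    have : (fun j => solSym m G j ξ t) = fun j => ∑ l,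
        (solCoef m G ξ l * Complex.exp (t * (root m l * tau ξ))) * (root m l * tau ξ) ^ j := by
      funext j
      exact Finset.sum_congr rfl fun l _ => by ring
    rw [this, bdry_sum]
    exact Finset.sum_eq_zero fun l _ => by rw [bdry_root_zero, mul_zero]
  rw [h2, ← mul_zero ((-1 : ℂ) ^ m), ← h3, bdry, Finset.mul_sum]
  refine Finset.sum_congr rfl fun j hj => ?_
  have hj' : j ≤ m := Nat.lt_succ_iff.1 (Finset.mem_range.1 hj)
  rw [neg_pow, zero_add, Nat.sub_zero, ← mul_assoc, ← mul_assoc, ← pow_add,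
    show m + j = m - j + 2 * j by omega, pow_add _ (m - j), pow_mul]
  simp

theorem sum_specialCoeff_mul_partialD_neuSol (hGm : ∀ γ, Measurable (G γ))
    (hG : ∀ γ ∈ multiIdx n (m - 1), MemLp (G γ) 2) {z : Space n} (hz : z ∈ halfSpace n) :
    ∑ α ∈ multiIdx n m, specialCoeff n α α * partialD (α + α) (neuSol m G) z = 0 := by
  have hlen : ∀ α ∈ multiIdx n m, m ≤ (α + α).len := fun α hα => by
    rw [MIdx.len_add, mem_multiIdx.1 hα]; omega
  have h1 : ∀ α ∈ multiIdx n m, specialCoeff n α α * partialD (α + α) (neuSol m G) z =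
      ∫ ξ, Complex.exp (ell ξ 0 z) * (specialCoeff n α α * solDiff m G (α + α) ξ z.2) := by
    intro α hα
    rw [partialD_neuSol hGm hG (hlen α hα) hz, symFn_eq_integral, ← integral_const_mul]
    congr 1
    funext ξ
    ring
  have hint : ∀ α ∈ multiIdx n m, Integrable fun ξ =>
      Complex.exp (ell ξ 0 z) * (specialCoeff n α α * solDiff m G (α + α) ξ z.2) := by
    intro α hα
    refine ((integrable_solDiff hGm hG _ (hlen α hα) hz).const_mul (specialCoeff n α α)).bdd_mul
      (c := 1) (Continuous.aestronglyMeasurable ?_) (Eventually.of_forall fun ξ => ?_)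
    · simp only [ell_apply]
      fun_prop
    · exact (norm_exp_ell_zero ξ z).le
  rw [Finset.sum_congr rfl h1, ← integral_finsetSum _ hint]
  simp only [← Finset.mul_sum, sum_specialCoeff_mul_solDiff, mul_zero, integral_zero]

theorem partialD_partialD_of_contDiffOn {f : Space n → ℂ} {Ω : Set (Space n)} (hΩ : IsOpen Ω)
    (hf : ContDiffOn ℝ ∞ f Ω) (α β : MIdx n) {z : Space n} (hz : z ∈ Ω) :
    partialD α (partialD β f) z = partialD (α + β) f z := by
  obtain ⟨g, hg, hfg⟩ := exists_contDiff_eventuallyEq hΩ hf hz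
  rw [(eventuallyEq_partialD α (eventuallyEq_partialD β hfg)).eq_of_nhds,
    (eventuallyEq_partialD _ hfg).eq_of_nhds, partialD_partialD _ _ hg]

theorem equation_neuSol (hGm : ∀ γ, Measurable (G γ))
    (hG : ∀ γ ∈ multiIdx n (m - 1), MemLp (G γ) 2) {φ : Space n → ℂ} (hφ : IsTestHalf φ) :
    ∑ α ∈ multiIdx n m, ∫ z in halfSpace n, starRingEnd ℂ (partialD α φ z) *
      applyCoeff m (specialCoeff n) (fun β => partialD β (neuSol m G) z) α = 0 := by
  have hw := contDiffOn_neuSol hGm hG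
  have hΩ := isOpen_halfSpace n
  have h1 : ∀ α ∈ multiIdx n m, ∫ z in halfSpace n, starRingEnd ℂ (partialD α φ z) *
      applyCoeff m (specialCoeff n) (fun β => partialD β (neuSol m G) z) α =
      (-1) ^ m * ∫ z in halfSpace n,
        specialCoeff n α α * partialD (α + α) (neuSol m G) z * starRingEnd ℂ (φ z) := by
    intro α hα
    have h2 := integral_halfSpace_mul_partialD (contDiffOn_partialD hΩ hw α) hφ.conj α
    have h3 : ∫ z in halfSpace n, partialD α (partialD α (neuSol m G)) z * starRingEnd ℂ (φ z) =
        ∫ z in halfSpace n, partialD (α + α) (neuSol m G) z * starRingEnd ℂ (φ z) :=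
      setIntegral_congr_fun hΩ.measurableSet fun z hz => by
        simp only [partialD_partialD_of_contDiffOn hΩ hw α α hz]
    rw [h3, mem_multiIdx.1 hα] at h2
    simp only [applyCoeff_specialCoeff _ hα, mul_assoc]
    rw [integral_const_mul, mul_left_comm, ← h2, ← integral_const_mul]
    congr 1
    funext z
    rw [partialD_conj α hφ.1.1, specialCoeff_self]
    ring
  have hint : ∀ α ∈ multiIdx n m, IntegrableOn (fun z =>
      specialCoeff n α α * partialD (α + α) (neuSol m G) z * starRingEnd ℂ (φ z)) (halfSpace n) := by
    intro α _
    have hc := (contDiffOn_partialD hΩ hw (α + α)).continuousOn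
    obtain ⟨δ, hδ, hs⟩ := hφ.exists_lt
    obtain ⟨g, hg, hgw⟩ := exists_contDiff_eq_of_lt (contDiffOn_partialD hΩ hw (α + α)) hδ
    have he : (fun z => specialCoeff n α α * partialD (α + α) (neuSol m G) z *
        starRingEnd ℂ (φ z)) = fun z => specialCoeff n α α * g z * starRingEnd ℂ (φ z) := by
      funext z
      by_cases hz : z ∈ tsupport φ
      · rw [hgw z (hs z hz)]
      · rw [image_eq_zero_of_notMem_tsupport hz, map_zero, mul_zero, mul_zero]
    rw [he]
    refine Integrable.integrableOn (Continuous.integrable_of_hasCompactSupport ?_ ?_)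
    · exact (continuous_const.mul hg.continuous).mul
        (Complex.continuous_conj.comp hφ.1.1.continuous)
    · exact (hφ.1.2.comp_left (map_zero (starRingEnd ℂ))).mul_left
  rw [Finset.sum_congr rfl h1, ← Finset.mul_sum, ← integral_finsetSum _ hint]
  refine mul_eq_zero_of_right _ (setIntegral_eq_zero_of_forall_eq_zero fun z hz => ?_)
  rw [← Finset.sum_mul, sum_specialCoeff_mul_partialD_neuSol hGm hG hz, zero_mul]

end Solution

end

section


/-! ### The symbol of the extension operator -/

section Heat

open Polynomial

/-- The polynomials in the derivatives of `t ^ k * exp (-(τ t) ^ (2 m))`. -/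
def heatPoly (m k : ℕ) : ℕ → ℝ[X]
  | 0 => 1
  | j + 1 => if j < k then
      C ((k - j : ℕ) : ℝ) * heatPoly m k j + X * derivative (heatPoly m k j) -
        C (2 * m : ℝ) * X ^ (2 * m) * heatPoly m k j
    else derivative (heatPoly m k j) - C (2 * m : ℝ) * X ^ (2 * m - 1) * heatPoly m k j

/-- The `j`-th derivative of `t ^ k * exp (-(τ t) ^ (2 m))`. -/
def heatJet (m k j : ℕ) (τ t : ℝ) : ℝ :=
  t ^ (k - j) * τ ^ (j - k) * (heatPoly m k j).eval (τ * t) * Real.exp (-(τ * t) ^ (2 * m))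

theorem heatJet_zero (m k : ℕ) (τ t : ℝ) :
    heatJet m k 0 τ t = t ^ k * Real.exp (-(τ * t) ^ (2 * m)) := by
  simp [heatJet, heatPoly]

/-- Up to order k the derivatives lower the power of t; afterwards they produce powers of τ. The
truncated exponents k - j and j - k encode this change, and the two branches of `heatPoly`
correspond to it. -/
theorem hasDerivAt_heatJet {m : ℕ} (hm : 1 ≤ m) (k j : ℕ) (τ t : ℝ) :
    HasDerivAt (heatJet m k j τ) (heatJet m k (j + 1) τ t) t := by
  have hlin : HasDerivAt (fun t : ℝ => τ * t) τ t := by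
    simpa using (hasDerivAt_id t).const_mul τ
  have hQ : HasDerivAt (fun t : ℝ => (heatPoly m k j).eval (τ * t))
      ((derivative (heatPoly m k j)).eval (τ * t) * τ) t :=
    ((heatPoly m k j).hasDerivAt (τ * t)).comp t hlin
  have hE : HasDerivAt (fun t : ℝ => Real.exp (-(τ * t) ^ (2 * m)))
      (Real.exp (-(τ * t) ^ (2 * m)) * -((2 * m : ℕ) * (τ * t) ^ (2 * m - 1) * τ)) t :=
    (hlin.pow (2 * m)).neg.exp
  obtain ⟨p, rfl⟩ : ∃ p, m = p + 1 := ⟨m - 1, by omega⟩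
  rcases lt_or_ge j k with h | h
  · obtain ⟨d, rfl⟩ : ∃ d, k = j + 1 + d := ⟨k - (j + 1), by omega⟩
    have h1 := (((hasDerivAt_pow (d + 1) t).mul_const (1 : ℝ)).fun_mul hQ).fun_mul hE
    refine (h1.congr_of_eventuallyEq (Eventually.of_forall fun s => ?_)).congr_deriv ?_
    · simp only [heatJet]
      rw [show j + 1 + d - j = d + 1 by omega, show j - (j + 1 + d) = 0 by omega, pow_zero]
    · simp only [heatJet, heatPoly, if_pos h]
      rw [show j + 1 + d - (j + 1) = d by omega, show j + 1 + d - j = d + 1 by omega,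
        show j + 1 - (j + 1 + d) = 0 by omega, show 2 * (p + 1) - 1 = 2 * p + 1 by omega]
      simp only [eval_sub, eval_add, eval_mul, eval_C, eval_X, eval_pow]
      push_cast
      ring
  · have h1 := (hQ.const_mul (τ ^ (j - k))).fun_mul hE
    refine (h1.congr_of_eventuallyEq (Eventually.of_forall fun s => ?_)).congr_deriv ?_
    · simp only [heatJet]
      rw [show k - j = 0 by omega, pow_zero, one_mul]
    · simp only [heatJet, heatPoly, if_neg (not_lt.2 h)]
      rw [show k - (j + 1) = 0 by omega, show j + 1 - k = j - k + 1 by omega,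
        show 2 * (p + 1) - 1 = 2 * p + 1 by omega]
      simp only [eval_sub, eval_mul, eval_C, eval_X, eval_pow]
      push_cast
      ring

theorem exists_abs_eval_le (p : ℝ[X]) : ∃ C : ℝ, 0 ≤ C ∧ ∀ x, |p.eval x| ≤ C * Real.exp |x| := by
  induction p using Polynomial.induction_on' with
  | add p q hp hq =>
    obtain ⟨C₁, h₁, H₁⟩ := hp
    obtain ⟨C₂, h₂, H₂⟩ := hq
    refine ⟨C₁ + C₂, by positivity, fun x => ?_⟩
    rw [eval_add, add_mul]
    exact (abs_add_le _ _).trans (add_le_add (H₁ x) (H₂ x))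
  | monomial d a =>
    refine ⟨|a| * d.factorial, by positivity, fun x => ?_⟩
    rw [eval_monomial, abs_mul, abs_pow, mul_assoc]
    refine mul_le_mul_of_nonneg_left ?_ (abs_nonneg a)
    have := Real.pow_div_factorial_le_exp |x| (abs_nonneg x) d
    rwa [div_le_iff₀ (by positivity), mul_comm] at this

theorem exists_heatPoly_bound {m : ℕ} (hm : 1 ≤ m) (k j : ℕ) : ∃ C : ℝ, 0 ≤ C ∧ ∀ s : ℝ,
    |(heatPoly m k j).eval s| * Real.exp (-s ^ (2 * m)) ≤ C * Real.exp (-|s|) := by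
  obtain ⟨C, hC0, hC⟩ := exists_abs_eval_le (heatPoly m k j)
  refine ⟨C * Real.exp 2, by positivity, fun s => ?_⟩
  -- From s^(2m) ≥ s² - 1 ≥ 2|s| - 2. The rate 2 leaves exp(-|s|) after the polynomial has been
  -- estimated by exp |s|.
  have h1 : 2 * |s| - 2 ≤ s ^ (2 * m) := by
    have h2 : s ^ 2 - 1 ≤ s ^ (2 * m) := by
      rw [pow_mul]
      rcases le_or_gt 1 (s ^ 2) with h | h
      · have := le_self_pow₀ h (by omega : m ≠ 0)
        linarith
      · have : 0 ≤ (s ^ 2) ^ m := by positivity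
        linarith
    have h3 : 0 ≤ (|s| - 1) ^ 2 := sq_nonneg _
    have h4 : |s| ^ 2 = s ^ 2 := sq_abs s
    nlinarith
  calc |(heatPoly m k j).eval s| * Real.exp (-s ^ (2 * m))
      ≤ C * Real.exp |s| * Real.exp (2 - 2 * |s|) :=
        mul_le_mul (hC s) (Real.exp_le_exp.2 (by linarith)) (Real.exp_pos _).le (by positivity)
    _ = C * Real.exp 2 * Real.exp (-|s|) := by
        rw [mul_assoc, mul_assoc, ← Real.exp_add, ← Real.exp_add]
        congr 2
        ring

theorem exists_heatJet_bound {m : ℕ} (hm : 1 ≤ m) (k j : ℕ) : ∃ C : ℝ, 0 ≤ C ∧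
    ∀ τ t : ℝ, 0 ≤ τ → |heatJet m k j τ t| ≤
      C * (|t| ^ (k - j) * τ ^ (j - k) * Real.exp (-(τ * |t|))) := by
  obtain ⟨C, hC0, hC⟩ := exists_heatPoly_bound hm k j
  refine ⟨C, hC0, fun τ t hτ => ?_⟩
  rw [heatJet, abs_mul, abs_mul, abs_mul, abs_pow, abs_pow, abs_of_nonneg hτ,
    abs_of_pos (Real.exp_pos _), mul_assoc _ |eval _ _|]
  have h := hC (τ * t)
  rw [abs_mul, abs_of_nonneg hτ] at h
  calc |t| ^ (k - j) * τ ^ (j - k) *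
        (|eval (τ * t) (heatPoly m k j)| * Real.exp (-(τ * t) ^ (2 * m)))
      ≤ |t| ^ (k - j) * τ ^ (j - k) * (C * Real.exp (-(τ * |t|))) :=
        mul_le_mul_of_nonneg_left h (by positivity)
    _ = _ := by ring

/-- Since exp(-s^(2m)) = 1 + O(s^(2m)), the derivatives of the damped monomial agree near s = 0 with
those of the monomial itself. The error has order 2m, and each derivative beyond the k-th lowers it
by one. -/
theorem heatPoly_dvd {m : ℕ} (hm : 1 ≤ m) (k j : ℕ) :
    (X : ℝ[X]) ^ (2 * m - (j - k)) ∣ heatPoly m k j - C (k.descFactorial j : ℝ) := by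
  induction j with
  | zero => simp [heatPoly]
  | succ j ih =>
    have hder : derivative (heatPoly m k j) =
        derivative (heatPoly m k j - C (k.descFactorial j : ℝ)) := by simp
    have ih' := pow_sub_one_dvd_derivative_of_pow_dvd ih
    rw [← hder] at ih'
    rw [Nat.descFactorial_succ]
    simp only [heatPoly]
    split_ifs with h
    · rw [show 2 * m - (j - k) = 2 * m by omega] at ih ih'
      rw [show 2 * m - (j + 1 - k) = 2 * m by omega]
      have e : C ((k - j : ℕ) : ℝ) * heatPoly m k j + X * derivative (heatPoly m k j) -
          C (2 * m : ℝ) * X ^ (2 * m) * heatPoly m k j -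
            C (((k - j) * k.descFactorial j : ℕ) : ℝ) =
          C ((k - j : ℕ) : ℝ) * (heatPoly m k j - C (k.descFactorial j : ℝ)) +
            X * derivative (heatPoly m k j) - X ^ (2 * m) * (C (2 * m : ℝ) * heatPoly m k j) := by
        simp only [Nat.cast_mul, C_mul]
        ring
      rw [e]
      refine ((ih.mul_left _).add ?_).sub (dvd_mul_right _ _)
      obtain ⟨p, hp⟩ : ∃ p, 2 * m = p + 1 := ⟨2 * m - 1, by omega⟩
      rw [hp, Nat.add_sub_cancel] at ih'
      rw [hp, pow_succ']
      exact mul_dvd_mul_left _ ih'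
    -- Beyond order k the descending factorial is zero, as the monomial itself has been
    -- differentiated to zero.
    · rw [show (k - j) * k.descFactorial j = 0 by rw [show k - j = 0 by omega, zero_mul],
        Nat.cast_zero, C_0, sub_zero]
      have e2 : (X : ℝ[X]) ^ (2 * m - (j + 1 - k)) ∣ X ^ (2 * m - 1) := pow_dvd_pow _ (by omega)
      refine Dvd.dvd.sub ?_ ((e2.mul_left _).mul_right _)
      rwa [show 2 * m - (j + 1 - k) = 2 * m - (j - k) - 1 by omega]

/-- For j < m the exponent 2m - (j - k) is positive, so the damping is invisible at t = 0. This is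
why ℰφ has the same vertical derivatives as φ at the boundary up to order m-1. -/
theorem heatJet_at_zero {m : ℕ} (hm : 1 ≤ m) {k j : ℕ} (hj : j < m) (τ : ℝ) :
    heatJet m k j τ 0 = if j = k then (k.factorial : ℝ) else 0 := by
  have h := heatPoly_dvd hm k j
  have h2 : (X : ℝ[X]) ∣ heatPoly m k j - C (k.descFactorial j : ℝ) :=
    (dvd_pow_self X (by omega)).trans h
  rw [X_dvd_iff, coeff_zero_eq_eval_zero, eval_sub, eval_C, sub_eq_zero] at h2
  rw [heatJet, mul_zero, h2, zero_pow (by omega : 2 * m ≠ 0), neg_zero, Real.exp_zero, mul_one]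
  split_ifs with hjk
  · subst hjk
    simp [Nat.descFactorial_self]
  · rcases lt_or_gt_of_ne hjk with h3 | h3
    · rw [zero_pow (by omega), zero_mul, zero_mul]
    · rw [Nat.descFactorial_of_lt h3, Nat.cast_zero, mul_zero]

end Heat

/-- Rapidly decreasing continuous functions of the frequency. -/
structure IsRapid {n : ℕ} (a : Hor n → ℂ) : Prop where
  continuous : Continuous a
  bound : ∀ N : ℕ, ∃ C : ℝ, 0 ≤ C ∧ ∀ ξ, (1 + ‖ξ‖) ^ N * ‖a ξ‖ ≤ C

theorem isRapid_schwartz {n : ℕ} (f : SchwartzMap (Hor n) ℂ) : IsRapid f where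
  continuous := f.continuous
  bound N := by
    refine ⟨_, ?_, fun ξ => by
      simpa using SchwartzMap.one_add_le_sup_seminorm_apply (𝕜 := ℂ) (m := (N, 0)) (k := N) (n := 0)
        le_rfl le_rfl f ξ⟩
    positivity

section Extension

variable {n m : ℕ}

/-- The Fourier transform of `∂_t^k φ(·, 0)`. -/
def trHat (φ : Space n → ℂ) (k : ℕ) : Hor n → ℂ := 𝓕 (fun x : Hor n => dVert^[k] φ (x, 0))

theorem iterate_dVert_eq_partialD (k : ℕ) (φ : Space n → ℂ) : dVert^[k] φ = partialD (0, k) φ := by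
  unfold partialD
  induction List.finRange n with
  | nil => rfl
  | cons i l ih => exact ih

theorem exists_schwartz_trace {φ : Space n → ℂ} (hφ : IsTest φ) (k : ℕ) :
    ∃ f : SchwartzMap (Hor n) ℂ, ∀ x, f x = dVert^[k] φ (x, 0) := by
  rw [iterate_dVert_eq_partialD]
  have h := hφ.partialD (0, k)
  have h1 : HasCompactSupport fun x : Hor n => partialD (0, k) φ (x, 0) := by
    refine HasCompactSupport.of_support_subset_isCompact (h.2.isCompact.image continuous_fst) ?_
    intro x hx
    exact ⟨(x, 0), subset_tsupport _ hx, rfl⟩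
  have h2 : ContDiff ℝ ∞ fun x : Hor n => partialD (0, k) φ (x, 0) :=
    h.1.comp (contDiff_id.prodMk contDiff_const)
  exact ⟨h1.toSchwartzMap h2, fun x => rfl⟩

theorem isRapid_trHat {φ : Space n → ℂ} (hφ : IsTest φ) (k : ℕ) : IsRapid (trHat φ k) := by
  obtain ⟨f, hf⟩ := exists_schwartz_trace hφ k
  have : trHat φ k = (𝓕 f : SchwartzMap (Hor n) ℂ) := by
    rw [SchwartzMap.fourier_coe, trHat]
    congr 1
    exact funext fun x => (hf x).symm
  rw [this]
  exact isRapid_schwartz _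

theorem fourierInv_trHat {φ : Space n → ℂ} (hφ : IsTest φ) (k : ℕ) :
    𝓕⁻ (trHat φ k) = fun x => dVert^[k] φ (x, 0) := by
  obtain ⟨f, hf⟩ := exists_schwartz_trace hφ k
  have h1 : trHat φ k = (𝓕 f : SchwartzMap (Hor n) ℂ) := by
    rw [SchwartzMap.fourier_coe, trHat]
    congr 1
    exact funext fun x => (hf x).symm
  rw [h1, ← SchwartzMap.fourierInv_coe, FourierTransform.fourierInv_fourier_eq]
  exact funext hf

/-- The symbol of the `j`-th vertical derivative of the extension of `φ`. -/
def extSym (m : ℕ) (φ : Space n → ℂ) (j : ℕ) (ξ : Hor n) (t : ℝ) : ℂ :=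
  ∑ k ∈ Finset.range m, trHat φ k ξ / k.factorial * (heatJet m k j (tau ξ) t : ℝ)

theorem continuous_extSym {φ : Space n → ℂ} (hφ : IsTest φ) (j : ℕ) :
    Continuous fun p : Hor n × ℝ => extSym m φ j p.1 p.2 := by
  unfold extSym
  refine continuous_finsetSum _ fun k _ => Continuous.mul ?_ ?_
  · exact ((isRapid_trHat hφ k).continuous.comp continuous_fst).div_const _
  · unfold heatJet
    have := (heatPoly m k j).continuous
    fun_prop

theorem exists_extSym_bound (hm : 1 ≤ m) (φ : Space n → ℂ) (j : ℕ) : ∃ C : ℝ, 0 ≤ C ∧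
    ∀ ξ t, ‖extSym m φ j ξ t‖ ≤ C * ∑ k ∈ Finset.range m, ‖trHat φ k ξ‖ *
      (|t| ^ (k - j) * tau ξ ^ (j - k) * Real.exp (-(tau ξ * |t|))) := by
  choose C hC0 hC using fun k => exists_heatJet_bound hm k j
  refine ⟨∑ k ∈ Finset.range m, C k, Finset.sum_nonneg fun k _ => hC0 k, fun ξ t => ?_⟩
  rw [extSym, Finset.mul_sum]
  refine (norm_sum_le _ _).trans (Finset.sum_le_sum fun k hk => ?_)
  have hτ := tau_nonneg ξ
  rw [norm_mul, norm_div, Complex.norm_real, Complex.norm_natCast]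
  have h1 : ‖trHat φ k ξ‖ / k.factorial ≤ ‖trHat φ k ξ‖ :=
    div_le_self (norm_nonneg _) (by exact_mod_cast Nat.one_le_iff_ne_zero.2 (Nat.factorial_ne_zero k))
  have h2 : C k ≤ ∑ k ∈ Finset.range m, C k :=
    Finset.single_le_sum (fun k _ => hC0 k) hk
  calc ‖trHat φ k ξ‖ / k.factorial * ‖heatJet m k j (tau ξ) t‖
      ≤ ‖trHat φ k ξ‖ * (C k * (|t| ^ (k - j) * tau ξ ^ (j - k) * Real.exp (-(tau ξ * |t|)))) :=
        mul_le_mul h1 (hC k _ t hτ) (norm_nonneg _) (norm_nonneg _)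
    _ ≤ ‖trHat φ k ξ‖ * ((∑ k ∈ Finset.range m, C k) *
          (|t| ^ (k - j) * tau ξ ^ (j - k) * Real.exp (-(tau ξ * |t|)))) := by gcongr
    _ = _ := by ring

theorem rapidSymbol_extSym (hm : 1 ≤ m) {φ : Space n → ℂ} (hφ : IsTest φ) :
    RapidSymbol (extSym m φ) where
  deriv j ξ t := by
    have h1 : ∀ k ∈ Finset.range m, HasDerivAt
        (fun t => trHat φ k ξ / k.factorial * ((heatJet m k j (tau ξ) t : ℝ) : ℂ))
        (trHat φ k ξ / k.factorial * ((heatJet m k (j + 1) (tau ξ) t : ℝ) : ℂ)) t := fun k _ =>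
      HasDerivAt.const_mul _ (hasDerivAt_heatJet hm k j (tau ξ) t).ofReal_comp
    exact HasDerivAt.fun_sum h1
  meas j t := by
    refine Continuous.aestronglyMeasurable ?_
    exact (continuous_extSym (m := m) hφ j).comp
      (g := fun p : Hor n × ℝ => extSym m φ j p.1 p.2) (f := fun ξ => (ξ, t)) (by fun_prop)
  bound j N T := by
    obtain ⟨C, hC0, hC⟩ := exists_extSym_bound hm φ j
    choose B hB0 hB using fun k => (isRapid_trHat hφ k).bound (N + (j - k))
    refine ⟨C * ∑ k ∈ Finset.range m, B k * (|T| ^ (k - j) * (2 * Real.pi) ^ (j - k)),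
      fun ξ t ht => ?_⟩
    have hτ := tau_nonneg ξ
    refine (mul_le_mul_of_nonneg_left (hC ξ t) (by positivity)).trans ?_
    rw [mul_left_comm, Finset.mul_sum]
    refine mul_le_mul_of_nonneg_left (Finset.sum_le_sum fun k _ => ?_) hC0
    have h1 : tau ξ ≤ 2 * Real.pi * (1 + ‖ξ‖) := by
      unfold tau
      exact mul_le_mul_of_nonneg_left (by linarith) (by positivity)
    have h2 : Real.exp (-(tau ξ * |t|)) ≤ 1 := Real.exp_le_one_iff.2 (by
      have := mul_nonneg hτ (abs_nonneg t); linarith)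
    have h3 : |t| ≤ |T| := ht.trans (le_abs_self T)
    calc (1 + ‖ξ‖) ^ N * (‖trHat φ k ξ‖ *
          (|t| ^ (k - j) * tau ξ ^ (j - k) * Real.exp (-(tau ξ * |t|))))
        ≤ (1 + ‖ξ‖) ^ N * (‖trHat φ k ξ‖ *
          (|T| ^ (k - j) * (2 * Real.pi * (1 + ‖ξ‖)) ^ (j - k) * 1)) := by gcongr
      _ = (1 + ‖ξ‖) ^ (N + (j - k)) * ‖trHat φ k ξ‖ *
          (|T| ^ (k - j) * (2 * Real.pi) ^ (j - k)) := by rw [pow_add, mul_pow]; ring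
      _ ≤ _ := mul_le_mul_of_nonneg_right (hB k ξ) (by positivity)

theorem IsRapid.integrable {a : Hor n → ℂ} (h : IsRapid a) : Integrable a := by
  obtain ⟨C, hC0, hC⟩ := h.bound (n + 1)
  refine ((integrable_inv_one_add_norm_pow n).const_mul C).mono'
    h.continuous.aestronglyMeasurable (Eventually.of_forall fun ξ => ?_)
  rw [← div_eq_mul_inv, le_div_iff₀ (by positivity), mul_comm]
  exact hC ξ

/-- Puts ℰφ in the form of an inverse Fourier integral, where (4π²t²|ξ|²)^m is (τt)^(2m), so that
its derivatives and slice norms can be read off from symbols. -/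
theorem extE_eq_symFn {φ : Space n → ℂ} (hφ : IsTest φ) :
    extE m φ = symFn (extSym m φ 0) := by
  funext z
  have hint : ∀ k, Integrable fun ξ : Hor n =>
      ((Real.exp (-((4 * Real.pi ^ 2 * z.2 ^ 2 * ‖ξ‖ ^ 2) ^ m)) : ℝ) : ℂ) * trHat φ k ξ := by
    intro k
    refine (isRapid_trHat hφ k).integrable.bdd_mul (c := 1)
      (Continuous.aestronglyMeasurable (by fun_prop)) (Eventually.of_forall fun ξ => ?_)
    rw [Complex.norm_real, Real.norm_of_nonneg (Real.exp_pos _).le, Real.exp_le_one_iff]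
    have : 0 ≤ (4 * Real.pi ^ 2 * z.2 ^ 2 * ‖ξ‖ ^ 2) ^ m := by positivity
    linarith
  have hc : Continuous fun ξ : Hor n => Complex.exp (ell ξ 0 z) := by
    simp only [ell_apply]
    fun_prop
  have h1 : ∀ k, heatQ m z.2 (fun x => dVert^[k] φ (x, 0)) z.1 = ∫ ξ, Complex.exp (ell ξ 0 z) *
      (((Real.exp (-((4 * Real.pi ^ 2 * z.2 ^ 2 * ‖ξ‖ ^ 2) ^ m)) : ℝ) : ℂ) * trHat φ k ξ) :=
    fun k => symFn_eq_integral (fun ξ t =>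
      ((Real.exp (-((4 * Real.pi ^ 2 * t ^ 2 * ‖ξ‖ ^ 2) ^ m)) : ℝ) : ℂ) * trHat φ k ξ) z
  rw [extE, symFn_eq_integral]
  simp only [h1]
  have hint2 : ∀ k ∈ Finset.range m, Integrable fun ξ : Hor n =>
      ((z.2 : ℂ) ^ k / (k.factorial : ℂ)) * (Complex.exp (ell ξ 0 z) *
      (((Real.exp (-((4 * Real.pi ^ 2 * z.2 ^ 2 * ‖ξ‖ ^ 2) ^ m)) : ℝ) : ℂ) * trHat φ k ξ)) :=
    fun k _ => ((hint k).bdd_mul (c := 1) hc.aestronglyMeasurable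
      (Eventually.of_forall fun ξ => (norm_exp_ell_zero ξ z).le)).const_mul _
  simp only [← integral_const_mul]
  rw [← integral_finsetSum _ hint2]
  congr 1
  funext ξ
  rw [extSym, Finset.mul_sum]
  refine Finset.sum_congr rfl fun k _ => ?_
  rw [heatJet_zero, show (4 * Real.pi ^ 2 * z.2 ^ 2 * ‖ξ‖ ^ 2) ^ m = (tau ξ * z.2) ^ (2 * m) by
    rw [pow_mul, tau]; congr 1; ring]
  push_cast
  ring

theorem extSym_at_zero (hm : 1 ≤ m) (φ : Space n → ℂ) {j : ℕ} (hj : j < m) (ξ : Hor n) :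
    extSym m φ j ξ 0 = trHat φ j ξ := by
  rw [extSym, Finset.sum_eq_single j]
  · rw [heatJet_at_zero hm hj, if_pos rfl]
    push_cast
    rw [div_mul_cancel₀]
    exact_mod_cast Nat.factorial_ne_zero j
  · intro k _ hk
    rw [heatJet_at_zero hm hj, if_neg (Ne.symm hk)]
    simp
  · intro h
    exact absurd (Finset.mem_range.2 hj) h

/-! ### Traces of test functions -/

theorem partialD_fst_const (β : Fin n → ℕ) (f : Space n → ℂ) :
    partialD (β, 0) (fun z : Space n => f (z.1, 0)) = fun z => partialD (β, 0) f (z.1, 0) := by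
  have h1 : ∀ (i : Fin n) (f : Space n → ℂ),
      dHor i (fun z : Space n => f (z.1, 0)) = fun z => dHor i f (z.1, 0) := by
    intro i f
    funext z
    simp [dHor, lineDeriv]
  have h2 : ∀ (i : Fin n) (k : ℕ) (f : Space n → ℂ),
      (dHor i)^[k] (fun z : Space n => f (z.1, 0)) = fun z => (dHor i)^[k] f (z.1, 0) := by
    intro i k
    induction k with
    | zero => intro f; rfl
    | succ k ih => intro f; rw [Function.iterate_succ_apply, h1, ih]; rfl
  unfold partialD
  induction List.finRange n with
  | nil => rfl
  | cons i l ih =>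
    simp only [List.foldr_cons]
    rw [ih, h2]

theorem partialD_trace {φ : Space n → ℂ} (hφ : IsTest φ) (γ : MIdx n) (x : Hor n) :
    partialD γ φ (x, 0) = 𝓕⁻ (fun ξ => horMono γ.1 ξ * trHat φ γ.2 ξ) x := by
  -- A symbol that is constant in t: its function is x ↦ ∂_t^k φ(x, 0) extended constantly in t, so
  -- the rule for derivatives of `symFn` supplies the horizontal ones.
  let q : ℕ → Hor n → ℝ → ℂ := fun j ξ _ => if j = 0 then trHat φ γ.2 ξ else 0
  have hq : RapidSymbol q := by
    refine ⟨fun j ξ t => ?_, fun j t => ?_, fun j N T => ?_⟩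
    · simpa [q] using hasDerivAt_const t (q j ξ 0)
    · by_cases h : j = 0
      · simpa [q, h] using (isRapid_trHat hφ γ.2).continuous.aestronglyMeasurable
      · simpa [q, h] using aestronglyMeasurable_const
    · obtain ⟨C, hC0, hC⟩ := (isRapid_trHat hφ γ.2).bound N
      refine ⟨C, fun ξ t _ => ?_⟩
      by_cases h : j = 0
      · simpa [q, h] using hC ξ
      · simpa [q, h] using hC0
  have h1 : symFn (q 0) = fun z : Space n => partialD (0, γ.2) φ (z.1, 0) := by
    funext z
    have := congrFun (fourierInv_trHat hφ γ.2) z.1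
    rw [iterate_dVert_eq_partialD] at this
    simpa [symFn, q] using this
  have h2 := congrFun (hq.partialD_symFn (γ.1, 0)) (x, 0)
  rw [h1, partialD_fst_const, partialD_partialD _ _ hφ.1] at h2
  have h3 : ((γ.1, 0) + (0, γ.2) : MIdx n) = γ := by ext <;> simp
  rw [h3] at h2
  refine h2.trans ?_
  simp [symFn, RapidSymbol.diff, q]

end Extension

end

section


/-! ### The Neumann data of the solution -/

theorem integral_exp_decay {c τ : ℝ} (hc : 0 < c) (hτ : 0 ≤ τ) :
    IntegrableOn (fun t => τ * Real.exp (-(c * t * τ))) (Ioi 0) ∧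
      ∫ t in Ioi (0 : ℝ), τ * Real.exp (-(c * t * τ)) ≤ 1 / c := by
  rcases hτ.eq_or_lt with h | h
  · simp only [← h, zero_mul, integral_zero]
    exact ⟨integrableOn_zero, by positivity⟩
  have h0 : -(c * τ) < 0 := by have := mul_pos hc h; linarith
  have h1 : (fun t => τ * Real.exp (-(c * t * τ))) = fun t => τ * Real.exp (-(c * τ) * t) := by
    funext t; congr 2; ring
  rw [h1]
  refine ⟨(integrableOn_exp_mul_Ioi h0 0).const_mul _, le_of_eq ?_⟩
  rw [integral_const_mul, integral_exp_mul_Ioi h0]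
  simp
  field_simp

theorem integrable_prod_of_norm_le_exp {n : ℕ} {F : Hor n × ℝ → ℂ}
    (hF : AEStronglyMeasurable F (volume.prod (volume.restrict (Ioi 0)))) {b : Hor n → ℝ}
    (hb : Integrable b) (hb0 : ∀ ξ, 0 ≤ b ξ) {c : ℝ} (hc : 0 < c)
    (h : ∀ ξ t, 0 < t → ‖F (ξ, t)‖ ≤ b ξ * (tau ξ * Real.exp (-(c * t * tau ξ)))) :
    Integrable F (volume.prod (volume.restrict (Ioi 0))) := by
  have h1 : ∀ ξ : Hor n, IntegrableOn (fun t => b ξ * (tau ξ * Real.exp (-(c * t * tau ξ))))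
      (Ioi 0) := fun ξ => (integral_exp_decay hc (tau_nonneg ξ)).1.const_mul _
  rw [integrable_prod_iff hF]
  constructor
  · filter_upwards [hF.prodMk_left] with ξ hξ
    refine (h1 ξ).mono' hξ ?_
    filter_upwards [ae_restrict_mem measurableSet_Ioi] with t ht using h ξ t ht
  · refine (hb.mul_const (1 / c)).mono' hF.norm.integral_prod_right' (Eventually.of_forall fun ξ => ?_)
    rw [Real.norm_of_nonneg (integral_nonneg fun _ => norm_nonneg _)]
    calc ∫ t in Ioi (0 : ℝ), ‖F (ξ, t)‖
        ≤ ∫ t in Ioi (0 : ℝ), b ξ * (tau ξ * Real.exp (-(c * t * tau ξ))) := by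
          refine integral_mono_of_nonneg (Eventually.of_forall fun _ => norm_nonneg _) (h1 ξ) ?_
          filter_upwards [ae_restrict_mem measurableSet_Ioi] with t ht using h ξ t ht
      _ ≤ b ξ * (1 / c) := by
          rw [integral_const_mul]
          exact mul_le_mul_of_nonneg_left (integral_exp_decay hc (tau_nonneg ξ)).2 (hb0 ξ)

theorem tendsto_setIntegral_Ioi_zero {f : ℝ → ℂ} (hf : IntegrableOn f (Ioi 0)) :
    Tendsto (fun ε => ∫ t in Ioi ε, f t) (𝓝[>] 0) (𝓝 (∫ t in Ioi 0, f t)) := by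
  have h1 : AECover (volume.restrict (Ioi (0 : ℝ))) (𝓝[>] (0 : ℝ)) fun ε => Ioi ε :=
    aecover_Ioi_of_Ioi (tendsto_id.mono_left nhdsWithin_le_nhds)
  have h2 := h1.integral_tendsto_of_countably_generated hf
  refine h2.congr' ?_
  filter_upwards [self_mem_nhdsWithin] with ε hε
  rw [Measure.restrict_restrict measurableSet_Ioi,
    inter_eq_left.2 (Ioi_subset_Ioi (le_of_lt hε))]

/-- Once the slice pairings are integrable on (0, ∞), the iterated limit is an ordinary integral. -/
theorem hasNeumannData_of_integrableOn {n m : ℕ} {A : MIdx n → MIdx n → ℂ}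
    {D : MIdx n → Space n → ℂ} {g : MIdx n → Hor n → ℂ}
    (H : ∀ φ : Space n → ℂ, IsTest φ → ∃ J : ℝ → ℂ, IntegrableOn J (Ioi 0) ∧
      (∀ t, 0 < t → ∑ α ∈ multiIdx n m, ∫ x : Hor n,
        starRingEnd ℂ (applyCoeff m A (fun β => D β (x, t)) α) * partialD α (extE m φ) (x, t) = J t) ∧
      ∫ t in Ioi 0, J t = ∑ γ ∈ multiIdx n (m - 1), ∫ x : Hor n,
        starRingEnd ℂ (g γ x) * partialD γ φ (x, 0)) :
    HasNeumannData m A D g := by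
  intro φ hφ
  obtain ⟨J, hJ, h1, h2⟩ := H φ hφ
  refine ⟨fun ε => ∫ t in Ioi ε, J t, fun ε hε => ?_, ?_⟩
  · refine (intervalIntegral_tendsto_integral_Ioi ε (hJ.mono_set (Ioi_subset_Ioi hε.le))
      tendsto_id).congr' ?_
    filter_upwards [eventually_ge_atTop ε] with T hT
    refine intervalIntegral.integral_congr fun t ht => ?_
    rw [uIcc_of_le (show ε ≤ id T from hT)] at ht
    exact (h1 t (hε.trans_le ht.1)).symm
  · rw [← h2]
    exact tendsto_setIntegral_Ioi_zero hJ

section Solution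

variable {n m : ℕ} {G : MIdx n → Hor n → ℂ}

/-- The energy pairing of the solution with the extension of `φ` on the Fourier side. -/
def energySym (m : ℕ) (G : MIdx n → Hor n → ℂ) (φ : Space n → ℂ) (ξ : Hor n) (t : ℝ) : ℂ :=
  ∑ j ∈ Finset.range (m + 1), ((tau ξ : ℂ) ^ 2) ^ (m - j) *
    (starRingEnd ℂ (solSym m G j ξ t) * extSym m φ j ξ t)

theorem mul_pow_mul_exp_le (d : ℕ) {τ t : ℝ} (hτ : 0 ≤ τ) (ht : 0 ≤ t) :
    (τ * t) ^ d * Real.exp (-(τ * t)) ≤ d.factorial := by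
  have h := Real.pow_div_factorial_le_exp (τ * t) (by positivity) d
  rw [div_le_iff₀ (by positivity)] at h
  rw [Real.exp_neg, ← div_eq_mul_inv, div_le_iff₀ (Real.exp_pos _)]
  linarith

/-- Excess powers of t always come paired with τ, and (τt)^d exp(-τt) is bounded; what is left is
independent of t. -/
theorem exists_tau_pow_mul_extSym_le (hm : 1 ≤ m) (φ : Space n → ℂ) {j : ℕ} (hj : j ≤ m) :
    ∃ C : ℝ, 0 ≤ C ∧ ∀ ξ t, 0 < t → tau ξ ^ (m - j) * ‖extSym m φ j ξ t‖ ≤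
      C * ∑ k ∈ Finset.range m, ‖trHat φ k ξ‖ * tau ξ ^ (m - k) := by
  obtain ⟨C, hC0, hC⟩ := exists_extSym_bound hm φ j
  refine ⟨C * m.factorial, by positivity, fun ξ t ht => ?_⟩
  have hτ := tau_nonneg ξ
  refine (mul_le_mul_of_nonneg_left (hC ξ t) (by positivity)).trans ?_
  rw [mul_left_comm, mul_assoc]
  refine mul_le_mul_of_nonneg_left ?_ hC0
  rw [Finset.mul_sum, Finset.mul_sum]
  refine Finset.sum_le_sum fun k hk => ?_
  have hk' := Finset.mem_range.1 hk
  rw [abs_of_pos ht]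
  calc tau ξ ^ (m - j) * (‖trHat φ k ξ‖ * (t ^ (k - j) * tau ξ ^ (j - k) *
        Real.exp (-(tau ξ * t))))
      = ‖trHat φ k ξ‖ * tau ξ ^ (m - k) * ((tau ξ * t) ^ (k - j) * Real.exp (-(tau ξ * t))) := by
        have e : tau ξ ^ (m - j) * tau ξ ^ (j - k) = tau ξ ^ (m - k) * tau ξ ^ (k - j) := by
          rw [← pow_add, ← pow_add]
          congr 1
          omega
        rw [mul_pow]
        linear_combination (‖trHat φ k ξ‖ * t ^ (k - j) * Real.exp (-(tau ξ * t))) * e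
    _ ≤ ‖trHat φ k ξ‖ * tau ξ ^ (m - k) * m.factorial := by
        refine mul_le_mul_of_nonneg_left ((mul_pow_mul_exp_le _ hτ ht.le).trans ?_) (by positivity)
        exact_mod_cast Nat.factorial_le (by omega)
    _ = _ := by ring

/-- Each of the two factors carries a share τ^(m-j) of the weight. The extension yields one spare
factor τ, which makes the exponential decay of the solution integrable in t uniformly in ξ,
including near ξ = 0. -/
theorem exists_energySym_bound (hm : 1 ≤ m) (φ : Space n → ℂ) : ∃ C : ℝ, 0 ≤ C ∧
    ∀ (G : MIdx n → Hor n → ℂ) ξ t, 0 < t → ‖energySym m G φ ξ t‖ ≤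
      (C * (arrSize m G ξ * ∑ k ∈ Finset.range m, ‖trHat φ k ξ‖ * tau ξ ^ (m - 1 - k))) *
        (tau ξ * Real.exp (-(decayRate m * t * tau ξ))) := by
  choose! C hC0 hC using fun j (hj : j ∈ Finset.range (m + 1)) =>
    exists_tau_pow_mul_extSym_le hm φ (Nat.lt_succ_iff.1 (Finset.mem_range.1 hj))
  refine ⟨solBound m * ∑ j ∈ Finset.range (m + 1), C j,
    mul_nonneg (solBound_nonneg m) (Finset.sum_nonneg hC0), fun G ξ t ht => ?_⟩
  have hτ := tau_nonneg ξ
  have hS : ∑ k ∈ Finset.range m, ‖trHat φ k ξ‖ * tau ξ ^ (m - k) =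
      (∑ k ∈ Finset.range m, ‖trHat φ k ξ‖ * tau ξ ^ (m - 1 - k)) * tau ξ := by
    rw [Finset.sum_mul]
    refine Finset.sum_congr rfl fun k hk => ?_
    have := Finset.mem_range.1 hk
    rw [mul_assoc, ← pow_succ, show m - 1 - k + 1 = m - k by omega]
  rw [energySym]
  refine (norm_sum_le _ _).trans ?_
  calc ∑ j ∈ Finset.range (m + 1), ‖((tau ξ : ℂ) ^ 2) ^ (m - j) *
        (starRingEnd ℂ (solSym m G j ξ t) * extSym m φ j ξ t)‖
      ≤ ∑ j ∈ Finset.range (m + 1), (solBound m * arrSize m G ξ *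
          Real.exp (-(decayRate m * t * tau ξ))) *
        (C j * ((∑ k ∈ Finset.range m, ‖trHat φ k ξ‖ * tau ξ ^ (m - 1 - k)) * tau ξ)) := by
        refine Finset.sum_le_sum fun j hj => ?_
        have hj' := Nat.lt_succ_iff.1 (Finset.mem_range.1 hj)
        have h1 := norm_tau_pow_mul_solSym_le (m := m) (G := G) (m - j) j 0 (by omega) ξ ht.le
        rw [pow_zero, one_mul] at h1
        have h2 := hC j hj ξ t ht
        rw [hS] at h2
        rw [norm_mul, norm_mul, norm_pow, norm_pow, Complex.norm_real, Real.norm_of_nonneg hτ,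
          RCLike.norm_conj, ← pow_mul]
        calc tau ξ ^ (2 * (m - j)) * (‖solSym m G j ξ t‖ * ‖extSym m φ j ξ t‖)
            = (tau ξ ^ (m - j) * ‖solSym m G j ξ t‖) * (tau ξ ^ (m - j) * ‖extSym m φ j ξ t‖) := by
              rw [two_mul, pow_add]; ring
          _ ≤ _ := mul_le_mul h1 h2 (by positivity) (mul_nonneg (mul_nonneg (solBound_nonneg m)
              (arrSize_nonneg ξ)) (Real.exp_pos _).le)
    _ = _ := by
        rw [← Finset.mul_sum, ← Finset.sum_mul]
        ring

theorem IsRapid.mul_tau_pow_le {a : Hor n → ℂ} (h : IsRapid a) (d N : ℕ) :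
    ∃ C : ℝ, 0 ≤ C ∧ ∀ ξ, ‖a ξ‖ * tau ξ ^ d ≤ C * ((1 + ‖ξ‖) ^ N)⁻¹ := by
  obtain ⟨C, hC0, hC⟩ := h.bound (N + d)
  refine ⟨C * (2 * Real.pi) ^ d, by positivity, fun ξ => ?_⟩
  rw [← div_eq_mul_inv, le_div_iff₀ (by positivity)]
  have h1 : tau ξ ≤ 2 * Real.pi * (1 + ‖ξ‖) := by
    unfold tau
    exact mul_le_mul_of_nonneg_left (by linarith) (by positivity)
  have hτ := tau_nonneg ξ
  calc ‖a ξ‖ * tau ξ ^ d * (1 + ‖ξ‖) ^ N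
      ≤ ‖a ξ‖ * (2 * Real.pi * (1 + ‖ξ‖)) ^ d * (1 + ‖ξ‖) ^ N := by gcongr
    _ = ((1 + ‖ξ‖) ^ (N + d) * ‖a ξ‖) * (2 * Real.pi) ^ d := by rw [mul_pow, pow_add]; ring
    _ ≤ _ := mul_le_mul_of_nonneg_right (hC ξ) (by positivity)

theorem IsRapid.memLp {a : Hor n → ℂ} (h : IsRapid a) : MemLp a 2 := by
  obtain ⟨C, hC0, hC⟩ := h.mul_tau_pow_le 0 (n + 1)
  refine ((memLp_two_inv_one_add_norm_pow n).const_mul C).mono'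
    h.continuous.aestronglyMeasurable (Eventually.of_forall fun ξ => ?_)
  simpa using hC ξ

theorem IsRapid.horMono_mul {a : Hor n → ℂ} (h : IsRapid a) (β : Fin n → ℕ) :
    IsRapid fun ξ => horMono β ξ * a ξ where
  continuous := (continuous_horMono β).mul h.continuous
  bound N := by
    obtain ⟨C, hC0, hC⟩ := h.mul_tau_pow_le (∑ i, β i) N
    refine ⟨C, hC0, fun ξ => ?_⟩
    have h1 := hC ξ
    rw [← div_eq_mul_inv, le_div_iff₀ (by positivity), mul_comm] at h1
    refine le_trans (mul_le_mul_of_nonneg_left ?_ (by positivity)) h1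
    rw [norm_mul, mul_comm]
    exact mul_le_mul_of_nonneg_left (norm_horMono_le β ξ) (norm_nonneg _)

theorem memLp_sum_trHat {φ : Space n → ℂ} (hφ : IsTest φ) (d : ℕ → ℕ) :
    MemLp (fun ξ => ∑ k ∈ Finset.range m, ‖trHat φ k ξ‖ * tau ξ ^ d k) 2 := by
  refine memLp_finsetSum _ fun k _ => ?_
  obtain ⟨C, hC0, hC⟩ := (isRapid_trHat hφ k).mul_tau_pow_le (d k) (n + 1)
  have hτ : ∀ ξ : Hor n, 0 ≤ tau ξ := tau_nonneg
  refine ((memLp_two_inv_one_add_norm_pow n).const_mul C).mono' (Continuous.aestronglyMeasurable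
    ((isRapid_trHat hφ k).continuous.norm.mul (by fun_prop))) (Eventually.of_forall fun ξ => ?_)
  rw [Real.norm_of_nonneg (mul_nonneg (norm_nonneg _) (pow_nonneg (hτ ξ) _))]
  exact hC ξ

theorem integrable_energySym (hm : 1 ≤ m) (hGm : ∀ γ, Measurable (G γ))
    (hG : ∀ γ ∈ multiIdx n (m - 1), MemLp (G γ) 2) {φ : Space n → ℂ} (hφ : IsTest φ) :
    Integrable (fun p : Hor n × ℝ => energySym m G φ p.1 p.2)
      (volume.prod (volume.restrict (Ioi 0))) := by
  obtain ⟨C, hC0, hC⟩ := exists_energySym_bound hm φ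
  refine integrable_prod_of_norm_le_exp ?_
    (((memLp_arrSize hG).integrable_mul (memLp_sum_trHat hφ fun k => m - 1 - k)).const_mul C)
    (fun ξ => mul_nonneg hC0 (mul_nonneg (arrSize_nonneg ξ) (Finset.sum_nonneg fun k _ =>
      mul_nonneg (norm_nonneg _) (pow_nonneg (tau_nonneg ξ) _)))) (decayRate_pos m)
    (fun ξ t ht => hC G ξ t ht)
  refine Measurable.aestronglyMeasurable ?_
  unfold energySym
  refine Finset.measurable_fun_sum _ fun j _ => Measurable.mul (Continuous.measurable (by fun_prop))
    (Measurable.mul ?_ (continuous_extSym hφ j).measurable)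
  exact Complex.continuous_conj.measurable.comp (measurable_solSym hGm j)

/-- Conjugation changes the sign of each imaginary factor, so the multinomial theorem now produces
+τ² and not -τ². -/
theorem sum_specialCoeff_mul_horMono (ξ : Hor n) (F : ℕ → ℂ) :
    ∑ α ∈ multiIdx n m, specialCoeff n α α *
      (starRingEnd ℂ (horMono α.1 ξ) * horMono α.1 ξ * F α.2) =
      ∑ j ∈ Finset.range (m + 1), ((tau ξ : ℂ) ^ 2) ^ (m - j) * F j := by
  have h1 := sum_multinomial_mul (m := m)
    (fun i : Fin n => -((2 * Real.pi * ξ i : ℝ) * Complex.I) ^ 2) F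
  rw [Finset.sum_neg_distrib, sum_horMono_sq, neg_neg] at h1
  rw [← h1]
  refine Finset.sum_congr rfl fun α _ => ?_
  rw [specialCoeff_self, horMono, map_prod, ← Finset.prod_mul_distrib]
  congr 2
  refine Finset.prod_congr rfl fun i _ => ?_
  rw [map_pow, ← mul_pow, map_mul, Complex.conj_ofReal, Complex.conj_I]
  congr 1
  ring

theorem sum_integral_neuSol_extE (hm : 1 ≤ m) (hGm : ∀ γ, Measurable (G γ))
    (hG : ∀ γ ∈ multiIdx n (m - 1), MemLp (G γ) 2) {φ : Space n → ℂ} (hφ : IsTest φ) {t : ℝ}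
    (ht : 0 < t) :
    ∑ α ∈ multiIdx n m, ∫ x : Hor n, starRingEnd ℂ (applyCoeff m (specialCoeff n)
      (fun β => partialD β (neuSol m G) (x, t)) α) * partialD α (extE m φ) (x, t) =
      ∫ ξ, energySym m G φ ξ t := by
  have hR := rapidSymbol_extSym hm hφ
  have hreal : ∀ α, starRingEnd ℂ (specialCoeff n α α) = specialCoeff n α α := fun α => by
    rw [specialCoeff_self, Complex.conj_natCast]
  have h1 : ∀ α ∈ multiIdx n m, ∫ x : Hor n, starRingEnd ℂ (applyCoeff m (specialCoeff n)
      (fun β => partialD β (neuSol m G) (x, t)) α) * partialD α (extE m φ) (x, t) =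
      ∫ ξ, specialCoeff n α α * (starRingEnd ℂ (solDiff m G α ξ t) *
        RapidSymbol.diff (extSym m φ) α 0 ξ t) := by
    intro α hα
    have hα' : m ≤ α.len := (mem_multiIdx.1 hα).ge
    rw [integral_const_mul, ← integral_conj_fourierInv_mul (integrable_solDiff hGm hG α hα' ht)
      (memLp_solDiff hGm hG α hα' ht) ((hR.isRapid_diff α).integrable 0 t)
      ((hR.isRapid_diff α).memLp 0 t), ← integral_const_mul]
    congr 1
    funext x
    rw [applyCoeff_specialCoeff _ hα, ← specialCoeff_self, map_mul, hreal,
      partialD_neuSol hGm hG hα' (z := (x, t)) ht, extE_eq_symFn hφ, hR.partialD_symFn]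
    simp only [symFn]
    ring
  have hint : ∀ α ∈ multiIdx n m, Integrable fun ξ => specialCoeff n α α *
      (starRingEnd ℂ (solDiff m G α ξ t) * RapidSymbol.diff (extSym m φ) α 0 ξ t) := by
    intro α hα
    have hα' : m ≤ α.len := (mem_multiIdx.1 hα).ge
    exact (MemLp.integrable_mul (memLp_solDiff hGm hG α hα' ht).star
      ((hR.isRapid_diff α).memLp 0 t)).const_mul _
  rw [Finset.sum_congr rfl h1, ← integral_finsetSum _ hint]
  congr 1
  funext ξ
  rw [energySym, ← sum_specialCoeff_mul_horMono ξ fun j =>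
    starRingEnd ℂ (solSym m G j ξ t) * extSym m φ j ξ t]
  refine Finset.sum_congr rfl fun α _ => ?_
  simp only [solDiff, RapidSymbol.diff, zero_add, map_mul]
  ring

theorem hasDerivAt_bdryPair {U V : ℕ → ℝ → ℂ} (m : ℕ) (s : ℂ) (t : ℝ)
    (hU : ∀ j, HasDerivAt (U j) (U (j + 1) t) t) (hV : ∀ j, HasDerivAt (V j) (V (j + 1) t) t) :
    HasDerivAt (fun t => bdryPair m s (fun j => U j t) (fun j => V j t))
      ((∑ j ∈ Finset.range (m + 1), s ^ (m - j) * (U j t * V j t)) -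
        bdry m s (fun j => U j t) 0 * V 0 t) t := by
  rw [← bdryPair_deriv]
  unfold bdryPair
  refine HasDerivAt.fun_sum fun j _ => HasDerivAt.fun_mul ?_ (hV j)
  unfold bdry
  exact HasDerivAt.fun_sum fun i _ => by
    have := (hU (j + 1 + 2 * i)).const_mul ((-1) ^ i * s ^ (m - (j + 1) - i))
    rwa [show j + 1 + 2 * i + 1 = j + 1 + 2 * i + 1 from rfl] at this

theorem tendsto_of_norm_le_exp {f : ℝ → ℂ} {C c : ℝ} (hc : 0 < c)
    (h : ∀ t, 0 < t → ‖f t‖ ≤ C * Real.exp (-(c * t))) : Tendsto f atTop (𝓝 0) := by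
  have h1 : Tendsto (fun t : ℝ => C * Real.exp (-(c * t))) atTop (𝓝 (C * 0)) :=
    (Real.tendsto_exp_neg_atTop_nhds_zero.comp (tendsto_id.const_mul_atTop hc)).const_mul C
  rw [mul_zero] at h1
  refine squeeze_zero_norm' ?_ h1
  filter_upwards [eventually_gt_atTop 0] with t ht using h t ht

theorem exists_norm_extSym_le (hm : 1 ≤ m) (φ : Space n → ℂ) (j : ℕ) (ξ : Hor n) :
    ∃ C : ℝ, ∀ t, 0 < t → ‖extSym m φ j ξ t‖ ≤ C * (1 + t) ^ m := by
  obtain ⟨C, hC0, hC⟩ := exists_extSym_bound hm φ j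
  have hτ := tau_nonneg ξ
  refine ⟨C * ∑ k ∈ Finset.range m, ‖trHat φ k ξ‖ * tau ξ ^ (j - k), fun t ht => ?_⟩
  refine (hC ξ t).trans ?_
  rw [mul_assoc, Finset.sum_mul]
  refine mul_le_mul_of_nonneg_left (Finset.sum_le_sum fun k hk => ?_) hC0
  have hk' := Finset.mem_range.1 hk
  rw [abs_of_pos ht, mul_assoc ‖trHat φ k ξ‖ (tau ξ ^ (j - k))]
  refine mul_le_mul_of_nonneg_left ?_ (norm_nonneg (trHat φ k ξ))
  calc t ^ (k - j) * tau ξ ^ (j - k) * Real.exp (-(tau ξ * t))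
      ≤ (1 + t) ^ m * tau ξ ^ (j - k) * 1 := by
        have h1 : t ^ (k - j) ≤ (1 + t) ^ m :=
          (pow_le_pow_left₀ ht.le (by linarith) _).trans (pow_le_pow_right₀ (by linarith) (by omega))
        have h2 : Real.exp (-(tau ξ * t)) ≤ 1 := Real.exp_le_one_iff.2 (by
          have := mul_nonneg hτ ht.le; linarith)
        gcongr
    _ = _ := by ring

/-- For fixed ξ ≠ 0 the solution decays exponentially, while the extension grows at most like a
power of t; half of the decay rate absorbs that power. -/
theorem tendsto_solSym_mul_extSym (hm : 1 ≤ m) (φ : Space n → ℂ) (i j : ℕ) {ξ : Hor n}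
    (hξ : ξ ≠ 0) :
    Tendsto (fun t => starRingEnd ℂ (solSym m G i ξ t) * extSym m φ j ξ t) atTop (𝓝 0) := by
  have hτ := tau_pos hξ
  have hc := mul_pos (decayRate_pos m) hτ
  obtain ⟨C, hC⟩ := exists_norm_extSym_le hm φ j ξ
  obtain ⟨B, hB0, hB⟩ := exists_pow_mul_exp_le m (half_pos hc)
  refine tendsto_of_norm_le_exp (half_pos hc)
    (C := solBound m * arrSize m G ξ * tau ξ ^ i / tau ξ ^ m * (|C| * B)) fun t ht => ?_
  have h1 : ‖solSym m G i ξ t‖ ≤ solBound m * arrSize m G ξ * tau ξ ^ i / tau ξ ^ m *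
      Real.exp (-(decayRate m * tau ξ * t)) := by
    have h1 := norm_tau_pow_mul_solSym_le (G := G) m i i rfl ξ ht.le
    rw [div_mul_eq_mul_div, le_div_iff₀ (by positivity), mul_comm]
    refine h1.trans (le_of_eq ?_)
    rw [mul_assoc (decayRate m), mul_comm t, ← mul_assoc (decayRate m)]
    ring
  have hK : 0 ≤ solBound m * arrSize m G ξ * tau ξ ^ i / tau ξ ^ m :=
    div_nonneg (mul_nonneg (mul_nonneg (solBound_nonneg m) (arrSize_nonneg ξ)) (by positivity))
      (by positivity)
  have h2 : ‖extSym m φ j ξ t‖ ≤ |C| * (1 + t) ^ m :=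
    (hC t ht).trans (mul_le_mul_of_nonneg_right (le_abs_self C) (by positivity))
  have h3 : Real.exp (-(decayRate m * tau ξ * t)) =
      Real.exp (-(decayRate m * tau ξ / 2 * t)) * Real.exp (-(decayRate m * tau ξ / 2 * t)) := by
    rw [← Real.exp_add]; congr 1; ring
  rw [norm_mul, RCLike.norm_conj]
  calc ‖solSym m G i ξ t‖ * ‖extSym m φ j ξ t‖
      ≤ (solBound m * arrSize m G ξ * tau ξ ^ i / tau ξ ^ m *
          Real.exp (-(decayRate m * tau ξ * t))) * (|C| * (1 + t) ^ m) :=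
        mul_le_mul h1 h2 (norm_nonneg _) (mul_nonneg hK (Real.exp_pos _).le)
    _ = solBound m * arrSize m G ξ * tau ξ ^ i / tau ξ ^ m * (|C| * ((1 + t) ^ m *
          Real.exp (-(decayRate m * tau ξ / 2 * t)))) *
          Real.exp (-(decayRate m * tau ξ / 2 * t)) := by rw [h3]; ring
    _ ≤ _ := by
        refine mul_le_mul_of_nonneg_right (mul_le_mul_of_nonneg_left
          (mul_le_mul_of_nonneg_left (hB t ht.le) (abs_nonneg C)) hK) (Real.exp_pos _).le

theorem bdry_conj (m : ℕ) (s : ℝ) (u : ℕ → ℂ) (j : ℕ) :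
    bdry m ((s : ℂ) ^ 2) (fun k => starRingEnd ℂ (u k)) j =
      starRingEnd ℂ (bdry m ((s : ℂ) ^ 2) u j) := by
  simp [bdry, map_sum]

theorem bdry_solSym_zero (ξ : Hor n) (t : ℝ) :
    bdry m ((tau ξ : ℂ) ^ 2) (fun j => solSym m G j ξ t) 0 = 0 := by
  have : (fun j => solSym m G j ξ t) = fun j => ∑ l,
      (solCoef m G ξ l * Complex.exp (t * (root m l * tau ξ))) * (root m l * tau ξ) ^ j := by
    funext j
    exact Finset.sum_congr rfl fun l _ => by ring
  rw [this, bdry_sum]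
  exact Finset.sum_eq_zero fun l _ => by rw [bdry_root_zero, mul_zero]

/-- The energy density is the derivative of the boundary pairing, since the solution satisfies the
equation. The pairing vanishes at infinity, so the integral is minus its value at t = 0, and the
minus sign in `neuDatum` compensates. -/
theorem integral_energySym (hm : 1 ≤ m) {φ : Space n → ℂ} {ξ : Hor n} (hξ : ξ ≠ 0)
    (hint : IntegrableOn (fun t => energySym m G φ ξ t) (Ioi 0)) :
    ∫ t in Ioi 0, energySym m G φ ξ t =
      ∑ γ ∈ multiIdx n (m - 1), starRingEnd ℂ (G γ ξ) * (horMono γ.1 ξ * trHat φ γ.2 ξ) := by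
  set s : ℂ := (tau ξ : ℂ) ^ 2 with hs
  set U : ℕ → ℝ → ℂ := fun j t => starRingEnd ℂ (solSym m G j ξ t) with hU
  have hUd : ∀ j t, HasDerivAt (U j) (U (j + 1) t) t := fun j t => by
    exact (hasDerivAt_solSym (m := m) (G := G) j ξ t).star
  have hVd : ∀ j t, HasDerivAt (extSym m φ j ξ) (extSym m φ (j + 1) ξ t) t := fun j t => by
    unfold extSym
    exact HasDerivAt.fun_sum fun k _ =>
      HasDerivAt.const_mul _ (hasDerivAt_heatJet hm k j (tau ξ) t).ofReal_comp
  have hd : ∀ t, HasDerivAt (fun t => bdryPair m s (fun j => U j t) fun j => extSym m φ j ξ t)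
      (energySym m G φ ξ t) t := by
    intro t
    have h := hasDerivAt_bdryPair (V := fun j => extSym m φ j ξ) m s t (fun j => hUd j t)
      (fun j => hVd j t)
    have h0 : bdry m s (fun j => U j t) 0 = 0 := by
      rw [hs, hU, bdry_conj, bdry_solSym_zero, map_zero]
    rw [h0, zero_mul, sub_zero] at h
    exact h
  have hlim : Tendsto (fun t => bdryPair m s (fun j => U j t) fun j => extSym m φ j ξ t)
      atTop (𝓝 0) := by
    unfold bdryPair bdry
    rw [← Finset.sum_const_zero (s := Finset.range m)]
    refine tendsto_finsetSum _ fun j _ => ?_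
    simp only [Finset.sum_mul, mul_assoc]
    rw [← Finset.sum_const_zero (s := Finset.range (m + 1 - (j + 1)))]
    refine tendsto_finsetSum _ fun i _ => ?_
    have := ((tendsto_solSym_mul_extSym (G := G) hm φ (j + 1 + 2 * i) j hξ).const_mul
      (s ^ (m - (j + 1) - i))).const_mul ((-1) ^ i)
    simpa using this
  rw [integral_Ioi_of_hasDerivAt_of_tendsto (hd 0).continuousAt.continuousWithinAt
    (fun t _ => hd t) hint hlim, zero_sub, bdryPair]
  -- At t = 0 the boundary operators of the solution are the prescribed data, and the vertical
  -- derivatives of the extension are those of φ. Each j collects the data with γ.2 = j.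
  have hb : ∀ j ∈ Finset.range m, bdry m s (fun j => U j 0) (j + 1) * extSym m φ j ξ 0 =
      -∑ γ ∈ multiIdx n (m - 1) with γ.2 = j,
        starRingEnd ℂ (G γ ξ) * (horMono γ.1 ξ * trHat φ γ.2 ξ) := by
    intro j hj
    have hj' := Finset.mem_range.1 hj
    have h1 : (fun j => solSym m G j ξ 0) = fun j => ∑ l,
        neuCoef m (tau ξ) (fun k => neuDatum m G ξ k) l * (root m l * tau ξ) ^ j := by
      funext j
      simp [solSym, solCoef]
    have h2 := bdry_neuCoef (m := m) (τ := (tau ξ : ℂ)) (by exact_mod_cast (tau_pos hξ).ne')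
      (fun k => neuDatum m G ξ k) ⟨j, hj'⟩
    rw [hs, hU, bdry_conj, h1, h2, extSym_at_zero hm φ hj', neuDatum, map_neg, map_sum, neg_mul,
      Finset.sum_mul]
    congr 1
    refine Finset.sum_congr rfl fun γ hγ => ?_
    rw [(Finset.mem_filter.1 hγ).2, map_mul, Complex.conj_conj]
    ring
  rw [Finset.sum_congr rfl hb, Finset.sum_neg_distrib, neg_neg]
  refine Finset.sum_fiberwise_of_maps_to (fun γ hγ => Finset.mem_range.2 ?_) _
  have : (∑ i, γ.1 i) + γ.2 = m - 1 := mem_multiIdx.1 hγ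
  omega

end Solution

/-! ### The existence statement -/

theorem measurable_fourierL2 {n : ℕ} (g : Hor n → ℂ) : Measurable (fourierL2 g) := by
  unfold fourierL2
  split_ifs
  · exact (Lp.stronglyMeasurable _).measurable
  · exact measurable_const

/-- Plancherel, Fubini, the one-dimensional Green formula at almost every frequency, and Plancherel
back. -/
theorem hasNeumannData_neuSol {n m : ℕ} (hn : 1 ≤ n) (hm : 1 ≤ m) {g : MIdx n → Hor n → ℂ}
    (hg : ∀ γ ∈ multiIdx n (m - 1), MemLp (g γ) 2) :
    HasNeumannData m (specialCoeff n)
      (fun α => partialD α (neuSol m fun γ => fourierL2 (g γ))) g := by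
  set G : MIdx n → Hor n → ℂ := fun γ => fourierL2 (g γ)
  have hGm : ∀ γ, Measurable (G γ) := fun γ => measurable_fourierL2 _
  have hG : ∀ γ ∈ multiIdx n (m - 1), MemLp (G γ) 2 := fun γ hγ => memLp_fourierL2 (hg γ hγ)
  refine hasNeumannData_of_integrableOn fun φ hφ => ?_
  have hI := integrable_energySym hm hGm hG hφ
  refine ⟨fun t => ∫ ξ, energySym m G φ ξ t, hI.integral_prod_right, fun t ht =>
    sum_integral_neuSol_extE hm hGm hG hφ ht, ?_⟩
  rw [← integral_integral_swap (f := fun ξ t => energySym m G φ ξ t) hI]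
  -- The frequency 0 has measure zero because n ≥ 1; Green's formula is not available there.
  have : Nontrivial (Hor n) := by
    have : Nonempty (Fin n) := ⟨⟨0, hn⟩⟩
    infer_instance
  have h0 : ∀ᵐ ξ : Hor n, ξ ≠ 0 := by
    rw [ae_iff]
    simp
  have h1 : ∀ᵐ ξ : Hor n, ∫ t in Ioi 0, energySym m G φ ξ t =
      ∑ γ ∈ multiIdx n (m - 1), starRingEnd ℂ (G γ ξ) * (horMono γ.1 ξ * trHat φ γ.2 ξ) := by
    filter_upwards [h0, hI.prod_right_ae] with ξ hξ hξ2 using integral_energySym hm hξ hξ2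
  have hr : ∀ γ : MIdx n, IsRapid fun ξ => horMono γ.1 ξ * trHat φ γ.2 ξ := fun γ =>
    (isRapid_trHat hφ γ.2).horMono_mul γ.1
  have hint : ∀ γ ∈ multiIdx n (m - 1), Integrable fun ξ =>
      starRingEnd ℂ (G γ ξ) * (horMono γ.1 ξ * trHat φ γ.2 ξ) := fun γ hγ =>
    (hG γ hγ).star.integrable_mul (hr γ).memLp
  rw [integral_congr_ae h1, integral_finsetSum _ hint]
  refine Finset.sum_congr rfl fun γ hγ => ?_
  simp only [partialD_trace hφ]
  exact (integral_conj_mul_fourierInv (hg γ hγ) (hr γ).integrable (hr γ).memLp).symm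

theorem exists_isNeumannSol {n m : ℕ} (hn : 1 ≤ n) (hm : 1 ≤ m) :
    ∃ C : ℝ, ∀ g : MIdx n → Hor n → ℂ, (∀ γ ∈ multiIdx n (m - 1), MemLp (g γ) 2 volume) →
      ∃ w : Space n → ℂ, ContDiffOn ℝ ∞ w (halfSpace n) ∧
      IsNeumannSol m (specialCoeff n) g w (fun α => partialD α w) ∧
      squareFn m (fun α => partialD α w) + supSlice m (fun α => partialD α w) ≤
        ENNReal.ofReal C * arrNormSq (m - 1) g := by
  set A : ℝ := (multiIdx n m).card * solBound m ^ 2 with hAdef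
  have hA : 0 ≤ A := by positivity
  set N : ℝ := ((multiIdx n (m - 1)).card : ℝ) with hN
  refine ⟨(A * (1 / decayRate m ^ 2) + A) * N, fun g hg => ?_⟩
  set G : MIdx n → Hor n → ℂ := fun γ => fourierL2 (g γ)
  have hGm : ∀ γ, Measurable (G γ) := fun γ => measurable_fourierL2 _
  have hG : ∀ γ ∈ multiIdx n (m - 1), MemLp (G γ) 2 := fun γ hγ => memLp_fourierL2 (hg γ hγ)
  have hw := contDiffOn_neuSol hGm hG
  have hsq := squareFn_neuSol_le hGm hG
  have hsup := supSlice_neuSol_le hGm hG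
  have hS : ∫⁻ ξ, ENNReal.ofReal (arrSize m G ξ ^ 2) ≤ ENNReal.ofReal N * arrNormSq (m - 1) g := by
    refine (lintegral_arrSize_sq_le m hGm).trans (le_of_eq ?_)
    rw [ENNReal.ofReal_natCast, arrNormSq, lintegral_finsetSum' _ fun γ hγ =>
      ((hg γ hγ).1.enorm.pow_const _)]
    congr 1
    exact Finset.sum_congr rfl fun γ hγ => lintegral_enorm_sq_fourierL2 (hg γ hγ)
  have hfin : ∫⁻ ξ, ENNReal.ofReal (arrSize m G ξ ^ 2) < ⊤ := by
    refine hS.trans_lt (ENNReal.mul_lt_top ENNReal.ofReal_lt_top ?_)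
    rw [arrNormSq, lintegral_finsetSum' _ fun γ hγ => ((hg γ hγ).1.enorm.pow_const _)]
    refine ENNReal.sum_lt_top.2 fun γ hγ => ?_
    rw [← eLpNorm_two_sq]
    exact ENNReal.pow_lt_top (hg γ hγ).2
  refine ⟨neuSol m G, hw, ⟨?_, fun α _ => isWeakDeriv_partialD hw α,
    fun α _ => isWeakDeriv_partialD hw _, ?_, ?_, fun φ hφ => equation_neuSol hGm hG hφ,
    hasNeumannData_neuSol hn hm hg⟩, ?_⟩
  · exact hw.continuousOn.locallyIntegrableOn (isOpen_halfSpace n).measurableSet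
  · exact hsq.trans_lt (ENNReal.mul_lt_top ENNReal.ofReal_lt_top hfin)
  · exact hsup.trans_lt (ENNReal.mul_lt_top ENNReal.ofReal_lt_top hfin)
  · refine (add_le_add hsq hsup).trans ?_
    rw [← add_mul, ← ENNReal.ofReal_add (by positivity) hA, 
      ENNReal.ofReal_mul (q := N) (by positivity), mul_assoc (ENNReal.ofReal _)]
    exact mul_le_mul_right hS _

end

section


/-! ### Pairing with arrays that are bounded on slices -/

theorem restrict_halfSpace (n : ℕ) : (volume : Measure (Space n)).restrict (halfSpace n) =
    (volume : Measure (Hor n)).prod (volume.restrict (Ioi (0 : ℝ))) := by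
  have h : halfSpace n = univ ×ˢ Ioi (0 : ℝ) := by
    ext z; simp [halfSpace]
  rw [h, Measure.volume_eq_prod, ← Measure.prod_restrict, Measure.restrict_univ]

theorem integrable_one_add_abs_rpow : Integrable fun t : ℝ => (1 + ‖t‖) ^ (-(3 / 2) : ℝ) :=
  integrable_one_add_norm (by simp; norm_num)

/-- The array is only bounded on slices, so the other factor must have slice norms integrable in t;
square norms of order (1+t)^(-3) are enough. -/
theorem integrableOn_mul_of_slice {n : ℕ} {d F : Space n → ℂ}
    (hd : AEStronglyMeasurable d (volume.restrict (halfSpace n)))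
    (hF : AEStronglyMeasurable F (volume.restrict (halfSpace n)))
    (hFs : ∀ t, Measurable fun x : Hor n => F (x, t)) {M C : ℝ}
    (hM : ∀ t, 0 < t → ∫⁻ x : Hor n, ‖d (x, t)‖ₑ ^ 2 ≤ ENNReal.ofReal M)
    (hC : ∀ t, 0 < t → ∫⁻ x : Hor n, ‖F (x, t)‖ₑ ^ 2 ≤ ENNReal.ofReal (C * ((1 + t) ^ 3)⁻¹)) :
    IntegrableOn (fun z => d z * F z) (halfSpace n) := by
  have hmul : AEStronglyMeasurable (fun z => d z * F z) (volume.restrict (halfSpace n)) :=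
    hd.mul hF
  refine ⟨hmul, ?_⟩
  rw [restrict_halfSpace] at hmul ⊢
  rw [hasFiniteIntegral_iff_enorm, lintegral_prod_symm _ hmul.enorm]
  have key : ∀ t ∈ Ioi (0 : ℝ), ∫⁻ x : Hor n, ‖d (x, t) * F (x, t)‖ₑ ≤
      ENNReal.ofReal ((1 + ‖t‖) ^ (-(3 / 2) : ℝ)) * (ENNReal.ofReal M + ENNReal.ofReal C) := by
    intro t ht
    have ht' : 0 < t := ht
    rw [Real.norm_of_nonneg ht'.le]
    -- Weighted Young inequality: with r = (1+t)^(-3/2) both r‖d‖² and ‖F‖²/r are of order r on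
    -- slices, and r is integrable.
    set r : ℝ := (1 + t) ^ (-(3 / 2) : ℝ) with hr
    have hr0 : 0 < r := Real.rpow_pos_of_pos (by linarith) _
    have hr2 : ((1 + t) ^ 3)⁻¹ = r * r := by
      rw [hr, ← Real.rpow_add (by linarith), ← Real.rpow_natCast, ← Real.rpow_neg (by linarith)]
      norm_num
    have h1 : ∀ x : Hor n, ‖d (x, t) * F (x, t)‖ₑ ≤
        ENNReal.ofReal r * ‖d (x, t)‖ₑ ^ 2 + ENNReal.ofReal r⁻¹ * ‖F (x, t)‖ₑ ^ 2 := by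
      intro x
      rw [enorm_sq_eq_ofReal, enorm_sq_eq_ofReal, ← ENNReal.ofReal_mul hr0.le,
        ← ENNReal.ofReal_mul (inv_pos.2 hr0).le, ← ENNReal.ofReal_add (by positivity)
        (by positivity), ← ofReal_norm, norm_mul]
      refine ENNReal.ofReal_le_ofReal ?_
      have h2 : 0 ≤ r⁻¹ * (r * ‖d (x, t)‖ - ‖F (x, t)‖) ^ 2 := by positivity
      have h3 : r⁻¹ * (r * ‖d (x, t)‖ - ‖F (x, t)‖) ^ 2 =
          r * ‖d (x, t)‖ ^ 2 + r⁻¹ * ‖F (x, t)‖ ^ 2 - 2 * (‖d (x, t)‖ * ‖F (x, t)‖) := by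
        field_simp
        ring
      have h4 : 0 ≤ ‖d (x, t)‖ * ‖F (x, t)‖ := by positivity
      linarith
    refine (lintegral_mono h1).trans ?_
    rw [lintegral_add_right _ (((hFs t).enorm.pow_const _).const_mul _),
      lintegral_const_mul' _ _ ENNReal.ofReal_ne_top, lintegral_const_mul' _ _
      ENNReal.ofReal_ne_top, mul_add]
    refine add_le_add (mul_le_mul_right (hM t ht') _)
      ((mul_le_mul_right (hC t ht') _).trans (le_of_eq ?_))
    rw [hr2, ← ENNReal.ofReal_mul (inv_pos.2 hr0).le, ← ENNReal.ofReal_mul hr0.le]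
    congr 1
    field_simp
  refine (setLIntegral_mono' measurableSet_Ioi key).trans_lt ?_
  rw [lintegral_mul_const' _ _ (ENNReal.add_ne_top.2
    ⟨ENNReal.ofReal_ne_top, ENNReal.ofReal_ne_top⟩)]
  exact ENNReal.mul_lt_top integrable_one_add_abs_rpow.integrableOn.lintegral_lt_top
    (ENNReal.add_lt_top.2 ⟨ENNReal.ofReal_lt_top, ENNReal.ofReal_lt_top⟩)

/-- The functions whose derivative `∂^γ`, multiplied with `wt(t)`, decays on slices. -/
def SliceDecay {n : ℕ} (wt : ℝ → ℝ) (F : Space n → ℂ) : Prop :=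
  ∃ C : ℝ, ∀ t, 0 < t →
    ∫⁻ x : Hor n, ‖(wt t : ℂ) * F (x, t)‖ₑ ^ 2 ≤ ENNReal.ofReal (C * ((1 + t) ^ 3)⁻¹)

/-- Dominated convergence after the Leibniz rule. The terms in which the cut-off is differentiated
tend to zero pointwise, and the weights `wt`, uniform in N, must be compensated by decay or
vanishing of the derivatives of Φ. -/
theorem tendsto_integral_cutoff {n : ℕ} {d Φ : Space n → ℂ}
    (hd : AEStronglyMeasurable d (volume.restrict (halfSpace n))) {M : ℝ}
    (hM : ∀ t, 0 < t → ∫⁻ x : Hor n, ‖d (x, t)‖ₑ ^ 2 ≤ ENNReal.ofReal M) (α : MIdx n)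
    (hΦ : ContDiff ℝ ∞ Φ) {κ : ℕ → Space n → ℂ} (hκ : ∀ N, ContDiff ℝ ∞ (κ N))
    (hκ1 : ∀ z ∈ halfSpace n, ∀ᶠ N in atTop, κ N =ᶠ[𝓝 z] fun _ => 1)
    (hb : ∀ β γ : MIdx n, β + γ = α → ∃ wt : ℝ → ℝ, Measurable wt ∧
      (∀ N z, 0 < z.2 → ‖partialD β (κ N) z‖ ≤ wt z.2) ∧ SliceDecay wt (partialD γ Φ)) :
    IntegrableOn (fun z => d z * partialD α Φ z) (halfSpace n) ∧
    Tendsto (fun N => ∫ z in halfSpace n, d z * partialD α (fun y => κ N y * Φ y) z) atTop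
      (𝓝 (∫ z in halfSpace n, d z * partialD α Φ z)) := by
  obtain ⟨ι, _, β, γ, hβγ, hL⟩ := exists_leibniz α
  choose wt hwtm hwt C hC using fun i => hb (β i) (γ i) (hβγ i)
  have hcont : ∀ i, Continuous (partialD (γ i) Φ) := fun i => (contDiff_partialD _ hΦ).continuous
  have hint : ∀ i, IntegrableOn (fun z => d z * ((wt i z.2 : ℂ) * partialD (γ i) Φ z))
      (halfSpace n) := fun i =>
    integrableOn_mul_of_slice hd
      ((Complex.measurable_ofReal.comp ((hwtm i).comp measurable_snd)).mul
        (hcont i).measurable).aestronglyMeasurable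
      (fun t => ((hcont i).comp (by fun_prop : Continuous fun x : Hor n => (x, t))).measurable.const_mul
        (wt i t : ℂ)) hM (hC i)
  have hbd : ∀ N, ∀ z ∈ halfSpace n, ‖d z * partialD α (fun y => κ N y * Φ y) z‖ ≤
      ∑ i, ‖d z * ((wt i z.2 : ℂ) * partialD (γ i) Φ z)‖ := by
    intro N z hz
    rw [hL _ _ (hκ N) hΦ, Finset.mul_sum]
    refine (norm_sum_le _ _).trans (Finset.sum_le_sum fun i _ => ?_)
    rw [norm_mul, norm_mul, norm_mul, norm_mul, Complex.norm_real]
    exact mul_le_mul_of_nonneg_left (mul_le_mul_of_nonneg_right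
      ((hwt i N z hz).trans (le_abs_self _)) (norm_nonneg _)) (norm_nonneg _)
  have hev : ∀ z ∈ halfSpace n, ∀ᶠ N in atTop,
      d z * partialD α (fun y => κ N y * Φ y) z = d z * partialD α Φ z := by
    intro z hz
    filter_upwards [hκ1 z hz] with N hN
    have : (fun y => κ N y * Φ y) =ᶠ[𝓝 z] Φ := by
      filter_upwards [hN] with y hy
      rw [hy, one_mul]
    rw [(eventuallyEq_partialD α this).eq_of_nhds]
  have hmeas : ∀ Ψ : Space n → ℂ, ContDiff ℝ ∞ Ψ → AEStronglyMeasurable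
      (fun z => d z * partialD α Ψ z) (volume.restrict (halfSpace n)) := fun Ψ hΨ =>
    hd.mul (contDiff_partialD α hΨ).continuous.aestronglyMeasurable
  have hmem : ∀ᵐ z ∂(volume.restrict (halfSpace n)), z ∈ halfSpace n :=
    ae_restrict_mem (isOpen_halfSpace n).measurableSet
  have hsum : Integrable (fun z => ∑ i, ‖d z * ((wt i z.2 : ℂ) * partialD (γ i) Φ z)‖)
      (volume.restrict (halfSpace n)) := integrable_finsetSum _ fun i _ => (hint i).norm
  constructor
  · refine hsum.mono' (hmeas Φ hΦ) ?_
    filter_upwards [hmem] with z hz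
    obtain ⟨N, hN⟩ := (hev z hz).exists
    rw [← hN]
    exact hbd N z hz
  · refine tendsto_integral_of_dominated_convergence _
      (fun N => hmeas _ ((hκ N).mul hΦ)) hsum (fun N => ?_) ?_
    · filter_upwards [hmem] with z hz using hbd N z hz
    · filter_upwards [hmem] with z hz
      exact tendsto_const_nhds.congr' ((hev z hz).mono fun N hN => hN.symm)

/-! ### Cut-off functions -/

theorem partialD_comp_smul {n : ℕ} {f : Space n → ℂ} (hf : ContDiff ℝ ∞ f) (s : ℝ) (β : MIdx n) :
    partialD β (fun z => f (s • z)) = fun z => (s : ℂ) ^ β.len * partialD β f (s • z) := by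
  have hs : ContDiff ℝ ∞ fun z : Space n => s • z := contDiff_const_smul s
  induction β using MIdx.induction_unit with
  | h0 => simp [partialD_zero, MIdx.len]
  | hs β o ih =>
    have hd : ContDiff ℝ ∞ (partialD β f) := contDiff_partialD β hf
    have hfs : ContDiff ℝ ∞ fun z : Space n => f (s • z) := hf.comp hs
    have hds : ContDiff ℝ ∞ fun z : Space n => partialD β f (s • z) := hd.comp hs
    rw [partialD_add_unitIdx _ _ hfs, ih, dDir_const_mul o _ (hds.differentiable (by simp)),
      partialD_add_unitIdx _ _ hf]
    funext z
    have h1 : HasFDerivAt (fun z : Space n => partialD β f (s • z)) _ z :=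
      (hd.differentiable (by simp) (s • z)).hasFDerivAt.comp z
        (s • ContinuousLinearMap.id ℝ (Space n)).hasFDerivAt
    rw [h1.dDir_eq o, dDir_eq_fderiv o (hd.differentiable (by simp) (s • z)), MIdx.len_add,
      MIdx.len_unitIdx]
    simp
    ring

theorem partialD_comp_snd {n : ℕ} {u : ℕ → ℝ → ℂ} (hu : ∀ j t, HasDerivAt (u j) (u (j + 1) t) t)
    (β : MIdx n) : partialD β (fun z : Space n => u 0 z.2) =
      fun z => 0 ^ (∑ i, β.1 i) * u β.2 z.2 := by
  have hsm : ∀ j, ContDiff ℝ ∞ fun z : Space n => u j z.2 := fun j =>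
    (contDiff_of_hasDerivAt_succ hu j).comp contDiff_snd
  induction β using MIdx.induction_unit with
  | h0 => simp [partialD_zero]
  | hs β o ih =>
    rw [partialD_add_unitIdx _ _ (hsm 0), ih,
      dDir_const_mul o _ ((hsm _).differentiable (by simp))]
    funext z
    have h1 : HasFDerivAt (fun z : Space n => u β.2 z.2) _ z :=
      (hu β.2 z.2).hasFDerivAt.comp z hasFDerivAt_snd
    rw [h1.dDir_eq o]
    cases o with
    | none => simp [unitIdx, dirVec]
    | some i => simp [unitIdx, dirVec, Finset.sum_add_distrib]

/-- The derivatives of a smooth step from `0` to `1` in `[1, 2]`. -/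
def stepJet (j : ℕ) : ℝ → ℂ := iteratedDeriv j fun t : ℝ => ((t - 1).smoothTransition : ℂ)

theorem contDiff_step : ContDiff ℝ ∞ fun t : ℝ => ((t - 1).smoothTransition : ℂ) :=
  Complex.ofRealCLM.contDiff.comp
    (Real.smoothTransition.contDiff.comp (contDiff_id.sub contDiff_const))

theorem hasDerivAt_stepJet (j : ℕ) (t : ℝ) : HasDerivAt (stepJet j) (stepJet (j + 1) t) t := by
  have h := (contDiff_step.differentiable_iteratedDeriv j (by exact_mod_cast WithTop.coe_lt_top _)) t
  unfold stepJet
  rw [iteratedDeriv_succ]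
  exact h.hasDerivAt

theorem stepJet_zero (t : ℝ) : stepJet 0 t = ((t - 1).smoothTransition : ℂ) := by
  simp [stepJet]

/-- The scale-invariant form of the bound: applied at (N+1)t it gives t^(-j) for the j-th derivative
of the rescaled step, uniformly in N. -/
theorem exists_stepJet_bound (j : ℕ) : ∃ C : ℝ, 0 ≤ C ∧ ∀ t, |t| ^ j * ‖stepJet j t‖ ≤ C := by
  rcases Nat.eq_zero_or_pos j with rfl | hj
  · refine ⟨1, zero_le_one, fun t => ?_⟩
    rw [pow_zero, one_mul, stepJet_zero, Complex.norm_real,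
      Real.norm_of_nonneg (Real.smoothTransition.nonneg _)]
    exact Real.smoothTransition.le_one _
  · have hc : Continuous (stepJet j) :=
      continuous_iff_continuousAt.2 fun t => (hasDerivAt_stepJet j t).continuousAt
    have hz : ∀ t, t ∉ Icc (1 : ℝ) 2 → stepJet j t = 0 := by
      intro t ht
      rw [mem_Icc, not_and_or, not_le, not_le] at ht
      have hconst : ∃ c : ℂ, (fun t : ℝ => ((t - 1).smoothTransition : ℂ)) =ᶠ[𝓝 t] fun _ => c := by
        rcases ht with ht | ht
        · refine ⟨0, ?_⟩
          filter_upwards [Iio_mem_nhds ht] with s hs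
          rw [Real.smoothTransition.zero_of_nonpos (by linarith [show s < 1 from hs])]
          simp
        · refine ⟨1, ?_⟩
          filter_upwards [Ioi_mem_nhds ht] with s hs
          rw [Real.smoothTransition.one_of_one_le (by linarith [show 2 < s from hs])]
          simp
      obtain ⟨c, hc⟩ := hconst
      rw [stepJet, hc.iteratedDeriv_eq, iteratedDeriv_const, if_neg hj.ne']
    obtain ⟨C, hC⟩ := isCompact_Icc.exists_bound_of_continuousOn (s := Icc (1 : ℝ) 2)
      hc.continuousOn
    refine ⟨2 ^ j * |C|, by positivity, fun t => ?_⟩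
    by_cases ht : t ∈ Icc (1 : ℝ) 2
    · have h1 : |t| ≤ 2 := by rw [abs_of_nonneg (by linarith [ht.1])]; exact ht.2
      exact mul_le_mul (pow_le_pow_left₀ (abs_nonneg t) h1 j) ((hC t ht).trans (le_abs_self C))
        (norm_nonneg _) (by positivity)
    · rw [hz t ht, norm_zero, mul_zero]
      positivity

/-- A smooth bump function on `ℝⁿ⁺¹`. -/
def spaceBump (n : ℕ) : ContDiffBump (0 : Space n) := ⟨1, 2, one_pos, one_lt_two⟩

/-- Cut-off functions that increase to `1`. -/
def cutFar (n N : ℕ) (z : Space n) : ℂ := (spaceBump n (((N : ℝ) + 1)⁻¹ • z) : ℝ)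

/-- Cut-off functions with support in the half-space that increase to `1`. -/
def cutNear (n N : ℕ) (z : Space n) : ℂ := stepJet 0 (((N : ℝ) + 1) * z.2) * cutFar n N z

theorem contDiff_spaceBump (n : ℕ) : ContDiff ℝ ∞ fun z => ((spaceBump n z : ℝ) : ℂ) :=
  Complex.ofRealCLM.contDiff.comp (spaceBump n).contDiff

theorem contDiff_cutFar (n N : ℕ) : ContDiff ℝ ∞ (cutFar n N) :=
  (contDiff_spaceBump n).comp (contDiff_const_smul _)

theorem contDiff_stepJet (j : ℕ) : ContDiff ℝ ∞ (stepJet j) :=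
  contDiff_of_hasDerivAt_succ hasDerivAt_stepJet j

theorem contDiff_cutNear (n N : ℕ) : ContDiff ℝ ∞ (cutNear n N) :=
  ((contDiff_stepJet 0).comp (contDiff_const.mul contDiff_snd)).mul (contDiff_cutFar n N)

theorem cutFar_eventually (n : ℕ) (z : Space n) : ∀ᶠ N in atTop, cutFar n N =ᶠ[𝓝 z] fun _ => 1 := by
  filter_upwards [(tendsto_natCast_atTop_atTop (R := ℝ)).eventually_gt_atTop ‖z‖] with N hN
  have : {y : Space n | ‖y‖ < (N : ℝ) + 1} ∈ 𝓝 z :=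
    (isOpen_lt continuous_norm continuous_const).mem_nhds (by
      simp only [mem_ofPred_eq]; linarith)
  filter_upwards [this] with y hy
  rw [cutFar, (spaceBump n).one_of_mem_closedBall]
  · simp
  · rw [mem_closedBall_zero_iff, norm_smul, norm_inv, Real.norm_of_nonneg (by positivity)]
    show ((N : ℝ) + 1)⁻¹ * ‖y‖ ≤ 1
    rw [inv_mul_le_one₀ (by positivity)]
    exact le_of_lt hy

theorem cutNear_eventually (n : ℕ) {z : Space n} (hz : z ∈ halfSpace n) :
    ∀ᶠ N in atTop, cutNear n N =ᶠ[𝓝 z] fun _ => 1 := by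
  have hz' : 0 < z.2 := hz
  filter_upwards [cutFar_eventually n z,
    (tendsto_natCast_atTop_atTop (R := ℝ)).eventually_gt_atTop (2 / (z.2 / 2))] with N h1 h2
  filter_upwards [h1, (isOpen_lt continuous_const continuous_snd).mem_nhds
    (show z.2 / 2 < z.2 by linarith)] with y hy1 hy2
  have hy2' : z.2 / 2 < y.2 := hy2
  rw [cutNear, hy1, mul_one, stepJet_zero, Real.smoothTransition.one_of_one_le]
  · simp
  · rw [div_lt_iff₀ (by linarith)] at h2
    have : (N : ℝ) * (z.2 / 2) ≤ ((N : ℝ) + 1) * y.2 :=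
      mul_le_mul (by linarith) hy2'.le (by linarith) (by positivity)
    linarith

/-- Each derivative gains 1/(N+1). On the support of the cut-off t ≤ 2(N+1), so this is at most a
constant times 1/(1+t), uniformly in N. -/
theorem exists_cutFar_bound (n : ℕ) (β : MIdx n) : ∃ C : ℝ, 0 ≤ C ∧ ∀ N z, 0 < z.2 →
    ‖partialD β (cutFar n N) z‖ ≤ C * ((1 + z.2) ^ β.len)⁻¹ := by
  have hf := contDiff_spaceBump n
  have hcs : HasCompactSupport (partialD β fun z => ((spaceBump n z : ℝ) : ℂ)) :=
    ((spaceBump n).hasCompactSupport.comp_left (g := ((↑) : ℝ → ℂ)) rfl).mono'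
      ((subset_tsupport _).trans (support_partialD_subset β _))
  obtain ⟨K, hK⟩ := hcs.exists_bound_of_continuous (contDiff_partialD β hf).continuous
  refine ⟨|K| * 3 ^ β.len, by positivity, fun N z hz => ?_⟩
  have hN : (0 : ℝ) < (N : ℝ) + 1 := by positivity
  have h1 : partialD β (cutFar n N) z = (((N : ℝ) + 1)⁻¹ : ℝ) ^ β.len *
      partialD β (fun z => ((spaceBump n z : ℝ) : ℂ)) (((N : ℝ) + 1)⁻¹ • z) :=
    congrFun (partialD_comp_smul hf ((N : ℝ) + 1)⁻¹ β) z
  rw [h1, norm_mul, norm_pow, Complex.norm_real, Real.norm_of_nonneg (by positivity)]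
  by_cases hzs : (((N : ℝ) + 1)⁻¹ • z) ∈ tsupport fun z => ((spaceBump n z : ℝ) : ℂ)
  · have h2 : ‖z‖ ≤ 2 * ((N : ℝ) + 1) := by
      have h3 : (((N : ℝ) + 1)⁻¹ • z) ∈ tsupport (spaceBump n) :=
        closure_mono (fun y hy => by
          simp only [Function.mem_support, ne_eq, Complex.ofReal_eq_zero] at hy ⊢
          exact hy) hzs
      rw [(spaceBump n).tsupport_eq, mem_closedBall_zero_iff, norm_smul, norm_inv,
        Real.norm_of_nonneg hN.le, inv_mul_le_iff₀ hN, mul_comm] at h3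
      exact h3
    have h4 : z.2 ≤ 2 * ((N : ℝ) + 1) := (le_abs_self _).trans ((norm_snd_le z).trans h2)
    have h5 : ((N : ℝ) + 1)⁻¹ ≤ 3 * (1 + z.2)⁻¹ := by
      rw [← div_eq_mul_inv, inv_eq_one_div, div_le_div_iff₀ hN (by linarith)]
      have : (0 : ℝ) ≤ N := by positivity
      linarith
    calc ((N : ℝ) + 1)⁻¹ ^ β.len * ‖_‖ ≤ (3 * (1 + z.2)⁻¹) ^ β.len * |K| :=
          mul_le_mul (pow_le_pow_left₀ (by positivity) h5 _) ((hK _).trans (le_abs_self K))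
            (norm_nonneg _) (by positivity)
      _ = _ := by rw [mul_pow, inv_pow]; ring
  · rw [image_eq_zero_of_notMem_tsupport fun h => hzs (support_partialD_subset β _ h), norm_zero,
      mul_zero]
    positivity

theorem partialD_step_smul (n N : ℕ) (β : MIdx n) :
    partialD β (fun z : Space n => stepJet 0 (((N : ℝ) + 1) * z.2)) = fun z =>
      (((N : ℝ) + 1 : ℝ) : ℂ) ^ β.len * (0 ^ (∑ i, β.1 i) * stepJet β.2 (((N : ℝ) + 1) * z.2)) := by
  have hf : ContDiff ℝ ∞ fun z : Space n => stepJet 0 z.2 := (contDiff_stepJet 0).comp contDiff_snd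
  have h := partialD_comp_smul hf ((N : ℝ) + 1) β
  rw [partialD_comp_snd hasDerivAt_stepJet] at h
  exact h

/-- Horizontal derivatives can fall only on the far cut-off and so gain 1/(1+t); vertical ones may
fall on the step near the boundary and cost 1/t. -/
theorem exists_cutNear_bound (n : ℕ) (β : MIdx n) : ∃ C : ℝ, 0 ≤ C ∧ ∀ N z, 0 < z.2 →
    ‖partialD β (cutNear n N) z‖ ≤
      C * ((z.2 ^ β.2)⁻¹ * ((1 + z.2) ^ ∑ i, β.1 i)⁻¹) := by
  obtain ⟨ι, _, b, c, hbc, hL⟩ := exists_leibniz β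
  choose C hC0 hC using fun i => exists_cutFar_bound n (c i)
  choose B hB0 hB using fun i => exists_stepJet_bound (b i).2
  refine ⟨∑ i, B i * C i, Finset.sum_nonneg fun i _ => mul_nonneg (hB0 i) (hC0 i),
    fun N z hz => ?_⟩
  have hN : (0 : ℝ) < (N : ℝ) + 1 := by positivity
  have hs : ContDiff ℝ ∞ fun z : Space n => stepJet 0 (((N : ℝ) + 1) * z.2) :=
    (contDiff_stepJet 0).comp (contDiff_const.mul contDiff_snd)
  have h0 : partialD β (cutNear n N) z = _ := congrFun (hL _ _ hs (contDiff_cutFar n N)) z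
  rw [h0, Finset.sum_mul]
  refine (norm_sum_le _ _).trans (Finset.sum_le_sum fun i _ => ?_)
  rw [norm_mul, partialD_step_smul]
  -- The step depends on t alone; the conditional factor records that every horizontal derivative of
  -- it vanishes.
  have h1 : ‖(((N : ℝ) + 1 : ℝ) : ℂ) ^ (b i).len *
      (0 ^ (∑ k, (b i).1 k) * stepJet (b i).2 (((N : ℝ) + 1) * z.2))‖ ≤
      B i * (z.2 ^ (b i).2)⁻¹ * (if ∑ k, (b i).1 k = 0 then 1 else 0) := by
    split_ifs with h
    · have h2 := hB i (((N : ℝ) + 1) * z.2)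
      rw [abs_of_pos (by positivity), mul_pow] at h2
      rw [MIdx.len, h, zero_add, pow_zero, one_mul, norm_mul, norm_pow, Complex.norm_real,
        Real.norm_of_nonneg hN.le, mul_one, ← div_eq_mul_inv, le_div_iff₀ (by positivity)]
      linarith
    · rw [zero_pow h, zero_mul, mul_zero, norm_zero, mul_zero]
  have hlen : (b i).2 + (c i).2 = β.2 := congrArg Prod.snd (hbc i)
  have hlen1 : ∑ k, (b i).1 k + ∑ k, (c i).1 k = ∑ k, β.1 k := by
    rw [← Finset.sum_add_distrib]
    exact Finset.sum_congr rfl fun k _ => congrFun (congrArg Prod.fst (hbc i)) k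
  refine (mul_le_mul h1 (hC i N z hz) (norm_nonneg _) ?_).trans ?_
  · have := hB0 i
    split_ifs <;> positivity
  · split_ifs with h
    · rw [h, zero_add] at hlen1
      have h3 : ((1 + z.2) ^ (c i).len)⁻¹ ≤ (z.2 ^ (c i).2)⁻¹ * ((1 + z.2) ^ ∑ k, β.1 k)⁻¹ := by
        rw [MIdx.len, hlen1, pow_add, mul_inv, mul_comm]
        refine mul_le_mul_of_nonneg_right ?_ (by positivity)
        exact inv_anti₀ (by positivity) (pow_le_pow_left₀ hz.le (by linarith) _)
      have := hB0 i
      have := hC0 i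
      calc B i * (z.2 ^ (b i).2)⁻¹ * 1 * (C i * ((1 + z.2) ^ (c i).len)⁻¹)
          ≤ B i * (z.2 ^ (b i).2)⁻¹ * 1 *
            (C i * ((z.2 ^ (c i).2)⁻¹ * ((1 + z.2) ^ ∑ k, β.1 k)⁻¹)) := by gcongr
        _ = _ := by rw [← hlen, pow_add, mul_inv]; ring
    · rw [mul_zero, zero_mul]
      have := hB0 i
      have := hC0 i
      positivity

theorem isTest_cutFar_mul {n N : ℕ} {Φ : Space n → ℂ} (hΦ : ContDiff ℝ ∞ Φ) :
    IsTest fun z => cutFar n N z * Φ z := by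
  have h1 : HasCompactSupport fun z => ((spaceBump n z : ℝ) : ℂ) :=
    (spaceBump n).hasCompactSupport.comp_left (g := ((↑) : ℝ → ℂ)) rfl
  have h2 : HasCompactSupport (cutFar n N) :=
    h1.comp_smul (inv_ne_zero (by positivity : (N : ℝ) + 1 ≠ 0))
  exact ⟨(contDiff_cutFar n N).mul hΦ, h2.mul_right⟩

theorem isTestHalf_cutNear_mul {n N : ℕ} {Φ : Space n → ℂ} (hΦ : ContDiff ℝ ∞ Φ) :
    IsTestHalf fun z => cutNear n N z * Φ z := by
  have h1 : IsTest fun z => cutFar n N z * (stepJet 0 (((N : ℝ) + 1) * z.2) * Φ z) :=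
    isTest_cutFar_mul (((contDiff_stepJet 0).comp (contDiff_const.mul contDiff_snd)).mul hΦ)
  have h2 : (fun z : Space n => cutNear n N z * Φ z) =
      fun z => cutFar n N z * (stepJet 0 (((N : ℝ) + 1) * z.2) * Φ z) := by
    funext z; rw [cutNear]; ring
  refine ⟨h2 ▸ h1, ?_⟩
  have h3 : tsupport (fun z => cutNear n N z * Φ z) ⊆ {z | ((N : ℝ) + 1)⁻¹ ≤ z.2} := by
    refine closure_minimal (fun z hz => ?_) (isClosed_le continuous_const continuous_snd)
    by_contra hlt
    have hlt' : z.2 < ((N : ℝ) + 1)⁻¹ := not_le.1 hlt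
    refine hz ?_
    have h4 : ((N : ℝ) + 1) * z.2 ≤ 1 := by
      have hN : (0 : ℝ) < (N : ℝ) + 1 := by positivity
      calc ((N : ℝ) + 1) * z.2 ≤ ((N : ℝ) + 1) * ((N : ℝ) + 1)⁻¹ :=
            mul_le_mul_of_nonneg_left hlt'.le hN.le
        _ = 1 := mul_inv_cancel₀ hN.ne'
    show cutNear n N z * Φ z = 0
    rw [cutNear, stepJet_zero, Real.smoothTransition.zero_of_nonpos (by linarith)]
    simp
  exact fun z hz => lt_of_lt_of_le (show (0 : ℝ) < ((N : ℝ) + 1)⁻¹ by positivity) (h3 hz)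

end

section


/-! ### Slices of test functions and of their extensions -/

theorem sq_lintegral_enorm_le {X : Type*} [MeasurableSpace X] {μ : Measure X} {g : X → ℂ}
    (hg : AEStronglyMeasurable g μ) :
    (∫⁻ s, ‖g s‖ₑ ∂μ) ^ 2 ≤ (∫⁻ s, ‖g s‖ₑ ^ 2 ∂μ) * μ univ := by
  have h := eLpNorm_le_eLpNorm_mul_rpow_measure_univ (p := 1) (q := 2) (by norm_num) hg
  rw [eLpNorm_one_eq_lintegral_enorm] at h
  have h2 : eLpNorm g 2 μ ^ 2 = ∫⁻ s, ‖g s‖ₑ ^ 2 ∂μ := by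
    simpa using eLpNorm_nnreal_pow_eq_lintegral (μ := μ) (f := g) (p := 2) (by norm_num)
  calc (∫⁻ s, ‖g s‖ₑ ∂μ) ^ 2
      ≤ (eLpNorm g 2 μ * μ univ ^ (1 / (1 : ℝ≥0∞).toReal - 1 / (2 : ℝ≥0∞).toReal)) ^ 2 :=
        pow_le_pow_left' h 2
    _ = _ := by
        rw [mul_pow, h2, ← ENNReal.rpow_natCast, ← ENNReal.rpow_mul]
        norm_num

/-- Cauchy–Schwarz for f(x,t) = ∫₀ᵗ f' ds: each integration from a zero boundary value gains t² in
the square norm, with the same constant K. -/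
theorem lintegral_slice_le_of_hasDerivAt {n : ℕ} {f f' : Space n → ℂ} (hf' : Continuous f')
    (hd : ∀ x t, HasDerivAt (fun t => f (x, t)) (f' (x, t)) t) (h0 : ∀ x, f (x, 0) = 0) {K : ℝ}
    (hK0 : 0 ≤ K) {j : ℕ} (hK : ∀ s, 0 < s → s ≤ 1 →
      ∫⁻ x : Hor n, ‖f' (x, s)‖ₑ ^ 2 ≤ ENNReal.ofReal (K * s ^ (2 * j))) {t : ℝ} (ht : 0 < t)
    (ht1 : t ≤ 1) :
    ∫⁻ x : Hor n, ‖f (x, t)‖ₑ ^ 2 ≤ ENNReal.ofReal (K * t ^ (2 * (j + 1))) := by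
  have h1 : ∀ x, ‖f (x, t)‖ₑ ^ 2 ≤ (∫⁻ s in Ioc 0 t, ‖f' (x, s)‖ₑ ^ 2) * ENNReal.ofReal t := by
    intro x
    have hc : Continuous fun s => f' (x, s) := hf'.comp (by fun_prop)
    have h2 : f (x, t) = ∫ s in Ioc 0 t, f' (x, s) := by
      have := intervalIntegral.integral_eq_sub_of_hasDerivAt (a := 0) (b := t)
        (fun s _ => hd x s) (hc.intervalIntegrable _ _)
      rw [intervalIntegral.integral_of_le ht.le] at this
      rw [this, h0, sub_zero]
    have h3 := sq_lintegral_enorm_le (μ := volume.restrict (Ioc 0 t)) hc.aestronglyMeasurable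
    rw [Measure.restrict_apply_univ, Real.volume_Ioc, sub_zero] at h3
    refine le_trans (pow_le_pow_left' ?_ 2) h3
    rw [h2]
    exact enorm_integral_le_lintegral_enorm _
  have hm : Measurable fun p : Hor n × ℝ => ‖f' p‖ₑ ^ 2 := hf'.measurable.enorm.pow_const _
  calc ∫⁻ x : Hor n, ‖f (x, t)‖ₑ ^ 2
      ≤ ∫⁻ x : Hor n, (∫⁻ s in Ioc 0 t, ‖f' (x, s)‖ₑ ^ 2) * ENNReal.ofReal t := lintegral_mono h1
    _ = (∫⁻ s in Ioc 0 t, ∫⁻ x : Hor n, ‖f' (x, s)‖ₑ ^ 2) * ENNReal.ofReal t := by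
        rw [lintegral_mul_const' _ _ ENNReal.ofReal_ne_top,
          lintegral_lintegral_swap (f := fun x s => ‖f' (x, s)‖ₑ ^ 2) hm.aemeasurable]
    _ ≤ (∫⁻ _s in Ioc 0 t, ENNReal.ofReal (K * t ^ (2 * j))) * ENNReal.ofReal t := by
        refine mul_le_mul_left (setLIntegral_mono measurable_const fun s hs => ?_) _
        refine (hK s hs.1 (hs.2.trans ht1)).trans (ENNReal.ofReal_le_ofReal ?_)
        exact mul_le_mul_of_nonneg_left (pow_le_pow_left₀ hs.1.le hs.2 _) hK0
    _ = _ := by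
        rw [setLIntegral_const, Real.volume_Ioc, sub_zero, ← ENNReal.ofReal_mul (by positivity),
          ← ENNReal.ofReal_mul (by positivity)]
        congr 1
        ring

theorem IsTest.exists_slice_bound {n : ℕ} {ψ : Space n → ℂ} (hψ : IsTest ψ) : ∃ C : ℝ, 0 ≤ C ∧
    ∀ t, 0 < t → ∫⁻ x : Hor n, ‖ψ (x, t)‖ₑ ^ 2 ≤ ENNReal.ofReal (C * ((1 + t) ^ 3)⁻¹) := by
  obtain ⟨B, hB⟩ := hψ.2.exists_bound_of_continuous hψ.1.continuous
  obtain ⟨R, hR⟩ := hψ.2.isCompact.isBounded.subset_closedBall (0 : Space n)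
  set V : ℝ := (volume (Metric.closedBall (0 : Hor n) R)).toReal with hV
  have hVe : volume (Metric.closedBall (0 : Hor n) R) = ENNReal.ofReal V :=
    (ENNReal.ofReal_toReal measure_closedBall_lt_top.ne).symm
  have hV0 : 0 ≤ V := ENNReal.toReal_nonneg
  refine ⟨B ^ 2 * V * (1 + |R|) ^ 3, by positivity, fun t ht => ?_⟩
  have hz : ∀ x : Hor n, ψ (x, t) ≠ 0 → ‖x‖ ≤ R ∧ t ≤ R := by
    intro x hx
    have h := mem_closedBall_zero_iff.1 (hR (subset_tsupport _ hx))
    exact ⟨(norm_fst_le (x, t)).trans h, (le_abs_self t).trans ((norm_snd_le (x, t)).trans h)⟩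
  by_cases htR : t ≤ R
  · have h1 : ∀ x : Hor n, ‖ψ (x, t)‖ₑ ^ 2 ≤
        (Metric.closedBall (0 : Hor n) R).indicator (fun _ => ENNReal.ofReal (B ^ 2)) x := by
      intro x
      by_cases hx : ψ (x, t) = 0
      · simp [hx]
      · rw [indicator_of_mem (mem_closedBall_zero_iff.2 (hz x hx).1), enorm_sq_eq_ofReal]
        exact ENNReal.ofReal_le_ofReal (pow_le_pow_left₀ (norm_nonneg _) (hB _) 2)
    refine (lintegral_mono h1).trans ?_
    rw [lintegral_indicator Metric.isClosed_closedBall.measurableSet, setLIntegral_const, hVe,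
      ← ENNReal.ofReal_mul (by positivity), mul_assoc (B ^ 2 * V)]
    refine ENNReal.ofReal_le_ofReal (le_mul_of_one_le_right (by positivity) ?_)
    rw [← div_eq_mul_inv, one_le_div (by positivity)]
    exact pow_le_pow_left₀ (by positivity) (by linarith [le_abs_self R]) 3
  · have h1 : ∀ x : Hor n, ψ (x, t) = 0 := fun x => by
      by_contra h
      exact htR (hz x h).2
    simp [h1]

section Extension

variable {n m : ℕ}

theorem RapidSymbol.exists_slice_bound {q : ℕ → Hor n → ℝ → ℂ} (h : RapidSymbol q) (T : ℝ) :
    ∃ C : ℝ, 0 ≤ C ∧ ∀ t, |t| ≤ T →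
      ∫⁻ x : Hor n, ‖symFn (q 0) (x, t)‖ₑ ^ 2 ≤ ENNReal.ofReal C := by
  obtain ⟨C, hC0, hC⟩ := h.bound' 0 (n + 1) T
  have hI := (memLp_two_iff_integrable_sq
    (memLp_two_inv_one_add_norm_pow n).1).1 (memLp_two_inv_one_add_norm_pow n)
  refine ⟨∫ ξ : Hor n, C ^ 2 * (((1 + ‖ξ‖) ^ (n + 1))⁻¹) ^ 2,
    integral_nonneg fun ξ => by positivity, fun t ht => ?_⟩
  rw [h.lintegral_slice, ofReal_integral_eq_lintegral_ofReal (hI.const_mul _)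
    (Eventually.of_forall fun ξ => by positivity)]
  refine lintegral_mono fun ξ => ?_
  rw [enorm_sq_eq_ofReal, ← mul_pow]
  exact ENNReal.ofReal_le_ofReal (pow_le_pow_left₀ (norm_nonneg _) (hC ξ t ht) 2)

/-- Scaling of ξ gives t^(-n), which is at most t^(-1) because n ≥ 1 and t ≥ 1. -/
theorem exists_lintegral_exp_tau_le (hn : 1 ≤ n) : ∃ C : ℝ, 0 ≤ C ∧ ∀ t : ℝ, 1 ≤ t →
    ∫⁻ ξ : Hor n, ENNReal.ofReal (Real.exp (-(tau ξ * t))) ≤ ENNReal.ofReal (C * t⁻¹) := by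
  obtain ⟨B, hB0, hB⟩ := exists_tau_pow_mul_exp_le n 0 (n + 1) one_pos
  have hc : Continuous fun ξ : Hor n => Real.exp (-tau ξ) := by fun_prop
  have hI : Integrable fun ξ : Hor n => Real.exp (-tau ξ) :=
    ((integrable_inv_one_add_norm_pow n).const_mul B).mono' hc.aestronglyMeasurable
      (Eventually.of_forall fun ξ => by
        rw [Real.norm_of_nonneg (Real.exp_pos _).le]
        simpa using hB ξ)
  refine ⟨∫ ξ : Hor n, Real.exp (-tau ξ), integral_nonneg fun ξ => (Real.exp_pos _).le,
    fun t ht => ?_⟩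
  have ht0 : 0 < t := by linarith
  have h1 : ∀ ξ : Hor n, Real.exp (-(tau ξ * t)) = Real.exp (-tau (t • ξ)) := by
    intro ξ
    rw [tau, tau, norm_smul, Real.norm_of_nonneg ht0.le]
    congr 1
    ring
  simp only [h1]
  rw [← ofReal_integral_eq_lintegral_ofReal
    (f := fun ξ : Hor n => Real.exp (-tau (t • ξ)))
    ((integrable_comp_smul_iff volume (fun ξ : Hor n => Real.exp (-tau ξ)) ht0.ne').2 hI)
    (Eventually.of_forall fun ξ => (Real.exp_pos _).le),
    Measure.integral_comp_smul volume (fun ξ : Hor n => Real.exp (-tau ξ)) t]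
  refine ENNReal.ofReal_le_ofReal ?_
  rw [smul_eq_mul, mul_comm, finrank_euclideanSpace_fin, abs_of_pos (by positivity)]
  refine mul_le_mul_of_nonneg_left ?_ (integral_nonneg fun ξ => (Real.exp_pos _).le)
  exact inv_anti₀ ht0 (le_self_pow₀ ht (by omega))

/-- The powers of τ are matched with powers of t, and half of the exponential absorbs the resulting
power of τt. The surplus t^k, with k ≤ m-1, comes from the monomials in the extension. -/
theorem exists_diff_extSym_le (hm : 1 ≤ m) {φ : Space n → ℂ} (hφ : IsTest φ) (γ : MIdx n) :
    ∃ C : ℝ, 0 ≤ C ∧ ∀ ξ t, 1 ≤ t → t ^ γ.len * ‖RapidSymbol.diff (extSym m φ) γ 0 ξ t‖ ≤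
      C * t ^ (m - 1) * Real.exp (-(tau ξ * t / 2)) := by
  obtain ⟨C, hC0, hC⟩ := exists_extSym_bound hm φ γ.2
  choose B hB0 hB using fun k => (isRapid_trHat hφ k).bound 0
  set D : ℕ → ℝ := fun k => 2 ^ (∑ i, γ.1 i + (γ.2 - k)) * (∑ i, γ.1 i + (γ.2 - k)).factorial
    with hD
  refine ⟨C * ∑ k ∈ Finset.range m, B k * D k, mul_nonneg hC0 (Finset.sum_nonneg fun k _ =>
    mul_nonneg (hB0 k) (by positivity)), fun ξ t ht => ?_⟩
  have hτ := tau_nonneg ξ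
  have ht0 : 0 < t := by linarith
  rw [RapidSymbol.diff, zero_add, norm_mul]
  have h1 := mul_le_mul (norm_horMono_le γ.1 ξ) (hC ξ t) (norm_nonneg _) (by positivity)
  refine (mul_le_mul_of_nonneg_left h1 (by positivity)).trans ?_
  rw [mul_left_comm (tau ξ ^ _), mul_left_comm, mul_assoc C, mul_assoc C]
  refine mul_le_mul_of_nonneg_left ?_ hC0
  rw [Finset.mul_sum, Finset.mul_sum, Finset.sum_mul, Finset.sum_mul]
  refine Finset.sum_le_sum fun k hk => ?_
  have hk' := Finset.mem_range.1 hk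
  rw [abs_of_pos ht0]
  set a := ∑ i, γ.1 i
  have h2 := mul_pow_mul_exp_le (a + (γ.2 - k)) (τ := tau ξ) (t := t / 2) hτ (by positivity)
  have h3 : (tau ξ * t) ^ (a + (γ.2 - k)) * Real.exp (-(tau ξ * t / 2)) ≤ D k := by
    rw [show tau ξ * (t / 2) = tau ξ * t / 2 by ring, div_pow, div_mul_eq_mul_div,
      div_le_iff₀ (by positivity)] at h2
    rw [hD]
    simp only
    linarith
  have h4 : Real.exp (-(tau ξ * t)) =
      Real.exp (-(tau ξ * t / 2)) * Real.exp (-(tau ξ * t / 2)) := by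
    rw [← Real.exp_add]; congr 1; ring
  have h5 : t ^ γ.len * (tau ξ ^ a * (t ^ (k - γ.2) * tau ξ ^ (γ.2 - k))) =
      (tau ξ * t) ^ (a + (γ.2 - k)) * t ^ k := by
    have e : γ.len + (k - γ.2) = a + (γ.2 - k) + k := by
      have : γ.len = a + γ.2 := rfl
      omega
    calc t ^ γ.len * (tau ξ ^ a * (t ^ (k - γ.2) * tau ξ ^ (γ.2 - k)))
        = t ^ (γ.len + (k - γ.2)) * (tau ξ ^ (a + (γ.2 - k))) := by
          rw [pow_add, pow_add]; ring
      _ = _ := by rw [e, pow_add _ _ k, mul_pow]; ring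
  have h6 : ‖trHat φ k ξ‖ ≤ B k := by simpa using hB k ξ
  calc t ^ γ.len * (tau ξ ^ a * (‖trHat φ k ξ‖ * (t ^ (k - γ.2) * tau ξ ^ (γ.2 - k) *
        Real.exp (-(tau ξ * t)))))
      = ‖trHat φ k ξ‖ * ((tau ξ * t) ^ (a + (γ.2 - k)) * Real.exp (-(tau ξ * t / 2))) *
          (t ^ k * Real.exp (-(tau ξ * t / 2))) := by
        rw [h4]
        linear_combination (‖trHat φ k ξ‖ * Real.exp (-(tau ξ * t / 2)) *
          Real.exp (-(tau ξ * t / 2))) * h5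
    _ ≤ B k * D k * (t ^ (m - 1) * Real.exp (-(tau ξ * t / 2))) := by
        refine mul_le_mul (mul_le_mul h6 h3 (by positivity) (hB0 k)) ?_ (by positivity)
          (mul_nonneg (hB0 k) (by positivity))
        exact mul_le_mul_of_nonneg_right (pow_le_pow_right₀ ht (by omega)) (Real.exp_pos _).le
    _ = _ := (mul_assoc _ _ _).symm

/-- Squaring the symbol bound gives t^(2(m-1)) exp(-τt), and the integral over frequencies gains a
further 1/t. The total t^(2m-3) is just enough for the integrability in t that
`integrableOn_mul_of_slice` asks for. -/
theorem exists_slice_extE_le (hn : 1 ≤ n) (hm : 1 ≤ m) {φ : Space n → ℂ} (hφ : IsTest φ)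
    (γ : MIdx n) : ∃ C : ℝ, 0 ≤ C ∧ ∀ t, 1 ≤ t →
      ENNReal.ofReal (t ^ (2 * γ.len)) * ∫⁻ x : Hor n, ‖partialD γ (extE m φ) (x, t)‖ₑ ^ 2 ≤
        ENNReal.ofReal (C * (t ^ (2 * m) * (t ^ 3)⁻¹)) := by
  obtain ⟨C, hC0, hC⟩ := exists_diff_extSym_le hm hφ γ
  obtain ⟨B, hB0, hB⟩ := exists_lintegral_exp_tau_le hn
  have hR := rapidSymbol_extSym hm hφ
  refine ⟨C ^ 2 * B, by positivity, fun t ht => ?_⟩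
  have ht0 : 0 < t := by linarith
  rw [extE_eq_symFn hφ, hR.partialD_symFn, (hR.isRapid_diff γ).lintegral_slice,
    ← lintegral_const_mul' _ _ ENNReal.ofReal_ne_top]
  calc ∫⁻ ξ, ENNReal.ofReal (t ^ (2 * γ.len)) * ‖RapidSymbol.diff (extSym m φ) γ 0 ξ t‖ₑ ^ 2
      ≤ ∫⁻ ξ : Hor n, ENNReal.ofReal (C ^ 2 * t ^ (2 * (m - 1))) *
          ENNReal.ofReal (Real.exp (-(tau ξ * t))) := by
        refine lintegral_mono fun ξ => ?_
        rw [enorm_sq_eq_ofReal, ← ENNReal.ofReal_mul (by positivity),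
          ← ENNReal.ofReal_mul (by positivity)]
        refine ENNReal.ofReal_le_ofReal ?_
        have h := pow_le_pow_left₀ (by positivity) (hC ξ t ht) 2
        calc _ = (t ^ γ.len * ‖RapidSymbol.diff (extSym m φ) γ 0 ξ t‖) ^ 2 := by
              rw [mul_pow, ← pow_mul, mul_comm 2]
          _ ≤ _ := h
          _ = _ := by
              rw [mul_pow, mul_pow, ← pow_mul, mul_comm (m - 1), ← Real.exp_nat_mul]
              congr 2
              push_cast
              ring
    _ ≤ ENNReal.ofReal (C ^ 2 * t ^ (2 * (m - 1))) * ENNReal.ofReal (B * t⁻¹) := by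
        rw [lintegral_const_mul' _ _ ENNReal.ofReal_ne_top]
        exact mul_le_mul_right (hB t ht) _
    _ = _ := by
        rw [← ENNReal.ofReal_mul (by positivity)]
        congr 1
        rw [show 2 * m = 2 * (m - 1) + 2 by omega, pow_add]
        field_simp

theorem inv_pow_three_le {t : ℝ} (ht : 1 ≤ t) : (t ^ 3)⁻¹ ≤ 8 * ((1 + t) ^ 3)⁻¹ := by
  rw [← div_eq_mul_inv, inv_eq_one_div, div_le_div_iff₀ (by positivity) (by positivity)]
  have h := pow_le_pow_left₀ (by linarith) (by linarith : 1 + t ≤ 2 * t) 3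
  rw [mul_pow] at h
  linarith

theorem one_le_eight_mul_inv {t : ℝ} (ht0 : 0 < t) (ht : t ≤ 1) : 1 ≤ 8 * ((1 + t) ^ 3)⁻¹ := by
  rw [← div_eq_mul_inv, one_le_div (by positivity)]
  have h := pow_le_pow_left₀ (by linarith) (by linarith : 1 + t ≤ 2) 3
  linarith

theorem sliceDecay_extE (hn : 1 ≤ n) (hm : 1 ≤ m) {φ : Space n → ℂ} (hφ : IsTest φ) {α : MIdx n}
    (hα : α.len = m) : SliceDecay (fun _ => 1) (partialD α (extE m φ)) := by
  obtain ⟨C, hC0, hC⟩ := exists_slice_extE_le hn hm hφ α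
  have hR := rapidSymbol_extSym hm hφ
  obtain ⟨B, hB0, hB⟩ := (hR.isRapid_diff α).exists_slice_bound 1
  refine ⟨8 * (B + C), fun t ht => ?_⟩
  simp only [Complex.ofReal_one, one_mul]
  rcases le_or_gt t 1 with h1 | h1
  · have h := hB t (by rwa [abs_of_pos ht])
    rw [← hR.partialD_symFn, ← extE_eq_symFn hφ] at h
    refine h.trans (ENNReal.ofReal_le_ofReal ?_)
    have := one_le_eight_mul_inv ht h1
    nlinarith
  · have h := hC t h1.le
    have hp : 0 < t ^ (2 * m) := by positivity
    rw [hα, mul_left_comm, ENNReal.ofReal_mul (p := t ^ (2 * m)) hp.le] at h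
    have h2 := (ENNReal.mul_le_mul_iff_right (ENNReal.ofReal_pos.2 hp).ne'
      ENNReal.ofReal_ne_top).1 h
    refine h2.trans (ENNReal.ofReal_le_ofReal ?_)
    have h3 := inv_pow_three_le h1.le
    have h4 : 0 ≤ ((1 + t) ^ 3)⁻¹ := by positivity
    calc C * (t ^ 3)⁻¹ ≤ C * (8 * ((1 + t) ^ 3)⁻¹) := mul_le_mul_of_nonneg_left h3 hC0
      _ ≤ _ := by nlinarith

/-! ### The difference of a test function and its extension -/

theorem contDiff_extE (hm : 1 ≤ m) {φ : Space n → ℂ} (hφ : IsTest φ) :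
    ContDiff ℝ ∞ (extE m φ) := by
  rw [extE_eq_symFn hφ]
  exact (rapidSymbol_extSym hm hφ).contDiff_symFn

/-- The extension has the boundary traces of φ up to vertical order m-1; on the Fourier side the two
symbols coincide at t = 0. -/
theorem partialD_sub_extE_at_zero (hm : 1 ≤ m) {φ : Space n → ℂ} (hφ : IsTest φ) {γ : MIdx n}
    (hγ : γ.2 < m) (x : Hor n) : partialD γ (fun z => φ z - extE m φ z) (x, 0) = 0 := by
  rw [partialD_sub γ hφ.1 (contDiff_extE hm hφ), extE_eq_symFn hφ]
  show partialD γ φ (x, 0) - partialD γ (symFn (extSym m φ 0)) (x, 0) = 0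
  rw [(rapidSymbol_extSym hm hφ).partialD_symFn, partialD_trace hφ]
  simp only [symFn, RapidSymbol.diff, zero_add, extSym_at_zero hm φ hγ, sub_self]

theorem enorm_sub_sq_le (a b : ℂ) : ‖a - b‖ₑ ^ 2 ≤ 2 * ‖a‖ₑ ^ 2 + 2 * ‖b‖ₑ ^ 2 := by
  rw [enorm_sq_eq_ofReal, enorm_sq_eq_ofReal, enorm_sq_eq_ofReal,
    show (2 : ℝ≥0∞) = ENNReal.ofReal 2 by simp, ← ENNReal.ofReal_mul (by norm_num),
    ← ENNReal.ofReal_mul (by norm_num), ← ENNReal.ofReal_add (by positivity) (by positivity)]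
  refine ENNReal.ofReal_le_ofReal ?_
  have h := pow_le_pow_left₀ (norm_nonneg _) (norm_sub_le a b) 2
  nlinarith [sq_nonneg (‖a‖ - ‖b‖)]

theorem lintegral_enorm_sub_sq_le {F H : Hor n → ℂ} (hF : Measurable F) {A B : ℝ} (hA : 0 ≤ A)
    (hB : 0 ≤ B) (h1 : ∫⁻ x, ‖F x‖ₑ ^ 2 ≤ ENNReal.ofReal A)
    (h2 : ∫⁻ x, ‖H x‖ₑ ^ 2 ≤ ENNReal.ofReal B) :
    ∫⁻ x, ‖F x - H x‖ₑ ^ 2 ≤ ENNReal.ofReal (2 * (A + B)) := by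
  refine (lintegral_mono fun x => enorm_sub_sq_le (F x) (H x)).trans ?_
  rw [lintegral_add_left ((hF.enorm.pow_const _).const_mul _), lintegral_const_mul' _ _ (by simp),
    lintegral_const_mul' _ _ (by simp), ← mul_add, ENNReal.ofReal_mul (by norm_num),
    ENNReal.ofReal_add hA hB]
  rw [show ENNReal.ofReal 2 = 2 by simp]
  gcongr

/-- Starting from m vertical derivatives, where the slices are merely bounded, one integrates in t
from the boundary r times. Every intermediate trace vanishes, so each step gains a factor t in norm.
-/
theorem exists_slice_sub_extE_le (hm : 1 ≤ m) {φ : Space n → ℂ} (hφ : IsTest φ)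
    (b : Fin n → ℕ) (r : ℕ) (hr : r ≤ m) : ∃ K : ℝ, 0 ≤ K ∧ ∀ t, 0 < t → t ≤ 1 →
      ∫⁻ x : Hor n, ‖partialD (b, m - r) (fun z => φ z - extE m φ z) (x, t)‖ₑ ^ 2 ≤
        ENNReal.ofReal (K * t ^ (2 * r)) := by
  have hsm : ContDiff ℝ ∞ fun z => φ z - extE m φ z := hφ.1.sub (contDiff_extE hm hφ)
  induction r with
  | zero =>
    have hR := rapidSymbol_extSym hm hφ
    obtain ⟨B, hB0, hB⟩ := (hR.isRapid_diff (b, m)).exists_slice_bound 1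
    obtain ⟨C, hC0, hC⟩ := (hφ.partialD (b, m)).exists_slice_bound
    refine ⟨2 * (C + B), by positivity, fun t ht ht1 => ?_⟩
    rw [Nat.sub_zero, mul_zero, pow_zero, mul_one, partialD_sub _ hφ.1 (contDiff_extE hm hφ),
      extE_eq_symFn hφ, hR.partialD_symFn]
    have hm1 : Measurable fun x : Hor n => partialD (b, m) φ (x, t) :=
      ((hφ.partialD (b, m)).1.continuous.comp
        (by fun_prop : Continuous fun x : Hor n => (x, t))).measurable
    refine lintegral_enorm_sub_sq_le hm1 hC0 hB0 ((hC t ht).trans (ENNReal.ofReal_le_ofReal ?_))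
      (hB t (by rwa [abs_of_pos ht]))
    exact mul_le_of_le_one_right hC0 (inv_le_one_of_one_le₀ (one_le_pow₀ (by linarith)))
  | succ r ih =>
    obtain ⟨K, hK0, hK⟩ := ih (by omega)
    refine ⟨K, hK0, fun t ht ht1 => ?_⟩
    have hsm1 := contDiff_partialD (b, m - (r + 1)) hsm
    have he : partialD (b, m - r) (fun z => φ z - extE m φ z) =
        dDir none (partialD (b, m - (r + 1)) fun z => φ z - extE m φ z) := by
      rw [← partialD_add_unitIdx _ _ hsm]
      congr 1
      refine Prod.ext ?_ ?_
      · simp [unitIdx]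
      · simp [unitIdx]; omega
    refine lintegral_slice_le_of_hasDerivAt (contDiff_partialD (b, m - r) hsm).continuous
      (fun x s => ?_) (fun x => partialD_sub_extE_at_zero hm hφ (by simp; omega) x) hK0 hK ht ht1
    rw [he, dDir_eq_fderiv none (hsm1.differentiable (by simp) _)]
    have h1 := (hsm1.differentiable (by simp) (x, s)).hasFDerivAt.comp_hasDerivAt s
      ((hasDerivAt_const s x).prodMk (hasDerivAt_id s))
    exact h1

/-- Near the boundary, the loss t^(-β.2) from the cut-off is covered by the order m - γ.2 of
vanishing. Far away, φ has compact support and the weight turns the growth of lower derivatives of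
ℰφ into the decay of derivatives of order m. -/
theorem sliceDecay_sub_extE (hn : 1 ≤ n) (hm : 1 ≤ m) {φ : Space n → ℂ} (hφ : IsTest φ)
    {β γ : MIdx n} (h : (β + γ).len = m) (C₀ : ℝ) :
    SliceDecay (fun t => C₀ * ((t ^ β.2)⁻¹ * ((1 + t) ^ ∑ i, β.1 i)⁻¹))
      (partialD γ fun z => φ z - extE m φ z) := by
  have hlen : β.len + γ.len = m := by rw [← MIdx.len_add, h]
  have hβ : β.len = (∑ i, β.1 i) + β.2 := rfl
  have hγ : γ.len = (∑ i, γ.1 i) + γ.2 := rfl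
  obtain ⟨K, hK0, hK⟩ := exists_slice_sub_extE_le hm hφ γ.1 (m - γ.2) (by omega)
  rw [show m - (m - γ.2) = γ.2 by omega] at hK
  obtain ⟨C, hC0, hC⟩ := exists_slice_extE_le hn hm hφ γ
  obtain ⟨B, hB0, hB⟩ := (hφ.partialD γ).exists_slice_bound
  refine ⟨8 * C₀ ^ 2 * K + 2 * (C₀ ^ 2 * (B + 8 * C)), fun t ht => ?_⟩
  set wt : ℝ := C₀ * ((t ^ β.2)⁻¹ * ((1 + t) ^ ∑ i, β.1 i)⁻¹) with hwt
  have hq : 0 ≤ ((1 + t) ^ 3)⁻¹ := by positivity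
  have hout : ∀ F : Hor n → ℂ, ∫⁻ x, ‖(wt : ℂ) * F x‖ₑ ^ 2 =
      ENNReal.ofReal (wt ^ 2) * ∫⁻ x, ‖F x‖ₑ ^ 2 := by
    intro F
    rw [← lintegral_const_mul' _ _ ENNReal.ofReal_ne_top]
    congr 1
    funext x
    rw [enorm_mul, mul_pow, enorm_sq_eq_ofReal (wt : ℂ), Complex.norm_real, Real.norm_eq_abs,
      sq_abs]
  rw [hout]
  rcases le_or_gt t 1 with h1 | h1
  · refine (mul_le_mul_right (hK t ht h1) _).trans ?_
    rw [← ENNReal.ofReal_mul (by positivity)]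
    refine ENNReal.ofReal_le_ofReal ?_
    have h2 : wt ^ 2 * t ^ (2 * (m - γ.2)) ≤ C₀ ^ 2 := by
      have h3 : ((1 + t) ^ ∑ i, β.1 i)⁻¹ ≤ 1 := inv_le_one_of_one_le₀ (one_le_pow₀ (by linarith))
      have h4 : (t ^ β.2)⁻¹ * t ^ (m - γ.2) ≤ 1 := by
        rw [inv_mul_le_one₀ (by positivity)]
        exact pow_le_pow_of_le_one ht.le h1 (by omega)
      have h5 : ((t ^ β.2)⁻¹ * ((1 + t) ^ ∑ i, β.1 i)⁻¹ * t ^ (m - γ.2)) ^ 2 ≤ 1 := by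
        refine pow_le_one₀ (by positivity) ?_
        calc _ = ((t ^ β.2)⁻¹ * t ^ (m - γ.2)) * ((1 + t) ^ ∑ i, β.1 i)⁻¹ := by ring
          _ ≤ 1 := mul_le_one₀ h4 (by positivity) h3
      calc wt ^ 2 * t ^ (2 * (m - γ.2))
          = C₀ ^ 2 * ((t ^ β.2)⁻¹ * ((1 + t) ^ ∑ i, β.1 i)⁻¹ * t ^ (m - γ.2)) ^ 2 := by
            rw [hwt, mul_comm 2, pow_mul]; ring
        _ ≤ C₀ ^ 2 * 1 := mul_le_mul_of_nonneg_left h5 (by positivity)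
        _ = _ := mul_one _
    have h6 := one_le_eight_mul_inv ht h1
    calc wt ^ 2 * (K * t ^ (2 * (m - γ.2))) = (wt ^ 2 * t ^ (2 * (m - γ.2))) * K := by ring
      _ ≤ C₀ ^ 2 * K := mul_le_mul_of_nonneg_right h2 hK0
      _ ≤ C₀ ^ 2 * K * (8 * ((1 + t) ^ 3)⁻¹) := le_mul_of_one_le_right (by positivity) h6
      _ = 8 * C₀ ^ 2 * K * ((1 + t) ^ 3)⁻¹ := by ring
      _ ≤ _ := mul_le_mul_of_nonneg_right (le_add_of_nonneg_right (by positivity)) hq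
  · have hm1 : Measurable fun x : Hor n => (wt : ℂ) * partialD γ φ (x, t) :=
      ((hφ.partialD γ).1.continuous.comp
        (by fun_prop : Continuous fun x : Hor n => (x, t))).measurable.const_mul _
    have hwt1 : wt ^ 2 ≤ C₀ ^ 2 := by
      rw [hwt, mul_pow]
      refine mul_le_of_le_one_right (by positivity) (pow_le_one₀ (by positivity) ?_)
      exact mul_le_one₀ (inv_le_one_of_one_le₀ (one_le_pow₀ h1.le)) (by positivity)
        (inv_le_one_of_one_le₀ (one_le_pow₀ (by linarith)))
    have h2 : ∫⁻ x : Hor n, ‖(wt : ℂ) * partialD γ φ (x, t)‖ₑ ^ 2 ≤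
        ENNReal.ofReal (C₀ ^ 2 * B * ((1 + t) ^ 3)⁻¹) := by
      rw [hout]
      refine (mul_le_mul_right (hB t ht) _).trans ?_
      rw [← ENNReal.ofReal_mul (by positivity), ← mul_assoc]
      exact ENNReal.ofReal_le_ofReal (mul_le_mul_of_nonneg_right
        (mul_le_mul_of_nonneg_right hwt1 hB0) hq)
    have h3 : ∫⁻ x : Hor n, ‖(wt : ℂ) * partialD γ (extE m φ) (x, t)‖ₑ ^ 2 ≤
        ENNReal.ofReal (C₀ ^ 2 * (8 * C) * ((1 + t) ^ 3)⁻¹) := by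
      rw [hout]
      have hp : 0 < t ^ (2 * γ.len) := by positivity
      -- For t > 1 the weight is at most C₀ t^(-|β|), and |β| = m - |γ|.
      have hwt2 : wt ^ 2 ≤ C₀ ^ 2 * ((t ^ (2 * m))⁻¹ * t ^ (2 * γ.len)) := by
        rw [hwt, mul_pow]
        refine mul_le_mul_of_nonneg_left ?_ (by positivity)
        rw [← hlen, mul_add, pow_add, mul_inv, mul_assoc, inv_mul_cancel₀ hp.ne', mul_one, hβ,
          mul_comm 2, pow_mul, ← inv_pow (t ^ _) 2]
        refine pow_le_pow_left₀ (show 0 ≤ (t ^ β.2)⁻¹ * ((1 + t) ^ ∑ i, β.1 i)⁻¹ by positivity) ?_ 2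
        rw [pow_add, mul_inv, mul_comm]
        exact mul_le_mul_of_nonneg_right (inv_anti₀ (show 0 < t ^ ∑ i, β.1 i by positivity)
          (pow_le_pow_left₀ ht.le (by linarith) _)) (show 0 ≤ (t ^ β.2)⁻¹ by positivity)
      calc ENNReal.ofReal (wt ^ 2) * ∫⁻ x : Hor n, ‖partialD γ (extE m φ) (x, t)‖ₑ ^ 2
          ≤ ENNReal.ofReal (C₀ ^ 2 * ((t ^ (2 * m))⁻¹ * t ^ (2 * γ.len))) *
              ∫⁻ x : Hor n, ‖partialD γ (extE m φ) (x, t)‖ₑ ^ 2 :=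
            mul_le_mul_left (ENNReal.ofReal_le_ofReal hwt2) _
        _ = ENNReal.ofReal (C₀ ^ 2 * (t ^ (2 * m))⁻¹) * (ENNReal.ofReal (t ^ (2 * γ.len)) *
              ∫⁻ x : Hor n, ‖partialD γ (extE m φ) (x, t)‖ₑ ^ 2) := by
            rw [← mul_assoc (C₀ ^ 2), ENNReal.ofReal_mul (by positivity), mul_assoc]
        _ ≤ ENNReal.ofReal (C₀ ^ 2 * (t ^ (2 * m))⁻¹) *
              ENNReal.ofReal (C * (t ^ (2 * m) * (t ^ 3)⁻¹)) := mul_le_mul_right (hC t h1.le) _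
        _ = ENNReal.ofReal (C₀ ^ 2 * C * (t ^ 3)⁻¹) := by
            rw [← ENNReal.ofReal_mul (by positivity)]
            congr 1
            field_simp
        _ ≤ _ := by
            refine ENNReal.ofReal_le_ofReal ?_
            have := mul_le_mul_of_nonneg_left (inv_pow_three_le h1.le)
              (by positivity : 0 ≤ C₀ ^ 2 * C)
            linarith
    have h4 := lintegral_enorm_sub_sq_le hm1 (show 0 ≤ C₀ ^ 2 * B * ((1 + t) ^ 3)⁻¹ by positivity)
      (show 0 ≤ C₀ ^ 2 * (8 * C) * ((1 + t) ^ 3)⁻¹ by positivity) h2 h3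
    simp only [← mul_sub] at h4
    rw [hout] at h4
    rw [partialD_sub γ hφ.1 (contDiff_extE hm hφ)]
    refine h4.trans (ENNReal.ofReal_le_ofReal ?_)
    have : 0 ≤ 8 * C₀ ^ 2 * K * ((1 + t) ^ 3)⁻¹ := by positivity
    linarith

end Extension

end

section


/-! ### The difference of two solutions -/

/-- The properties of the conjugate gradient array `d` of a weak solution that are used for
uniqueness; `ℓ` is the functional of the Neumann data. -/
structure IsGradArray {n : ℕ} (m : ℕ) (d : MIdx n → Space n → ℂ) (ℓ : (Space n → ℂ) → ℂ) :
    Prop where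
  meas : ∀ α ∈ multiIdx n m, AEStronglyMeasurable (d α) (volume.restrict (halfSpace n))
  bound : ∃ M : ℝ, 0 ≤ M ∧ ∀ α ∈ multiIdx n m, ∀ t, 0 < t →
    ∫⁻ x : Hor n, ‖d α (x, t)‖ₑ ^ 2 ≤ ENNReal.ofReal M
  compat : ∀ α ∈ multiIdx n m, ∀ β ∈ multiIdx n m, ∀ γ δ : MIdx n, α + γ = β + δ →
    ∀ φ : Space n → ℂ, IsTestHalf φ →
      ∫ z in halfSpace n, d α z * partialD γ φ z = ∫ z in halfSpace n, d β z * partialD δ φ z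
  equation : ∀ φ : Space n → ℂ, IsTestHalf φ →
    ∑ α ∈ multiIdx n m, (Nat.multinomial Finset.univ α.1 : ℂ) *
      ∫ z in halfSpace n, d α z * partialD α φ z = 0
  neumann : ∀ φ : Space n → ℂ, IsTest φ →
    ∑ α ∈ multiIdx n m, (Nat.multinomial Finset.univ α.1 : ℂ) *
      ∫ z in halfSpace n, d α z * partialD α (extE m φ) z = ℓ φ

variable {n m : ℕ} {d d₁ d₂ : MIdx n → Space n → ℂ} {ℓ : (Space n → ℂ) → ℂ}

theorem SliceDecay.of_one {F : Space n → ℂ} (h : SliceDecay (fun _ => 1) F) :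
    ∃ C : ℝ, ∀ t, 0 < t →
      ∫⁻ x : Hor n, ‖F (x, t)‖ₑ ^ 2 ≤ ENNReal.ofReal (C * ((1 + t) ^ 3)⁻¹) := by
  obtain ⟨C, hC⟩ := h
  exact ⟨C, fun t ht => by simpa using hC t ht⟩

theorem IsGradArray.integrableOn (h : IsGradArray m d ℓ) {α : MIdx n} (hα : α ∈ multiIdx n m)
    {F : Space n → ℂ} (hF : Continuous F) (hC : SliceDecay (fun _ => 1) F) :
    IntegrableOn (fun z => d α z * F z) (halfSpace n) := by
  obtain ⟨M, -, hM⟩ := h.bound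
  obtain ⟨C, hC⟩ := hC.of_one
  exact integrableOn_mul_of_slice (h.meas α hα) hF.aestronglyMeasurable
    (fun t => (hF.comp (by fun_prop : Continuous fun x : Hor n => (x, t))).measurable)
    (hM α hα) hC

theorem IsTest.sliceDecay {ψ : Space n → ℂ} (hψ : IsTest ψ) : SliceDecay (fun _ => 1) ψ := by
  obtain ⟨C, -, hC⟩ := hψ.exists_slice_bound
  exact ⟨C, fun t ht => by simpa using hC t ht⟩

theorem IsGradArray.integrableOn_test (h : IsGradArray m d ℓ) {α : MIdx n}
    (hα : α ∈ multiIdx n m) {ψ : Space n → ℂ} (hψ : IsTest ψ) :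
    IntegrableOn (fun z => d α z * ψ z) (halfSpace n) :=
  h.integrableOn hα hψ.1.continuous hψ.sliceDecay

/-- A measurable representative may violate the slice bound for a null set of t; it is set to zero
on those slices. Thus the bound keeps holding for every t. -/
theorem exists_measurable_slice_le {f : Space n → ℂ}
    (hf : AEStronglyMeasurable f (volume.restrict (halfSpace n))) {M : ℝ≥0∞}
    (hM : ∀ t, 0 < t → ∫⁻ x : Hor n, ‖f (x, t)‖ₑ ^ 2 ≤ M) :
    ∃ f' : Space n → ℂ, Measurable f' ∧ f' =ᵐ[volume.restrict (halfSpace n)] f ∧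
      ∀ t, ∫⁻ x : Hor n, ‖f' (x, t)‖ₑ ^ 2 ≤ M := by
  set k := hf.mk f with hk
  have hkm : Measurable k := hf.stronglyMeasurable_mk.measurable
  have hkf : f =ᵐ[volume.restrict (halfSpace n)] k := hf.ae_eq_mk
  have hI : Measurable fun t : ℝ => ∫⁻ x : Hor n, ‖k (x, t)‖ₑ ^ 2 :=
    (hkm.enorm.pow_const 2).lintegral_prod_left'
  have hS : MeasurableSet {t : ℝ | ∫⁻ x : Hor n, ‖k (x, t)‖ₑ ^ 2 ≤ M} :=
    measurableSet_le hI measurable_const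
  classical
  refine ⟨fun z => if z.2 ∈ {t : ℝ | ∫⁻ x : Hor n, ‖k (x, t)‖ₑ ^ 2 ≤ M} then k z else 0,
    Measurable.ite (measurable_snd hS) hkm measurable_const, ?_, fun t => ?_⟩
  · have h1 : ∀ᵐ t ∂(volume.restrict (Ioi (0 : ℝ))), ∀ᵐ x : Hor n, f (x, t) = k (x, t) := by
      rw [restrict_halfSpace] at hkf
      have h3 : ∀ᵐ z ∂((volume.restrict (Ioi (0 : ℝ))).prod (volume : Measure (Hor n))),
          f z.swap = k z.swap :=
        Measure.measurePreserving_swap.quasiMeasurePreserving.ae hkf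
      exact Measure.ae_ae_of_ae_prod h3
    have h4 : ∀ᵐ z ∂(volume.restrict (halfSpace n)),
        ∫⁻ x : Hor n, ‖k (x, z.2)‖ₑ ^ 2 ≤ M := by
      rw [restrict_halfSpace]
      refine Measure.quasiMeasurePreserving_snd.ae (p := fun t : ℝ =>
        ∫⁻ x : Hor n, ‖k (x, t)‖ₑ ^ 2 ≤ M) ?_
      filter_upwards [h1, ae_restrict_mem measurableSet_Ioi] with t ht ht0
      refine le_trans (le_of_eq (lintegral_congr_ae ?_)) (hM t ht0)
      filter_upwards [ht] with x hx
      rw [hx]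
    filter_upwards [hkf, h4] with z hz1 hz2
    rw [hz1]
    exact if_pos hz2
  · by_cases ht : ∫⁻ x : Hor n, ‖k (x, t)‖ₑ ^ 2 ≤ M
    · simp [ht]
    · simp [ht]

theorem IsGradArray.exists_measurable (h : IsGradArray m d ℓ) : ∃ d', IsGradArray m d' ℓ ∧
    ∀ α ∈ multiIdx n m, Measurable (d' α) ∧ d' α =ᵐ[volume.restrict (halfSpace n)] d α := by
  obtain ⟨M, hM0, hM⟩ := h.bound
  have h1 : ∀ α, ∃ f' : Space n → ℂ, α ∈ multiIdx n m →
      Measurable f' ∧ f' =ᵐ[volume.restrict (halfSpace n)] d α ∧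
        ∀ t, ∫⁻ x : Hor n, ‖f' (x, t)‖ₑ ^ 2 ≤ ENNReal.ofReal M := by
    intro α
    by_cases hα : α ∈ multiIdx n m
    · obtain ⟨f', hf'⟩ := exists_measurable_slice_le (h.meas α hα) (hM α hα)
      exact ⟨f', fun _ => hf'⟩
    · exact ⟨0, fun h => absurd h hα⟩
  choose d' hd' using h1
  have key : ∀ α ∈ multiIdx n m, ∀ F : Space n → ℂ, ∫ z in halfSpace n, d' α z * F z =
      ∫ z in halfSpace n, d α z * F z := by
    intro α hα F
    refine integral_congr_ae ?_
    filter_upwards [(hd' α hα).2.1] with z hz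
    rw [hz]
  refine ⟨d', ⟨fun α hα => (hd' α hα).1.aestronglyMeasurable,
    ⟨M, hM0, fun α hα t _ => (hd' α hα).2.2 t⟩, ?_, ?_, ?_⟩,
    fun α hα => ⟨(hd' α hα).1, (hd' α hα).2.1⟩⟩
  · intro α hα β hβ γ δ hγδ φ hφ
    rw [key α hα, key β hβ, h.compat α hα β hβ γ δ hγδ φ hφ]
  · intro φ hφ
    rw [← h.equation φ hφ]
    exact Finset.sum_congr rfl fun α hα => by rw [key α hα]
  · intro φ hφ
    rw [← h.neumann φ hφ]
    exact Finset.sum_congr rfl fun α hα => by rw [key α hα]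

/-- All conditions are linear once the pairings converge absolutely. Measurability of the first
array is needed to estimate the slices of the difference for every t. -/
theorem IsGradArray.sub (hn : 1 ≤ n) (hm : 1 ≤ m) (h₁ : IsGradArray m d₁ ℓ)
    (h₂ : IsGradArray m d₂ ℓ) (hm₁ : ∀ α ∈ multiIdx n m, Measurable (d₁ α)) :
    IsGradArray m (fun α z => d₁ α z - d₂ α z) fun _ => 0 := by
  have key : ∀ α ∈ multiIdx n m, ∀ F : Space n → ℂ, Continuous F → SliceDecay (fun _ => 1) F →
      ∫ z in halfSpace n, (d₁ α z - d₂ α z) * F z =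
        (∫ z in halfSpace n, d₁ α z * F z) - ∫ z in halfSpace n, d₂ α z * F z := by
    intro α hα F hF hC
    simp only [sub_mul]
    exact integral_sub (h₁.integrableOn hα hF hC) (h₂.integrableOn hα hF hC)
  refine ⟨fun α hα => (h₁.meas α hα).sub (h₂.meas α hα), ?_, ?_, ?_, ?_⟩
  · obtain ⟨M₁, hM₁0, hM₁⟩ := h₁.bound
    obtain ⟨M₂, hM₂0, hM₂⟩ := h₂.bound
    exact ⟨2 * (M₁ + M₂), by positivity, fun α hα t ht => lintegral_enorm_sub_sq_le
      ((hm₁ α hα).comp measurable_prodMk_right) hM₁0 hM₂0 (hM₁ α hα t ht) (hM₂ α hα t ht)⟩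
  · intro α hα β hβ γ δ hγδ φ hφ
    rw [key α hα _ (contDiff_partialD γ hφ.1.1).continuous (hφ.1.partialD γ).sliceDecay,
      key β hβ _ (contDiff_partialD δ hφ.1.1).continuous (hφ.1.partialD δ).sliceDecay,
      h₁.compat α hα β hβ γ δ hγδ φ hφ, h₂.compat α hα β hβ γ δ hγδ φ hφ]
  · intro φ hφ
    rw [← sub_self (0 : ℂ)]
    nth_rewrite 1 [← h₁.equation φ hφ]
    rw [← h₂.equation φ hφ, ← Finset.sum_sub_distrib]
    refine Finset.sum_congr rfl fun α hα => ?_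
    rw [key α hα _ (contDiff_partialD α hφ.1.1).continuous (hφ.1.partialD α).sliceDecay, mul_sub]
  · intro φ hφ
    rw [← sub_self (ℓ φ)]
    nth_rewrite 1 [← h₁.neumann φ hφ]
    rw [← h₂.neumann φ hφ, ← Finset.sum_sub_distrib]
    refine Finset.sum_congr rfl fun α hα => ?_
    rw [key α hα _ (contDiff_partialD α (contDiff_extE hm hφ)).continuous
      (sliceDecay_extE hn hm hφ (mem_multiIdx.1 hα)), mul_sub]

theorem enorm_conj (z : ℂ) : ‖starRingEnd ℂ z‖ₑ = ‖z‖ₑ := by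
  rw [← ofReal_norm, ← ofReal_norm, RCLike.norm_conj]

theorem integral_conj_mul {s : Set (Space n)} (f g : Space n → ℂ) :
    ∫ z in s, starRingEnd ℂ (f z) * g z =
      starRingEnd ℂ (∫ z in s, f z * starRingEnd ℂ (g z)) := by
  rw [← integral_conj]
  simp

/-- The functional of Neumann data. -/
def dataPairing (m : ℕ) (g : MIdx n → Hor n → ℂ) (φ : Space n → ℂ) : ℂ :=
  ∑ γ ∈ multiIdx n (m - 1), ∫ x : Hor n, starRingEnd ℂ (g γ x) * partialD γ φ (x, 0)

/-- After this lemma the functions w themselves are no longer needed: uniqueness concerns the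
gradient only. Conjugation makes the pairing bilinear. -/
theorem IsNeumannSol.isGradArray (hn : 1 ≤ n) (hm : 1 ≤ m) {g : MIdx n → Hor n → ℂ}
    {w : Space n → ℂ} {D : MIdx n → Space n → ℂ} (h : IsNeumannSol m (specialCoeff n) g w D) :
    IsGradArray m (fun α z => starRingEnd ℂ (D α z)) (dataPairing m g) := by
  have hmeas : ∀ α ∈ multiIdx n m, AEStronglyMeasurable (fun z => starRingEnd ℂ (D α z))
      (volume.restrict (halfSpace n)) := fun α hα =>
    Complex.continuous_conj.comp_aestronglyMeasurable
      ((h.weakDeriv α hα).1.aestronglyMeasurable)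
  have hbd : ∀ α ∈ multiIdx n m, ∀ t, 0 < t →
      ∫⁻ x : Hor n, ‖starRingEnd ℂ (D α (x, t))‖ₑ ^ 2 ≤
        ENNReal.ofReal (supSlice m D).toReal := by
    intro α hα t ht
    rw [ENNReal.ofReal_toReal h.sup_lt_top.ne]
    refine le_trans (lintegral_mono fun x => ?_)
      (le_iSup (fun t : Ioi (0 : ℝ) => ∫⁻ x : Hor n, ∑ α ∈ multiIdx n m, ‖D α (x, (t : ℝ))‖ₑ ^ 2)
        ⟨t, ht⟩)
    simp only [enorm_conj]
    exact Finset.single_le_sum (f := fun α => ‖D α (x, t)‖ₑ ^ 2) (fun _ _ => zero_le) hα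
  refine ⟨hmeas, ⟨_, ENNReal.toReal_nonneg, hbd⟩, ?_, ?_, ?_⟩
  -- Both sides are (-1)^m times the integral of w against the common derivative of order α + γ = β
  -- + δ, up to conjugation.
  · intro α hα β hβ γ δ hγδ φ hφ
    have key : ∀ α ∈ multiIdx n m, ∀ γ, ∫ z in halfSpace n, starRingEnd ℂ (D α z) * partialD γ φ z =
        starRingEnd ℂ ((-1 : ℂ) ^ m * ∫ z in halfSpace n, w z *
          partialD (α + γ) (fun z => starRingEnd ℂ (φ z)) z) := by
      intro α hα γ
      have h1 := (h.weakDeriv α hα).2 _ (hφ.conj.partialD γ)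
      rw [partialD_partialD _ _ hφ.conj.1.1, mem_multiIdx.1 hα] at h1
      rw [h1, ← mul_assoc, ← mul_pow, integral_conj_mul, partialD_conj γ hφ.1.1]
      simp
    rw [key α hα, key β hβ, hγδ]
  · intro φ hφ
    have h1 := congrArg (starRingEnd ℂ) (h.equation φ hφ)
    rw [map_sum, map_zero] at h1
    rw [← h1]
    refine Finset.sum_congr rfl fun α hα => ?_
    simp only [applyCoeff_specialCoeff _ hα]
    rw [← integral_conj, ← integral_const_mul]
    refine integral_congr_ae (Eventually.of_forall fun z => ?_)
    simp only [map_mul, Complex.conj_conj, map_natCast]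
    ring
  · intro φ hφ
    obtain ⟨I, hI, hI0⟩ := h.neumann φ hφ
    have hE := contDiff_extE hm hφ
    have hint : ∀ α ∈ multiIdx n m, IntegrableOn
        (fun z => starRingEnd ℂ (D α z) * partialD α (extE m φ) z) (halfSpace n) := by
      intro α hα
      obtain ⟨C, hC⟩ := (sliceDecay_extE hn hm hφ (mem_multiIdx.1 hα)).of_one
      have hc := (contDiff_partialD α hE).continuous
      exact integrableOn_mul_of_slice (hmeas α hα) hc.aestronglyMeasurable
        (fun t => (hc.comp (by fun_prop : Continuous fun x : Hor n => (x, t))).measurable)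
        (hbd α hα) hC
    set J : ℝ → ℂ := fun t => ∑ α ∈ multiIdx n m, ∫ x : Hor n,
      starRingEnd ℂ (applyCoeff m (specialCoeff n) (fun β => D β (x, t)) α) *
        partialD α (extE m φ) (x, t) with hJ
    have hJ' : J = fun t => ∑ α ∈ multiIdx n m, (Nat.multinomial Finset.univ α.1 : ℂ) *
        ∫ x : Hor n, starRingEnd ℂ (D α (x, t)) * partialD α (extE m φ) (x, t) := by
      funext t
      refine Finset.sum_congr rfl fun α hα => ?_
      simp only [applyCoeff_specialCoeff _ hα]
      rw [← integral_const_mul]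
      simp only [map_mul, map_natCast, mul_assoc]
    have hslice : ∀ α ∈ multiIdx n m, IntegrableOn (fun t => ∫ x : Hor n,
        starRingEnd ℂ (D α (x, t)) * partialD α (extE m φ) (x, t)) (Ioi 0) ∧
        ∫ t in Ioi (0 : ℝ), ∫ x : Hor n,
          starRingEnd ℂ (D α (x, t)) * partialD α (extE m φ) (x, t) =
        ∫ z in halfSpace n, starRingEnd ℂ (D α z) * partialD α (extE m φ) z := by
      intro α hα
      have h1 := hint α hα
      rw [IntegrableOn, restrict_halfSpace] at h1
      refine ⟨h1.integral_prod_right, ?_⟩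
      rw [restrict_halfSpace]
      exact (integral_prod_symm _ h1).symm
    have hJint : IntegrableOn J (Ioi 0) := by
      rw [hJ']
      exact integrable_finsetSum _ fun α hα => (hslice α hα).1.const_mul _
    have hJtot : ∫ t in Ioi (0 : ℝ), J t = ∑ α ∈ multiIdx n m,
        (Nat.multinomial Finset.univ α.1 : ℂ) *
          ∫ z in halfSpace n, starRingEnd ℂ (D α z) * partialD α (extE m φ) z := by
      rw [hJ', integral_finsetSum _ fun α hα => (hslice α hα).1.const_mul _]
      refine Finset.sum_congr rfl fun α hα => ?_
      rw [integral_const_mul, (hslice α hα).2]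
    -- The slice pairing is integrable on the whole half-line, so each inner limit is the integral
    -- over (ε, ∞), and the outer limit is the full integral.
    rw [← hJtot]
    have hIe : ∀ ε, 0 < ε → ∫ t in Ioi ε, J t = I ε := fun ε hε =>
      tendsto_nhds_unique (intervalIntegral_tendsto_integral_Ioi ε
        (hJint.mono_set (Ioi_subset_Ioi hε.le)) tendsto_id) (hI ε hε)
    refine tendsto_nhds_unique ((tendsto_setIntegral_Ioi_zero hJint).congr' ?_) hI0
    filter_upwards [self_mem_nhdsWithin] with ε hε using hIe ε hε

/-- The zero Neumann functional disposes of ℰφ. The rest φ - ℰφ vanishes to order m at the boundary,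
hence is a limit of test functions of the half-space, for which the weak equation holds. So the
natural boundary condition is now contained in the equation. -/
theorem IsGradArray.sum_integral_eq_zero (hn : 1 ≤ n) (hm : 1 ≤ m)
    (h : IsGradArray m d fun _ => 0) {φ : Space n → ℂ} (hφ : IsTest φ) :
    ∑ α ∈ multiIdx n m, (Nat.multinomial Finset.univ α.1 : ℂ) *
      ∫ z in halfSpace n, d α z * partialD α φ z = 0 := by
  obtain ⟨M, -, hM⟩ := h.bound
  have hE := contDiff_extE hm hφ
  have hs : ContDiff ℝ ∞ fun z => φ z - extE m φ z := hφ.1.sub hE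
  have h1 : ∀ α ∈ multiIdx n m, Tendsto (fun N => ∫ z in halfSpace n, d α z *
      partialD α (fun y => cutNear n N y * (φ y - extE m φ y)) z) atTop
      (𝓝 (∫ z in halfSpace n, d α z * partialD α (fun y => φ y - extE m φ y) z)) := by
    intro α hα
    refine (tendsto_integral_cutoff (h.meas α hα) (hM α hα) α hs (contDiff_cutNear n)
      (fun z hz => cutNear_eventually n hz) fun β γ hβγ => ?_).2
    obtain ⟨C, -, hC⟩ := exists_cutNear_bound n β
    refine ⟨_, by fun_prop, hC, sliceDecay_sub_extE hn hm hφ ?_ C⟩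
    rw [hβγ, mem_multiIdx.1 hα]
  have h2 := tendsto_finsetSum _ fun α hα =>
    (h1 α hα).const_mul (Nat.multinomial Finset.univ α.1 : ℂ)
  simp only [fun N => h.equation _ (isTestHalf_cutNear_mul (N := N) hs)] at h2
  have h3 := tendsto_nhds_unique h2 tendsto_const_nhds
  rw [← h3, ← sub_eq_zero, ← Finset.sum_sub_distrib, ← h.neumann φ hφ]
  refine Finset.sum_congr rfl fun α hα => ?_
  have hE' := h.integrableOn hα (contDiff_partialD α hE).continuous
    (sliceDecay_extE hn hm hφ (mem_multiIdx.1 hα))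
  simp only [partialD_sub α hφ.1 hE, mul_sub]
  rw [integral_sub (h.integrableOn_test hα (hφ.partialD α)) hE', mul_sub]
  ring

end

section


/-! ### Symbols with bounded frequencies -/

/-- A symbol `q 0 ξ t` with its derivatives `q j ξ t` in `t`, supported in a ball of frequencies
and decaying for `t → ∞`. -/
structure BandSymbol {n : ℕ} (q : ℕ → Hor n → ℝ → ℂ) : Prop where
  deriv : ∀ j ξ t, HasDerivAt (q j ξ) (q (j + 1) ξ t) t
  meas : ∀ j t, Measurable fun ξ => q j ξ t
  supp : ∃ R : ℝ, ∀ j ξ t, R < ‖ξ‖ → q j ξ t = 0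
  bound : ∀ (j : ℕ) (T : ℝ), ∃ C : ℝ, ∀ ξ t, |t| ≤ T → ‖q j ξ t‖ ≤ C
  decay : ∀ j : ℕ, ∃ C : ℝ, 0 ≤ C ∧ ∀ ξ t, 0 ≤ t → ‖q j ξ t‖ ≤ C * ((1 + t) ^ 2)⁻¹

namespace BandSymbol

variable {n : ℕ} {q p : ℕ → Hor n → ℝ → ℂ}

theorem rapid (h : BandSymbol q) : RapidSymbol q where
  deriv := h.deriv
  meas j t := (h.meas j t).aestronglyMeasurable
  bound j N T := by
    obtain ⟨R, hR⟩ := h.supp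
    obtain ⟨C, hC⟩ := h.bound j T
    refine ⟨(1 + |R|) ^ N * |C|, fun ξ t ht => ?_⟩
    by_cases hξ : R < ‖ξ‖
    · rw [hR j ξ t hξ, norm_zero, mul_zero]; positivity
    · have h1 : ‖ξ‖ ≤ |R| := (not_lt.1 hξ).trans (le_abs_self R)
      exact mul_le_mul (pow_le_pow_left₀ (by positivity) (by linarith) _)
        ((hC ξ t ht).trans (le_abs_self C)) (norm_nonneg _) (by positivity)

theorem mul (h : BandSymbol q) {c : Hor n → ℂ} (hc : Continuous c) :
    BandSymbol fun j ξ t => c ξ * q j ξ t := by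
  obtain ⟨R, hR⟩ := h.supp
  obtain ⟨K, hK⟩ := (isCompact_closedBall (0 : Hor n) R).exists_bound_of_continuousOn hc.continuousOn
  have key : ∀ j ξ t, ‖c ξ * q j ξ t‖ ≤ |K| * ‖q j ξ t‖ := by
    intro j ξ t
    by_cases hξ : R < ‖ξ‖
    · simp [hR j ξ t hξ]
    · rw [norm_mul]
      exact mul_le_mul_of_nonneg_right ((hK ξ (mem_closedBall_zero_iff.2 (not_lt.1 hξ))).trans
        (le_abs_self K)) (norm_nonneg _)
  refine ⟨fun j ξ t => (h.deriv j ξ t).const_mul _, fun j t => hc.measurable.mul (h.meas j t),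
    ⟨R, fun j ξ t hξ => by rw [hR j ξ t hξ, mul_zero]⟩, fun j T => ?_, fun j => ?_⟩
  · obtain ⟨C, hC⟩ := h.bound j T
    exact ⟨|K| * C, fun ξ t ht => (key j ξ t).trans
      (mul_le_mul_of_nonneg_left (hC ξ t ht) (abs_nonneg K))⟩
  · obtain ⟨C, hC0, hC⟩ := h.decay j
    refine ⟨|K| * C, by positivity, fun ξ t ht => (key j ξ t).trans ?_⟩
    rw [mul_assoc]
    exact mul_le_mul_of_nonneg_left (hC ξ t ht) (abs_nonneg K)

theorem shift (h : BandSymbol q) (k : ℕ) : BandSymbol fun j => q (j + k) where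
  deriv j ξ t := by
    have := h.deriv (j + k) ξ t
    rwa [show j + k + 1 = j + 1 + k by ring] at this
  meas j t := h.meas _ t
  supp := by
    obtain ⟨R, hR⟩ := h.supp
    exact ⟨R, fun j => hR (j + k)⟩
  bound j := h.bound (j + k)
  decay j := h.decay (j + k)

theorem diff (h : BandSymbol q) (γ : MIdx n) : BandSymbol (RapidSymbol.diff q γ) :=
  (h.shift γ.2).mul (continuous_horMono γ.1)

theorem zero : BandSymbol fun (_ : ℕ) (_ : Hor n) (_ : ℝ) => (0 : ℂ) where
  deriv _ _ t := hasDerivAt_const t 0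
  meas _ _ := measurable_const
  supp := ⟨0, fun _ _ _ _ => rfl⟩
  bound _ _ := ⟨0, fun _ _ _ => by simp⟩
  decay _ := ⟨0, le_rfl, fun _ _ _ => by simp⟩

theorem add (h : BandSymbol q) (h' : BandSymbol p) : BandSymbol fun j ξ t => q j ξ t + p j ξ t where
  deriv j ξ t := (h.deriv j ξ t).add (h'.deriv j ξ t)
  meas j t := (h.meas j t).add (h'.meas j t)
  supp := by
    obtain ⟨R, hR⟩ := h.supp
    obtain ⟨R', hR'⟩ := h'.supp
    refine ⟨max R R', fun j ξ t hξ => ?_⟩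
    rw [max_lt_iff] at hξ
    rw [hR j ξ t hξ.1, hR' j ξ t hξ.2, add_zero]
  bound j T := by
    obtain ⟨C, hC⟩ := h.bound j T
    obtain ⟨C', hC'⟩ := h'.bound j T
    exact ⟨C + C', fun ξ t ht => (norm_add_le _ _).trans (add_le_add (hC ξ t ht) (hC' ξ t ht))⟩
  decay j := by
    obtain ⟨C, hC0, hC⟩ := h.decay j
    obtain ⟨C', hC0', hC'⟩ := h'.decay j
    refine ⟨C + C', by positivity, fun ξ t ht => (norm_add_le _ _).trans ?_⟩
    rw [add_mul]
    exact add_le_add (hC ξ t ht) (hC' ξ t ht)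

theorem sum {ι : Type*} (s : Finset ι) {q : ι → ℕ → Hor n → ℝ → ℂ}
    (h : ∀ i ∈ s, BandSymbol (q i)) : BandSymbol fun j ξ t => ∑ i ∈ s, q i j ξ t := by
  classical
  induction s using Finset.induction_on with
  | empty => simpa using zero
  | insert i s hi ih =>
    simp only [Finset.sum_insert hi]
    exact (h i (Finset.mem_insert_self i s)).add
      (ih fun k hk => h k (Finset.mem_insert_of_mem hk))

theorem sliceDecay_of_le (h : BandSymbol q) {wt : ℝ → ℝ} {C : ℝ}
    (hC : ∀ ξ t, 0 < t → |wt t| * ‖q 0 ξ t‖ ≤ C * ((1 + t) ^ 2)⁻¹) :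
    SliceDecay wt (symFn (q 0)) := by
  obtain ⟨R, hR⟩ := h.supp
  set V : ℝ := (volume (Metric.closedBall (0 : Hor n) R)).toReal with hV
  have hVo : volume (Metric.closedBall (0 : Hor n) R) = ENNReal.ofReal V :=
    (ENNReal.ofReal_toReal measure_closedBall_lt_top.ne).symm
  refine ⟨C ^ 2 * V, fun t ht => ?_⟩
  have h1 : ∫⁻ x : Hor n, ‖(wt t : ℂ) * symFn (q 0) (x, t)‖ₑ ^ 2 =
      ∫⁻ ξ : Hor n, ‖(wt t : ℂ) * q 0 ξ t‖ₑ ^ 2 := by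
    simp only [enorm_mul, mul_pow]
    rw [lintegral_const_mul' _ _ (by simp), lintegral_const_mul' _ _ (by simp),
      h.rapid.lintegral_slice]
  rw [h1]
  have h2 : ∀ ξ : Hor n, ‖(wt t : ℂ) * q 0 ξ t‖ₑ ^ 2 ≤
      (Metric.closedBall (0 : Hor n) R).indicator
        (fun _ => ENNReal.ofReal (C ^ 2 * ((1 + t) ^ 3)⁻¹)) ξ := by
    intro ξ
    by_cases hξ : ξ ∈ Metric.closedBall (0 : Hor n) R
    · rw [indicator_of_mem hξ, enorm_sq_eq_ofReal, norm_mul, Complex.norm_real, Real.norm_eq_abs]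
      refine ENNReal.ofReal_le_ofReal ?_
      refine (pow_le_pow_left₀ (by positivity) (hC ξ t ht) 2).trans ?_
      rw [mul_pow, ← inv_pow, ← inv_pow]
      refine mul_le_mul_of_nonneg_left ?_ (sq_nonneg C)
      rw [← pow_mul]
      exact pow_le_pow_of_le_one (by positivity) (inv_le_one_of_one_le₀ (by linarith)) (by norm_num)
    · rw [hR 0 ξ t (not_le.1 fun h => hξ (mem_closedBall_zero_iff.2 h))]
      simp
  refine (lintegral_mono h2).trans ?_
  rw [lintegral_indicator measurableSet_closedBall, setLIntegral_const, hVo,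
    ← ENNReal.ofReal_mul (by positivity)]
  exact le_of_eq (by congr 1; ring)

theorem sliceDecay_partialD (h : BandSymbol q) (γ : MIdx n) {wt : ℝ → ℝ} {C : ℝ}
    (hC : ∀ ξ t, 0 < t → |wt t| * ‖q γ.2 ξ t‖ ≤ C * ((1 + t) ^ 2)⁻¹) :
    SliceDecay wt (partialD γ (symFn (q 0))) := by
  rw [h.rapid.partialD_symFn]
  obtain ⟨R, hR⟩ := h.supp
  obtain ⟨K, hK⟩ := (isCompact_closedBall (0 : Hor n) R).exists_bound_of_continuousOn
    (continuous_horMono γ.1).continuousOn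
  refine (h.diff γ).sliceDecay_of_le (C := |K| * C) fun ξ t ht => ?_
  by_cases hξ : R < ‖ξ‖
  · have h1 := hC ξ t ht
    rw [hR _ ξ t hξ, norm_zero, mul_zero] at h1
    rw [RapidSymbol.diff, hR _ ξ t hξ, mul_zero, norm_zero, mul_zero, mul_assoc]
    exact mul_nonneg (abs_nonneg K) h1
  · rw [RapidSymbol.diff, zero_add, norm_mul, mul_left_comm, mul_assoc]
    exact mul_le_mul ((hK ξ (mem_closedBall_zero_iff.2 (not_lt.1 hξ))).trans
        (le_abs_self K)) (hC ξ t ht) (by positivity) (abs_nonneg K)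

theorem sliceDecay (h : BandSymbol q) : SliceDecay (fun _ => 1) (symFn (q 0)) := by
  obtain ⟨C, -, hC⟩ := h.decay 0
  exact h.sliceDecay_of_le (C := C) fun ξ t ht => by simpa using hC ξ t ht.le

/-- A symbol that vanishes at `t = 0` is divisible by `t`. -/
theorem norm_le_mul_of_zero (h : BandSymbol q) (h0 : ∀ ξ, q 0 ξ 0 = 0) :
    ∃ C : ℝ, ∀ ξ t, 0 < t → ‖q 0 ξ t‖ ≤ C * (t * ((1 + t) ^ 2)⁻¹) := by
  obtain ⟨C₀, hC₀0, hC₀⟩ := h.decay 0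
  obtain ⟨C₁, hC₁0, hC₁⟩ := h.decay 1
  refine ⟨C₀ + 4 * C₁, fun ξ t ht => ?_⟩
  rcases le_total 1 t with h1 | h1
  · refine (hC₀ ξ t ht.le).trans ?_
    refine mul_le_mul (by linarith) (le_mul_of_one_le_left (by positivity) h1) (by positivity)
      (by positivity)
  · have h2 := (convex_Icc (0 : ℝ) t).norm_image_sub_le_of_norm_hasDerivWithin_le
      (f := q 0 ξ) (f' := q 1 ξ) (C := C₁) (x := 0) (y := t)
      (fun s _ => (h.deriv 0 ξ s).hasDerivWithinAt) (fun s hs => (hC₁ ξ s hs.1).trans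
        (mul_le_of_le_one_right hC₁0 (inv_le_one_of_one_le₀ (one_le_pow₀ (by linarith [hs.1])))))
      (left_mem_Icc.2 ht.le) (right_mem_Icc.2 ht.le)
    rw [h0, sub_zero, sub_zero, Real.norm_of_nonneg ht.le] at h2
    refine h2.trans ?_
    have h3 : 1 ≤ 4 * ((1 + t) ^ 2)⁻¹ := by
      rw [← div_eq_mul_inv, le_div_iff₀ (by positivity)]
      nlinarith
    calc C₁ * t ≤ C₁ * t * (4 * ((1 + t) ^ 2)⁻¹) := le_mul_of_one_le_right (by positivity) h3
      _ = (4 * C₁) * (t * ((1 + t) ^ 2)⁻¹) := by ring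
      _ ≤ _ := mul_le_mul_of_nonneg_right (by linarith) (by positivity)

end BandSymbol

/-! ### Testing with functions of bounded frequency -/

variable {n m : ℕ} {d : MIdx n → Space n → ℂ} {q : ℕ → Hor n → ℝ → ℂ}

theorem IsGradArray.integrableOn_symFn {ℓ : (Space n → ℂ) → ℂ} (h : IsGradArray m d ℓ) {α : MIdx n}
    (hα : α ∈ multiIdx n m) (hq : BandSymbol q) :
    IntegrableOn (fun z => d α z * symFn (q 0) z) (halfSpace n) :=
  h.integrableOn hα hq.rapid.contDiff_symFn.continuous hq.sliceDecay

/-- Functions with bounded frequencies are not compactly supported, but all their derivatives decay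
on slices, so a cut-off at infinity can be removed. No vanishing at t = 0 is required. -/
theorem IsGradArray.sum_integral_symFn (hn : 1 ≤ n) (hm : 1 ≤ m)
    (h : IsGradArray m d fun _ => 0) (hq : BandSymbol q) :
    ∑ α ∈ multiIdx n m, (Nat.multinomial Finset.univ α.1 : ℂ) *
      ∫ z in halfSpace n, d α z * symFn (RapidSymbol.diff q α 0) z = 0 := by
  obtain ⟨M, -, hM⟩ := h.bound
  have hs : ContDiff ℝ ∞ (symFn (q 0)) := hq.rapid.contDiff_symFn
  have h1 : ∀ α ∈ multiIdx n m, Tendsto (fun N => ∫ z in halfSpace n, d α z *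
      partialD α (fun y => cutFar n N y * symFn (q 0) y) z) atTop
      (𝓝 (∫ z in halfSpace n, d α z * symFn (RapidSymbol.diff q α 0) z)) := by
    intro α hα
    rw [← hq.rapid.partialD_symFn]
    refine (tendsto_integral_cutoff (h.meas α hα) (hM α hα) α hs (contDiff_cutFar n)
      (fun z _ => cutFar_eventually n z) fun β γ hβγ => ?_).2
    obtain ⟨C, hC0, hC⟩ := exists_cutFar_bound n β
    obtain ⟨K, -, hK⟩ := hq.decay γ.2
    refine ⟨fun _ => C, measurable_const, fun N z hz => (hC N z hz).trans
      (mul_le_of_le_one_right hC0 (inv_le_one_of_one_le₀ (one_le_pow₀ (by linarith)))),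
      hq.sliceDecay_partialD γ (C := C * K) fun ξ t ht => ?_⟩
    rw [abs_of_nonneg hC0, mul_assoc]
    exact mul_le_mul_of_nonneg_left (hK ξ t ht.le) hC0
  have h2 := tendsto_finsetSum _ fun α hα =>
    (h1 α hα).const_mul (Nat.multinomial Finset.univ α.1 : ℂ)
  simp only [fun N => h.sum_integral_eq_zero hn hm (isTest_cutFar_mul (N := N) hs)] at h2
  exact tendsto_nhds_unique h2 tendsto_const_nhds

/-- The cut-off near the boundary costs t^(-k) when it receives k vertical derivatives; `hflat` asks
that the symbol vanish to the matching order. Purely horizontal γ and δ need no vanishing at all. -/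
theorem IsGradArray.compat_symFn {ℓ : (Space n → ℂ) → ℂ} (h : IsGradArray m d ℓ)
    (hq : BandSymbol q) {α β : MIdx n} (hα : α ∈ multiIdx n m) (hβ : β ∈ multiIdx n m)
    {γ δ : MIdx n} (hγδ : α + γ = β + δ)
    (hflat : ∀ k j, (k + j = γ.2 ∨ k + j = δ.2) → ∃ C : ℝ, ∀ ξ t, 0 < t →
      ‖q j ξ t‖ ≤ C * (t ^ k * ((1 + t) ^ 2)⁻¹)) :
    ∫ z in halfSpace n, d α z * symFn (RapidSymbol.diff q γ 0) z =
      ∫ z in halfSpace n, d β z * symFn (RapidSymbol.diff q δ 0) z := by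
  obtain ⟨M, -, hM⟩ := h.bound
  have hs : ContDiff ℝ ∞ (symFn (q 0)) := hq.rapid.contDiff_symFn
  have key : ∀ α ∈ multiIdx n m, ∀ γ : MIdx n, (∀ k j, k + j = γ.2 → ∃ C : ℝ, ∀ ξ t, 0 < t →
      ‖q j ξ t‖ ≤ C * (t ^ k * ((1 + t) ^ 2)⁻¹)) →
      Tendsto (fun N => ∫ z in halfSpace n, d α z *
        partialD γ (fun y => cutNear n N y * symFn (q 0) y) z) atTop
        (𝓝 (∫ z in halfSpace n, d α z * symFn (RapidSymbol.diff q γ 0) z)) := by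
    intro α hα γ hγ
    rw [← hq.rapid.partialD_symFn]
    refine (tendsto_integral_cutoff (h.meas α hα) (hM α hα) γ hs (contDiff_cutNear n)
      (fun z hz => cutNear_eventually n hz) fun β γ' hβγ => ?_).2
    obtain ⟨C, hC0, hC⟩ := exists_cutNear_bound n β
    obtain ⟨K, hK⟩ := hγ β.2 γ'.2 (by rw [← hβγ]; rfl)
    refine ⟨fun t => C * (t ^ β.2)⁻¹, by fun_prop, fun N z hz => (hC N z hz).trans ?_,
      hq.sliceDecay_partialD γ' (C := C * K) fun ξ t ht => ?_⟩
    · exact mul_le_mul_of_nonneg_left (mul_le_of_le_one_right (by positivity)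
        (inv_le_one_of_one_le₀ (one_le_pow₀ (by linarith)))) hC0
    · have hp : 0 < t ^ β.2 := pow_pos ht _
      rw [abs_of_nonneg (by positivity), mul_assoc, mul_assoc]
      refine mul_le_mul_of_nonneg_left ?_ hC0
      rw [inv_mul_le_iff₀ hp]
      exact (hK ξ t ht).trans (le_of_eq (by ring))
  refine tendsto_nhds_unique (key α hα γ fun k j hkj => hflat k j (Or.inl hkj)) ?_
  refine (key β hβ δ fun k j hkj => hflat k j (Or.inr hkj)).congr fun N => ?_
  exact (h.compat α hα β hβ γ δ hγδ _ (isTestHalf_cutNear_mul hs)).symm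

end

section


/-! ### Reduction to one component -/

variable {n m : ℕ} {d : MIdx n → Space n → ℂ} {q p : ℕ → Hor n → ℝ → ℂ}
  {ℓ : (Space n → ℂ) → ℂ}

theorem symFn_sum {ι : Type*} (s : Finset ι) {q : ι → ℕ → Hor n → ℝ → ℂ}
    (h : ∀ i ∈ s, BandSymbol (q i)) (z : Space n) :
    symFn (fun ξ t => ∑ i ∈ s, q i 0 ξ t) z = ∑ i ∈ s, symFn (q i 0) z := by
  simp only [symFn_eq_integral]
  rw [← integral_finsetSum]
  · simp only [Finset.mul_sum]
  · intro i hi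
    have h1 := (h i hi).rapid.integrable 0 z.2
    refine h1.bdd_mul (c := 1) (Continuous.aestronglyMeasurable ?_) (Eventually.of_forall fun ξ => ?_)
    · simp only [ell_apply]
      fun_prop
    · rw [Complex.norm_exp]
      simp [ell_apply]

theorem IsGradArray.integral_symFn_sum (h : IsGradArray m d ℓ) {α : MIdx n}
    (hα : α ∈ multiIdx n m) {ι : Type*} (s : Finset ι) {q : ι → ℕ → Hor n → ℝ → ℂ}
    (hq : ∀ i ∈ s, BandSymbol (q i)) :
    ∫ z in halfSpace n, d α z * symFn (fun ξ t => ∑ i ∈ s, q i 0 ξ t) z =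
      ∑ i ∈ s, ∫ z in halfSpace n, d α z * symFn (q i 0) z := by
  rw [← integral_finsetSum _ fun i hi => h.integrableOn_symFn hα (hq i hi)]
  refine integral_congr_ae (Eventually.of_forall fun z => ?_)
  simp only [symFn_sum s hq, Finset.mul_sum]

theorem symFn_const_mul (c : ℂ) (q : Hor n → ℝ → ℂ) (z : Space n) :
    symFn (fun ξ t => c * q ξ t) z = c * symFn q z := by
  rw [symFn_eq_integral, symFn_eq_integral, ← integral_const_mul]
  refine integral_congr_ae (Eventually.of_forall fun ξ => ?_)
  simp only
  ring

theorem integral_symFn_const_mul {f : Space n → ℂ} (c : ℂ) (q : Hor n → ℝ → ℂ) :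
    ∫ z in halfSpace n, f z * symFn (fun ξ t => c * q ξ t) z =
      c * ∫ z in halfSpace n, f z * symFn q z := by
  rw [← integral_const_mul]
  refine integral_congr_ae (Eventually.of_forall fun z => ?_)
  simp only [symFn_const_mul]
  ring

/-- The multiindex with `m - j` derivatives in the direction `x_{i₀}` and `j` in `t`. -/
def mixIdx (m : ℕ) (i₀ : Fin n) (j : ℕ) : MIdx n := (Pi.single i₀ (m - j), j)

theorem mixIdx_mem {i₀ : Fin n} {j : ℕ} (hj : j ≤ m) : mixIdx m i₀ j ∈ multiIdx n m := by
  rw [mem_multiIdx, MIdx.len, mixIdx, Finset.sum_pi_single']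
  simp only [Finset.mem_univ, if_true]
  omega

/-- The pairing with the component `mixIdx m i₀ j` of the gradient array. -/
def mixPair (m : ℕ) (d : MIdx n → Space n → ℂ) (i₀ : Fin n) (j : ℕ) (p : Hor n → ℝ → ℂ) : ℂ :=
  ∫ z in halfSpace n, d (mixIdx m i₀ j) z * symFn (fun ξ t => horMono (Pi.single i₀ j) ξ * p ξ t) z

theorem IsGradArray.mixPair_sum (h : IsGradArray m d ℓ) (i₀ : Fin n) {j : ℕ} (hj : j ≤ m)
    {ι : Type*} (s : Finset ι) {q : ι → ℕ → Hor n → ℝ → ℂ} (hq : ∀ i ∈ s, BandSymbol (q i)) :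
    mixPair m d i₀ j (fun ξ t => ∑ i ∈ s, q i 0 ξ t) = ∑ i ∈ s, mixPair m d i₀ j (q i 0) := by
  simp only [mixPair, Finset.mul_sum]
  exact h.integral_symFn_sum (mixIdx_mem hj) s (q := fun i k ξ t =>
    horMono (Pi.single i₀ j) ξ * q i k ξ t) fun i hi => (hq i hi).mul (continuous_horMono _)

theorem mixPair_const_mul (i₀ : Fin n) (j : ℕ) (c : ℂ) (p : Hor n → ℝ → ℂ) :
    mixPair m d i₀ j (fun ξ t => c * p ξ t) = c * mixPair m d i₀ j p := by
  rw [mixPair, mixPair, ← integral_symFn_const_mul]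
  simp only [mul_left_comm]

theorem IsGradArray.mixPair_sub (h : IsGradArray m d ℓ) (i₀ : Fin n) {j : ℕ} (hj : j ≤ m)
    (hq : BandSymbol q) (hp : BandSymbol p) :
    mixPair m d i₀ j (fun ξ t => q 0 ξ t - p 0 ξ t) =
      mixPair m d i₀ j (q 0) - mixPair m d i₀ j (p 0) := by
  have h1 := h.mixPair_sum i₀ hj Finset.univ
    (q := fun b : Bool => if b then q else fun k ξ t => (-1) * p k ξ t) (by
      intro b _
      cases b
      · simpa using hp.mul (continuous_const (y := (-1 : ℂ)))
      · simpa using hq)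
  simp only [Fintype.sum_bool, if_true, Bool.false_eq_true, if_false] at h1
  rw [mixPair_const_mul] at h1
  rw [sub_eq_add_neg, ← neg_one_mul (mixPair m d i₀ j (p 0)), ← h1]
  congr 1
  funext ξ t
  ring

/-- Exchanges ∂_{i₀} on the test side for ∂_t and lowers the vertical order of the component of d.
Only one vertical derivative is involved, so p = 0 at t = 0 suffices. -/
theorem IsGradArray.mixPair_succ (h : IsGradArray m d ℓ) (i₀ : Fin n) {j : ℕ} (hj : j < m)
    (hp : BandSymbol p) (h0 : ∀ ξ, p 0 ξ 0 = 0) :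
    mixPair m d i₀ (j + 1) (p 0) = mixPair m d i₀ j (p 1) := by
  set P : ℕ → Hor n → ℝ → ℂ := fun k ξ t => horMono (Pi.single i₀ j) ξ * p k ξ t with hPdef
  have hP : BandSymbol P := hp.mul (continuous_horMono _)
  have h1 := h.compat_symFn hP (mixIdx_mem (i₀ := i₀) (show j + 1 ≤ m by omega))
    (mixIdx_mem (i₀ := i₀) hj.le) (γ := (Pi.single i₀ 1, 0)) (δ := (0, 1)) (by
      simp only [mixIdx, Prod.mk_add_mk, add_zero]
      rw [← Pi.single_add, show m - (j + 1) + 1 = m - j by omega]) (by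
      have hdec : ∀ j, ∃ C : ℝ, ∀ ξ t, 0 < t → ‖P j ξ t‖ ≤ C * (t ^ 0 * ((1 + t) ^ 2)⁻¹) := by
        intro j
        obtain ⟨C, -, hC⟩ := hP.decay j
        exact ⟨C, fun ξ t ht => by simpa using hC ξ t ht.le⟩
      rintro k i (hki | hki)
      · obtain rfl : k = 0 := by simp at hki; omega
        exact hdec i
      · simp only at hki
        rcases Nat.eq_zero_or_pos k with rfl | hk
        · exact hdec i
        · obtain ⟨rfl, rfl⟩ : k = 1 ∧ i = 0 := by omega
          obtain ⟨C, hC⟩ := hP.norm_le_mul_of_zero fun ξ => by simp [hPdef, h0]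
          exact ⟨C, fun ξ t ht => by simpa using hC ξ t ht⟩)
  unfold mixPair
  have e1 : (fun ξ t => horMono (Pi.single i₀ (j + 1)) ξ * p 0 ξ t) =
      RapidSymbol.diff P (Pi.single i₀ 1, 0) 0 := by
    funext ξ t
    simp only [RapidSymbol.diff, hPdef, horMono_single]
    ring
  have e2 : (fun ξ t => horMono (Pi.single i₀ j) ξ * p 1 ξ t) = RapidSymbol.diff P (0, 1) 0 := by
    funext ξ t
    simp [RapidSymbol.diff, hPdef, horMono]
  rw [e1, e2]
  exact h1

/-- Testing with ∂_{i₀}^m q leaves enough horizontal derivatives to replace each component (β, j) by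
the one with all its horizontal derivatives in direction i₀. The multinomial theorem then sums the
symbols. -/
theorem IsGradArray.sum_mixPair (hn : 1 ≤ n) (hm : 1 ≤ m) (h : IsGradArray m d fun _ => 0)
    (i₀ : Fin n) (hq : BandSymbol q) :
    ∑ j ∈ Finset.range (m + 1),
      mixPair m d i₀ j (fun ξ t => (-(tau ξ : ℂ) ^ 2) ^ (m - j) * q j ξ t) = 0 := by
  rw [← h.sum_integral_symFn hn hm (hq.mul (continuous_horMono (Pi.single i₀ m))), sum_multiIdx]
  refine Finset.sum_congr rfl fun j hj => ?_
  have hj' : j ≤ m := by have := Finset.mem_range.1 hj; omega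
  -- Q is chosen so that ∂_{i₀}^(m-j) Q is the test symbol paired with the component (β, j), while
  -- ∂^β Q is the one paired with `mixIdx m i₀ j`.
  set Q : (Fin n → ℕ) → ℕ → Hor n → ℝ → ℂ := fun β k ξ t =>
    horMono (β + Pi.single i₀ j) ξ * q (k + j) ξ t with hQdef
  have hQ : ∀ β, BandSymbol (Q β) := fun β => (hq.shift j).mul (continuous_horMono _)
  have e1 : (fun ξ t => (-(tau ξ : ℂ) ^ 2) ^ (m - j) * q j ξ t) = fun ξ t =>
      ∑ β ∈ Finset.piAntidiag Finset.univ (m - j), (Nat.multinomial Finset.univ β : ℂ) *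
        ((horMono β ξ) ^ 2 * q (0 + j) ξ t) := by
    funext ξ t
    rw [← sum_horMono_sq, Finset.sum_pow_eq_sum_piAntidiag, Finset.sum_mul, zero_add]
    refine Finset.sum_congr rfl fun β _ => ?_
    rw [horMono, ← Finset.prod_pow]
    simp only [mul_assoc, ← pow_mul, mul_comm 2]
  rw [e1, h.mixPair_sum i₀ hj' _ (q := fun β k ξ t => (Nat.multinomial Finset.univ β : ℂ) *
    ((horMono β ξ) ^ 2 * q (k + j) ξ t)) fun β _ => ((hq.shift j).mul
      ((continuous_horMono β).pow 2)).mul continuous_const]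
  refine Finset.sum_congr rfl fun β hβ => ?_
  have hβm : (β, j) ∈ multiIdx n m := by
    rw [mem_multiIdx, MIdx.len]
    have := (Finset.mem_piAntidiag.1 hβ).1
    simp only [this]
    omega
  rw [mixPair_const_mul]
  congr 1
  have h1 := h.compat_symFn (hQ β) hβm (mixIdx_mem (i₀ := i₀) hj') (γ := (Pi.single i₀ (m - j), 0))
    (δ := (β, 0)) (by simp [mixIdx, add_comm]) (by
      intro k i hki
      obtain ⟨rfl, rfl⟩ : k = 0 ∧ i = 0 := by simp at hki; omega
      obtain ⟨C, -, hC⟩ := (hQ β).decay 0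
      exact ⟨C, fun ξ t ht => by simpa using hC ξ t ht.le⟩)
  have e2 : RapidSymbol.diff (Q β) (Pi.single i₀ (m - j), 0) 0 =
      RapidSymbol.diff (fun k ξ t => horMono (Pi.single i₀ m) ξ * q k ξ t) (β, j) 0 := by
    funext ξ t
    have : (horMono (Pi.single i₀ m) ξ : ℂ) =
        horMono (Pi.single i₀ (m - j)) ξ * horMono (Pi.single i₀ j) ξ := by
      rw [← horMono_add, ← Pi.single_add, Nat.sub_add_cancel hj']
    simp only [RapidSymbol.diff, hQdef, this, horMono_add, zero_add, add_zero]
    ring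
  have e3 : RapidSymbol.diff (Q β) (β, 0) 0 = fun ξ t => horMono (Pi.single i₀ j) ξ *
      ((horMono β ξ) ^ 2 * q (0 + j) ξ t) := by
    funext ξ t
    simp only [RapidSymbol.diff, hQdef, horMono_add, zero_add, add_zero]
    ring
  rw [e2, e3] at h1
  exact h1.symm

/-- The Neumann boundary symbols of `q`. -/
def bdrySym (m : ℕ) (q : ℕ → Hor n → ℝ → ℂ) (j : ℕ) : ℕ → Hor n → ℝ → ℂ :=
  fun k ξ t => bdry m ((tau ξ : ℂ) ^ 2) (fun i => q (i + k) ξ t) j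

theorem BandSymbol.bdrySym (hq : BandSymbol q) (j : ℕ) : BandSymbol (bdrySym m q j) := by
  unfold HigherOrderNeumann.bdrySym bdry
  refine BandSymbol.sum _ (q := fun i k ξ t => (-1 : ℂ) ^ i * ((tau ξ : ℂ) ^ 2) ^ (m - j - i) *
    q (j + 2 * i + k) ξ t) fun i _ => ?_
  have h1 := (hq.shift (j + 2 * i)).mul (c := fun ξ => (-1 : ℂ) ^ i *
    ((tau ξ : ℂ) ^ 2) ^ (m - j - i)) (by fun_prop)
  simpa only [add_comm] using h1

/-- All vertical orders are moved from d to q. The terms at the boundary are the Neumann operators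
of q, which vanish by `h0`, and what is left is the equation applied to q, against one purely
horizontal component. -/
theorem IsGradArray.integral_bdrySym (hn : 1 ≤ n) (hm : 1 ≤ m) (h : IsGradArray m d fun _ => 0)
    (i₀ : Fin n) (hq : BandSymbol q) (h0 : ∀ j < m, ∀ ξ, bdrySym m q (j + 1) 0 ξ 0 = 0) :
    ∫ z in halfSpace n, d (Pi.single i₀ m, 0) z * symFn (bdrySym m q 0 0) z = 0 := by
  -- Summation from the highest vertical order downwards. In each step `mixPair_succ` trades a
  -- boundary symbol in component j+1 for its t-derivative in component j, and `bdry_rec` absorbs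
  -- this into the next boundary symbol.
  have key : ∀ k ≤ m, ∑ i ∈ Finset.range (k + 1), mixPair m d i₀ (m - i)
      (fun ξ t => (-(tau ξ : ℂ) ^ 2) ^ i * q (m - i) ξ t) =
        (-1) ^ k * mixPair m d i₀ (m - k) (bdrySym m q (m - k) 0) := by
    intro k
    induction k with
    | zero =>
      intro _
      have e : bdrySym m q m 0 = fun ξ t => q m ξ t := by
        funext ξ t
        simp [bdrySym, bdry_top]
      simp [e]
    | succ k ih =>
      intro hk
      rw [Finset.sum_range_succ, ih (by omega)]
      obtain ⟨j, hj⟩ : ∃ j, m - k = j + 1 := ⟨m - k - 1, by omega⟩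
      have hj' : m - (k + 1) = j := by omega
      have hjm : j < m := by omega
      have e : bdrySym m q j 0 = fun ξ t => ((tau ξ : ℂ) ^ 2) ^ (m - j) * q (0 + j) ξ t -
          bdrySym m q (j + 1) (0 + 1) ξ t := by
        funext ξ t
        simp only [bdrySym, add_zero, zero_add]
        exact bdry_rec _ _ hjm
      have e2 : (fun ξ t => (-(tau ξ : ℂ) ^ 2) ^ (k + 1) * q j ξ t) = fun ξ t =>
          (-1 : ℂ) ^ (k + 1) * (((tau ξ : ℂ) ^ 2) ^ (m - j) * q (0 + j) ξ t) := by
        funext ξ t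
        rw [neg_pow, show m - j = k + 1 by omega, zero_add]
        ring
      rw [hj, hj', h.mixPair_succ i₀ hjm (hq.bdrySym (j + 1)) (h0 j hjm), e,
        h.mixPair_sub i₀ hjm.le (q := fun i ξ t => ((tau ξ : ℂ) ^ 2) ^ (m - j) * q (i + j) ξ t)
          (p := fun i => bdrySym m q (j + 1) (i + 1))
          ((hq.shift j).mul (c := fun ξ => ((tau ξ : ℂ) ^ 2) ^ (m - j)) (by fun_prop))
          ((hq.bdrySym (j + 1)).shift 1), e2, mixPair_const_mul]
      simp only [zero_add]
      ring
  have h1 := key m le_rfl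
  rw [← Finset.sum_range_reflect] at h1
  have h2 := h.sum_mixPair hn hm i₀ hq
  rw [Nat.sub_self] at h1
  have h3 : mixPair m d i₀ 0 (bdrySym m q 0 0) = 0 := by
    refine (mul_eq_zero.1 (h1.symm.trans ((Finset.sum_congr rfl fun j hj => ?_).trans h2))).resolve_left
      (by simp)
    have := Finset.mem_range.1 hj
    rw [show m - (m + 1 - 1 - j) = j by omega, show m + 1 - 1 - j = m - j by omega]
  simpa [mixPair, mixIdx, horMono] using h3

end

section


/-! ### Exponential symbols -/

variable {n m : ℕ} {d : MIdx n → Space n → ℂ} {ℓ : (Space n → ℂ) → ℂ}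

/-- On the compact set K the real part of z is bounded away from zero, so the decay in t is
exponential, uniformly in ξ. -/
theorem bandSymbol_exp {K : Set (Hor n)} (hK : IsCompact K) {c z : Hor n → ℂ} (hcm : Measurable c)
    (hc : ContinuousOn c K) (hc0 : ∀ ξ ∉ K, c ξ = 0) (hz : Continuous z)
    (hz0 : ∀ ξ ∈ K, (z ξ).re < 0) :
    BandSymbol fun j ξ (t : ℝ) => c ξ * z ξ ^ j * Complex.exp (t * z ξ) := by
  obtain ⟨A, hA⟩ := hK.exists_bound_of_continuousOn hc
  obtain ⟨B, hB⟩ := hK.exists_bound_of_continuousOn hz.continuousOn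
  obtain ⟨δ, hδ, hδ'⟩ := hK.exists_forall_le' (f := fun ξ => -(z ξ).re) (a := 0)
    (Complex.continuous_re.comp hz).neg.continuousOn fun ξ hξ => by linarith [hz0 ξ hξ]
  obtain ⟨R, hR⟩ := hK.isBounded.subset_closedBall (0 : Hor n)
  have key : ∀ j ξ (t : ℝ), ‖c ξ * z ξ ^ j * Complex.exp (t * z ξ)‖ ≤
      |A| * |B| ^ j * Real.exp (t * (z ξ).re) := by
    intro j ξ t
    rw [norm_mul, norm_mul, norm_pow, Complex.norm_exp, Complex.re_ofReal_mul]
    by_cases hξ : ξ ∈ K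
    · refine mul_le_mul_of_nonneg_right (mul_le_mul ((hA ξ hξ).trans (le_abs_self A))
        (pow_le_pow_left₀ (norm_nonneg _) ((hB ξ hξ).trans (le_abs_self B)) j) (by positivity)
        (abs_nonneg A)) (Real.exp_pos _).le
    · rw [hc0 ξ hξ, norm_zero, zero_mul, zero_mul]; positivity
  refine ⟨fun j ξ t => ?_, fun j t => by fun_prop, ⟨R, fun j ξ t hξ => ?_⟩, fun j T => ?_, fun j => ?_⟩
  · have := (hasDerivAt_cexp_ofReal_mul (z ξ) t).const_mul (c ξ * z ξ ^ j)
    rwa [← mul_assoc, mul_assoc (c ξ), ← pow_succ] at this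
  · rw [hc0 ξ fun h => (mem_closedBall_zero_iff.1 (hR h)).not_gt hξ, zero_mul, zero_mul]
  · refine ⟨|A| * |B| ^ j * Real.exp (T * |B|), fun ξ t ht => ?_⟩
    by_cases hξ : ξ ∈ K
    · refine (key j ξ t).trans (mul_le_mul_of_nonneg_left (Real.exp_le_exp.2 ?_) (by positivity))
      have h1 : |(z ξ).re| ≤ |B| :=
        (Complex.abs_re_le_norm _).trans ((hB ξ hξ).trans (le_abs_self B))
      calc t * (z ξ).re ≤ |t| * |(z ξ).re| := by rw [← abs_mul]; exact le_abs_self _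
        _ ≤ T * |B| := mul_le_mul ht h1 (abs_nonneg _) ((abs_nonneg t).trans ht)
    · rw [hc0 ξ hξ, zero_mul, zero_mul, norm_zero]; positivity
  · obtain ⟨C, -, hC⟩ := exists_pow_mul_exp_le 2 hδ
    refine ⟨|A| * |B| ^ j * |C|, by positivity, fun ξ t ht => ?_⟩
    by_cases hξ : ξ ∈ K
    · refine (key j ξ t).trans ?_
      rw [mul_assoc (|A| * |B| ^ j)]
      refine mul_le_mul_of_nonneg_left ?_ (by positivity)
      rw [← div_eq_mul_inv, le_div_iff₀ (by positivity), mul_comm]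
      refine le_trans (mul_le_mul_of_nonneg_left (Real.exp_le_exp.2 ?_) (by positivity))
        ((hC t ht).trans (le_abs_self C))
      have := mul_le_mul_of_nonneg_left (hδ' ξ hξ) ht
      linarith
    · rw [hc0 ξ hξ, zero_mul, zero_mul, norm_zero]; positivity

/-- A geometric sum in -σ² and τ² can vanish only if the (m+1)-st powers agree, which |σ| > τ
excludes. Hence exp(-σt) is not resonant. -/
theorem bdry_exp_ne_zero {τ : ℝ} (hτ : 0 ≤ τ) {σ : ℂ} (hσ : τ + 1 ≤ ‖σ‖) :
    bdry m ((τ : ℂ) ^ 2) (fun j => (-σ) ^ j) 0 ≠ 0 := by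
  intro h0
  have h1 : bdry m ((τ : ℂ) ^ 2) (fun j => (-σ) ^ j) 0 =
      ∑ i ∈ Finset.range (m + 1), (-σ ^ 2) ^ i * ((τ : ℂ) ^ 2) ^ (m + 1 - 1 - i) := by
    refine Finset.sum_congr rfl fun i hi => ?_
    simp only [zero_add, Nat.sub_zero, Nat.add_sub_cancel]
    rw [neg_pow (σ ^ 2), pow_mul, neg_sq]
    ring
  have h2 := (Commute.all (-σ ^ 2) ((τ : ℂ) ^ 2)).geom_sum₂_mul (m + 1)
  rw [← h1, h0, zero_mul, eq_comm, sub_eq_zero] at h2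
  have h3 := congrArg norm h2
  rw [norm_pow, norm_pow, norm_neg, norm_pow, norm_pow, Complex.norm_real,
    Real.norm_of_nonneg hτ, ← pow_mul, ← pow_mul] at h3
  exact absurd h3 (pow_lt_pow_left₀ (by linarith) hτ (by omega)).ne'

/-- Duality: q solves the ordinary differential equation with right-hand side a(ξ) exp(-σt) and zero
Neumann data. It is the particular solution exp(-σt)/P(ξ,0) corrected by decaying exponentials,
which exist by the invertibility of `neuMat`. -/
theorem IsGradArray.integral_symFn_exp (hn : 1 ≤ n) (hm : 1 ≤ m) (h : IsGradArray m d fun _ => 0)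
    (i₀ : Fin n) {a : Hor n → ℝ} (ha : Continuous a) (hac : HasCompactSupport a)
    (ha0 : (0 : Hor n) ∉ tsupport a) {σ : ℂ} (hσ0 : 0 < σ.re)
    (hσ : ∀ ξ ∈ tsupport a, tau ξ + 1 ≤ ‖σ‖) :
    IntegrableOn (fun z => d (Pi.single i₀ m, 0) z *
      symFn (fun ξ (t : ℝ) => (a ξ : ℂ) * Complex.exp (t * (-σ))) z) (halfSpace n) ∧
    ∫ z in halfSpace n, d (Pi.single i₀ m, 0) z *
      symFn (fun ξ (t : ℝ) => (a ξ : ℂ) * Complex.exp (t * (-σ))) z = 0 := by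
  set P : Hor n → ℕ → ℂ := fun ξ k => bdry m ((tau ξ : ℂ) ^ 2) (fun j => (-σ) ^ j) k with hP
  have hPc : ∀ k, Continuous fun ξ => P ξ k := by
    intro k
    simp only [hP, bdry]
    fun_prop
  have hτ : ∀ ξ ∈ tsupport a, (tau ξ : ℂ) ≠ 0 := fun ξ hξ =>
    Complex.ofReal_ne_zero.2 (tau_pos fun h0 => ha0 (h0 ▸ hξ)).ne'
  have hP0 : ∀ ξ ∈ tsupport a, P ξ 0 ≠ 0 := fun ξ hξ =>
    bdry_exp_ne_zero (tau_nonneg ξ) (hσ ξ hξ)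
  have hac' : Continuous fun ξ => (a ξ : ℂ) := Complex.continuous_ofReal.comp ha
  set z : Option (Fin m) → Hor n → ℂ := fun o ξ => o.elim (-σ) fun l => root m l * tau ξ with hz
  -- The index `none` is the particular solution; the others cancel its boundary operators
  -- P(ξ,k+1)/P(ξ,0).
  set c : Option (Fin m) → Hor n → ℂ := fun o ξ => o.elim (a ξ * (P ξ 0)⁻¹)
    fun l => a ξ * neuCoef m (tau ξ) (fun k => -((P ξ 0)⁻¹ * P ξ (k + 1))) l with hc
  have hE : ∀ o, BandSymbol fun j ξ (t : ℝ) => c o ξ * z o ξ ^ j * Complex.exp (t * z o ξ) := by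
    intro o
    have hoff : ∀ ξ ∉ tsupport a, c o ξ = 0 := by
      intro ξ hξ
      have : a ξ = 0 := image_eq_zero_of_notMem_tsupport hξ
      cases o <;> simp [hc, this]
    cases o with
    | none =>
      refine bandSymbol_exp hac ?_ ?_ hoff continuous_const fun ξ _ => by simpa [hz] using hσ0
      · exact hac'.measurable.mul (hPc 0).measurable.inv
      · exact hac'.continuousOn.mul ((hPc 0).continuousOn.inv₀ hP0)
    | some l =>
      refine bandSymbol_exp hac ?_ ?_ hoff (by simp only [hz, Option.elim]; fun_prop) fun ξ hξ => ?_
      · simp only [hc, Option.elim, neuCoef]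
        refine hac'.measurable.mul (Finset.measurable_fun_sum _ fun k _ => ?_)
        refine Measurable.const_mul (Measurable.div ?_ ?_) _
        · exact ((hPc 0).measurable.inv.mul (hPc _).measurable).neg
        · exact Continuous.measurable (by fun_prop)
      · simp only [hc, Option.elim, neuCoef]
        refine hac'.continuousOn.mul (continuousOn_finsetSum _ fun k _ => ?_)
        refine continuousOn_const.mul (ContinuousOn.div ?_ ?_ fun ξ hξ => pow_ne_zero _ (hτ ξ hξ))
        · exact (((hPc 0).continuousOn.inv₀ hP0).mul (hPc _).continuousOn).neg
        · exact Continuous.continuousOn (by fun_prop)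
      · simp only [hz, Option.elim, Complex.re_mul_ofReal]
        exact mul_neg_of_neg_of_pos (root_re_neg l) (tau_pos fun h0 => ha0 (h0 ▸ hξ))
  set q : ℕ → Hor n → ℝ → ℂ := fun j ξ t =>
    ∑ o : Option (Fin m), c o ξ * z o ξ ^ j * Complex.exp (t * z o ξ) with hq
  have hqB : BandSymbol q := BandSymbol.sum _ fun o _ => hE o
  have hbd : ∀ k ξ (t : ℝ), bdrySym m q k 0 ξ t = ∑ o : Option (Fin m),
      c o ξ * Complex.exp (t * z o ξ) * bdry m ((tau ξ : ℂ) ^ 2) (fun j => z o ξ ^ j) k := by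
    intro k ξ t
    rw [← bdry_sum, bdrySym]
    congr 1
    funext j
    simp only [hq, add_zero]
    exact Finset.sum_congr rfl fun o _ => by ring
  have h0 : ∀ j < m, ∀ ξ, bdrySym m q (j + 1) 0 ξ 0 = 0 := by
    intro j hj ξ
    rw [hbd]
    by_cases hξ : ξ ∈ tsupport a
    · have h1 := bdry_neuCoef (hτ ξ hξ) (fun k : Fin m => -((P ξ 0)⁻¹ * P ξ (k + 1))) ⟨j, hj⟩
      rw [bdry_sum] at h1
      simp only at h1
      rw [Fintype.sum_option]
      simp only [hc, hz, Option.elim, Complex.ofReal_zero, zero_mul, Complex.exp_zero, mul_one,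
        mul_assoc, ← Finset.mul_sum]
      rw [h1, ← mul_add]
      simp [hP]
    · have : a ξ = 0 := image_eq_zero_of_notMem_tsupport hξ
      refine Finset.sum_eq_zero fun o _ => ?_
      cases o <;> simp [hc, this]
  -- The characteristic exponentials solve the homogeneous equation, so only the particular solution
  -- contributes.
  have hR : bdrySym m q 0 0 = fun ξ (t : ℝ) => (a ξ : ℂ) * Complex.exp (t * (-σ)) := by
    funext ξ t
    rw [hbd, Fintype.sum_option]
    simp only [hc, hz, Option.elim, bdry_root_zero, mul_zero, Finset.sum_const_zero, add_zero]
    by_cases hξ : ξ ∈ tsupport a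
    · have h1 : (P ξ 0)⁻¹ * bdry m ((tau ξ : ℂ) ^ 2) (fun j => (-σ) ^ j) 0 = 1 :=
        inv_mul_cancel₀ (hP0 ξ hξ)
      linear_combination ((a ξ : ℂ) * Complex.exp (t * (-σ))) * h1
    · have : a ξ = 0 := image_eq_zero_of_notMem_tsupport hξ
      simp [this]
  have h1 := h.integral_bdrySym hn hm i₀ hqB h0
  have h2 := h.integrableOn_symFn (α := (Pi.single i₀ m, 0)) (by
    simpa [mixIdx] using mixIdx_mem (i₀ := i₀) (Nat.zero_le m)) (hqB.bdrySym (m := m) 0)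
  rw [hR] at h1 h2
  exact ⟨h2, h1⟩

end

section


/-! ### Vanishing of the gradient array -/

variable {n m : ℕ} {d : MIdx n → Space n → ℂ} {ℓ : (Space n → ℂ) → ℂ}

theorem symFn_mul_apply (c : Hor n → ℂ) (e : ℝ → ℂ) (x : Hor n) (t : ℝ) :
    symFn (fun ξ t => c ξ * e t) (x, t) = e t * 𝓕⁻ c x := by
  have h1 : (fun ξ t => c ξ * e t) = fun ξ (s : ℝ) => c ξ * e s := rfl
  have h2 := symFn_const_mul (n := n) (e t) (fun ξ _ => c ξ) (x, t)
  rw [symFn] at h2 ⊢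
  rw [show (fun ξ => c ξ * e (x, t).2) = fun ξ => e t * c ξ by funext ξ; exact mul_comm _ _]
  exact h2

theorem integral_halfSpace_mul_symFn {f : Space n → ℂ} {c : Hor n → ℂ} {e : ℝ → ℂ}
    (h : IntegrableOn (fun z => f z * symFn (fun ξ t => c ξ * e t) z) (halfSpace n)) :
    IntegrableOn (fun t => e t * ∫ x, f (x, t) * 𝓕⁻ c x) (Ioi 0) ∧
    ∫ z in halfSpace n, f z * symFn (fun ξ t => c ξ * e t) z =
      ∫ t in Ioi (0 : ℝ), e t * ∫ x, f (x, t) * 𝓕⁻ c x := by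
  have e1 : ∀ t : ℝ, ∫ x, f (x, t) * symFn (fun ξ t => c ξ * e t) (x, t) =
      e t * ∫ x, f (x, t) * 𝓕⁻ c x := by
    intro t
    rw [← integral_const_mul]
    refine integral_congr_ae (Eventually.of_forall fun x => ?_)
    simp only [symFn_mul_apply]
    ring
  rw [IntegrableOn, restrict_halfSpace] at h
  rw [restrict_halfSpace]
  constructor
  · have h1 := h.integral_prod_right
    simp only [e1] at h1
    exact h1
  · rw [integral_prod_symm _ h]
    simp only [e1]

/-- On the line Re σ = A the Laplace transform of f is the Fourier transform of exp(-At) f(t) on (0,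
∞), and integrable functions are determined by their Fourier transforms. -/
theorem ae_eq_zero_of_laplace {f : ℝ → ℂ} {A : ℝ} (H : ∀ σ : ℂ, σ.re = A →
    IntegrableOn (fun t : ℝ => Complex.exp (t * (-σ)) * f t) (Ioi 0) ∧
      ∫ t in Ioi (0 : ℝ), Complex.exp (t * (-σ)) * f t = 0) :
    ∀ᵐ t ∂(volume.restrict (Ioi (0 : ℝ))), f t = 0 := by
  set g : ℝ → ℂ := (Ioi (0 : ℝ)).indicator fun t : ℝ => Complex.exp (t * (-(A : ℂ))) * f t with hg
  have hgi : Integrable g := (integrable_indicator_iff measurableSet_Ioi).2 (H A (by simp)).1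
  have h1 : ∀ w : ℝ, 𝓕⁻ g w = 0 := by
    intro w
    rw [Real.fourierInv_eq']
    -- The point σ = A - 2πiw turns exp(-σt) into exp(-At) exp(2πiwt).
    have h2 := (H ((A : ℂ) - 2 * Real.pi * w * Complex.I) (by simp)).2
    rw [← h2, ← integral_indicator measurableSet_Ioi]
    refine integral_congr_ae (Eventually.of_forall fun t => ?_)
    simp only [hg, smul_eq_mul]
    by_cases ht : t ∈ Ioi (0 : ℝ)
    · rw [indicator_of_mem ht, indicator_of_mem ht, ← mul_assoc, ← Complex.exp_add]
      congr 2
      simp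
      ring
    · rw [indicator_of_notMem ht, indicator_of_notMem ht, mul_zero]
  have h3 := ae_eq_zero_of_fourier_eq_zero hgi h1
  rw [ae_restrict_iff' measurableSet_Ioi]
  filter_upwards [h3] with t ht ht0
  rw [hg, indicator_of_mem ht0] at ht
  exact (mul_eq_zero.1 ht).resolve_left (Complex.exp_ne_zero _)

/-- The exceptional set of t may depend on the function a. Separability of L² provides a countable
dense family, hence one null set for all a; continuity of the pairing on each slice does the rest.
-/
theorem ae_eq_zero_of_slice_pairing {f : Space n → ℂ} (hf : Measurable f) {M : ℝ}
    (hM : ∀ t, 0 < t → ∫⁻ x : Hor n, ‖f (x, t)‖ₑ ^ 2 ≤ ENNReal.ofReal M) {U : Set (Hor n)}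
    (hU : IsOpen U) (hU' : ∀ᵐ ξ, ξ ∈ U)
    (H : ∀ a : Hor n → ℝ, ContDiff ℝ ∞ a → HasCompactSupport a → tsupport a ⊆ U →
      ∀ᵐ t ∂(volume.restrict (Ioi (0 : ℝ))), ∫ x, f (x, t) * 𝓕⁻ (fun ξ => (a ξ : ℂ)) x = 0) :
    f =ᵐ[volume.restrict (halfSpace n)] 0 := by
  have : Fact ((2 : ℝ≥0∞) ≠ ⊤) := ⟨by simp⟩
  set S : Set (Lp (α := Hor n) ℂ 2 volume) := {u | ∃ a : Hor n → ℝ, ContDiff ℝ ∞ a ∧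
    HasCompactSupport a ∧ tsupport a ⊆ U ∧ u =ᵐ[volume] 𝓕⁻ (fun ξ => (a ξ : ℂ))} with hS
  have hsep : TopologicalSpace.IsSeparable S := TopologicalSpace.IsSeparable.of_separableSpace S
  obtain ⟨c, hcS, hc, hcl⟩ := hsep.exists_countable_dense_subset
  have h1 : ∀ᵐ t ∂(volume.restrict (Ioi (0 : ℝ))), ∀ u ∈ c, ∫ x, f (x, t) * u x = 0 := by
    rw [ae_ball_iff hc]
    intro u hu
    obtain ⟨a, ha1, ha2, ha3, hau⟩ := hcS hu
    filter_upwards [H a ha1 ha2 ha3] with t ht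
    rw [← ht]
    refine integral_congr_ae ?_
    filter_upwards [hau] with x hx
    rw [hx]
  have h2 : ∀ᵐ t ∂(volume.restrict (Ioi (0 : ℝ))), ∀ᵐ x : Hor n, f (x, t) = 0 := by
    filter_upwards [h1, ae_restrict_mem measurableSet_Ioi] with t ht ht0
    have hfm : Measurable fun x : Hor n => f (x, t) := hf.comp measurable_prodMk_right
    have hft : MemLp (fun x : Hor n => f (x, t)) 2 := by
      refine ⟨hfm.aestronglyMeasurable, ?_⟩
      have h3 := (hM t ht0).trans_lt ENNReal.ofReal_lt_top
      rw [← eLpNorm_two_sq] at h3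
      exact lt_top_iff_ne_top.2 fun h => by simp [h] at h3
    have hfc : MemLp (fun x : Hor n => starRingEnd ℂ (f (x, t))) 2 :=
      hft.of_le (Complex.continuous_conj.comp_aestronglyMeasurable hft.1)
        (Eventually.of_forall fun x => by simp)
    have h3 : ∀ u : Lp (α := Hor n) ℂ 2 volume,
        inner ℂ (hfc.toLp _) u = ∫ x, f (x, t) * u x := by
      intro u
      rw [← integral_conj_mul_eq_inner]
      refine integral_congr_ae ?_
      filter_upwards [hfc.coeFn_toLp] with x hx
      rw [hx, Complex.conj_conj]
    have h4 : IsClosed {u : Lp (α := Hor n) ℂ 2 volume | inner ℂ (hfc.toLp _) u = 0} :=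
      isClosed_eq (by fun_prop) continuous_const
    have h5 : closure c ⊆ {u : Lp (α := Hor n) ℂ 2 volume | inner ℂ (hfc.toLp _) u = 0} :=
      closure_minimal (fun u hu => (h3 u).trans (ht u hu)) h4
    refine ae_eq_zero_of_integral_mul_fourierInv hft hU hU' fun a ha1 ha2 ha3 => ?_
    have hac : Continuous fun ξ => (a ξ : ℂ) := Complex.continuous_ofReal.comp ha1.continuous
    have hacs : HasCompactSupport fun ξ => (a ξ : ℂ) := ha2.comp_left Complex.ofReal_zero
    have hai := hac.integrable_of_hasCompactSupport (μ := volume) hacs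
    have ham := memLp_fourierInv hai (hac.memLp_of_hasCompactSupport hacs)
    have h6 : ham.toLp _ ∈ S := ⟨a, ha1, ha2, ha3, ham.coeFn_toLp⟩
    have h7 := h5 (hcl h6)
    rw [mem_ofPred_eq, h3] at h7
    rw [← h7]
    refine integral_congr_ae ?_
    filter_upwards [ham.coeFn_toLp] with x hx
    rw [hx]
  have h3 : ∫⁻ z in halfSpace n, ‖f z‖ₑ = 0 := by
    rw [restrict_halfSpace, lintegral_prod_symm _ hf.enorm.aemeasurable]
    rw [lintegral_eq_zero_iff hf.enorm.lintegral_prod_left']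
    filter_upwards [h2] with t ht
    rw [Pi.zero_apply, lintegral_congr_ae (g := fun _ => 0) (by
      filter_upwards [ht] with x hx
      simp [hx]), lintegral_zero]
  rw [lintegral_eq_zero_iff hf.enorm] at h3
  filter_upwards [h3] with z hz
  simpa using hz

theorem ae_coord_ne_zero (i₀ : Fin n) : ∀ᵐ ξ : Hor n, ξ i₀ ≠ 0 := by
  have h1 := Measure.addHaar_submodule (volume : Measure (Hor n))
    (LinearMap.ker (EuclideanSpace.proj i₀ : Hor n →L[ℝ] ℝ).toLinearMap) (by
      intro h
      have h2 : EuclideanSpace.single i₀ (1 : ℝ) ∈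
          LinearMap.ker (EuclideanSpace.proj i₀ : Hor n →L[ℝ] ℝ).toLinearMap := h ▸ trivial
      simp at h2)
  rw [ae_iff]
  refine measure_mono_null (fun ξ hξ => ?_) h1
  simpa using hξ

theorem IsGradArray.ae_eq_zero_horizontal (hn : 1 ≤ n) (hm : 1 ≤ m)
    (h : IsGradArray m d fun _ => 0) (hd : ∀ α ∈ multiIdx n m, Measurable (d α)) (i₀ : Fin n) :
    d (Pi.single i₀ m, 0) =ᵐ[volume.restrict (halfSpace n)] 0 := by
  obtain ⟨M, -, hM⟩ := h.bound
  have hα : (Pi.single i₀ m, 0) ∈ multiIdx n m := by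
    simpa [mixIdx] using mixIdx_mem (i₀ := i₀) (Nat.zero_le m)
  refine ae_eq_zero_of_slice_pairing (hd _ hα) (hM _ hα) (U := {ξ : Hor n | ξ i₀ ≠ 0})
    (isOpen_ne_fun (by fun_prop) continuous_const) (ae_coord_ne_zero i₀) fun a ha1 ha2 ha3 => ?_
  obtain ⟨B, hB⟩ := ha2.exists_bound_of_continuousOn (continuous_tau (n := n)).continuousOn
  -- B bounds τ on the support of a, so Re σ = |B| + 1 ensures |σ| ≥ τ + 1 there.
  refine ae_eq_zero_of_laplace (A := |B| + 1) fun σ hσ => ?_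
  have hσ0 : 0 < σ.re := by rw [hσ]; positivity
  obtain ⟨h1, h2⟩ := h.integral_symFn_exp hn hm i₀ ha1.continuous ha2
    (fun h0 => ha3 h0 (by simp)) hσ0 fun ξ hξ => by
      have h3 := (Real.le_norm_self _).trans (hB ξ hξ)
      have h4 := Complex.re_le_norm σ
      have h5 := le_abs_self B
      linarith
  have h3 := integral_halfSpace_mul_symFn (c := fun ξ => (a ξ : ℂ))
    (e := fun t : ℝ => Complex.exp (t * (-σ))) h1
  exact ⟨h3.1, h3.2.symm.trans h2⟩

/-! ### Symbols with compact support in t, and the remaining components -/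

theorem iteratedDeriv_eq_zero_of_notMem {η : ℝ → ℂ} (j : ℕ) {t : ℝ} (ht : t ∉ tsupport η) :
    iteratedDeriv j η t = 0 := by
  have h := (notMem_tsupport_iff_eventuallyEq.1 ht).iteratedDeriv_eq j
  rw [h]
  simp

/-- A factor supported in t > 0 is flat at the boundary to every order, which frees the
compatibility relation from conditions on vertical derivatives. -/
theorem bandSymbol_tensor {K : Set (Hor n)} (hK : IsCompact K) {c : Hor n → ℂ} (hcm : Measurable c)
    (hc : ContinuousOn c K) (hc0 : ∀ ξ ∉ K, c ξ = 0) {η : ℝ → ℂ} (hη : ContDiff ℝ ∞ η)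
    (hη0 : HasCompactSupport η) :
    BandSymbol (fun j ξ t => c ξ * iteratedDeriv j η t) ∧
    (tsupport η ⊆ Ioi 0 → ∀ k j, ∃ C : ℝ, ∀ ξ t, 0 < t →
      ‖c ξ * iteratedDeriv j η t‖ ≤ C * (t ^ k * ((1 + t) ^ 2)⁻¹)) := by
  obtain ⟨A, hA⟩ := hK.exists_bound_of_continuousOn hc
  obtain ⟨R, hR⟩ := hK.isBounded.subset_closedBall (0 : Hor n)
  have hAc : ∀ ξ, ‖c ξ‖ ≤ |A| := by
    intro ξ
    by_cases hξ : ξ ∈ K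
    · exact (hA ξ hξ).trans (le_abs_self A)
    · rw [hc0 ξ hξ, norm_zero]; positivity
  have hcont : ∀ j, Continuous (iteratedDeriv j η) := fun j =>
    hη.continuous_iteratedDeriv j (by exact_mod_cast le_top)
  have key : ∀ j, ∀ k : ℝ → ℝ, ContinuousOn k (tsupport η) → (∀ t ∈ tsupport η, 0 < k t) →
      ∃ C : ℝ, 0 ≤ C ∧ ∀ ξ t, 0 ≤ k t → ‖c ξ * iteratedDeriv j η t‖ ≤ C * k t := by
    intro j k hk hk0
    obtain ⟨B, hB⟩ := hη0.exists_bound_of_continuousOn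
      (((hcont j).norm.continuousOn (s := tsupport η)).div hk fun t ht => (hk0 t ht).ne')
    refine ⟨|A| * |B|, by positivity, fun ξ t hkt => ?_⟩
    by_cases ht : t ∈ tsupport η
    · rw [norm_mul, mul_assoc]
      refine mul_le_mul (hAc ξ) ?_ (norm_nonneg _) (abs_nonneg A)
      have h1 := (hB t ht).trans (le_abs_self B)
      rw [Pi.div_apply, norm_div, norm_norm, Real.norm_of_nonneg hkt, div_le_iff₀ (hk0 t ht)] at h1
      exact h1
    · rw [iteratedDeriv_eq_zero_of_notMem j ht, mul_zero, norm_zero]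
      positivity
  refine ⟨⟨fun j ξ t => ?_, fun j t => hcm.mul_const _, ⟨R, fun j ξ t hξ => ?_⟩, fun j T => ?_,
    fun j => ?_⟩, fun hsupp k j => ?_⟩
  · have h := (hη.differentiable_iteratedDeriv j (by exact_mod_cast WithTop.coe_lt_top _)) t
    rw [iteratedDeriv_succ]
    exact h.hasDerivAt.const_mul _
  · rw [hc0 ξ fun h => (mem_closedBall_zero_iff.1 (hR h)).not_gt hξ, zero_mul]
  · obtain ⟨C, -, hC⟩ := key j (fun _ => 1) continuousOn_const fun _ _ => one_pos
    exact ⟨C * 1, fun ξ t _ => hC ξ t zero_le_one⟩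
  · obtain ⟨C, hC0, hC⟩ := key j (fun t => ((1 + |t|) ^ 2)⁻¹)
      (Continuous.continuousOn (Continuous.inv₀ (by fun_prop) fun t => by positivity))
      fun t _ => by positivity
    refine ⟨C, hC0, fun ξ t ht => ?_⟩
    have := hC ξ t (by positivity)
    rwa [abs_of_nonneg ht] at this
  · obtain ⟨C, -, hC⟩ := key j (fun t => t ^ k * ((1 + t) ^ 2)⁻¹)
      (ContinuousOn.mul (by fun_prop) (ContinuousOn.inv₀ (by fun_prop) fun t ht => by
        have : 0 < t := hsupp ht
        positivity)) fun t ht => by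
        have : 0 < t := hsupp ht
        positivity
    exact ⟨C, fun ξ t ht => hC ξ t (by positivity)⟩

/-- By compatibility, d_α against ∂_{i₀}^m of a test function equals the component of ∂_{i₀}^m
against ∂^α of it, which is zero. Frequencies with ξ_{i₀} = 0 are negligible, and elsewhere ∂_{i₀}^m
can be inverted. -/
theorem IsGradArray.ae_eq_zero (hn : 1 ≤ n) (hm : 1 ≤ m) (h : IsGradArray m d fun _ => 0)
    (hd : ∀ α ∈ multiIdx n m, Measurable (d α)) {α : MIdx n} (hα : α ∈ multiIdx n m) :
    d α =ᵐ[volume.restrict (halfSpace n)] 0 := by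
  obtain ⟨M, -, hM⟩ := h.bound
  set i₀ : Fin n := ⟨0, hn⟩
  have hβ : (Pi.single i₀ m, 0) ∈ multiIdx n m := by
    simpa [mixIdx] using mixIdx_mem (i₀ := i₀) (Nat.zero_le m)
  have h0 := h.ae_eq_zero_horizontal hn hm hd i₀
  refine ae_eq_zero_of_slice_pairing (hd _ hα) (hM _ hα) (U := {ξ : Hor n | ξ i₀ ≠ 0})
    (isOpen_ne_fun (by fun_prop) continuous_const) (ae_coord_ne_zero i₀) fun a ha1 ha2 ha3 => ?_
  have hac : Continuous fun ξ => (a ξ : ℂ) := Complex.continuous_ofReal.comp ha1.continuous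
  have hoff : ∀ ξ ∉ tsupport a, a ξ = 0 := fun ξ hξ => image_eq_zero_of_notMem_tsupport hξ
  have hmono : ∀ ξ ∈ tsupport a, horMono (Pi.single i₀ m) ξ ≠ 0 := by
    intro ξ hξ
    have h1 : ξ i₀ ≠ 0 := ha3 hξ
    rw [horMono_single]
    simp [h1, Real.pi_ne_zero]
  -- Division by the symbol of ∂_{i₀}^m, harmless on the support of a, which avoids ξ_{i₀} = 0.
  set c : Hor n → ℂ := fun ξ => a ξ * (horMono (Pi.single i₀ m) ξ)⁻¹ with hc
  have hcc : ∀ ξ, horMono (Pi.single i₀ m) ξ * c ξ = a ξ := by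
    intro ξ
    by_cases hξ : ξ ∈ tsupport a
    · rw [hc, mul_left_comm, mul_inv_cancel₀ (hmono ξ hξ), mul_one]
    · simp [hc, hoff ξ hξ]
  have key : ∀ η : ℝ → ℂ, ContDiff ℝ ∞ η → HasCompactSupport η → tsupport η ⊆ Ioi 0 →
      ∫ t in Ioi (0 : ℝ), η t * ∫ x, d α (x, t) * 𝓕⁻ (fun ξ => (a ξ : ℂ)) x = 0 := by
    intro η hη hη0 hη1
    obtain ⟨hq, hflat⟩ := bandSymbol_tensor ha2 (c := c)
      (hac.measurable.mul (continuous_horMono _).measurable.inv)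
      (hac.continuousOn.mul ((continuous_horMono _).continuousOn.inv₀ hmono))
      (fun ξ hξ => by simp [hc, hoff ξ hξ]) hη hη0
    have h1 := h.compat_symFn hq hα hβ (γ := (Pi.single i₀ m, 0)) (δ := α) (add_comm _ _)
      fun k j _ => hflat hη1 k j
    have e1 : RapidSymbol.diff (fun j ξ t => c ξ * iteratedDeriv j η t) (Pi.single i₀ m, 0) 0 =
        fun ξ t => (a ξ : ℂ) * η t := by
      funext ξ t
      simp only [RapidSymbol.diff, zero_add, iteratedDeriv_zero]
      rw [← mul_assoc, hcc]
    have h2 : ∫ z in halfSpace n, d (Pi.single i₀ m, 0) z *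
        symFn (RapidSymbol.diff (fun j ξ t => c ξ * iteratedDeriv j η t) α 0) z = 0 := by
      refine integral_eq_zero_of_ae ?_
      filter_upwards [h0] with z hz
      simp [hz]
    have h3 := h.integrableOn_symFn hα (hq.diff (Pi.single i₀ m, 0))
    rw [h2, e1] at h1
    rw [e1] at h3
    exact (integral_halfSpace_mul_symFn h3).2.symm.trans h1
  -- The factor exp(-t) makes the slice pairing integrable on (0, ∞), hence locally integrable. It
  -- is absorbed into the test function below and never vanishes.
  have hexp := bandSymbol_exp ha2 hac.measurable hac.continuousOn
    (fun ξ hξ => by simp [hoff ξ hξ]) (z := fun _ => -1) continuous_const fun ξ _ => by simp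
  have h1 := h.integrableOn_symFn hα hexp
  simp only [pow_zero, mul_one] at h1
  have h2 := (integral_halfSpace_mul_symFn (c := fun ξ => (a ξ : ℂ))
    (e := fun t : ℝ => Complex.exp (t * (-1))) h1).1
  have h3 := isOpen_Ioi.ae_eq_zero_of_integral_contDiff_smul_eq_zero h2.locallyIntegrableOn
    fun g hg hg0 hg1 => by
      have hη : ContDiff ℝ ∞ fun t : ℝ => (g t : ℂ) * Complex.exp (t * (-1)) :=
        (Complex.ofRealCLM.contDiff.comp hg).mul
          ((Complex.ofRealCLM.contDiff.mul contDiff_const).cexp)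
      have hgc : HasCompactSupport fun t : ℝ => (g t : ℂ) := hg0.comp_left Complex.ofReal_zero
      have hts : tsupport (fun t : ℝ => (g t : ℂ) * Complex.exp (t * (-1))) ⊆ Ioi 0 :=
        (closure_mono fun t ht => by
          simp only [Function.mem_support] at ht ⊢
          exact fun h => ht (by simp [h])).trans hg1
      have h4 := key _ hη hgc.mul_right hts
      rw [← h4, ← integral_indicator measurableSet_Ioi]
      refine integral_congr_ae (Eventually.of_forall fun t => ?_)
      simp only
      by_cases ht : t ∈ Ioi (0 : ℝ)
      · rw [indicator_of_mem ht, Complex.real_smul, mul_assoc]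
      · rw [indicator_of_notMem ht, image_eq_zero_of_notMem_tsupport fun h => ht (hg1 h), zero_smul]
  rw [ae_restrict_iff' measurableSet_Ioi]
  filter_upwards [h3] with t ht ht0
  exact (mul_eq_zero.1 (ht ht0)).resolve_left (Complex.exp_ne_zero _)

end

section


/-! ### Functions with vanishing derivatives of order `m` -/

variable {n m : ℕ}

/-- Induction on m: the formula for the derivative says that g 0 minus its Taylor polynomial without
the constant term has zero derivative on [0, 1]. -/
theorem eq_sum_of_hasDerivAt_succ {g : ℕ → ℝ → ℂ} (hg : ∀ k s, HasDerivAt (g k) (g (k + 1) s) s)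
    {m : ℕ} (h0 : ∀ s ∈ Icc (0 : ℝ) 1, g m s = 0) :
    ∀ s ∈ Icc (0 : ℝ) 1, g 0 s = ∑ k ∈ Finset.range m, g k 0 * ((s : ℂ) ^ k / k.factorial) := by
  induction m generalizing g with
  | zero => intro s hs; simpa using h0 s hs
  | succ m ih =>
    intro s hs
    have h1 := ih (g := fun k => g (k + 1)) (fun k s => hg (k + 1) s) h0
    have he : ∀ (k : ℕ) (s : ℝ), HasDerivAt (fun s : ℝ => (s : ℂ) ^ (k + 1) / (k + 1).factorial)
        ((s : ℂ) ^ k / k.factorial) s := by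
      intro k s
      have h2 : HasDerivAt (fun s : ℝ => (s : ℂ) ^ (k + 1)) _ s :=
        ((Complex.ofRealCLM.hasDerivAt (x := s)).fun_pow (k + 1))
      have h3 := h2.div_const ((k + 1).factorial : ℂ)
      refine h3.congr_deriv ?_
      have : ((k : ℂ) + 1) ≠ 0 := by exact_mod_cast k.succ_ne_zero
      rw [Nat.factorial_succ]
      push_cast
      field_simp
      simp
    set h : ℝ → ℂ := fun s => g 0 s - ∑ k ∈ Finset.range m,
      g (k + 1) 0 * ((s : ℂ) ^ (k + 1) / (k + 1).factorial) with hh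
    have hd : ∀ s, HasDerivAt h (g 1 s - ∑ k ∈ Finset.range m,
        g (k + 1) 0 * ((s : ℂ) ^ k / k.factorial)) s := fun s =>
      (hg 0 s).fun_sub (HasDerivAt.fun_sum fun k _ => (he k s).const_mul _)
    have h2 := (convex_Icc (0 : ℝ) 1).norm_image_sub_le_of_norm_hasDerivWithin_le
      (f := h) (C := 0) (x := 0) (y := s) (fun s _ => (hd s).hasDerivWithinAt) (fun s hs => by
        have := h1 s hs
        simp only [zero_add] at this
        rw [this, sub_self, norm_zero]) (left_mem_Icc.2 zero_le_one) hs
    rw [zero_mul, norm_le_zero_iff, sub_eq_zero] at h2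
    have h3 : g 0 s = h s + ∑ k ∈ Finset.range m,
        g (k + 1) 0 * ((s : ℂ) ^ (k + 1) / (k + 1).factorial) := by rw [hh]; ring
    rw [Finset.sum_range_succ', h3, h2, hh]
    simp [add_comm]

/-- The `k`-th iterated derivative of `f` in the direction `v`. -/
def iterDir (v : Space n) : ℕ → (Space n → ℂ) → Space n → ℂ
  | 0, f => f
  | k + 1, f => fun z => ∑ o, (coordCLM o v : ℂ) * iterDir v k (dDir o f) z

theorem hasDerivAt_iterDir (v z₀ : Space n) (k : ℕ) {f : Space n → ℂ} (hf : ContDiff ℝ ∞ f) (s : ℝ) :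
    HasDerivAt (fun s : ℝ => iterDir v k f (z₀ + s • v)) (iterDir v (k + 1) f (z₀ + s • v)) s := by
  induction k generalizing f with
  | zero =>
    have h1 : HasDerivAt (fun s : ℝ => z₀ + s • v) v s := by
      simpa using ((hasDerivAt_id s).smul_const v).const_add z₀
    have h2 := (hasFDerivAt_of_dDir ((hf.differentiable (by simp)) (z₀ + s • v))).comp_hasDerivAt s h1
    refine h2.congr_deriv ?_
    simp only [sum_apply, dirForm_apply, iterDir, Complex.real_smul]
  | succ k ih =>
    exact HasDerivAt.fun_sum fun o _ => (ih (contDiff_dDir o hf)).const_mul _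

theorem iterDir_eq_zero (v : Space n) {z : Space n} (k : ℕ) {f : Space n → ℂ} (hf : ContDiff ℝ ∞ f)
    (h0 : ∀ α ∈ multiIdx n k, partialD α f z = 0) : iterDir v k f z = 0 := by
  induction k generalizing f with
  | zero => simpa [partialD_zero, iterDir] using h0 0 (mem_multiIdx.2 (by simp [MIdx.len]))
  | succ k ih =>
    refine Finset.sum_eq_zero fun o _ => ?_
    rw [ih (contDiff_dDir o hf), mul_zero]
    intro α hα
    rw [← partialD_add_unitIdx' α o hf]
    exact h0 _ (mem_multiIdx.2 (by rw [MIdx.len_add, MIdx.len_unitIdx, mem_multiIdx.1 hα]))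

/-- The variable of a coordinate direction. -/
def coordVar : Option (Fin n) → Fin n ⊕ Unit
  | none => Sum.inr ()
  | some i => Sum.inl i

theorem polyEval_X (o : Option (Fin n)) (z : Space n) :
    polyEval (MvPolynomial.X (coordVar o)) z = (coordCLM o z : ℂ) := by
  cases o <;> simp [polyEval, coordVar, coordCLM]

/-- Each directional derivative contributes one factor that is affine in z, namely a coordinate of z
- z₀. -/
theorem exists_polyEval_iterDir (z₀ : Space n) (k : ℕ) (f : Space n → ℂ) :
    ∃ p : MvPolynomial (Fin n ⊕ Unit) ℂ, p.totalDegree ≤ k ∧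
      ∀ z, iterDir (z - z₀) k f z₀ = polyEval p z := by
  induction k generalizing f with
  | zero => exact ⟨MvPolynomial.C (f z₀), by simp, fun z => by simp [iterDir, polyEval]⟩
  | succ k ih =>
    choose p hp hpe using fun o => ih (dDir o f)
    refine ⟨∑ o, (MvPolynomial.X (coordVar o) - MvPolynomial.C (coordCLM o z₀ : ℂ)) * p o, ?_,
      fun z => ?_⟩
    · refine MvPolynomial.totalDegree_finsetSum_le fun o _ => ?_
      refine (MvPolynomial.totalDegree_mul _ _).trans ?_
      have h1 := MvPolynomial.totalDegree_sub_C_le (MvPolynomial.X (R := ℂ) (coordVar o))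
        (coordCLM o z₀ : ℂ)
      rw [MvPolynomial.totalDegree_X] at h1
      have := hp o
      omega
    · have h2 : ∀ o : Option (Fin n), polyEval ((MvPolynomial.X (coordVar o) -
          MvPolynomial.C (coordCLM o z₀ : ℂ)) * p o) z =
          (coordCLM o (z - z₀) : ℂ) * polyEval (p o) z := by
        intro o
        rw [map_sub, Complex.ofReal_sub, ← polyEval_X o z]
        simp [polyEval]
      rw [show polyEval (∑ o, (MvPolynomial.X (coordVar o) -
        MvPolynomial.C (coordCLM o z₀ : ℂ)) * p o) z = ∑ o, polyEval ((MvPolynomial.X (coordVar o) -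
        MvPolynomial.C (coordCLM o z₀ : ℂ)) * p o) z from map_sum _ _ _]
      simp only [iterDir, h2, hpe]

/-- Taylor's formula on the segment from a fixed z₀; by convexity the remainder of order m vanishes
along it. -/
theorem exists_polyEval_of_partialD_eq_zero {f : Space n → ℂ} (hf : ContDiff ℝ ∞ f)
    {Ω : Set (Space n)} (hΩ : Convex ℝ Ω)
    (h0 : ∀ α ∈ multiIdx n m, ∀ z ∈ Ω, partialD α f z = 0) :
    ∃ p : MvPolynomial (Fin n ⊕ Unit) ℂ, p.totalDegree ≤ m - 1 ∧ ∀ z ∈ Ω, f z = polyEval p z := by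
  rcases Ω.eq_empty_or_nonempty with rfl | ⟨z₀, hz₀⟩
  · exact ⟨0, by simp, fun z hz => hz.elim⟩
  choose p hp hpe using fun k => exists_polyEval_iterDir z₀ k f
  refine ⟨∑ k ∈ Finset.range m, MvPolynomial.C (k.factorial : ℂ)⁻¹ * p k, ?_, fun z hz => ?_⟩
  · refine MvPolynomial.totalDegree_finsetSum_le fun k hk => ?_
    refine (MvPolynomial.totalDegree_mul _ _).trans ?_
    have := hp k
    have := Finset.mem_range.1 hk
    rw [MvPolynomial.totalDegree_C]
    omega
  · have h1 := eq_sum_of_hasDerivAt_succ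
      (g := fun k (s : ℝ) => iterDir (z - z₀) k f (z₀ + s • (z - z₀))) (m := m)
      (fun k s => hasDerivAt_iterDir (z - z₀) z₀ k hf s) (fun s hs => by
        refine iterDir_eq_zero _ m hf fun α hα => h0 α hα _ ?_
        exact hΩ.add_smul_sub_mem hz₀ hz hs) 1 (right_mem_Icc.2 zero_le_one)
    simp only [one_smul, add_sub_cancel, zero_smul, add_zero, Complex.ofReal_one, one_pow] at h1
    rw [show polyEval (∑ k ∈ Finset.range m, MvPolynomial.C (k.factorial : ℂ)⁻¹ * p k) z =
      ∑ k ∈ Finset.range m, polyEval (MvPolynomial.C (k.factorial : ℂ)⁻¹ * p k) z from map_sum _ _ _]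
    refine (show f z = _ from h1).trans (Finset.sum_congr rfl fun k _ => ?_)
    rw [hpe]
    simp [polyEval]
    ring

/-! ### Mollification -/

theorem partialD_comp_sub {f : Space n → ℂ} (hf : ContDiff ℝ ∞ f) (y : Space n) (β : MIdx n) :
    partialD β (fun z => f (z - y)) = fun z => partialD β f (z - y) := by
  have hs : ContDiff ℝ ∞ fun z : Space n => z - y := contDiff_id.sub contDiff_const
  induction β using MIdx.induction_unit with
  | h0 => simp [partialD_zero]
  | hs β o ih =>
    have hfs : ContDiff ℝ ∞ fun z : Space n => f (z - y) := hf.comp hs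
    rw [partialD_add_unitIdx _ _ hfs, ih, partialD_add_unitIdx _ _ hf]
    funext z
    have h1 : HasFDerivAt (fun z : Space n => partialD β f (z - y)) _ z :=
      (((contDiff_partialD β hf).differentiable (by simp)) (z - y)).hasFDerivAt.comp z
        ((hasFDerivAt_id z).sub_const y)
    rw [h1.dDir_eq o, dDir_eq_fderiv o (((contDiff_partialD β hf).differentiable (by simp)) (z - y))]
    simp

theorem partialD_comp_const_sub {f : Space n → ℂ} (hf : ContDiff ℝ ∞ f) (z : Space n)
    (β : MIdx n) (y : Space n) :
    partialD β (fun y => f (z - y)) y = (-1) ^ β.len * partialD β f (z - y) := by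
  have h1 : ContDiff ℝ ∞ fun y : Space n => f ((-1 : ℝ) • y) := hf.comp (contDiff_const_smul _)
  have h2 := partialD_comp_sub h1 z β
  rw [partialD_comp_smul hf] at h2
  have h3 : (fun y => f (z - y)) = fun y => f ((-1 : ℝ) • (y - z)) := by
    funext y; congr 1; simp
  rw [h3, h2]
  simp

/-- Convolutions fit the framework for integrals depending on a point: near z the kernel lives on a
fixed ball, on which W is integrable. -/
theorem isSmoothKernel_convolution {ρ : Space n → ℂ} (hρ : IsTest ρ) {W : Space n → ℂ}
    (hW : LocallyIntegrable W) :
    IsSmoothKernel volume (fun y (z : Space n) => ρ (z - y) * W y) univ ∧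
    ∀ (α : MIdx n) (y z : Space n),
      partialD α (fun z => ρ (z - y) * W y) z = partialD α ρ (z - y) * W y := by
  have hsub : ∀ y, ContDiff ℝ ∞ fun z => ρ (z - y) := fun y =>
    hρ.1.comp (contDiff_id.sub contDiff_const)
  have hpd : ∀ (α : MIdx n) (y z : Space n),
      partialD α (fun z => ρ (z - y) * W y) z = partialD α ρ (z - y) * W y := by
    intro α y z
    have h1 := congrFun (partialD_const_mul α (W y) (hsub y)) z
    rw [partialD_comp_sub hρ.1] at h1
    simpa only [mul_comm] using h1
  refine ⟨⟨fun y => (hsub y).mul contDiff_const, fun α z _ => ?_, fun α z _ => ?_⟩, hpd⟩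
  · simp only [hpd]
    exact ((hρ.partialD α).1.continuous.comp (continuous_const.sub continuous_id)
      ).aestronglyMeasurable.mul hW.aestronglyMeasurable
  · obtain ⟨B, hB⟩ := (hρ.partialD α).2.exists_bound_of_continuous (hρ.partialD α).1.continuous
    obtain ⟨R, hR⟩ := (hρ.partialD α).2.isCompact.isBounded.subset_closedBall (0 : Space n)
    refine ⟨Metric.ball z 1, Metric.ball_mem_nhds z one_pos,
      (Metric.closedBall z (R + 1)).indicator fun y => B * ‖W y‖, ?_,
      Eventually.of_forall fun y z' hz' => ?_⟩
    · refine (integrable_indicator_iff measurableSet_closedBall).2 ?_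
      exact ((hW.integrableOn_isCompact (isCompact_closedBall z (R + 1))).norm).const_mul B
    · rw [hpd]
      by_cases hy : y ∈ Metric.closedBall z (R + 1)
      · rw [indicator_of_mem hy, norm_mul]
        exact mul_le_mul_of_nonneg_right (hB _) (norm_nonneg _)
      · have h0 : partialD α ρ (z' - y) = 0 := by
          refine image_eq_zero_of_notMem_tsupport fun h => hy ?_
          have h1 := mem_closedBall_zero_iff.1 (hR h)
          have h2 : ‖z' - z‖ < 1 := mem_ball_iff_norm.1 hz'
          rw [mem_closedBall_iff_norm]
          calc ‖y - z‖ = ‖(z' - z) - (z' - y)‖ := by congr 1; abel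
            _ ≤ ‖z' - z‖ + ‖z' - y‖ := norm_sub_le _ _
            _ ≤ R + 1 := by linarith
        rw [h0, zero_mul, norm_zero, indicator_of_notMem hy]

theorem locallyIntegrable_indicator_lt {w : Space n → ℂ}
    (hw : LocallyIntegrableOn w (halfSpace n)) {δ : ℝ} (hδ : 0 < δ) :
    LocallyIntegrable ({z : Space n | δ < z.2}.indicator w) := by
  have hmeas : MeasurableSet {z : Space n | δ < z.2} :=
    (isOpen_lt continuous_const continuous_snd).measurableSet
  intro z
  by_cases hz : 0 < z.2
  · have h1 := hw z hz
    rw [(isOpen_halfSpace n).nhdsWithin_eq hz] at h1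
    obtain ⟨s, hs, hi⟩ := h1
    exact ⟨s, hs, Integrable.indicator hi hmeas⟩
  · refine ⟨{y : Space n | y.2 < δ}, (isOpen_lt continuous_snd continuous_const).mem_nhds
      (show z.2 < δ by linarith), ?_⟩
    have h0 : IntegrableOn (fun _ : Space n => (0 : ℂ)) {y : Space n | y.2 < δ} := integrableOn_zero
    refine h0.congr_fun (fun y hy => ?_)
      (isOpen_lt continuous_snd continuous_const).measurableSet
    have hn : y ∉ {z : Space n | δ < z.2} := fun h => lt_asymm (show δ < y.2 from h) hy
    exact (indicator_of_notMem hn w).symm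

/-- Mollifiers. -/
def mollBump (n k : ℕ) : ContDiffBump (0 : Space n) :=
  ⟨((k : ℝ) + 1)⁻¹ / 2, ((k : ℝ) + 1)⁻¹, by positivity, half_lt_self (by positivity)⟩

theorem isTest_mollBump (n k : ℕ) :
    IsTest fun z : Space n => (((mollBump n k).normed volume z : ℝ) : ℂ) :=
  ⟨Complex.ofRealCLM.contDiff.comp (mollBump n k).contDiff_normed,
    (mollBump n k).hasCompactSupport_normed.comp_left Complex.ofReal_zero⟩

theorem mollBump_eq_zero {k : ℕ} {z : Space n} (hz : ((k : ℝ) + 1)⁻¹ < |z.2|) :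
    z ∉ tsupport fun z : Space n => (((mollBump n k).normed volume z : ℝ) : ℂ) := by
  intro h
  have h1 : tsupport (fun z : Space n => (((mollBump n k).normed volume z : ℝ) : ℂ)) ⊆
      tsupport ((mollBump n k).normed volume) :=
    closure_mono (Function.support_comp_subset Complex.ofReal_zero _)
  have h2 := h1 h
  rw [(mollBump n k).tsupport_normed_eq, mem_closedBall_zero_iff] at h2
  have h3 : |z.2| ≤ ‖z‖ := norm_snd_le z
  have h4 : ‖z‖ ≤ ((k : ℝ) + 1)⁻¹ := h2
  linarith

/-- The mollification of `w` cut off near the boundary. -/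
def mollify (w : Space n → ℂ) (k : ℕ) (z : Space n) : ℂ :=
  ∫ y, (((mollBump n k).normed volume (z - y) : ℝ) : ℂ) *
    {z : Space n | ((k : ℝ) + 1)⁻¹ < z.2}.indicator w y

theorem contDiff_mollify {w : Space n → ℂ} (hw : LocallyIntegrableOn w (halfSpace n)) (k : ℕ) :
    ContDiff ℝ ∞ (mollify w k) := by
  have h := (isSmoothKernel_convolution (isTest_mollBump n k)
    (locallyIntegrable_indicator_lt hw (δ := ((k : ℝ) + 1)⁻¹)
      (by positivity))).1.contDiffOn_partialD isOpen_univ 0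
  simp only [partialD_zero] at h
  exact contDiffOn_univ.1 h

theorem partialD_mollify_eq_zero {w : Space n → ℂ} (hw : LocallyIntegrableOn w (halfSpace n))
    {α : MIdx n}
    (H : ∀ φ : Space n → ℂ, IsTestHalf φ → ∫ z in halfSpace n, w z * partialD α φ z = 0) {k : ℕ}
    {z : Space n} (hz : 2 * ((k : ℝ) + 1)⁻¹ < z.2) : partialD α (mollify w k) z = 0 := by
  set ρ : Space n → ℂ := fun z => (((mollBump n k).normed volume z : ℝ) : ℂ) with hρ
  have hT : IsTest ρ := isTest_mollBump n k
  have hk : 0 < ((k : ℝ) + 1)⁻¹ := by positivity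
  obtain ⟨h1, h2⟩ := isSmoothKernel_convolution hT (locallyIntegrable_indicator_lt hw hk)
  have h3 := h1.partialD_integral isOpen_univ α (mem_univ z)
  refine h3.trans ?_
  simp only [h2]
  -- Since z has height above 2/(k+1), the reflected mollifier is supported at heights at least
  -- 1/(k+1): it is admissible as a test function, and the cut-off of w is not felt.
  have hφ : IsTestHalf fun y => ρ (z - y) := by
    refine ⟨⟨hT.1.comp (contDiff_const.sub contDiff_id), ?_⟩, ?_⟩
    · exact hT.2.comp_homeomorph (Homeomorph.subLeft z)
    · refine (closure_minimal (t := {y : Space n | ((k : ℝ) + 1)⁻¹ ≤ y.2}) (fun y hy => ?_)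
        (isClosed_le continuous_const continuous_snd)).trans fun y hy => hk.trans_le hy
      by_contra hlt
      have hlt' : y.2 < ((k : ℝ) + 1)⁻¹ := not_le.1 hlt
      refine hy (image_eq_zero_of_notMem_tsupport (mollBump_eq_zero ?_))
      rw [Prod.snd_sub, lt_abs]
      left; linarith
  have h4 := H _ hφ
  simp only [partialD_comp_const_sub hT.1 z α] at h4
  rw [← integral_indicator (isOpen_halfSpace n).measurableSet] at h4
  have h5 : ∀ y, partialD α ρ (z - y) * {z : Space n | ((k : ℝ) + 1)⁻¹ < z.2}.indicator w y =
      (-1) ^ α.len * (halfSpace n).indicator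
        (fun y => w y * ((-1) ^ α.len * partialD α ρ (z - y))) y := by
    intro y
    by_cases hy : ((k : ℝ) + 1)⁻¹ < y.2
    · rw [indicator_of_mem (show y ∈ {z : Space n | ((k : ℝ) + 1)⁻¹ < z.2} from hy),
        indicator_of_mem (show y ∈ halfSpace n from hk.trans hy), mul_left_comm (w y), ← mul_assoc,
        ← mul_pow]
      simp [mul_comm]
    · have h6 : partialD α ρ (z - y) = 0 := by
        refine image_eq_zero_of_notMem_tsupport fun h =>
          mollBump_eq_zero (k := k) ?_ (support_partialD_subset α ρ h)
        rw [Prod.snd_sub, lt_abs]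
        left; linarith
      simp [h6, indicator]
  simp only [h5]
  rw [integral_const_mul, h4, mul_zero]

/-- The cut-off moves with k, whereas the convergence theorem needs a fixed function. It is
therefore applied to the countably many cut-offs indexed by j. -/
theorem ae_tendsto_mollify {w : Space n → ℂ} (hw : LocallyIntegrableOn w (halfSpace n)) :
    ∀ᵐ z : Space n, z ∈ halfSpace n → Tendsto (fun k => mollify w k z) atTop (𝓝 (w z)) := by
  have hr : Tendsto (fun k : ℕ => ((k : ℝ) + 1)⁻¹) atTop (𝓝 0) := by
    simpa [one_div] using tendsto_one_div_add_atTop_nhds_zero_nat (𝕜 := ℝ)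
  have h1 : ∀ᵐ z : Space n, ∀ j : ℕ, Tendsto (fun k => ∫ y,
      (((mollBump n k).normed volume (z - y) : ℝ) : ℂ) *
        {z : Space n | ((j : ℝ) + 1)⁻¹ < z.2}.indicator w y) atTop
      (𝓝 ({z : Space n | ((j : ℝ) + 1)⁻¹ < z.2}.indicator w z)) := by
    rw [ae_all_iff]
    intro j
    have h2 := ContDiffBump.ae_convolution_tendsto_right_of_locallyIntegrable
      (φ := fun k => mollBump n k) (l := atTop) (K := 2) (μ := (volume : Measure (Space n)))
      hr (Eventually.of_forall fun k => by
        show ((k : ℝ) + 1)⁻¹ ≤ 2 * (((k : ℝ) + 1)⁻¹ / 2)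
        linarith)
      (locallyIntegrable_indicator_lt hw (δ := ((j : ℝ) + 1)⁻¹) (by positivity))
    filter_upwards [h2] with z hz
    refine hz.congr fun k => ?_
    rw [convolution_eq_swap]
    refine integral_congr_ae (Eventually.of_forall fun y => ?_)
    simp [ContinuousLinearMap.lsmul_apply, Complex.real_smul]
  filter_upwards [h1] with z hz hz0
  have hz0' : 0 < z.2 / 2 := half_pos hz0
  -- Once 1/(k+1) < t/2, the mollifier at z only sees heights above t/2, where the cut-offs j and k
  -- both equal 1.
  have hev := hr.eventually (gt_mem_nhds hz0')
  obtain ⟨j, hj⟩ := hev.exists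
  have h2 := hz j
  have hj' : ((j : ℝ) + 1)⁻¹ < z.2 := by linarith
  rw [indicator_of_mem (show z ∈ {z : Space n | ((j : ℝ) + 1)⁻¹ < z.2} from hj')] at h2
  refine h2.congr' ?_
  filter_upwards [hev] with k hk
  refine integral_congr_ae (Eventually.of_forall fun y => ?_)
  simp only
  by_cases hy : z.2 / 2 < y.2
  · have h3 : ((j : ℝ) + 1)⁻¹ < y.2 := by linarith
    have h4 : ((k : ℝ) + 1)⁻¹ < y.2 := by linarith
    rw [indicator_of_mem (show y ∈ {z : Space n | ((j : ℝ) + 1)⁻¹ < z.2} from h3),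
      indicator_of_mem (show y ∈ {z : Space n | ((k : ℝ) + 1)⁻¹ < z.2} from h4)]
  · have h3 : (((mollBump n k).normed volume (z - y) : ℝ) : ℂ) = 0 := by
      refine image_eq_zero_of_notMem_tsupport
        (f := fun z : Space n => (((mollBump n k).normed volume z : ℝ) : ℂ)) (mollBump_eq_zero ?_)
      rw [Prod.snd_sub, lt_abs]
      left; linarith
    rw [h3, zero_mul, zero_mul]

/-- Pointwise limits of polynomials of bounded degree are polynomials. -/
theorem exists_polyEval_of_tendsto {S : Set (Space n)} {w : Space n → ℂ} {N : ℕ}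
    {u : ℕ → Space n → ℂ} (hu : ∀ z ∈ S, Tendsto (fun k => u k z) atTop (𝓝 (w z)))
    {p : ℕ → MvPolynomial (Fin n ⊕ Unit) ℂ} (hp : ∀ k, (p k).totalDegree ≤ N)
    (hup : ∀ z ∈ S, ∀ᶠ k in atTop, u k z = polyEval (p k) z) :
    ∃ q : MvPolynomial (Fin n ⊕ Unit) ℂ, q.totalDegree ≤ N ∧ ∀ z ∈ S, w z = polyEval q z := by
  -- Polynomials of bounded degree, restricted to S, form a finite-dimensional and hence closed
  -- subspace for pointwise convergence.
  let E : MvPolynomial.restrictTotalDegree (Fin n ⊕ Unit) ℂ N →ₗ[ℂ] (S → ℂ) :=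
    { toFun := fun p z => polyEval p.1 z
      map_add' := fun p q => by funext z; simp [polyEval]
      map_smul' := fun c p => by funext z; simp [polyEval] }
  have hcl : IsClosed (LinearMap.range E : Set (S → ℂ)) :=
    Submodule.closed_of_finiteDimensional _
  have h1 : Tendsto (fun k => E ⟨p k, (MvPolynomial.mem_restrictTotalDegree _ _ _).2 (hp k)⟩) atTop
      (𝓝 fun z : S => w z) := by
    rw [tendsto_pi_nhds]
    exact fun z => (hu z z.2).congr' (hup z z.2)
  obtain ⟨q, hq⟩ := hcl.mem_of_tendsto h1 (Eventually.of_forall fun k => ⟨_, rfl⟩)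
  exact ⟨q.1, (MvPolynomial.mem_restrictTotalDegree _ _ _).1 q.2,
    fun z hz => (congrFun hq ⟨z, hz⟩).symm⟩

/-- The mollified functions are polynomials of degree at most m-1 on half-spaces that exhaust the
given one, and pointwise limits of such polynomials are again of this kind. -/
theorem ae_eq_polyEval_of_weakDeriv_eq_zero {w : Space n → ℂ}
    (hw : LocallyIntegrableOn w (halfSpace n))
    (H : ∀ α ∈ multiIdx n m, ∀ φ : Space n → ℂ, IsTestHalf φ →
      ∫ z in halfSpace n, w z * partialD α φ z = 0) :
    ∃ p : MvPolynomial (Fin n ⊕ Unit) ℂ, p.totalDegree ≤ m - 1 ∧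
      ∀ᵐ z ∂(volume.restrict (halfSpace n)), w z = polyEval p z := by
  have h1 : ∀ k : ℕ, ∃ p : MvPolynomial (Fin n ⊕ Unit) ℂ, p.totalDegree ≤ m - 1 ∧
      ∀ z ∈ {z : Space n | 2 * ((k : ℝ) + 1)⁻¹ < z.2}, mollify w k z = polyEval p z := fun k =>
    exists_polyEval_of_partialD_eq_zero (contDiff_mollify hw k)
      (convex_halfSpace_gt (LinearMap.snd ℝ (Hor n) ℝ).isLinear _)
      fun α hα z hz => partialD_mollify_eq_zero hw (H α hα) hz
  choose p hp hpe using h1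
  obtain ⟨q, hq, hqe⟩ := exists_polyEval_of_tendsto
    (S := {z | z ∈ halfSpace n ∧ Tendsto (fun k => mollify w k z) atTop (𝓝 (w z))})
    (fun z hz => hz.2) hp fun z hz => by
      have hr : Tendsto (fun k : ℕ => 2 * ((k : ℝ) + 1)⁻¹) atTop (𝓝 0) := by
        have := (tendsto_one_div_add_atTop_nhds_zero_nat (𝕜 := ℝ)).const_mul 2
        simpa [one_div] using this
      filter_upwards [hr.eventually (gt_mem_nhds hz.1)] with k hk using hpe k z hk
  refine ⟨q, hq, ?_⟩
  rw [ae_restrict_iff' (isOpen_halfSpace n).measurableSet]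
  filter_upwards [ae_tendsto_mollify hw] with z hz hz0 using hqe z ⟨hz0, hz hz0⟩

end

section


/-! ### Well posedness -/

variable {n m : ℕ}

theorem IsTestHalf.integrableOn_mul {w φ : Space n → ℂ} (hφ : IsTestHalf φ)
    (hw : LocallyIntegrableOn w (halfSpace n)) :
    IntegrableOn (fun z => w z * φ z) (halfSpace n) := by
  have h1 : IntegrableOn w (tsupport φ) := hw.integrableOn_compact_subset hφ.2 hφ.1.2
  have h2 : IntegrableOn (fun z => w z * φ z) (tsupport φ) :=
    h1.mul_continuousOn hφ.1.1.continuous.continuousOn hφ.1.2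
  refine ((integrableOn_iff_integrable_of_support_subset fun z hz => ?_).1 h2).integrableOn
  exact subset_tsupport φ fun h : φ z = 0 => hz (by simp [h])

theorem IsNeumannSol.gradient_unique (hn : 1 ≤ n) (hm : 1 ≤ m) {g : MIdx n → Hor n → ℂ}
    {w₁ w₂ : Space n → ℂ} {D₁ D₂ : MIdx n → Space n → ℂ}
    (h₁ : IsNeumannSol m (specialCoeff n) g w₁ D₁) (h₂ : IsNeumannSol m (specialCoeff n) g w₂ D₂)
    {α : MIdx n} (hα : α ∈ multiIdx n m) :
    D₁ α =ᵐ[volume.restrict (halfSpace n)] D₂ α := by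
  obtain ⟨d₁, hd₁, hm₁⟩ := (h₁.isGradArray hn hm).exists_measurable
  obtain ⟨d₂, hd₂, hm₂⟩ := (h₂.isGradArray hn hm).exists_measurable
  have h := (hd₁.sub hn hm hd₂ fun β hβ => (hm₁ β hβ).1).ae_eq_zero hn hm
    (fun β hβ => (hm₁ β hβ).1.sub (hm₂ β hβ).1) hα
  filter_upwards [h, (hm₁ α hα).2, (hm₂ α hα).2] with z hz hz₁ hz₂
  have hz' : d₁ α z - d₂ α z = 0 := hz
  rw [hz₁, hz₂, ← map_sub] at hz'
  exact sub_eq_zero.1 ((map_eq_zero _).1 hz')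

theorem IsNeumannSol.ae_eq_add_polyEval (hn : 1 ≤ n) (hm : 1 ≤ m) {g : MIdx n → Hor n → ℂ}
    {w₁ w₂ : Space n → ℂ} {D₁ D₂ : MIdx n → Space n → ℂ}
    (h₁ : IsNeumannSol m (specialCoeff n) g w₁ D₁)
    (h₂ : IsNeumannSol m (specialCoeff n) g w₂ D₂) :
    ∃ p : MvPolynomial (Fin n ⊕ Unit) ℂ, p.totalDegree ≤ m - 1 ∧
      ∀ᵐ z ∂(volume.restrict (halfSpace n)), w₁ z = w₂ z + polyEval p z := by
  obtain ⟨p, hp, h⟩ := ae_eq_polyEval_of_weakDeriv_eq_zero (m := m) (w := w₁ - w₂)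
    (h₁.locInt.sub h₂.locInt) fun α hα φ hφ => by
      simp only [Pi.sub_apply, sub_mul]
      rw [integral_sub ((hφ.partialD α).integrableOn_mul h₁.locInt)
        ((hφ.partialD α).integrableOn_mul h₂.locInt), (h₁.weakDeriv α hα).2 φ hφ,
        (h₂.weakDeriv α hα).2 φ hφ, ← mul_sub]
      have h3 : ∫ z in halfSpace n, D₁ α z * φ z = ∫ z in halfSpace n, D₂ α z * φ z :=
        integral_congr_ae <| by
          filter_upwards [h₁.gradient_unique hn hm h₂ hα] with z hz
          rw [hz]
      rw [h3, sub_self, mul_zero]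
  refine ⟨p, hp, h.mono fun z hz => ?_⟩
  rw [← hz, Pi.sub_apply, add_sub_cancel]

theorem neumannWellPosed_specialCoeff (hn : 1 ≤ n) (hm : 1 ≤ m) :
    NeumannWellPosed n m (specialCoeff n) := by
  obtain ⟨C, hC⟩ := exists_isNeumannSol hn hm
  exact ⟨C, fun g hg => ⟨hC g hg, fun _ _ _ _ h₁ h₂ => h₁.ae_eq_add_polyEval hn hm h₂⟩⟩

end

end HigherOrderNeumann

end

theorem theorem6p1 (n m : ℕ) (hn : 1 ≤ n) (hm : 1 ≤ m) :
    -- the coefficients are real and self-adjoint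
    (∀ α ∈ HigherOrderNeumann.multiIdx n m, ∀ β ∈ HigherOrderNeumann.multiIdx n m,
      (HigherOrderNeumann.specialCoeff n α β).im = 0 ∧
      HigherOrderNeumann.specialCoeff n α β =
        starRingEnd ℂ (HigherOrderNeumann.specialCoeff n β α)) ∧
    -- they are bounded and satisfy the strong slice ellipticity
    (∃ lam Lam : ℝ, 0 < lam ∧ lam < Lam ∧
      (∀ α ∈ HigherOrderNeumann.multiIdx n m, ∀ β ∈ HigherOrderNeumann.multiIdx n m,
        ‖HigherOrderNeumann.specialCoeff n α β‖ ≤ Lam) ∧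
      HigherOrderNeumann.SliceElliptic m (HigherOrderNeumann.specialCoeff n) lam) ∧
    -- the associated operator of order `2m`
    (∀ u : HigherOrderNeumann.Space n → ℂ, ContDiff ℝ ∞ u →
      ∀ z : HigherOrderNeumann.Space n,
        HigherOrderNeumann.divOp m (HigherOrderNeumann.specialCoeff n) u z =
          ∑ j ∈ Finset.range (m + 1), (-1 : ℂ) ^ j *
            (HigherOrderNeumann.negLapHor^[m - j]
              (HigherOrderNeumann.dVert^[2 * j] u)) z) ∧
    -- the Neumann problem is well posed
    HigherOrderNeumann.NeumannWellPosed n m (HigherOrderNeumann.specialCoeff n) := by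
  refine ⟨fun α _ β _ => HigherOrderNeumann.specialCoeff_real α β,
    -- The ellipticity constant is 1, since the coefficients are at least 1. The summand 1 in the
    -- upper bound m! + 1 makes the inequality between the two constants strict.
    ⟨1, m.factorial + 1, one_pos, ?_, fun α hα β _ => ?_,
      HigherOrderNeumann.sliceElliptic_specialCoeff n m⟩,
    fun u hu z => HigherOrderNeumann.divOp_specialCoeff hu z,
    HigherOrderNeumann.neumannWellPosed_specialCoeff hn hm⟩
  · exact lt_add_of_pos_left _ (by exact_mod_cast m.factorial_pos)
  · exact (HigherOrderNeumann.norm_specialCoeff_le hα β).trans (le_add_of_nonneg_right zero_le_one)
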